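/- Let $X$ be a complex manifold of dimension $n$ (Hausdorff and second countable) and $E\to X$ a holomorphic vector bundle of finite rank. A singular Hermitian metric $h$ on $E$ is a measurable family of non-negative, possibly unbounded Hermitian forms on the fibres, with norms $|v|_h\in[0,\infty]$, such that $0<\det h<+\infty$ almost everywhere; its dual metric on $E^*$ is $|\xi|_{h^*}=\sup\{|\xi(v)| : |v|_h\le 1\}$. * $h$ is Griffiths semi-negative if $\log|u|_h$ is plurisubharmonic (the value $-\infty$, even identically, being allowed) for every local holomorphic section $u$. * For a Hermitian metric $\omega$ on $X$, a function $\varphi\in L^1_{loc}$ is $\omega$-subharmonic if $i\partial\bar\partial\varphi\wedge\omega^{n-1}\ge 0$ in the sense of currents. $h$ is $\omega$-trace semi-negative if for every $x\in X$ and every non-zero germ $s$ of a holomorphic section of the bundle at $x$, the function $\log|s|_h^2$ is $\omega$-subharmonic on a neighbourhood of $x$. * A smooth Hermitian metric $H$ is $\omega$-trace semi-negative if $\mathrm{tr}_\omega\, i\Theta_H\le 0$, where $\Theta_H$ is its Chern curvature. A singular Hermitian metric $h$ is $\omega$-trace semi-negative with approximation if every $x\in X$ has a neighbourhood $U$ with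 a sequence of smooth $\omega$-trace semi-negative Hermitian metrics on $U$ that decreases to $h$ almost everywhere on $U$. * $h$ is Griffiths semi-positive, $\omega$-trace semi-positive, or $\omega$-trace semi-positive with approximation, if the dual metric $h^*$ on $E^*$ is Griffiths semi-negative, $\omega$-trace semi-negative, or $\omega$-trace semi-negative with approximation, respectively. Then the following conditions are equivalent: (a) $E$ has a singular Hermitian metric $h_G$ that is Griffiths semi-positive; (b) $E$ has a singular Hermitian metric $h_{tr}$ that is $\omega$-trace semi-positive for every Hermitian metric $\omega$ on $X$; (b') $E$ has a singular Hermitian metric $h_{tr}$ that is $\omega$-trace semi-positive with approximation for every Hermitian metric $\omega$ on $X$. Moreover, every Griffiths semi-positive singular Hermitian metric $h_G$ on $E$ is itself $\omega$-trace semi-positive, both without and with approximation, for every Hermitian metric $\omega$. Conversely, for every singular Hermitian metric $h_{tr}$ as in (b) or as in (b') there is a Griffiths semi-positive singular Hermitian metric $h_G$ on $E$ that coincides with $h_{tr}$ almost everywhere. -/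

import Mathlib

open scoped ContDiff Manifold ENNReal Topology
open Bundle MeasureTheory

noncomputable section

namespace SingHerm

/-- The model space `ℂⁿ` with its Euclidean norm; its `volume` is Lebesgue measure. -/
abbrev Cn (n : ℕ) : Type := EuclideanSpace ℂ (Fin n)

/-! ### Wirtinger derivatives on `ℂⁿ` -/

/-- `∂f/∂z_j = (∂f/∂x_j - i ∂f/∂y_j) / 2`. -/
def dz {n : ℕ} (j : Fin n) (f : Cn n → ℂ) (y : Cn n) : ℂ :=
  (1 / 2 : ℂ) * (fderiv ℝ f y (EuclideanSpace.single j (1 : ℂ))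
    - Complex.I * fderiv ℝ f y (EuclideanSpace.single j Complex.I))

/-- `∂f/∂z̄_j = (∂f/∂x_j + i ∂f/∂y_j) / 2`. -/
def dzbar {n : ℕ} (j : Fin n) (f : Cn n → ℂ) (y : Cn n) : ℂ :=
  (1 / 2 : ℂ) * (fderiv ℝ f y (EuclideanSpace.single j (1 : ℂ))
    + Complex.I * fderiv ℝ f y (EuclideanSpace.single j Complex.I))

/-- Entrywise `∂/∂z_j` of a matrix-valued function. -/
def dzMat {n r : ℕ} (j : Fin n) (M : Cn n → Matrix (Fin r) (Fin r) ℂ) (y : Cn n) :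
    Matrix (Fin r) (Fin r) ℂ :=
  Matrix.of fun a b => dz j (fun w => M w a b) y

/-- Entrywise `∂/∂z̄_j` of a matrix-valued function. -/
def dzbarMat {n r : ℕ} (j : Fin n) (M : Cn n → Matrix (Fin r) (Fin r) ℂ) (y : Cn n) :
    Matrix (Fin r) (Fin r) ℂ :=
  Matrix.of fun a b => dzbar j (fun w => M w a b) y

/-! ### Functions on a complex manifold -/

/-- The part of the target of the chart `e` that corresponds to `U`. -/
def chartSet {n : ℕ} {X : Type*} [TopologicalSpace X]
    (e : OpenPartialHomeomorph X (Cn n)) (U : Set X) : Set (Cn n) :=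
  e.target ∩ e.symm ⁻¹' U

/-- `P` holds at almost every point of `U` (for Lebesgue measure in the charts). -/
def AEOn (n : ℕ) {X : Type*} [TopologicalSpace X] [ChartedSpace (Cn n) X]
    (U : Set X) (P : X → Prop) : Prop :=
  ∀ e ∈ atlas (Cn n) X, ∀ᵐ y ∂(volume : Measure (Cn n)), y ∈ chartSet e U → P (e.symm y)

/-- Plurisubharmonic functions on the open set `U`, with values in `[-∞, ∞)`; the function that
is identically `-∞` is allowed. In every chart, `φ` satisfies the sub-mean value inequality on the
closed discs `{y + ζ v : |ζ| ≤ 1}` in complex lines. The mean over the boundary circle of the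
function `φ` (bounded above, possibly with mean `-∞`) is the infimum over `M` of the means of
`max φ M`. -/
structure IsPlurisubharmonicOn (n : ℕ) {X : Type*} [TopologicalSpace X] [ChartedSpace (Cn n) X]
    (φ : X → EReal) (U : Set X) : Prop where
  upperSemicontinuousOn : UpperSemicontinuousOn φ U
  lt_top : ∀ x ∈ U, φ x < ⊤
  submean : ∀ e ∈ atlas (Cn n) X, ∀ y v : Cn n,
    (∀ ζ : ℂ, ‖ζ‖ ≤ 1 → y + ζ • v ∈ chartSet e U) →
    ∀ M : ℝ, φ (e.symm y) ≤
      ((Real.circleAverage (fun ζ : ℂ => (max (φ (e.symm (y + ζ • v))) (M : EReal)).toReal) 0 1 :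
        ℝ) : EReal)

/-! ### Vector bundles, sections, metrics -/

/-- `s` is a holomorphic section of `E` on `U`. -/
def IsHolomorphicSectionOn (n : ℕ) {X : Type*} [TopologicalSpace X] [ChartedSpace (Cn n) X]
    (F : Type*) [NormedAddCommGroup F] [NormedSpace ℂ F]
    {E : X → Type*} [∀ x, AddCommGroup (E x)] [∀ x, Module ℂ (E x)]
    [TopologicalSpace (TotalSpace F E)] [∀ x, TopologicalSpace (E x)] [FiberBundle F E]
    (s : ∀ x, E x) (U : Set X) : Prop :=
  ContMDiffOn 𝓘(ℂ, Cn n) (𝓘(ℂ, Cn n).prod 𝓘(ℂ, F)) ω (fun x => TotalSpace.mk' F x (s x)) U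

/-- A smooth (i.e. real `C^∞`) Hermitian metric on `E` over the open set `U`: positive definite
Hermitian forms on the fibres (linear in the first, conjugate-linear in the second variable) whose
values on local holomorphic sections are smooth functions. -/
structure IsSmoothHermitianMetricOn (n : ℕ) {X : Type*} [TopologicalSpace X]
    [ChartedSpace (Cn n) X]
    (F : Type*) [NormedAddCommGroup F] [NormedSpace ℂ F]
    {E : X → Type*} [∀ x, AddCommGroup (E x)] [∀ x, Module ℂ (E x)]
    [TopologicalSpace (TotalSpace F E)] [∀ x, TopologicalSpace (E x)] [FiberBundle F E]
    (H : ∀ x, E x →ₗ[ℂ] E x →ₗ⋆[ℂ] ℂ) (U : Set X) : Prop where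
  conj_symm : ∀ x ∈ U, ∀ v w : E x, H x w v = (starRingEnd ℂ) (H x v w)
  pos : ∀ x ∈ U, ∀ v : E x, v ≠ 0 → 0 < (H x v v).re
  smooth : ∀ W : Set X, IsOpen W → W ⊆ U → ∀ s t : ∀ x, E x,
    IsHolomorphicSectionOn n F s W → IsHolomorphicSectionOn n F t W →
    ContMDiffOn 𝓘(ℝ, Cn n) 𝓘(ℝ, ℂ) ∞ (fun x => H x (s x) (t x)) W

/-- The matrix `H(f_a, f_b)` of a Hermitian form in a frame `f`, read in the chart `e`. -/
def frameMatrix {n r : ℕ} {X : Type*} [TopologicalSpace X]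
    {E : X → Type*} [∀ x, AddCommGroup (E x)] [∀ x, Module ℂ (E x)]
    (H : ∀ x, E x →ₗ[ℂ] E x →ₗ⋆[ℂ] ℂ)
    (f : Fin r → ∀ x, E x)
    (e : OpenPartialHomeomorph X (Cn n)) (y : Cn n) : Matrix (Fin r) (Fin r) ℂ :=
  Matrix.of fun a b => H (e.symm y) (f a (e.symm y)) (f b (e.symm y))

/-- For the matrix `M` of a smooth Hermitian metric `H` in a holomorphic frame `f`, the matrix
`(Θ_{jk} f_a, f_b)_H` of the coefficient `Θ_{jk}` of the Chern curvature
`Θ = ∑ Θ_{jk} dz_j ∧ dz̄_k`. -/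
def chernCurvature {n r : ℕ} (M : Cn n → Matrix (Fin r) (Fin r) ℂ) (j k : Fin n) (y : Cn n) :
    Matrix (Fin r) (Fin r) ℂ :=
  - dzMat j (fun w => dzbarMat k M w) y + dzMat j M y * (M y)⁻¹ * dzbarMat k M y

/-- A singular Hermitian metric on `E`, given by the norm functions
`v ↦ |v|_h ∈ [0, ∞]` of non-negative, possibly unbounded Hermitian forms on the fibres. It is
measurable, and for almost every `x` the form on `E x` is finite and positive definite, i.e.
`0 < det h < ∞`. -/
structure IsSingularHermitianMetric (n : ℕ) {X : Type*} [TopologicalSpace X]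
    [ChartedSpace (Cn n) X]
    (F : Type*) [NormedAddCommGroup F] [NormedSpace ℂ F]
    {E : X → Type*} [∀ x, AddCommGroup (E x)] [∀ x, Module ℂ (E x)]
    [TopologicalSpace (TotalSpace F E)] [∀ x, TopologicalSpace (E x)] [FiberBundle F E]
    (h : ∀ x, E x → ℝ≥0∞) : Prop where
  zero : ∀ x, h x 0 = 0
  smul : ∀ x, ∀ c : ℂ, c ≠ 0 → ∀ v : E x, h x (c • v) = ‖c‖ₑ * h x v
  triangle : ∀ x, ∀ v w : E x, h x (v + w) ≤ h x v + h x w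
  parallelogram : ∀ x, ∀ v w : E x,
    h x (v + w) ^ 2 + h x (v - w) ^ 2 = 2 * h x v ^ 2 + 2 * h x w ^ 2
  measurable : ∀ U : Set X, IsOpen U → ∀ s : ∀ x, E x, IsHolomorphicSectionOn n F s U →
    ∀ e ∈ atlas (Cn n) X,
      AEMeasurable (fun y => h (e.symm y) (s (e.symm y))) (volume.restrict (chartSet e U))
  ae_posDef : AEOn n (Set.univ : Set X) fun x => ∀ v : E x, v ≠ 0 → 0 < h x v ∧ h x v < ⊤

/-- `h` is Griffiths semi-negative: `log |u|_h` is plurisubharmonic for every local holomorphic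
section `u`. -/
def GriffithsSemiNegative (n : ℕ) {X : Type*} [TopologicalSpace X] [ChartedSpace (Cn n) X]
    (F : Type*) [NormedAddCommGroup F] [NormedSpace ℂ F]
    {E : X → Type*} [∀ x, AddCommGroup (E x)] [∀ x, Module ℂ (E x)]
    [TopologicalSpace (TotalSpace F E)] [∀ x, TopologicalSpace (E x)] [FiberBundle F E]
    (h : ∀ x, E x → ℝ≥0∞) : Prop :=
  ∀ U : Set X, IsOpen U → ∀ u : ∀ x, E x, IsHolomorphicSectionOn n F u U →
    IsPlurisubharmonicOn n (fun x => ENNReal.log (h x (u x))) U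

/-! ### Hermitian metrics on the manifold, `ω`-subharmonicity and `ω`-trace negativity

The Hermitian metric on the manifold is called `g` here, since `ω` is Mathlib's notation for
analyticity. -/

section Trace

variable {n : ℕ} {X : Type*} [TopologicalSpace X] [ChartedSpace (Cn n) X]
  [IsManifold 𝓘(ℂ, Cn n) ω X]

/-- A Hermitian metric on the complex manifold `X`: a smooth Hermitian metric on the holomorphic
tangent bundle. -/
structure HermitianMetric (n : ℕ) (X : Type*) [TopologicalSpace X] [ChartedSpace (Cn n) X]
    [IsManifold 𝓘(ℂ, Cn n) ω X] where
  form : ∀ x : X, TangentSpace 𝓘(ℂ, Cn n) x →ₗ[ℂ] TangentSpace 𝓘(ℂ, Cn n) x →ₗ⋆[ℂ] ℂ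
  isSmooth : IsSmoothHermitianMetricOn n (Cn n)
    (E := fun x : X => TangentSpace 𝓘(ℂ, Cn n) x) form Set.univ

/-- The coefficients `g_{jk} = g(∂/∂z_j, ∂/∂z_k)` in a chart: the associated `(1,1)`-form is
`i ∑ g_{jk} dz_j ∧ dz̄_k`. -/
def HermitianMetric.coeff (g : HermitianMetric n X) (e : OpenPartialHomeomorph X (Cn n))
    (y : Cn n) : Matrix (Fin n) (Fin n) ℂ :=
  Matrix.of fun j k => g.form (e.symm y)
    (mfderiv 𝓘(ℂ, Cn n) 𝓘(ℂ, Cn n) e.symm y (EuclideanSpace.single j (1 : ℂ)))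
    (mfderiv 𝓘(ℂ, Cn n) 𝓘(ℂ, Cn n) e.symm y (EuclideanSpace.single k (1 : ℂ)))

/-- The density, with respect to Lebesgue measure in the chart `e`, of the top degree form
`i∂∂̄(ψ ω^{n-1}) / (n-1)!`. Up to the normalisation of the volume, `ω^{n-1} / (n-1)!` has the
coefficients `adj(g)_{kj} = det(g) (g⁻¹)_{kj}`, so this is `∑ ∂²(ψ adj(g)_{kj}) / ∂z_j ∂z̄_k`;
it equals `(Δ_ω)^* ψ · det g`, the adjoint of `Δ_ω = tr_ω i∂∂̄` being taken for `dV_ω`. -/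
def adjointDensity (g : HermitianMetric n X) (e : OpenPartialHomeomorph X (Cn n))
    (ψ : Cn n → ℝ) (y : Cn n) : ℝ :=
  (∑ j : Fin n, ∑ k : Fin n,
    dz j (dzbar k fun w => (ψ w : ℂ) * (g.coeff e w).adjugate k j) y).re

/-- `φ` is `ω`-subharmonic on the open set `U`: it is locally integrable (in particular finite
almost everywhere), and `i∂∂̄φ ∧ ω^{n-1} ≥ 0` in the sense of currents, i.e.
`∫ φ i∂∂̄(ψ ω^{n-1}) ≥ 0` for all test functions `ψ ≥ 0` with compact support in a chart. -/
structure IsOmegaSubharmonicOn (g : HermitianMetric n X) (φ : X → EReal) (U : Set X) : Prop where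
  ae_finite : AEOn n U fun x => φ x ≠ ⊥ ∧ φ x ≠ ⊤
  locallyIntegrable : ∀ e ∈ atlas (Cn n) X,
    LocallyIntegrableOn (fun y => (φ (e.symm y)).toReal) (chartSet e U) volume
  nonneg : ∀ e ∈ atlas (Cn n) X, ∀ ψ : Cn n → ℝ, ContDiff ℝ ∞ ψ → HasCompactSupport ψ →
    tsupport ψ ⊆ chartSet e U → (∀ y, 0 ≤ ψ y) →
    0 ≤ ∫ y in chartSet e U, (φ (e.symm y)).toReal * adjointDensity g e ψ y

variable (F : Type*) [NormedAddCommGroup F] [NormedSpace ℂ F]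
variable {E : X → Type*} [∀ x, AddCommGroup (E x)] [∀ x, Module ℂ (E x)]
  [TopologicalSpace (TotalSpace F E)] [∀ x, TopologicalSpace (E x)] [FiberBundle F E]

/-- The singular Hermitian metric `h` is `ω`-trace semi-negative: for every `x` and every non-zero
germ `s` of a holomorphic section at `x`, the function `log |s|_h²` is `ω`-subharmonic on a
neighbourhood of `x`. -/
def TraceSemiNegative (g : HermitianMetric n X) (h : ∀ x, E x → ℝ≥0∞) : Prop :=
  ∀ x : X, ∀ U : Set X, IsOpen U → x ∈ U → ∀ s : ∀ x, E x, IsHolomorphicSectionOn n F s U →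
    (¬ ∀ᶠ y in 𝓝 x, s y = 0) →
    ∃ W : Set X, IsOpen W ∧ x ∈ W ∧ W ⊆ U ∧
      IsOmegaSubharmonicOn g (fun y => ENNReal.log (h y (s y) ^ 2)) W

/-- The smooth Hermitian metric `H` on `E` over the open set `U` is `ω`-trace semi-negative:
the Hermitian form `u ↦ (tr_ω(iΘ) u, u)_H = ∑ (g⁻¹)_{kj} (Θ_{jk} u, u)_H` is negative semi-definite
at every point of `U`. The sum is computed in charts and local holomorphic frames. -/
def SmoothTraceSemiNegativeOn (g : HermitianMetric n X) (H : ∀ x, E x →ₗ[ℂ] E x →ₗ⋆[ℂ] ℂ)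
    (U : Set X) : Prop :=
  ∀ e ∈ atlas (Cn n) X, ∀ W : Set X, IsOpen W → W ⊆ U →
    ∀ f : Fin (Module.finrank ℂ F) → ∀ x, E x, IsLocalFrameOn 𝓘(ℂ, Cn n) F ω f W →
    ∀ y ∈ chartSet e W, ∀ c : Fin (Module.finrank ℂ F) → ℂ,
      (∑ a, ∑ b, c a * (starRingEnd ℂ) (c b) *
        (∑ j : Fin n, ∑ k : Fin n,
          (g.coeff e y)⁻¹ k j * chernCurvature (frameMatrix H f e) j k y a b)).re ≤ 0

/-- The singular Hermitian metric `h` is `ω`-trace semi-negative with approximation: locally it is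
almost everywhere the limit of a decreasing sequence of smooth `ω`-trace semi-negative Hermitian
metrics. -/
def TraceSemiNegativeWithApprox (g : HermitianMetric n X) (h : ∀ x, E x → ℝ≥0∞) : Prop :=
  ∀ x : X, ∃ U : Set X, IsOpen U ∧ x ∈ U ∧ ∃ H : ℕ → ∀ x, E x →ₗ[ℂ] E x →ₗ⋆[ℂ] ℂ,
    (∀ ν, IsSmoothHermitianMetricOn n F (H ν) U) ∧
    (∀ ν, SmoothTraceSemiNegativeOn F g (H ν) U) ∧
    (∀ y ∈ U, ∀ v : E y, Antitone fun ν => (H ν y v v).re) ∧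
    AEOn n U fun y => ∀ v : E y,
      Filter.Tendsto (fun ν => ENNReal.ofReal (H ν y v v).re) Filter.atTop (𝓝 (h y v ^ 2))

end Trace

/-! ### Dual metrics and positivity -/

section Positivity

variable {n : ℕ} {X : Type*} [TopologicalSpace X] [ChartedSpace (Cn n) X]
variable (F : Type*) [NormedAddCommGroup F] [NormedSpace ℂ F]
variable {E : X → Type*} [∀ x, AddCommGroup (E x)] [∀ x, Module ℂ (E x)]
  [TopologicalSpace (TotalSpace F E)] [∀ x, TopologicalSpace (E x)] [FiberBundle F E]

/-- The fibres of the dual bundle `E^*`, with model fibre `F →L[ℂ] ℂ`. -/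
abbrev Dual {X : Type*} (E : X → Type*) [∀ x, AddCommGroup (E x)] [∀ x, Module ℂ (E x)]
    [∀ x, TopologicalSpace (E x)] (x : X) : Type _ :=
  E x →L[ℂ] Bundle.Trivial X ℂ x

/-- The dual metric `h^*` on `E^*`: `|ξ|_{h^*} = sup {|ξ(v)| : |v|_h ≤ 1}`. -/
def dualMetric {X : Type*} {E : X → Type*} [∀ x, AddCommGroup (E x)] [∀ x, Module ℂ (E x)]
    [∀ x, TopologicalSpace (E x)] (h : ∀ x, E x → ℝ≥0∞) (x : X) (ξ : Dual E x) : ℝ≥0∞ :=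
  ⨆ v : E x, ⨆ _ : h x v ≤ 1, ‖(ξ v : ℂ)‖ₑ

variable [VectorBundle ℂ F E] [∀ x, IsTopologicalAddGroup (E x)] [∀ x, ContinuousSMul ℂ (E x)]

/-- `h` is Griffiths semi-positive: `h^*` is Griffiths semi-negative. -/
def GriffithsSemiPositive (n : ℕ) {X : Type*} [TopologicalSpace X] [ChartedSpace (Cn n) X]
    (F : Type*) [NormedAddCommGroup F] [NormedSpace ℂ F]
    {E : X → Type*} [∀ x, AddCommGroup (E x)] [∀ x, Module ℂ (E x)]
    [TopologicalSpace (TotalSpace F E)] [∀ x, TopologicalSpace (E x)] [FiberBundle F E]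
    [VectorBundle ℂ F E] [∀ x, IsTopologicalAddGroup (E x)] [∀ x, ContinuousSMul ℂ (E x)]
    (h : ∀ x, E x → ℝ≥0∞) : Prop :=
  GriffithsSemiNegative n (F →L[ℂ] ℂ) (E := Dual E) (dualMetric h)

variable [IsManifold 𝓘(ℂ, Cn n) ω X]

/-- `h` is `ω`-trace semi-positive: `h^*` is `ω`-trace semi-negative. -/
def TraceSemiPositive (g : HermitianMetric n X) (h : ∀ x, E x → ℝ≥0∞) : Prop :=
  TraceSemiNegative (F →L[ℂ] ℂ) (E := Dual E) g (dualMetric h)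

/-- `h` is `ω`-trace semi-positive with approximation: `h^*` is `ω`-trace semi-negative with
approximation. -/
def TraceSemiPositiveWithApprox (g : HermitianMetric n X) (h : ∀ x, E x → ℝ≥0∞) : Prop :=
  TraceSemiNegativeWithApprox (F →L[ℂ] ℂ) (E := Dual E) g (dualMetric h)

end Positivity

end SingHerm

end

open SingHerm

noncomputable section

namespace SingHerm

/-! Everything is decided for the dual metric `k = h^*`. Up to null sets, all the positivity
conditions are equivalent to one weak condition on `k` (`WeaklySemiNegative`): in a chart, the
squared length `|u|_k²` of every local holomorphic section `u` has non-negative complex Hessian in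
the sense of distributions.

Griffiths implies trace. If `log |u|_k` is plurisubharmonic and the germ of `u` is not zero, then
`log |u|_k` is locally integrable with non-negative distributional Hessian, and pairing this Hessian
with the positive semi-definite coefficients of `ω^{n-1}` gives a non-negative distribution
(`DistPSH.nonneg_of_posSemidef`).

Trace implies weak. The hypothesis is available for all `ω`. A partition of unity produces metrics
with arbitrary constant coefficients `B⁻¹` near a given point (`exists_hermitianMetric_coeff_eq`);
for these the trace condition says `∑ B_{kj} ∂_j ∂̄_k log |u|² ≥ 0`. Since `B` may come close to any
matrix of rank one, the whole Hessian is non-negative (`DistPSH.of_posDef`), and the exponential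
inherits this (`DistPSH.exp`). In the version with approximation the same metrics are used for the
smooth approximants `H_ν`: the identity `levi_sesq_eq`, in which Hessian plus curvature is the
squared length of a covariant derivative, makes `|u|²` for `H_ν` subharmonic for the operator of
`B`, and this passes to the decreasing limit.

Weak implies Griffiths. In a trivialization, `k²` is mollified with a radial kernel
(`exists_approximation`). The mollified form evaluated on `u` is a superposition of values of `k²`
on translates of `u`, so it is again weakly semi-negative, and radial kernels give a decreasing
sequence. For a smooth metric with this property the curvature is semi-negative after contraction
with any positive matrix (`curvature_nonpos`), which yields the approximation for every `ω` at once.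
Moreover, replacing `u` by `(1 + ℓ) u` with `ℓ` complex linear turns plurisubharmonicity of `|u|²`
into plurisubharmonicity of regularised logarithms (`levi_log_sesq_nonneg`). Their decreasing limit
is plurisubharmonic at every point. Local limits agree on overlaps, because plurisubharmonic
functions that are equal almost everywhere are equal. So there is a Griffiths semi-negative `k'`
with `k' = k` almost everywhere.

Return to `E`. The metric `h_G` is the dual norm of `k'`. In each fibre `k'` is a limit of Hermitian
norms, finite but possibly degenerate; the bipolar theorem for such limits (`polarNorm_polarNorm`)
shows that the dual of `h_G` is `k'` at every point, as the Griffiths condition requires. -/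

/-! ### Second order directional derivatives and circle means -/

/-- The derivative of `g` in the real direction `a`. -/
def dirDeriv {n : ℕ} {G : Type*} [NormedAddCommGroup G] [NormedSpace ℝ G] (a : Cn n)
    (g : Cn n → G) (z : Cn n) : G := fderiv ℝ g z a

/-- The Laplacian of `g` along the complex line in the direction `ξ`. -/
def levi {n : ℕ} {G : Type*} [NormedAddCommGroup G] [NormedSpace ℝ G] (ξ : Cn n)
    (g : Cn n → G) (z : Cn n) : G :=
  dirDeriv ξ (dirDeriv ξ g) z + dirDeriv (Complex.I • ξ) (dirDeriv (Complex.I • ξ) g) z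

section Calculus

variable {n : ℕ} {G : Type*} [NormedAddCommGroup G] [NormedSpace ℝ G]

theorem contDiffAt_fderiv_of_top {g : Cn n → G} {z : Cn n} (hg : ContDiffAt ℝ ∞ g z) :
    ContDiffAt ℝ ∞ (fderiv ℝ g) z :=
  hg.fderiv_right (m := ∞) (by simp)

theorem contDiffAt_dirDeriv {g : Cn n → G} {z : Cn n} (hg : ContDiffAt ℝ ∞ g z) (a : Cn n) :
    ContDiffAt ℝ ∞ (dirDeriv a g) z :=
  (contDiffAt_fderiv_of_top hg).clm_apply contDiffAt_const

theorem contDiff_dirDeriv {g : Cn n → G} (hg : ContDiff ℝ ∞ g) (a : Cn n) :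
    ContDiff ℝ ∞ (dirDeriv a g) :=
  contDiff_iff_contDiffAt.2 fun _ => contDiffAt_dirDeriv hg.contDiffAt a

theorem contDiffAt_levi {g : Cn n → G} {z : Cn n} (hg : ContDiffAt ℝ ∞ g z) (a : Cn n) :
    ContDiffAt ℝ ∞ (levi a g) z :=
  (contDiffAt_dirDeriv (contDiffAt_dirDeriv hg a) a).add
    (contDiffAt_dirDeriv (contDiffAt_dirDeriv hg _) _)

theorem contDiff_levi {g : Cn n → G} (hg : ContDiff ℝ ∞ g) (a : Cn n) :
    ContDiff ℝ ∞ (levi a g) :=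
  contDiff_iff_contDiffAt.2 fun _ => contDiffAt_levi hg.contDiffAt a

theorem ContDiffAt.differentiableAt_top {g : Cn n → G} {z : Cn n} (hg : ContDiffAt ℝ ∞ g z) :
    DifferentiableAt ℝ g z := hg.differentiableAt (by simp)

theorem dirDeriv_dirDeriv {g : Cn n → G} {z : Cn n} (hg : ContDiffAt ℝ ∞ g z) (a b : Cn n) :
    dirDeriv b (dirDeriv a g) z = fderiv ℝ (fderiv ℝ g) z b a := by
  have h := ((ContDiffAt.differentiableAt_top
    (contDiffAt_fderiv_of_top hg)).hasFDerivAt.clm_apply (hasFDerivAt_const a z)).fderiv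
  change fderiv ℝ (fun w => fderiv ℝ g w a) z b = _
  rw [h]
  simp

theorem levi_eq {g : Cn n → G} {z : Cn n} (hg : ContDiffAt ℝ ∞ g z) (ξ : Cn n) :
    levi ξ g z = fderiv ℝ (fderiv ℝ g) z ξ ξ
      + fderiv ℝ (fderiv ℝ g) z (Complex.I • ξ) (Complex.I • ξ) := by
  rw [levi, dirDeriv_dirDeriv hg, dirDeriv_dirDeriv hg]

theorem dirDeriv_congr {g g' : Cn n → G} {z : Cn n} (h : g =ᶠ[𝓝 z] g') (a : Cn n) :
    dirDeriv a g =ᶠ[𝓝 z] dirDeriv a g' := by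
  filter_upwards [h.fderiv (𝕜 := ℝ)] with w hw
  simp [dirDeriv, hw]

theorem levi_congr {g g' : Cn n → G} {z : Cn n} (h : g =ᶠ[𝓝 z] g') (a : Cn n) :
    levi a g =ᶠ[𝓝 z] levi a g' :=
  (dirDeriv_congr (dirDeriv_congr h a) a).add (dirDeriv_congr (dirDeriv_congr h _) _)

theorem exp_smul_eq (v : Cn n) (θ : ℝ) :
    Complex.exp (θ * Complex.I) • v = Real.cos θ • v + Real.sin θ • (Complex.I • v) := by
  rw [Complex.exp_mul_I, add_smul, mul_smul, ← Complex.ofReal_cos, ← Complex.ofReal_sin,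
    Complex.coe_smul, Complex.coe_smul]

/-- Multiplication by `e^{iθ}` rotates the real plane spanned by `v` and `iv`, and the trace of a
bilinear form on that plane is invariant; the mixed terms cancel even without symmetry of `B`. Thus
the Laplacian along a complex line may be computed in the radial and angular directions at each
point of a circle. -/
theorem bilin_rotate (B : Cn n →L[ℝ] Cn n →L[ℝ] G) (v : Cn n) (θ : ℝ) :
    B (Complex.exp (θ * Complex.I) • v) (Complex.exp (θ * Complex.I) • v)
      + B (Complex.I • Complex.exp (θ * Complex.I) • v)
          (Complex.I • Complex.exp (θ * Complex.I) • v)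
      = B v v + B (Complex.I • v) (Complex.I • v) := by
  have h2 : Complex.I • Complex.exp (θ * Complex.I) • v
      = Real.cos θ • (Complex.I • v) - Real.sin θ • v := by
    rw [smul_comm, exp_smul_eq, smul_smul Complex.I Complex.I, Complex.I_mul_I]
    simp [sub_eq_add_neg]
  have h := Real.sin_sq_add_cos_sq θ
  calc _ = (Real.sin θ ^ 2 + Real.cos θ ^ 2) • B v v
      + (Real.sin θ ^ 2 + Real.cos θ ^ 2) • B (Complex.I • v) (Complex.I • v) := by
        rw [h2, exp_smul_eq]
        simp only [map_add, map_sub, map_smul, add_apply, sub_apply, smul_apply, smul_add,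
          smul_sub, smul_smul]
        module
    _ = _ := by rw [h, one_smul, one_smul]

/-- The mean of `g` over the boundary of the disc `{y + ζ v : |ζ| ≤ 1}`. -/
def circMean (g : Cn n → ℝ) (y v : Cn n) : ℝ :=
  Real.circleAverage (fun ζ : ℂ => g (y + ζ • v)) 0 1

theorem circMean_eq (g : Cn n → ℝ) (y v : Cn n) :
    circMean g y v
      = (2 * Real.pi)⁻¹ * ∫ θ in (0 : ℝ)..2 * Real.pi, g (y + Complex.exp (θ * Complex.I) • v) := by
  simp [circMean, Real.circleAverage, circleMap]

@[simp] theorem circMean_zero (g : Cn n → ℝ) (y : Cn n) : circMean g y 0 = g y := by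
  rw [circMean]
  simp [Real.circleAverage_const]

/-- Only a compact interval around `r` and one period of the angle matter, and there continuity of
`F'` provides the constant bound for differentiation under the integral. -/
theorem hasDerivAt_integral_circle {R : ℝ} {F F' : ℝ → ℝ → ℝ}
    (hF : ∀ r ∈ Set.Ioo (-R) R, Continuous (F r))
    (hF' : ContinuousOn (Function.uncurry F') (Set.Ioo (-R) R ×ˢ Set.univ))
    (hd : ∀ r ∈ Set.Ioo (-R) R, ∀ θ, HasDerivAt (fun s => F s θ) (F' r θ) r)
    {r : ℝ} (hr : r ∈ Set.Ioo (-R) R) :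
    HasDerivAt (fun s => ∫ θ in (0 : ℝ)..2 * Real.pi, F s θ)
      (∫ θ in (0 : ℝ)..2 * Real.pi, F' r θ) r := by
  obtain ⟨δ, hδ, hδs⟩ := Metric.isOpen_iff.1 isOpen_Ioo r hr
  have hsub : Metric.closedBall r (δ / 2) ⊆ Set.Ioo (-R) R :=
    (Metric.closedBall_subset_ball (by linarith)).trans hδs
  have hK : IsCompact (Metric.closedBall r (δ / 2) ×ˢ Set.Icc (0 : ℝ) (2 * Real.pi)) :=
    (isCompact_closedBall r (δ / 2)).prod isCompact_Icc
  obtain ⟨C, hC⟩ := hK.exists_bound_of_continuousOn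
    (hF'.mono (Set.prod_mono hsub (Set.subset_univ _)))
  have hpos : (0 : ℝ) ≤ 2 * Real.pi := by positivity
  refine (intervalIntegral.hasDerivAt_integral_of_dominated_loc_of_deriv_le
    (bound := fun _ => C) (s := Metric.closedBall r (δ / 2))
    (Metric.closedBall_mem_nhds r (by linarith)) ?_ ?_ ?_ ?_ ?_ ?_).2
  · filter_upwards [Ioo_mem_nhds hr.1 hr.2] with s hs
    exact (hF s hs).aestronglyMeasurable
  · exact (hF r hr).intervalIntegrable _ _
  · have : Continuous (F' r) := by
      have := hF'.comp_continuous (f := fun θ : ℝ => (r, θ)) (by fun_prop) (fun θ => ⟨hr, trivial⟩)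
      exact this
    exact this.aestronglyMeasurable
  · refine Filter.Eventually.of_forall fun θ hθ s hs => ?_
    rw [Set.uIoc_of_le hpos] at hθ
    exact hC (s, θ) ⟨hs, hθ.1.le, hθ.2⟩
  · exact intervalIntegrable_const
  · exact Filter.Eventually.of_forall fun θ _ s hs => hd s (hsub hs) θ

theorem hasDerivAt_exp_smul (v : Cn n) (θ : ℝ) :
    HasDerivAt (fun t : ℝ => Complex.exp (t * Complex.I) • v)
      (Complex.I • Complex.exp (θ * Complex.I) • v) θ := by
  have h1 : HasDerivAt (fun t : ℝ => (t : ℂ) * Complex.I) Complex.I θ := by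
    simpa using (Complex.ofRealCLM.hasDerivAt (x := θ)).mul_const Complex.I
  have h := (h1.cexp).smul_const v
  rwa [mul_comm, mul_smul] at h

-- Let `A(r)` be the integral of `g` over the circle of radius `r`. Then `r A'(r)` vanishes at `0`,
-- and its derivative is `r` times the integral of the Laplacian, because the angular part
-- integrates to zero over a period. Hence `A' ≥ 0`.
set_option maxHeartbeats 400000 in
theorem circMean_monotoneOn {g : Cn n → ℝ} {O : Set (Cn n)} (hO : IsOpen O)
    (hg : ContDiffOn ℝ ∞ g O) {y v : Cn n} {R : ℝ}
    (hdisc : ∀ ζ : ℂ, ‖ζ‖ < R → y + ζ • v ∈ O)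
    (hlevi : ∀ z ∈ O, 0 ≤ levi v g z) :
    MonotoneOn (fun r : ℝ => circMean g y (r • v)) (Set.Ico 0 R) := by
  have hgA : ∀ z ∈ O, ContDiffAt ℝ ∞ g z := fun z hz => hg.contDiffAt (hO.mem_nhds hz)
  set E : ℝ → Cn n := fun θ => Complex.exp (θ * Complex.I) • v with hE
  have hEc : Continuous E := by fun_prop
  have hEd : ∀ θ, HasDerivAt E (Complex.I • E θ) θ := hasDerivAt_exp_smul v
  have hIEd : ∀ θ, HasDerivAt (fun t => Complex.I • E t) (-E θ) θ := fun θ => by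
    have h := (hEd θ).fun_const_smul Complex.I
    rwa [smul_smul, Complex.I_mul_I, neg_one_smul] at h
  have hmem : ∀ r ∈ Set.Ioo (-R) R, ∀ θ, y + r • E θ ∈ O := fun r hr θ => by
    have := hdisc (r * Complex.exp (θ * Complex.I)) (by
      rw [norm_mul, Complex.norm_exp_ofReal_mul_I, mul_one, Complex.norm_real]
      exact abs_lt.2 hr)
    rwa [mul_smul, Complex.coe_smul] at this
  have hcg : ContinuousOn g O := hg.continuousOn
  have hcD : ContinuousOn (fderiv ℝ g) O := fun z hz =>
    (contDiffAt_fderiv_of_top (hgA z hz)).continuousAt.continuousWithinAt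
  have hcD2 : ContinuousOn (fderiv ℝ (fderiv ℝ g)) O := fun z hz =>
    (contDiffAt_fderiv_of_top (contDiffAt_fderiv_of_top (hgA z hz))).continuousAt.continuousWithinAt
  have hgd : ∀ z ∈ O, HasFDerivAt g (fderiv ℝ g z) z := fun z hz =>
    (ContDiffAt.differentiableAt_top (hgA z hz)).hasFDerivAt
  have hgd2 : ∀ z ∈ O, HasFDerivAt (fderiv ℝ g) (fderiv ℝ (fderiv ℝ g) z) z := fun z hz =>
    (ContDiffAt.differentiableAt_top (contDiffAt_fderiv_of_top (hgA z hz))).hasFDerivAt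
  have hpc : Continuous fun p : ℝ × ℝ => y + p.1 • E p.2 := by fun_prop
  have hmaps : Set.MapsTo (fun p : ℝ × ℝ => y + p.1 • E p.2) (Set.Ioo (-R) R ×ˢ Set.univ) O :=
    fun p hp => hmem p.1 hp.1 p.2
  have hpr : ∀ r θ, HasDerivAt (fun s : ℝ => y + s • E θ) (E θ) r := fun r θ => by
    simpa using ((hasDerivAt_id r).smul_const (E θ)).const_add y
  have hpθ : ∀ r θ : ℝ, HasDerivAt (fun t : ℝ => y + r • E t) (r • Complex.I • E θ) θ := fun r θ => by
    exact ((hEd θ).fun_const_smul (r : ℝ)).const_add y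
  -- continuity in the angle
  have hslice : ∀ r ∈ Set.Ioo (-R) R, Continuous fun θ => y + r • E θ := fun r _ => by fun_prop
  have hD1c : ContinuousOn (fun p : ℝ × ℝ => fderiv ℝ g (y + p.1 • E p.2))
      (Set.Ioo (-R) R ×ˢ Set.univ) := hcD.comp hpc.continuousOn hmaps
  have hD2c : ContinuousOn (fun p : ℝ × ℝ => fderiv ℝ (fderiv ℝ g) (y + p.1 • E p.2))
      (Set.Ioo (-R) R ×ˢ Set.univ) := hcD2.comp hpc.continuousOn hmaps
  have hEc2 : ContinuousOn (fun p : ℝ × ℝ => E p.2) (Set.Ioo (-R) R ×ˢ Set.univ) := by fun_prop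
  have toSlice : ∀ {F : ℝ × ℝ → ℝ}, ContinuousOn F (Set.Ioo (-R) R ×ˢ Set.univ) →
      ∀ r ∈ Set.Ioo (-R) R, Continuous fun θ => F (r, θ) := fun hF r hr =>
    hF.comp_continuous (f := fun θ : ℝ => (r, θ)) (by fun_prop) (fun θ => ⟨hr, trivial⟩)
  -- first derivative of the mean
  have hA : ∀ r ∈ Set.Ioo (-R) R,
      HasDerivAt (fun s => ∫ θ in (0 : ℝ)..2 * Real.pi, g (y + s • E θ))
        (∫ θ in (0 : ℝ)..2 * Real.pi, fderiv ℝ g (y + r • E θ) (E θ)) r := fun r hr =>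
    hasDerivAt_integral_circle (F := fun s θ => g (y + s • E θ))
      (F' := fun s θ => fderiv ℝ g (y + s • E θ) (E θ))
      (fun r hr => toSlice (F := fun p => g (y + p.1 • E p.2))
        (hcg.comp hpc.continuousOn hmaps) r hr)
      (hD1c.clm_apply hEc2)
      (fun r hr θ => (hgd _ (hmem r hr θ)).comp_hasDerivAt r (hpr r θ)) hr
  -- second derivative
  obtain ⟨P, hP⟩ : ∃ P : ℝ → ℝ, P = fun r =>
      ∫ θ in (0 : ℝ)..2 * Real.pi, r * fderiv ℝ g (y + r • E θ) (E θ) := ⟨_, rfl⟩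
  have hIEc : Continuous fun p : ℝ × ℝ => Complex.I • E p.2 := by fun_prop
  have hc1 : ContinuousOn (fun p : ℝ × ℝ => fderiv ℝ g (y + p.1 • E p.2) (E p.2))
      (Set.Ioo (-R) R ×ˢ Set.univ) := hD1c.clm_apply hEc2
  have hc2 : ContinuousOn
      (fun p : ℝ × ℝ => fderiv ℝ (fderiv ℝ g) (y + p.1 • E p.2) (E p.2) (E p.2))
      (Set.Ioo (-R) R ×ˢ Set.univ) := (hD2c.clm_apply hEc2).clm_apply hEc2
  have hc3 : ContinuousOn
      (fun p : ℝ × ℝ => fderiv ℝ (fderiv ℝ g) (y + p.1 • E p.2) (Complex.I • E p.2)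
        (Complex.I • E p.2)) (Set.Ioo (-R) R ×ˢ Set.univ) :=
    (hD2c.clm_apply hIEc.continuousOn).clm_apply hIEc.continuousOn
  have hP' : ∀ r ∈ Set.Ioo (-R) R, HasDerivAt P
      (∫ θ in (0 : ℝ)..2 * Real.pi, (fderiv ℝ g (y + r • E θ) (E θ)
        + r * fderiv ℝ (fderiv ℝ g) (y + r • E θ) (E θ) (E θ))) r := fun r hr => hP ▸
    hasDerivAt_integral_circle (F := fun s θ => s * fderiv ℝ g (y + s • E θ) (E θ))
      (F' := fun s θ => fderiv ℝ g (y + s • E θ) (E θ)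
        + s * fderiv ℝ (fderiv ℝ g) (y + s • E θ) (E θ) (E θ))
      (fun r hr => (toSlice hc1 r hr).const_mul r)
      (hc1.add (continuousOn_fst.mul hc2))
      (fun r hr θ => by
        have h1 := (hgd2 _ (hmem r hr θ)).comp_hasDerivAt r (hpr r θ)
        have h2 := h1.clm_apply (hasDerivAt_const r (E θ))
        exact ((hasDerivAt_id r).fun_mul h2).congr_deriv (by simp)) hr
  -- The integrand is the `θ`-derivative of the derivative of `g` in the angular direction `iE(θ)`,
  -- which is periodic.
  have hzero : ∀ r ∈ Set.Ioo (-R) R, ∫ θ in (0 : ℝ)..2 * Real.pi,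
      (r * fderiv ℝ (fderiv ℝ g) (y + r • E θ) (Complex.I • E θ) (Complex.I • E θ)
        - fderiv ℝ g (y + r • E θ) (E θ)) = 0 := fun r hr => by
    have hder : ∀ θ ∈ Set.uIcc (0 : ℝ) (2 * Real.pi),
        HasDerivAt (fun t => fderiv ℝ g (y + r • E t) (Complex.I • E t))
        (r * fderiv ℝ (fderiv ℝ g) (y + r • E θ) (Complex.I • E θ) (Complex.I • E θ)
        - fderiv ℝ g (y + r • E θ) (E θ)) θ := fun θ _ => by
      have h1 := (hgd2 _ (hmem r hr θ)).comp_hasDerivAt θ (hpθ r θ)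
      have h2 := h1.clm_apply (hIEd θ)
      exact h2.congr_deriv (by simp [sub_eq_add_neg])
    rw [intervalIntegral.integral_eq_sub_of_hasDerivAt hder
      ((((toSlice hc3 r hr).const_mul r).sub (toSlice hc1 r hr)).intervalIntegrable _ _)]
    simp [hE, Complex.exp_two_pi_mul_I]
  have hP'nonneg : ∀ r ∈ Set.Ico 0 R, ∃ p, HasDerivAt P p r ∧ 0 ≤ p := fun r hr => by
    have hr' : r ∈ Set.Ioo (-R) R := ⟨by linarith [hr.1, hr.2], hr.2⟩
    refine ⟨_, hP' r hr', ?_⟩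
    have k1 := toSlice hc1 r hr'
    have k2 := toSlice hc2 r hr'
    have k3 := toSlice hc3 r hr'
    -- Adding the vanishing integral completes the derivative of `P` to `r` times the integral of
    -- the Laplacian, and `bilin_rotate` moves that Laplacian back to the fixed direction `v`.
    have hadd := intervalIntegral.integral_add (μ := volume) (a := 0) (b := 2 * Real.pi)
      (f := fun θ => fderiv ℝ g (y + r • E θ) (E θ)
        + r * fderiv ℝ (fderiv ℝ g) (y + r • E θ) (E θ) (E θ))
      (g := fun θ => r * fderiv ℝ (fderiv ℝ g) (y + r • E θ) (Complex.I • E θ) (Complex.I • E θ)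
        - fderiv ℝ g (y + r • E θ) (E θ))
      ((k1.add (k2.const_mul r)).intervalIntegrable _ _)
      (((k3.const_mul r).sub k1).intervalIntegrable _ _)
    rw [hzero r hr', add_zero] at hadd
    rw [← hadd]
    refine intervalIntegral.integral_nonneg (by positivity) fun θ _ => ?_
    have hz := hmem r hr' θ
    have h1 := hlevi _ hz
    rw [levi_eq (hgA _ hz), ← bilin_rotate _ v θ] at h1
    have h2 := mul_nonneg hr.1 h1
    simp only [hE] at h2 ⊢
    linarith
  have hPmono : ∀ r ∈ Set.Ico 0 R, 0 ≤ P r := fun r hr => by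
    have hP0 : P 0 = 0 := by simp [hP]
    have hm : MonotoneOn P (Set.Ico 0 R) := by
      refine monotoneOn_of_deriv_nonneg (convex_Ico 0 R) ?_ ?_ ?_
      · intro s hs
        obtain ⟨p, hp, _⟩ := hP'nonneg s hs
        exact hp.continuousAt.continuousWithinAt
      · intro s hs
        obtain ⟨p, hp, _⟩ := hP'nonneg s (interior_subset hs)
        exact hp.differentiableAt.differentiableWithinAt
      · intro s hs
        obtain ⟨p, hp, h0⟩ := hP'nonneg s (interior_subset hs)
        rwa [hp.deriv]
    have := hm ⟨le_rfl, hr.1.trans_lt hr.2⟩ hr hr.1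
    rwa [hP0] at this
  have hcm : ∀ s : ℝ, circMean g y (s • v)
      = (2 * Real.pi)⁻¹ * ∫ θ in (0 : ℝ)..2 * Real.pi, g (y + s • E θ) := fun s => by
    rw [circMean_eq]
    simp only [hE, smul_comm _ s v]
  refine monotoneOn_of_deriv_nonneg (convex_Ico 0 R) ?_ ?_ ?_
  · intro s hs
    simp only [hcm]
    exact ((hA s ⟨by linarith [hs.1, hs.2], hs.2⟩).const_mul _).continuousAt.continuousWithinAt
  · intro s hs
    simp only [hcm]
    rw [interior_Ico] at hs
    exact ((hA s ⟨by linarith [hs.1, hs.2], hs.2⟩).const_mul _).differentiableAt.differentiableWithinAt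
  · intro s hs
    simp only [hcm]
    rw [interior_Ico] at hs
    rw [((hA s ⟨by linarith [hs.1, hs.2], hs.2⟩).const_mul _).deriv]
    refine mul_nonneg (by positivity) ?_
    have h1 := hPmono s ⟨hs.1.le, hs.2⟩
    simp only [hP, intervalIntegral.integral_const_mul] at h1
    exact nonneg_of_mul_nonneg_right h1 hs.1

/-- Closed discs in an open set can be enlarged. -/
theorem exists_gt_disc_subset {O : Set (Cn n)} (hO : IsOpen O) {y v : Cn n}
    (h : ∀ ζ : ℂ, ‖ζ‖ ≤ 1 → y + ζ • v ∈ O) :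
    ∃ R > (1 : ℝ), ∀ ζ : ℂ, ‖ζ‖ < R → y + ζ • v ∈ O := by
  have hopen : IsOpen ((fun ζ : ℂ => y + ζ • v) ⁻¹' O) := hO.preimage (by fun_prop)
  obtain ⟨δ, hδ, hsub⟩ := (isCompact_closedBall (0 : ℂ) 1).exists_thickening_subset_open hopen
    (fun ζ hζ => h ζ (by simpa using hζ))
  refine ⟨1 + δ, by linarith, fun ζ hζ => hsub ?_⟩
  rw [thickening_closedBall hδ zero_le_one]
  simpa [add_comm] using hζ

theorem le_circMean_of_levi_nonneg {g : Cn n → ℝ} {O : Set (Cn n)} (hO : IsOpen O)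
    (hg : ContDiffOn ℝ ∞ g O) {y v : Cn n}
    (hdisc : ∀ ζ : ℂ, ‖ζ‖ ≤ 1 → y + ζ • v ∈ O)
    (hlevi : ∀ z ∈ O, 0 ≤ levi v g z) : g y ≤ circMean g y v := by
  obtain ⟨R, hR, h⟩ := exists_gt_disc_subset hO hdisc
  have := circMean_monotoneOn hO hg h hlevi (a := 0) (b := 1) ⟨le_rfl, by linarith⟩
    ⟨zero_le_one, hR⟩ zero_le_one
  simpa using this

theorem circMean_le_circMean_smul {g : Cn n → ℝ} {O : Set (Cn n)} (hO : IsOpen O)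
    (hg : ContDiffOn ℝ ∞ g O) {y v : Cn n} {r : ℝ} (h0 : 0 ≤ r) (hr : r ≤ 1)
    (hdisc : ∀ ζ : ℂ, ‖ζ‖ ≤ 1 → y + ζ • v ∈ O)
    (hlevi : ∀ z ∈ O, 0 ≤ levi v g z) : circMean g y (r • v) ≤ circMean g y v := by
  obtain ⟨R, hR, h⟩ := exists_gt_disc_subset hO hdisc
  have := circMean_monotoneOn hO hg h hlevi (a := r) (b := 1) ⟨h0, by linarith⟩
    ⟨zero_le_one, hR⟩ hr
  simpa using this

end Calculus

/-! ### Mollification by a radial kernel -/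

section Kernel

variable {n : ℕ}

/-- An unnormalised smooth radial bump function supported in the unit ball. -/
def rawKernel (w : Cn n) : ℝ := expNegInvGlue (1 - ‖w‖ ^ 2)

theorem contDiff_rawKernel : ContDiff ℝ ∞ (rawKernel (n := n)) :=
  expNegInvGlue.contDiff.comp (contDiff_const.sub (contDiff_norm_sq ℂ))

theorem rawKernel_nonneg (w : Cn n) : 0 ≤ rawKernel w := expNegInvGlue.nonneg _

theorem rawKernel_pos {w : Cn n} (h : ‖w‖ < 1) : 0 < rawKernel w := by
  refine expNegInvGlue.pos_of_pos ?_
  nlinarith [norm_nonneg w]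

theorem rawKernel_eq_zero {w : Cn n} (h : 1 ≤ ‖w‖) : rawKernel w = 0 := by
  refine expNegInvGlue.zero_of_nonpos ?_
  nlinarith [norm_nonneg w]

theorem rawKernel_le_one (w : Cn n) : rawKernel w ≤ 1 := by
  unfold rawKernel expNegInvGlue
  split_ifs with h
  · exact zero_le_one
  · exact Real.exp_le_one_iff.2 (by simpa using (not_le.1 h).le)

/-- The radial mollifying kernel with support in the ball of radius `ε`. -/
def mker (n : ℕ) (ε : ℝ) (w : Cn n) : ℝ :=
  (∫ x : Cn n, rawKernel (ε⁻¹ • x))⁻¹ * rawKernel (ε⁻¹ • w)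

variable {ε : ℝ}

theorem contDiff_mker (ε : ℝ) : ContDiff ℝ ∞ (mker n ε) :=
  contDiff_const.mul (contDiff_rawKernel.comp (contDiff_const_smul _))

theorem continuous_mker (ε : ℝ) : Continuous (mker n ε) := (contDiff_mker ε).continuous

theorem mker_nonneg (ε : ℝ) (w : Cn n) : 0 ≤ mker n ε w :=
  mul_nonneg (inv_nonneg.2 (integral_nonneg fun _ => rawKernel_nonneg _)) (rawKernel_nonneg _)

theorem mker_eq_zero (hε : 0 < ε) {w : Cn n} (h : ε ≤ ‖w‖) : mker n ε w = 0 := by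
  rw [mker, rawKernel_eq_zero, mul_zero]
  rw [norm_smul, norm_inv, Real.norm_of_nonneg hε.le]
  rwa [inv_mul_eq_div, one_le_div hε]

theorem support_mker_subset (hε : 0 < ε) : Function.support (mker n ε) ⊆ Metric.ball 0 ε := by
  intro w hw
  by_contra h
  exact hw (mker_eq_zero hε (by simpa using h))

theorem hasCompactSupport_mker (hε : 0 < ε) : HasCompactSupport (mker n ε) :=
  HasCompactSupport.of_support_subset_isCompact (isCompact_closedBall 0 ε)
    ((support_mker_subset hε).trans Metric.ball_subset_closedBall)

theorem integrable_mker (hε : 0 < ε) : Integrable (mker n ε) :=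
  (continuous_mker ε).integrable_of_hasCompactSupport (hasCompactSupport_mker hε)

theorem integral_rawKernel_pos : 0 < ∫ x : Cn n, rawKernel x := by
  have hc : HasCompactSupport (rawKernel (n := n)) :=
    HasCompactSupport.of_support_subset_isCompact (isCompact_closedBall 0 1) (by
      intro w hw
      by_contra h
      exact hw (rawKernel_eq_zero (by simpa using (not_le.1 (by simpa using h)).le)))
  exact contDiff_rawKernel.continuous.integral_pos_of_hasCompactSupport_nonneg_nonzero hc
    rawKernel_nonneg (x := 0) (rawKernel_pos (by simp)).ne'

theorem integral_rawKernel_smul (hε : 0 < ε) :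
    ∫ x : Cn n, rawKernel (ε⁻¹ • x)
      = ε ^ Module.finrank ℝ (Cn n) * ∫ x : Cn n, rawKernel x := by
  rw [Measure.integral_comp_smul, inv_pow, inv_inv, abs_of_nonneg (by positivity), smul_eq_mul]

theorem integral_mker (hε : 0 < ε) : ∫ w, mker n ε w = 1 := by
  simp only [mker]
  rw [integral_const_mul, inv_mul_cancel₀]
  rw [integral_rawKernel_smul hε]
  have := integral_rawKernel_pos (n := n)
  positivity

theorem mker_pos (hε : 0 < ε) {w : Cn n} (h : ‖w‖ < ε) : 0 < mker n ε w := by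
  refine mul_pos (inv_pos.2 ?_) (rawKernel_pos ?_)
  · rw [integral_rawKernel_smul hε]
    have := integral_rawKernel_pos (n := n)
    positivity
  · rw [norm_smul, norm_inv, Real.norm_of_nonneg hε.le]
    rwa [inv_mul_eq_div, div_lt_one hε]

theorem mker_smul (c : ℂ) (hc : ‖c‖ = 1) (w : Cn n) : mker n ε (c • w) = mker n ε w := by
  rw [mker, mker, smul_comm, rawKernel, rawKernel, norm_smul, hc, one_mul]

theorem mker_neg (w : Cn n) : mker n ε (-w) = mker n ε w := by
  simpa using mker_smul (ε := ε) (-1) (by simp) w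

theorem mker_sub_comm (z w : Cn n) : mker n ε (z - w) = mker n ε (w - z) := by
  rw [← mker_neg, neg_sub]

theorem mker_scale (hε : 0 < ε) (w : Cn n) :
    mker n ε (ε • w) = (ε ^ Module.finrank ℝ (Cn n))⁻¹ * mker n 1 w := by
  rw [mker, mker, integral_rawKernel_smul hε, smul_smul, inv_mul_cancel₀ hε.ne', mul_inv]
  simp [mul_assoc]

/-- This is the form required by the Lebesgue differentiation theorem: domination by a multiple of
the normalised indicator of a ball of the same radius. Scaling makes the constant independent of
`ε`. -/
theorem exists_mker_le : ∃ K : ℝ, ∀ ε : ℝ, 0 < ε → ∀ w x : Cn n,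
    |mker n ε w| ≤ K / (volume : Measure (Cn n)).real (Metric.closedBall x ε) := by
  refine ⟨(volume : Measure (Cn n)).real (Metric.ball 0 1) / ∫ x : Cn n, rawKernel x,
    fun ε hε w x => ?_⟩
  have hv : (volume : Measure (Cn n)).real (Metric.closedBall x ε)
      = ε ^ Module.finrank ℝ (Cn n) * (volume : Measure (Cn n)).real (Metric.ball 0 1) := by
    rw [Measure.real, Measure.addHaar_closedBall _ _ hε.le, ENNReal.toReal_mul,
      ENNReal.toReal_ofReal (by positivity), Measure.real]
  have hp : 0 < (volume : Measure (Cn n)).real (Metric.ball 0 1) :=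
    ENNReal.toReal_pos (Metric.measure_ball_pos _ _ one_pos).ne' measure_ball_lt_top.ne
  have hI := integral_rawKernel_pos (n := n)
  rw [abs_of_nonneg (mker_nonneg _ _), mker, integral_rawKernel_smul hε, hv]
  have h1 := rawKernel_le_one (ε⁻¹ • w)
  have hpow : 0 < ε ^ Module.finrank ℝ (Cn n) := by positivity
  have : (volume : Measure (Cn n)).real (Metric.ball 0 1) / (∫ x : Cn n, rawKernel x)
      / (ε ^ Module.finrank ℝ (Cn n) * (volume : Measure (Cn n)).real (Metric.ball 0 1))
      = (ε ^ Module.finrank ℝ (Cn n) * ∫ x : Cn n, rawKernel x)⁻¹ * 1 := by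
    field_simp
  rw [this]
  exact mul_le_mul_of_nonneg_left h1 (by positivity)

end Kernel

section Mollify

variable {n : ℕ} {G : Type*} [NormedAddCommGroup G] [NormedSpace ℝ G] {ε : ℝ}

/-- The convolution of `f` with the kernel `φ`. -/
def convKer (φ : Cn n → ℝ) (f : Cn n → G) (z : Cn n) : G := ∫ w, φ (z - w) • f w

/-- The mollification of `f` at scale `ε`. -/
def mollify (ε : ℝ) (f : Cn n → G) (z : Cn n) : G := convKer (mker n ε) f z

theorem convKer_eq_convolution (φ : Cn n → ℝ) (f : Cn n → G) :
    convKer φ f = convolution f φ (ContinuousLinearMap.lsmul ℝ ℝ).flip volume := by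
  ext z
  simp [convKer, convolution_def]

theorem contDiff_convKer {φ : Cn n → ℝ} (hφ : ContDiff ℝ ∞ φ) (hc : HasCompactSupport φ)
    {f : Cn n → G} (hf : LocallyIntegrable f) : ContDiff ℝ ∞ (convKer φ f) := by
  rw [convKer_eq_convolution]
  exact hc.contDiff_convolution_right (n := ⊤) _ hf hφ

theorem hasCompactSupport_dirDeriv {φ : Cn n → G} (hc : HasCompactSupport φ) (a : Cn n) :
    HasCompactSupport (dirDeriv a φ) := by
  refine HasCompactSupport.intro (K := tsupport φ) hc fun x hx => ?_
  have : fderiv ℝ φ x = 0 := by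
    by_contra h
    exact hx (support_fderiv_subset ℝ h)
  simp [dirDeriv, this]

theorem tsupport_dirDeriv_subset (φ : Cn n → G) (a : Cn n) :
    tsupport (dirDeriv a φ) ⊆ tsupport φ := by
  refine closure_minimal (fun x hx => ?_) (isClosed_tsupport φ)
  by_contra h
  have : fderiv ℝ φ x = 0 := by
    by_contra h'
    exact h (support_fderiv_subset ℝ h')
  exact hx (by simp [dirDeriv, this])

theorem tsupport_levi_subset (φ : Cn n → G) (a : Cn n) :
    tsupport (levi a φ) ⊆ tsupport φ :=
  (tsupport_add _ _).trans (Set.union_subset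
    ((tsupport_dirDeriv_subset _ _).trans (tsupport_dirDeriv_subset _ _))
    ((tsupport_dirDeriv_subset _ _).trans (tsupport_dirDeriv_subset _ _)))

theorem hasCompactSupport_levi {φ : Cn n → G} (hc : HasCompactSupport φ) (a : Cn n) :
    HasCompactSupport (levi a φ) :=
  hc.mono' ((subset_tsupport _).trans (tsupport_levi_subset φ a))

theorem dirDeriv_convKer {φ : Cn n → ℝ} (hφ : ContDiff ℝ ∞ φ) (hc : HasCompactSupport φ)
    {f : Cn n → G} (hf : LocallyIntegrable f) (a : Cn n) :
    dirDeriv a (convKer φ f) = convKer (dirDeriv a φ) f := by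
  ext z
  rw [convKer_eq_convolution, convKer_eq_convolution, dirDeriv,
    (hc.hasFDerivAt_convolution_right _ hf (hφ.of_le (by exact_mod_cast le_top)) z).fderiv,
    convolution_precompR_apply _ hf (hc.fderiv (𝕜 := ℝ)) (hφ.continuous_fderiv (by simp))]
  rfl

theorem integrable_convKer {φ : Cn n → ℝ} (hφ : Continuous φ) (hc : HasCompactSupport φ)
    {f : Cn n → G} (hf : LocallyIntegrable f) (z : Cn n) :
    Integrable fun w => φ (z - w) • f w :=
  hf.integrable_smul_left_of_hasCompactSupport (hφ.comp (by fun_prop))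
    (hc.comp_homeomorph (Homeomorph.subLeft z))

theorem levi_convKer {φ : Cn n → ℝ} (hφ : ContDiff ℝ ∞ φ) (hc : HasCompactSupport φ)
    {f : Cn n → G} (hf : LocallyIntegrable f) (a : Cn n) :
    levi a (convKer φ f) = convKer (levi a φ) f := by
  ext z
  have h1 := fun b => contDiff_dirDeriv hφ b
  have h2 := fun b => hasCompactSupport_dirDeriv hc b
  rw [levi, dirDeriv_convKer hφ hc hf, dirDeriv_convKer (h1 _) (h2 _) hf,
    dirDeriv_convKer hφ hc hf, dirDeriv_convKer (h1 _) (h2 _) hf, convKer, convKer, convKer,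
    ← integral_add
      (integrable_convKer (contDiff_dirDeriv (h1 _) _).continuous
        (hasCompactSupport_dirDeriv (h2 _) _) hf z)
      (integrable_convKer (contDiff_dirDeriv (h1 _) _).continuous
        (hasCompactSupport_dirDeriv (h2 _) _) hf z)]
  simp only [levi, add_smul]

theorem dirDeriv_comp_sub_left (φ : Cn n → G) (a z w : Cn n) :
    dirDeriv a (fun w => φ (z - w)) w = - dirDeriv a φ (z - w) := by
  have h := fderiv_comp_sub (𝕜 := ℝ) (f := fun x => φ (-x)) (x := w) z
  have h2 := fderiv_comp_smul (𝕜 := ℝ) (f := φ) (c := (-1 : ℝ)) (x := w - z)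
  simp only [neg_sub, neg_smul, one_smul] at h h2
  rw [dirDeriv, h, h2]
  simp [dirDeriv]

theorem levi_comp_sub_left (φ : Cn n → G) (a z w : Cn n) :
    levi a (fun w => φ (z - w)) w = levi a φ (z - w) := by
  have h : ∀ b, dirDeriv b (fun w => φ (z - w)) = fun w => - dirDeriv b φ (z - w) := fun b =>
    funext fun w => dirDeriv_comp_sub_left φ b z w
  have h' : ∀ b, dirDeriv b (fun w => - dirDeriv b φ (z - w)) w
      = dirDeriv b (dirDeriv b φ) (z - w) := fun b => by
    have := dirDeriv_comp_sub_left (fun x => - dirDeriv b φ x) b z w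
    rw [this]
    simp [dirDeriv, fderiv_fun_neg]
    rfl
  rw [levi, h, h, h', h', levi]

theorem contDiff_mollify (hε : 0 < ε) {f : Cn n → G} (hf : LocallyIntegrable f) :
    ContDiff ℝ ∞ (mollify ε f) :=
  contDiff_convKer (contDiff_mker ε) (hasCompactSupport_mker hε) hf

theorem integrable_mollify (hε : 0 < ε) {f : Cn n → G} (hf : LocallyIntegrable f) (z : Cn n) :
    Integrable fun w => mker n ε (z - w) • f w :=
  integrable_convKer (continuous_mker ε) (hasCompactSupport_mker hε) hf z

theorem mollify_eq_sub (ε : ℝ) (f : Cn n → G) (z : Cn n) :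
    mollify ε f z = ∫ w, mker n ε w • f (z - w) := by
  rw [mollify, convKer, ← integral_sub_left_eq_self _ _ z]
  simp

theorem mollify_eq_add (ε : ℝ) (f : Cn n → G) (z : Cn n) :
    mollify ε f z = ∫ w, mker n ε w • f (z + w) := by
  rw [mollify_eq_sub, ← integral_neg_eq_self]
  simp [mker_neg]

/-- The substitution moves the scale from the kernel to the argument, so that different radii can be
compared under one fixed kernel. -/
theorem mollify_eq_smul (hε : 0 < ε) (f : Cn n → G) (z : Cn n) :
    mollify ε f z = ∫ w, mker n 1 w • f (z + ε • w) := by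
  have h := Measure.integral_comp_smul volume (fun w => mker n ε w • f (z + w)) ε
  rw [← mollify_eq_add] at h
  simp only [mker_scale hε, mul_smul] at h
  rw [integral_smul, abs_of_nonneg (by positivity)] at h
  exact (smul_right_injective G (inv_ne_zero (pow_ne_zero _ hε.ne')) h).symm

theorem mollify_congr_of_eqOn_ball (hε : 0 < ε) {f g : Cn n → G} {z : Cn n}
    (h : ∀ᵐ w, w ∈ Metric.ball z ε → f w = g w) : mollify ε f z = mollify ε g z := by
  refine integral_congr_ae ?_
  filter_upwards [h] with w hw
  by_cases hwz : w ∈ Metric.ball z ε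
  · rw [hw hwz]
  · rw [mker_eq_zero hε (by rwa [Metric.mem_ball, dist_comm, dist_eq_norm, not_lt] at hwz),
      zero_smul, zero_smul]

theorem mollify_const [CompleteSpace G] (hε : 0 < ε) (c : G) (z : Cn n) :
    mollify ε (fun _ => c) z = c := by
  rw [mollify_eq_sub, integral_smul_const, integral_mker hε, one_smul]

theorem mollify_mono (hε : 0 < ε) {f g : Cn n → ℝ} (hf : LocallyIntegrable f)
    (hg : LocallyIntegrable g) {z : Cn n} (h : ∀ᵐ w, w ∈ Metric.ball z ε → f w ≤ g w) :
    mollify ε f z ≤ mollify ε g z := by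
  refine integral_mono_ae (integrable_mollify hε hf z) (integrable_mollify hε hg z) ?_
  filter_upwards [h] with w hw
  by_cases hwz : w ∈ Metric.ball z ε
  · exact mul_le_mul_of_nonneg_left (hw hwz) (mker_nonneg _ _)
  · simp [mker_eq_zero hε (by rwa [Metric.mem_ball, dist_comm, dist_eq_norm, not_lt] at hwz)]

theorem mollify_eq_mul_swap (ε : ℝ) (f : Cn n → ℝ) (z : Cn n) :
    mollify ε f z = ∫ w, mker n ε (w - z) * f w := by
  simp [mollify, convKer, mker_sub_comm]

/-- Mollification is symmetric. -/
theorem integral_smul_mollify [CompleteSpace G] (hε : 0 < ε) {f : Cn n → G} (hf : Integrable f) {θ : Cn n → ℝ}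
    (hθ : Integrable θ) (hb : ∃ C, ∀ z, |θ z| ≤ C) :
    ∫ z, θ z • mollify ε f z = ∫ w, mollify ε θ w • f w := by
  have hint : Integrable (Function.uncurry fun z w : Cn n => θ z • mker n ε (z - w) • f w)
      ((volume : Measure (Cn n)).prod volume) := by
    have h1 := Integrable.convolution_integrand (ContinuousLinearMap.lsmul ℝ ℝ).flip hf
      (integrable_mker (n := n) hε) (μ := volume)
    simp only [ContinuousLinearMap.flip_apply, ContinuousLinearMap.lsmul_apply] at h1
    obtain ⟨C, hC⟩ := hb
    refine h1.bdd_smul (C := C) ?_ ?_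
    · exact hθ.aestronglyMeasurable.comp_fst
    · exact Filter.Eventually.of_forall fun p => hC p.1
  calc ∫ z, θ z • mollify ε f z = ∫ z, ∫ w, θ z • mker n ε (z - w) • f w := by
        refine integral_congr_ae (Filter.Eventually.of_forall fun z => ?_)
        simp only [mollify, convKer, integral_smul]
    _ = ∫ w, ∫ z, θ z • mker n ε (z - w) • f w := integral_integral_swap hint
    _ = _ := by
        refine integral_congr_ae (Filter.Eventually.of_forall fun w => ?_)
        simp only [smul_smul]
        rw [integral_smul_const]
        congr 1
        rw [mollify_eq_mul_swap]
        simp only [mul_comm]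

theorem dist_mollify_le (hε : 0 < ε) {θ : Cn n → ℝ} (hθ : LocallyIntegrable θ) {δ : ℝ} {z : Cn n}
    (h : ∀ w ∈ Metric.ball z ε, |θ w - θ z| ≤ δ) : |mollify ε θ z - θ z| ≤ δ := by
  rw [abs_le]
  have hc : ∀ c : ℝ, LocallyIntegrable (fun _ : Cn n => c) := fun c => locallyIntegrable_const c
  constructor
  · have := mollify_mono hε (hc (θ z - δ)) hθ (z := z)
      (Filter.Eventually.of_forall fun w hw => by linarith [(abs_le.1 (h w hw)).1])
    rw [mollify_const hε] at this
    linarith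
  · have := mollify_mono hε hθ (hc (θ z + δ)) (z := z)
      (Filter.Eventually.of_forall fun w hw => by linarith [(abs_le.1 (h w hw)).2])
    rw [mollify_const hε] at this
    linarith

theorem tendsto_mollify_of_continuousAt {θ : Cn n → ℝ} (hθ : LocallyIntegrable θ) {z : Cn n}
    (hc : ContinuousAt θ z) {ι : Type*} {l : Filter ι} {e : ι → ℝ} (he : Filter.Tendsto e l (𝓝[>] 0)) :
    Filter.Tendsto (fun i => mollify (e i) θ z) l (𝓝 (θ z)) := by
  rw [Metric.tendsto_nhds]
  intro δ hδ
  obtain ⟨η, hη, hηs⟩ := Metric.continuousAt_iff.1 hc (δ / 2) (by linarith)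
  have hlt : ∀ᶠ i in l, 0 < e i ∧ e i < η := he.eventually (Ioo_mem_nhdsGT hη)
  filter_upwards [hlt] with i hi
  have := dist_mollify_le hi.1 hθ (δ := δ / 2) (z := z) fun w hw =>
    (hηs ((Metric.mem_ball.1 hw).trans hi.2)).le
  rw [Real.dist_eq]
  linarith

/-- Mollifications converge weakly. -/
theorem tendsto_integral_smul_mollify [CompleteSpace G] {f : Cn n → G} (hf : Integrable f) {θ : Cn n → ℝ}
    (hθ : Continuous θ) (hc : HasCompactSupport θ) {ι : Type*} {l : Filter ι}
    [l.IsCountablyGenerated] {e : ι → ℝ} (he : Filter.Tendsto e l (𝓝[>] 0)) :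
    Filter.Tendsto (fun i => ∫ z, θ z • mollify (e i) f z) l (𝓝 (∫ z, θ z • f z)) := by
  obtain ⟨C, hC⟩ := hc.exists_bound_of_continuous hθ
  have hθi : Integrable θ := hθ.integrable_of_hasCompactSupport hc
  have hpos : ∀ᶠ i in l, 0 < e i := he.eventually self_mem_nhdsWithin
  -- Symmetry moves the mollification to the continuous function `θ`, where it converges pointwise
  -- and keeps the bound of `θ`.
  have hev : ∀ᶠ i in l, ∫ w, mollify (e i) θ w • f w = ∫ z, θ z • mollify (e i) f z := by
    filter_upwards [hpos] with i hi
    exact (integral_smul_mollify hi hf hθi ⟨C, hC⟩).symm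
  refine Filter.Tendsto.congr' hev ?_
  refine tendsto_integral_filter_of_dominated_convergence (fun w => C * ‖f w‖) ?_ ?_
    (hf.norm.const_mul C) ?_
  · filter_upwards [hpos] with i hi
    exact (contDiff_mollify hi hθi.locallyIntegrable).continuous.aestronglyMeasurable.smul
      hf.aestronglyMeasurable
  · filter_upwards [hpos] with i hi
    refine Filter.Eventually.of_forall fun w => ?_
    rw [norm_smul]
    refine mul_le_mul_of_nonneg_right ?_ (norm_nonneg _)
    rw [Real.norm_eq_abs, abs_le]
    have hl : ∀ c : ℝ, LocallyIntegrable (fun _ : Cn n => c) := fun c => locallyIntegrable_const c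
    constructor
    · have := mollify_mono hi (hl (-C)) hθi.locallyIntegrable (z := w)
        (Filter.Eventually.of_forall fun x _ => (abs_le.1 (hC x)).1)
      rwa [mollify_const hi] at this
    · have := mollify_mono hi hθi.locallyIntegrable (hl C) (z := w)
        (Filter.Eventually.of_forall fun x _ => (abs_le.1 (hC x)).2)
      rwa [mollify_const hi] at this
  · refine Filter.Eventually.of_forall fun w => ?_
    exact (tendsto_mollify_of_continuousAt hθi.locallyIntegrable hθ.continuousAt he).smul_const _

/-- Lebesgue differentiation along balls (Besicovitch), applied to kernels bounded as in
`exists_mker_le`. The quantifier over `e` stands inside, so the null set does not depend on the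
sequence. -/
theorem ae_tendsto_mollify [CompleteSpace G] {f : Cn n → G} (hf : LocallyIntegrable f) :
    ∀ᵐ z, ∀ {e : ℕ → ℝ}, Filter.Tendsto e Filter.atTop (𝓝[>] 0) →
      Filter.Tendsto (fun i => mollify (e i) f z) Filter.atTop (𝓝 (f z)) := by
  obtain ⟨K, hK⟩ := exists_mker_le (n := n)
  filter_upwards [(Besicovitch.vitaliFamily volume).ae_tendsto_average_norm_sub hf] with z hz
  intro e he
  have h1 := (hz.comp (Besicovitch.tendsto_filterAt volume z)).comp he
  have hpos : ∀ᶠ i in Filter.atTop, 0 < e i := he.eventually self_mem_nhdsWithin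
  refine tendsto_integral_smul_of_tendsto_average_norm_sub (K := K) h1 ?_ ?_ ?_ ?_
  · exact Filter.Eventually.of_forall fun i => hf.integrableOn_isCompact (isCompact_closedBall _ _)
  · refine (Filter.tendsto_congr' ?_).2 tendsto_const_nhds
    filter_upwards [hpos] with i hi
    rw [integral_sub_left_eq_self (mker n (e i)) volume z, integral_mker hi]
  · filter_upwards [hpos] with i hi w hw
    have := support_mker_subset hi (show z - w ∈ Function.support (mker n (e i)) from hw)
    rw [Metric.mem_closedBall, dist_comm, dist_eq_norm]
    simpa using (mem_ball_zero_iff.1 this).le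
  · filter_upwards [hpos] with i hi x
    exact hK (e i) hi _ z

end Mollify

/-! ### Polar coordinates and monotonicity of mollifications -/

section Polar

variable {n : ℕ} {ε : ℝ}

/-- Multiplication by a complex number of modulus one, as a real isometry. -/
def rotate (n : ℕ) (c : ℂ) (hc : ‖c‖ = 1) : Cn n ≃ₗᵢ[ℝ] Cn n where
  toLinearEquiv := (LinearEquiv.smulOfNeZero ℂ (Cn n) c (by
    intro h
    simp [h] at hc)).restrictScalars ℝ
  norm_map' x := by simp [norm_smul, hc]

@[simp] theorem rotate_apply (c : ℂ) (hc : ‖c‖ = 1) (x : Cn n) : rotate n c hc x = c • x := rfl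

theorem integral_mker_mul_rotate (g : Cn n → ℝ) (z : Cn n) (c : ℂ) (hc : ‖c‖ = 1) :
    ∫ w, mker n ε w * g (z + c • w) = mollify ε g z := by
  rw [mollify_eq_add]
  have h := (rotate n c hc).measurePreserving.integral_comp
    (rotate n c hc).toHomeomorph.measurableEmbedding (fun w => mker n ε w • g (z + w))
  rw [← h]
  simp [mker_smul c hc]

/-- The kernel is invariant under multiplication by `e^{iθ}`, so rotating the variable of
integration does not change the mollification. Averaging over `θ` and exchanging the integrals puts
a circle mean in place of `g`; no radial integration is needed. -/
theorem mollify_polar (hε : 0 < ε) {g : Cn n → ℝ} (hg : Measurable g) {z : Cn n} {C : ℝ}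
    (hC : ∀ w ∈ Metric.closedBall z ε, |g w| ≤ C) :
    Integrable (fun w => mker n ε w * circMean g z w) ∧
      mollify ε g z = ∫ w, mker n ε w * circMean g z w := by
  have hpos : (0 : ℝ) ≤ 2 * Real.pi := by positivity
  set ν : Measure ℝ := volume.restrict (Set.Ioc 0 (2 * Real.pi)) with hν
  set F : Cn n → ℝ → ℝ :=
    fun w θ => mker n ε w * g (z + Complex.exp (θ * Complex.I) • w) with hF
  have hmeas : Measurable (Function.uncurry F) := by
    refine ((continuous_mker ε).measurable.comp measurable_fst).mul (hg.comp ?_)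
    have : Continuous fun p : Cn n × ℝ => z + Complex.exp (p.2 * Complex.I) • p.1 := by fun_prop
    exact this.measurable
  have hint : Integrable (Function.uncurry F) ((volume : Measure (Cn n)).prod ν) := by
    have h1 : Integrable (fun p : Cn n × ℝ => mker n ε p.1 * C)
        ((volume : Measure (Cn n)).prod ν) :=
      (integrable_mker hε).mul_prod (integrable_const C)
    refine h1.mono' hmeas.aestronglyMeasurable (Filter.Eventually.of_forall fun p => ?_)
    simp only [Function.uncurry, hF]
    rw [norm_mul, Real.norm_of_nonneg (mker_nonneg _ _)]
    by_cases hp : ‖p.1‖ < ε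
    · refine mul_le_mul_of_nonneg_left (hC _ ?_) (mker_nonneg _ _)
      rw [Metric.mem_closedBall, dist_eq_norm, add_sub_cancel_left, norm_smul,
        Complex.norm_exp_ofReal_mul_I, one_mul]
      exact hp.le
    · simp [mker_eq_zero hε (not_lt.1 hp)]
  have hinner : ∀ w, mker n ε w * circMean g z w = (2 * Real.pi)⁻¹ * ∫ θ, F w θ ∂ν := fun w => by
    rw [circMean_eq, intervalIntegral.integral_of_le hpos]
    simp only [hF, integral_const_mul]
    ring
  simp only [hinner]
  refine ⟨hint.integral_prod_left.const_mul _, ?_⟩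
  rw [integral_const_mul, integral_integral_swap hint]
  have : ∀ θ : ℝ, ∫ w, F w θ = mollify ε g z := fun θ =>
    integral_mker_mul_rotate g z _ (Complex.norm_exp_ofReal_mul_I θ)
  simp only [this, hν]
  rw [← intervalIntegral.integral_of_le hpos, intervalIntegral.integral_const]
  have := Real.pi_pos
  rw [sub_zero, smul_eq_mul]
  field_simp

theorem le_mollify_of_le_circMean (hε : 0 < ε) {g : Cn n → ℝ} (hg : Measurable g) {z : Cn n}
    {C : ℝ} (hC : ∀ w ∈ Metric.closedBall z ε, |g w| ≤ C)
    (h : ∀ w, ‖w‖ < ε → g z ≤ circMean g z w) : g z ≤ mollify ε g z := by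
  obtain ⟨hi, he⟩ := mollify_polar hε hg hC
  rw [he]
  have h1 : g z = ∫ w, mker n ε w * g z := by
    rw [integral_mul_const, integral_mker hε, one_mul]
  rw [h1]
  refine integral_mono ((integrable_mker hε).mul_const _) hi fun w => ?_
  by_cases hw : ‖w‖ < ε
  · exact mul_le_mul_of_nonneg_left (h w hw) (mker_nonneg _ _)
  · simp [mker_eq_zero hε (not_lt.1 hw)]

theorem add_smul_mem_closedBall {z v : Cn n} {ζ : ℂ} (hζ : ‖ζ‖ ≤ 1) (hv : ‖v‖ ≤ ε) :
    z + ζ • v ∈ Metric.closedBall z ε := by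
  rw [Metric.mem_closedBall, dist_eq_norm, add_sub_cancel_left, norm_smul]
  calc ‖ζ‖ * ‖v‖ ≤ 1 * ‖v‖ := mul_le_mul_of_nonneg_right hζ (norm_nonneg _)
    _ ≤ ε := by rwa [one_mul]

/-- After rescaling to the kernel of radius one, both sides integrate circle means whose radii are
proportional to `ε₁` and `ε₂`, and circle means increase with the radius. -/
theorem mollify_mono_radius_of_smooth {g : Cn n → ℝ} (hg : ContDiff ℝ ∞ g) {O : Set (Cn n)}
    (hO : IsOpen O) (hlevi : ∀ z ∈ O, ∀ ξ, 0 ≤ levi ξ g z) {z : Cn n} {ε₁ ε₂ : ℝ} (h1 : 0 < ε₁)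
    (h12 : ε₁ ≤ ε₂) (hz : Metric.closedBall z ε₂ ⊆ O) : mollify ε₁ g z ≤ mollify ε₂ g z := by
  have h2 := h1.trans_le h12
  have key : ∀ e : ℝ, 0 < e → Integrable (fun w => mker n 1 w * circMean g z (e • w)) ∧
      mollify e g z = ∫ w, mker n 1 w * circMean g z (e • w) := fun e he => by
    have hc : Continuous fun w => g (z + e • w) := hg.continuous.comp (by fun_prop)
    obtain ⟨C, hC⟩ := (isCompact_closedBall (0 : Cn n) 1).exists_bound_of_continuousOn
      hc.continuousOn
    have h := mollify_polar one_pos hc.measurable hC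
    have e1 : mollify e g z = mollify 1 (fun w => g (z + e • w)) 0 := by
      rw [mollify_eq_smul he, mollify_eq_add]
      simp
    have e2 : ∀ w, circMean (fun w => g (z + e • w)) 0 w = circMean g z (e • w) := fun w => by
      simp only [circMean, zero_add]
      congr 1
      ext ζ
      rw [smul_comm]
    simp only [e2] at h
    rwa [e1]
  rw [(key ε₁ h1).2, (key ε₂ h2).2]
  refine integral_mono (key ε₁ h1).1 (key ε₂ h2).1 fun w => ?_
  by_cases hw : ‖w‖ < 1
  · refine mul_le_mul_of_nonneg_left ?_ (mker_nonneg _ _)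
    have h3 := circMean_le_circMean_smul hO hg.contDiffOn (y := z) (v := ε₂ • w) (r := ε₁ / ε₂)
      (by positivity) ((div_le_one h2).2 h12)
      (fun ζ hζ => hz (add_smul_mem_closedBall hζ (by
        rw [norm_smul, Real.norm_of_nonneg h2.le]
        nlinarith))) (fun x hx => hlevi x hx _)
    rwa [smul_smul, div_mul_cancel₀ _ h2.ne'] at h3
  · simp [mker_eq_zero one_pos (not_lt.1 hw)]

theorem dirDeriv_sq_sub (L : Cn n →L[ℝ] ℝ) (k : ℝ) (a : Cn n) :
    dirDeriv a (fun z => (L z - k) ^ 2) = fun z => 2 * (L z - k) * L a := by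
  ext z
  have h := ((L.hasFDerivAt (x := z)).sub_const k).pow 2
  rw [dirDeriv, h.fderiv]
  simp

theorem levi_sq_sub (L : Cn n →L[ℝ] ℝ) (k : ℝ) (a z : Cn n) :
    levi a (fun z => (L z - k) ^ 2) z = 2 * L a ^ 2 + 2 * L (Complex.I • a) ^ 2 := by
  have h : ∀ b, dirDeriv b (fun z => 2 * (L z - k) * L b) z = 2 * L b ^ 2 := fun b => by
    have h := (((L.hasFDerivAt (x := z)).sub_const k).const_mul 2).mul_const (L b)
    rw [dirDeriv, h.fderiv]
    simp
    ring
  rw [levi, dirDeriv_sq_sub, dirDeriv_sq_sub, h, h]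

theorem levi_add {G : Type*} [NormedAddCommGroup G] [NormedSpace ℝ G] {f g : Cn n → G} {z : Cn n}
    (hf : ContDiffAt ℝ ∞ f z) (hg : ContDiffAt ℝ ∞ g z) (a : Cn n) :
    levi a (fun w => f w + g w) z = levi a f z + levi a g z := by
  have hev : ∀ b, dirDeriv b (fun w => f w + g w)
      =ᶠ[𝓝 z] fun w => dirDeriv b f w + dirDeriv b g w := fun b => by
    have h1 : ∀ᶠ w in 𝓝 z, DifferentiableAt ℝ f w := by
      filter_upwards [(hf.of_le (m := 1) (by exact_mod_cast le_top)).eventually (by simp)] with w hw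
      exact hw.differentiableAt (by simp)
    have h2 : ∀ᶠ w in 𝓝 z, DifferentiableAt ℝ g w := by
      filter_upwards [(hg.of_le (m := 1) (by exact_mod_cast le_top)).eventually (by simp)] with w hw
      exact hw.differentiableAt (by simp)
    filter_upwards [h1, h2] with w hw1 hw2
    simp [dirDeriv, fderiv_fun_add hw1 hw2]
  have h : ∀ b, dirDeriv b (dirDeriv b fun w => f w + g w) z
      = dirDeriv b (dirDeriv b f) z + dirDeriv b (dirDeriv b g) z := fun b => by
    rw [(dirDeriv_congr (hev b) b).self_of_nhds]
    change fderiv ℝ (fun w => dirDeriv b f w + dirDeriv b g w) z b = _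
    rw [fderiv_fun_add (ContDiffAt.differentiableAt_top (contDiffAt_dirDeriv hf b))
      (ContDiffAt.differentiableAt_top (contDiffAt_dirDeriv hg b))]
    rfl
  rw [levi, h, h, levi, levi]
  abel

theorem levi_const_mul {f : Cn n → ℝ} (c : ℝ) (a : Cn n) :
    levi a (fun w => c * f w) = fun w => c * levi a f w := by
  have h : ∀ (g : Cn n → ℝ) b, dirDeriv b (fun w => c * g w) = fun w => c * dirDeriv b g w :=
    fun g b => by
      ext w
      change fderiv ℝ (fun w => c • g w) w b = _
      rw [show (fun w => c • g w) = c • g from rfl, fderiv_const_smul_field]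
      rfl
  ext w
  simp only [levi, h]
  ring

theorem levi_zero {G : Type*} [NormedAddCommGroup G] [NormedSpace ℝ G] (g : Cn n → G) (z : Cn n) :
    levi 0 g z = 0 := by
  simp [levi, dirDeriv]

/-- A smooth function with the sub-mean value property on small discs has non-negative
Levi form. -/
theorem levi_nonneg_of_le_circMean {g : Cn n → ℝ} {O : Set (Cn n)} (hO : IsOpen O)
    (hg : ContDiffOn ℝ ∞ g O) {z ξ : Cn n} (hz : z ∈ O)
    (h : ∃ r₀ > 0, ∀ r : ℝ, 0 < r → r < r₀ → g z ≤ circMean g z (r • ξ)) : 0 ≤ levi ξ g z := by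
  by_contra! hneg
  obtain ⟨r₀, hr₀, hr⟩ := h
  have hξ : ξ ≠ 0 := fun h0 => by simp [h0, levi_zero] at hneg
  obtain ⟨j, hj⟩ : ∃ j, ξ j ≠ 0 := by
    by_contra! hcon
    exact hξ (PiLp.ext hcon)
  set Lr : Cn n →L[ℝ] ℝ := Complex.reCLM.comp
    ((EuclideanSpace.proj (𝕜 := ℂ) j : Cn n →L[ℂ] ℂ).restrictScalars ℝ) with hLr
  set Li : Cn n →L[ℝ] ℝ := Complex.imCLM.comp
    ((EuclideanSpace.proj (𝕜 := ℂ) j : Cn n →L[ℂ] ℂ).restrictScalars ℝ) with hLi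
  have hLra : ∀ w, Lr w = (w j).re := fun w => rfl
  have hLia : ∀ w, Li w = (w j).im := fun w => rfl
  -- `q` is `|w_j - z_j|²` for a coordinate with `ξ j ≠ 0`. Its Laplacian along `ξ` and its circle
  -- means are explicit, which makes a strict inequality for the Levi form visible in the means.
  set q : Cn n → ℝ := fun w => (Lr w - Lr z) ^ 2 + (Li w - Li z) ^ 2 with hq
  have hqs1 : ContDiff ℝ ∞ fun w => (Lr w - Lr z) ^ 2 :=
    (Lr.contDiff.sub contDiff_const).pow 2
  have hqs2 : ContDiff ℝ ∞ fun w => (Li w - Li z) ^ 2 :=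
    (Li.contDiff.sub contDiff_const).pow 2
  have hqs : ContDiff ℝ ∞ q := hqs1.add hqs2
  have hlq : ∀ w, levi ξ q w = 4 * ‖ξ j‖ ^ 2 := fun w => by
    rw [hq, levi_add hqs1.contDiffAt hqs2.contDiffAt, levi_sq_sub, levi_sq_sub, hLra, hLra, hLia,
      hLia, PiLp.smul_apply, smul_eq_mul, ← Complex.normSq_eq_norm_sq, Complex.normSq_apply]
    simp
    ring
  have hcq : ∀ r : ℝ, circMean q z (r • ξ) = r ^ 2 * ‖ξ j‖ ^ 2 := fun r => by
    rw [circMean]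
    refine Real.circleAverage_const_on_circle fun ζ hζ => ?_
    have hζ1 : ‖ζ‖ = 1 := by simpa using hζ
    have : q (z + ζ • r • ξ) = ‖(ζ * (r * ξ j))‖ ^ 2 := by
      rw [← Complex.normSq_eq_norm_sq, Complex.normSq_apply]
      simp only [hq, hLra, hLia, PiLp.add_apply, PiLp.smul_apply, smul_eq_mul, Complex.add_re,
        Complex.add_im, Complex.real_smul]
      ring
    rw [this, norm_mul, norm_mul, hζ1, Complex.norm_real, one_mul, mul_pow, Real.norm_eq_abs,
      sq_abs]
  have hξj : 0 < ‖ξ j‖ ^ 2 := by positivity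
  -- With this `c`, the function `-g - c q` still has the positive Levi form `-levi ξ g z / 2` at
  -- `z`, hence satisfies the sub-mean value inequality on small discs. Together with the inequality
  -- for `g` this contradicts `c r² ‖ξ j‖² > 0`.
  set c := - levi ξ g z / (8 * ‖ξ j‖ ^ 2) with hc
  have hcpos : 0 < c := div_pos (by linarith) (by positivity)
  have hgA : ∀ w ∈ O, ContDiffAt ℝ ∞ g w := fun w hw => hg.contDiffAt (hO.mem_nhds hw)
  set G : Cn n → ℝ := fun w => (-1) * g w + (-c) * q w with hG
  have hGs : ContDiffOn ℝ ∞ G O :=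
    (contDiffOn_const.mul hg).add (contDiffOn_const.mul hqs.contDiffOn)
  have hGl : ∀ w ∈ O, levi ξ G w = - levi ξ g w - c * (4 * ‖ξ j‖ ^ 2) := fun w hw => by
    rw [hG, levi_add (contDiffAt_const.mul (hgA w hw)) (contDiffAt_const.mul hqs.contDiffAt),
      levi_const_mul, levi_const_mul]
    simp only [hlq]
    ring
  have hGz : 0 < levi ξ G z := by
    rw [hGl z hz, hc]
    have : -levi ξ g z / (8 * ‖ξ j‖ ^ 2) * (4 * ‖ξ j‖ ^ 2) = - levi ξ g z / 2 := by
      field_simp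
      ring
    linarith
  have hcont : ContinuousAt (levi ξ G) z :=
    (contDiffAt_levi (hGs.contDiffAt (hO.mem_nhds hz)) ξ).continuousAt
  obtain ⟨δ, hδ, hδs⟩ := Metric.eventually_nhds_iff_ball.1
    ((hcont.eventually (lt_mem_nhds hGz)).and (hO.mem_nhds hz))
  have hξn : 0 < ‖ξ‖ := norm_pos_iff.2 hξ
  set r := min (r₀ / 2) (δ / (2 * ‖ξ‖)) with hrdef
  have hrpos : 0 < r := lt_min (by linarith) (by positivity)
  have hrξ : ‖r • ξ‖ ≤ δ / 2 := by
    rw [norm_smul, Real.norm_of_nonneg hrpos.le]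
    calc r * ‖ξ‖ ≤ δ / (2 * ‖ξ‖) * ‖ξ‖ := by gcongr; exact min_le_right _ _
      _ = δ / 2 := by field_simp
  have hdisc : ∀ ζ : ℂ, ‖ζ‖ ≤ 1 → z + ζ • r • ξ ∈ Metric.ball z δ := fun ζ hζ =>
    Metric.closedBall_subset_ball (by linarith) (add_smul_mem_closedBall hζ hrξ)
  have hleviG : ∀ w ∈ Metric.ball z δ, 0 ≤ levi (r • ξ) G w := fun w hw => by
    have hA := hGs.contDiffAt (hO.mem_nhds (hδs w hw).2)
    have h1 := (hδs w hw).1.le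
    rw [levi_eq hA] at h1 ⊢
    rw [smul_comm Complex.I r ξ]
    simp only [map_smul, smul_apply, smul_eq_mul]
    have : 0 ≤ r * r := by positivity
    nlinarith
  have h3 := le_circMean_of_levi_nonneg Metric.isOpen_ball
    (hGs.mono fun w hw => (hδs w hw).2) hdisc hleviG
  have hgi : CircleIntegrable (fun ζ : ℂ => g (z + ζ • r • ξ)) 0 1 := by
    refine ContinuousOn.circleIntegrable zero_le_one ?_
    exact hg.continuousOn.comp (by fun_prop) fun ζ hζ =>
      (hδs _ (hdisc ζ (by simpa using (mem_sphere_iff_norm.1 hζ).le))).2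
  have hqi : CircleIntegrable (fun ζ : ℂ => q (z + ζ • r • ξ)) 0 1 :=
    ContinuousOn.circleIntegrable zero_le_one
      (hqs.continuous.comp (by fun_prop)).continuousOn
  have h4 : circMean G z (r • ξ) = - circMean g z (r • ξ) - c * circMean q z (r • ξ) := by
    simp only [circMean, hG]
    have ha := Real.circleAverage_add (f₁ := (-1 : ℝ) • fun ζ : ℂ => g (z + ζ • r • ξ))
      (f₂ := (-c) • fun ζ : ℂ => q (z + ζ • r • ξ)) (c := 0) (R := 1)
      (hgi.const_smul) (hqi.const_smul)
    rw [Real.circleAverage_smul, Real.circleAverage_smul] at ha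
    simp only [smul_eq_mul] at ha
    refine Eq.trans ?_ (ha.trans ?_)
    · rfl
    · ring
  have h5 := hr r hrpos ((min_le_left _ _).trans_lt (by linarith))
  rw [h4, hcq] at h3
  have h6 : q z = 0 := by simp [hq]
  have h7 : 0 < c * (r ^ 2 * ‖ξ j‖ ^ 2) := by positivity
  simp only [hG, h6] at h3
  linarith

end Polar

/-! ### Distributional plurisubharmonicity -/

section Test

variable {n : ℕ}

/-- Non-negative test functions with compact support in `Ω`. -/
structure IsTest (ψ : Cn n → ℝ) (Ω : Set (Cn n)) : Prop where
  smooth : ContDiff ℝ ∞ ψ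
  compact : HasCompactSupport ψ
  subset : tsupport ψ ⊆ Ω
  nonneg : ∀ y, 0 ≤ ψ y

theorem IsTest.mono {ψ : Cn n → ℝ} {Ω Ω' : Set (Cn n)} (h : IsTest ψ Ω) (hs : Ω ⊆ Ω') :
    IsTest ψ Ω' := ⟨h.smooth, h.compact, h.subset.trans hs, h.nonneg⟩

theorem integrable_mul_of_locallyIntegrableOn {𝕜 : Type*} [RCLike 𝕜] {f θ : Cn n → 𝕜}
    {Ω : Set (Cn n)}
    (hf : LocallyIntegrableOn f Ω) (hθ : Continuous θ) (hc : HasCompactSupport θ)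
    (hs : tsupport θ ⊆ Ω) : Integrable fun y => f y * θ y := by
  have h1 : IntegrableOn f (tsupport θ) := hf.integrableOn_compact_subset hs hc
  have h2 : IntegrableOn (fun y => f y * θ y) (tsupport θ) :=
    h1.mul_continuousOn hθ.continuousOn hc
  rwa [integrableOn_iff_integrable_of_support_subset] at h2
  refine fun y hy => subset_tsupport θ ?_
  exact right_ne_zero_of_mul hy

theorem continuous_mul_of_tsupport_subset {f θ : Cn n → ℂ} {Ω : Set (Cn n)} (hO : IsOpen Ω)
    (hf : ContinuousOn f Ω) (hθ : Continuous θ) (hs : tsupport θ ⊆ Ω) :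
    Continuous fun y => f y * θ y := by
  rw [continuous_iff_continuousAt]
  intro y
  by_cases hy : y ∈ Ω
  · exact (hf.continuousAt (hO.mem_nhds hy)).mul hθ.continuousAt
  · have h0 : (fun y => f y * θ y) =ᶠ[𝓝 y] fun _ => 0 := by
      filter_upwards [(notMem_tsupport_iff_eventuallyEq.1 fun h => hy (hs h))] with w hw
      rw [hw, Pi.zero_apply, mul_zero]
    exact continuousAt_const.congr h0.symm

theorem hasCompactSupport_mul {f θ : Cn n → ℂ} (hc : HasCompactSupport θ) :
    HasCompactSupport fun y => f y * θ y := hc.mul_left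

theorem integrable_mul_of_tsupport_subset {f θ : Cn n → ℂ} {Ω : Set (Cn n)} (hO : IsOpen Ω)
    (hf : ContinuousOn f Ω) (hθ : Continuous θ) (hc : HasCompactSupport θ) (hs : tsupport θ ⊆ Ω) :
    Integrable fun y => f y * θ y :=
  (continuous_mul_of_tsupport_subset hO hf hθ hs).integrable_of_hasCompactSupport
    (hasCompactSupport_mul hc)

theorem contDiffOn_dirDeriv {G : Type*} [NormedAddCommGroup G] [NormedSpace ℝ G] {f : Cn n → G}
    {Ω : Set (Cn n)} (hO : IsOpen Ω) (hf : ContDiffOn ℝ ∞ f Ω) (a : Cn n) :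
    ContDiffOn ℝ ∞ (dirDeriv a f) Ω := fun _ hz =>
  (contDiffAt_dirDeriv (hf.contDiffAt (hO.mem_nhds hz)) a).contDiffWithinAt

theorem contDiffOn_levi {G : Type*} [NormedAddCommGroup G] [NormedSpace ℝ G] {f : Cn n → G}
    {Ω : Set (Cn n)} (hO : IsOpen Ω) (hf : ContDiffOn ℝ ∞ f Ω) (a : Cn n) :
    ContDiffOn ℝ ∞ (levi a f) Ω := fun _ hz =>
  (contDiffAt_levi (hf.contDiffAt (hO.mem_nhds hz)) a).contDiffWithinAt

/-- Integration by parts. -/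
theorem integral_mul_dirDeriv {f θ : Cn n → ℂ} {Ω : Set (Cn n)} (hO : IsOpen Ω)
    (hf : ContDiffOn ℝ ∞ f Ω) (hθ : ContDiff ℝ ∞ θ) (hc : HasCompactSupport θ)
    (hs : tsupport θ ⊆ Ω) (a : Cn n) :
    ∫ y, f y * dirDeriv a θ y = - ∫ y, dirDeriv a f y * θ y := by
  refine integral_mul_fderiv_eq_neg_fderiv_mul_of_integrable ?_ ?_ ?_ ?_ ?_
  · exact integrable_mul_of_tsupport_subset hO (contDiffOn_dirDeriv hO hf a).continuousOn
      hθ.continuous hc hs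
  · exact integrable_mul_of_tsupport_subset hO hf.continuousOn (contDiff_dirDeriv hθ a).continuous
      (hasCompactSupport_dirDeriv hc a) ((tsupport_dirDeriv_subset θ a).trans hs)
  · exact integrable_mul_of_tsupport_subset hO hf.continuousOn hθ.continuous hc hs
  · exact fun x hx =>
      ContDiffAt.differentiableAt_top (hf.contDiffAt (hO.mem_nhds (hs hx)))
  · exact fun x _ => ContDiffAt.differentiableAt_top hθ.contDiffAt

theorem dirDeriv_ofReal {f : Cn n → ℝ} {z : Cn n} (hf : DifferentiableAt ℝ f z) (a : Cn n) :
    dirDeriv a (fun y => (f y : ℂ)) z = ((dirDeriv a f z : ℝ) : ℂ) := by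
  have h := (Complex.ofRealCLM.hasFDerivAt.comp z hf.hasFDerivAt).fderiv
  change fderiv ℝ (Complex.ofRealCLM ∘ f) z a = _
  rw [h]
  rfl

theorem contDiffAt_ofReal {f : Cn n → ℝ} {z : Cn n} (hf : ContDiffAt ℝ ∞ f z) :
    ContDiffAt ℝ ∞ (fun y => (f y : ℂ)) z :=
  Complex.ofRealCLM.contDiff.contDiffAt.comp z hf

theorem eventually_contDiffAt {G : Type*} [NormedAddCommGroup G] [NormedSpace ℝ G] {f : Cn n → G}
    {z : Cn n} (hf : ContDiffAt ℝ ∞ f z) : ∀ᶠ w in 𝓝 z, DifferentiableAt ℝ f w := by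
  filter_upwards [(hf.of_le (m := 1) (by exact_mod_cast le_top)).eventually (by simp)] with w hw
  exact hw.differentiableAt (by simp)

theorem levi_ofReal {f : Cn n → ℝ} {z : Cn n} (hf : ContDiffAt ℝ ∞ f z) (a : Cn n) :
    levi a (fun y => (f y : ℂ)) z = ((levi a f z : ℝ) : ℂ) := by
  have h : ∀ b, dirDeriv b (dirDeriv b fun y => (f y : ℂ)) z
      = ((dirDeriv b (dirDeriv b f) z : ℝ) : ℂ) := fun b => by
    have : dirDeriv b (fun y => (f y : ℂ)) =ᶠ[𝓝 z] fun y => ((dirDeriv b f y : ℝ) : ℂ) := by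
      filter_upwards [eventually_contDiffAt hf] with w hw
      exact dirDeriv_ofReal hw b
    rw [(dirDeriv_congr this b).self_of_nhds,
      dirDeriv_ofReal (ContDiffAt.differentiableAt_top (contDiffAt_dirDeriv hf b))]
  rw [levi, h, h, levi]
  push_cast
  rfl

theorem tsupport_ofReal (ψ : Cn n → ℝ) : tsupport (fun y => (ψ y : ℂ)) = tsupport ψ := by
  have : Function.support (fun y => (ψ y : ℂ)) = Function.support ψ := by
    ext y
    simp
  rw [tsupport, tsupport, this]

theorem hasCompactSupport_ofReal {ψ : Cn n → ℝ} (h : HasCompactSupport ψ) :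
    HasCompactSupport (fun y => (ψ y : ℂ)) := by
  rwa [HasCompactSupport, tsupport_ofReal]

/-- The Levi form is symmetric for the pairing with test functions. -/
theorem integral_mul_levi {f ψ : Cn n → ℝ} {Ω : Set (Cn n)} (hO : IsOpen Ω)
    (hf : ContDiffOn ℝ ∞ f Ω) (hψ : ContDiff ℝ ∞ ψ) (hc : HasCompactSupport ψ)
    (hs : tsupport ψ ⊆ Ω) (ξ : Cn n) :
    ∫ y, f y * levi ξ ψ y = ∫ y, levi ξ f y * ψ y := by
  have hfc : ContDiffOn ℝ ∞ (fun y => (f y : ℂ)) Ω := fun z hz =>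
    (contDiffAt_ofReal (hf.contDiffAt (hO.mem_nhds hz))).contDiffWithinAt
  have hψc : ContDiff ℝ ∞ (fun y => (ψ y : ℂ)) :=
    contDiff_iff_contDiffAt.2 fun z => contDiffAt_ofReal hψ.contDiffAt
  have hcc := hasCompactSupport_ofReal hc
  have hsc : tsupport (fun y => (ψ y : ℂ)) ⊆ Ω := by rwa [tsupport_ofReal]
  have key : ∀ b, ∫ y, (f y : ℂ) * dirDeriv b (dirDeriv b fun y => (ψ y : ℂ)) y
      = ∫ y, dirDeriv b (dirDeriv b fun y => (f y : ℂ)) y * (ψ y : ℂ) := fun b => by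
    rw [integral_mul_dirDeriv hO hfc (contDiff_dirDeriv hψc b) (hasCompactSupport_dirDeriv hcc b)
      ((tsupport_dirDeriv_subset _ b).trans hsc),
      integral_mul_dirDeriv hO (contDiffOn_dirDeriv hO hfc b) hψc hcc hsc, neg_neg]
  have hi1 : ∀ b, Integrable fun y => (f y : ℂ) * dirDeriv b (dirDeriv b fun y => (ψ y : ℂ)) y :=
    fun b => integrable_mul_of_tsupport_subset hO hfc.continuousOn
      (contDiff_dirDeriv (contDiff_dirDeriv hψc b) b).continuous
      (hasCompactSupport_dirDeriv (hasCompactSupport_dirDeriv hcc b) b)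
      ((tsupport_dirDeriv_subset _ b).trans ((tsupport_dirDeriv_subset _ b).trans hsc))
  have hi2 : ∀ b, Integrable fun y => dirDeriv b (dirDeriv b fun y => (f y : ℂ)) y * (ψ y : ℂ) :=
    fun b => integrable_mul_of_tsupport_subset hO
      (contDiffOn_dirDeriv hO (contDiffOn_dirDeriv hO hfc b) b).continuousOn hψc.continuous hcc hsc
  have hC : ∫ y, (f y : ℂ) * levi ξ (fun y => (ψ y : ℂ)) y
      = ∫ y, levi ξ (fun y => (f y : ℂ)) y * (ψ y : ℂ) := by
    simp only [levi, mul_add, add_mul]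
    rw [integral_add (hi1 _) (hi1 _), integral_add (hi2 _) (hi2 _), key, key]
  have e1 : ∫ y, (f y : ℂ) * levi ξ (fun y => (ψ y : ℂ)) y = ((∫ y, f y * levi ξ ψ y : ℝ) : ℂ) := by
    refine Eq.trans ?_ integral_ofReal
    refine integral_congr_ae (Filter.Eventually.of_forall fun y => ?_)
    simp [levi_ofReal hψ.contDiffAt]
  have e2 : ∫ y, levi ξ (fun y => (f y : ℂ)) y * (ψ y : ℂ) = ((∫ y, levi ξ f y * ψ y : ℝ) : ℂ) := by
    refine Eq.trans ?_ integral_ofReal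
    refine integral_congr_ae (Filter.Eventually.of_forall fun y => ?_)
    by_cases hy : y ∈ Ω
    · simp [levi_ofReal (hf.contDiffAt (hO.mem_nhds hy))]
    · have : ψ y = 0 := image_eq_zero_of_notMem_tsupport fun h => hy (hs h)
      simp [this]
  rw [e1, e2] at hC
  exact_mod_cast hC

theorem levi_zero_fun {G : Type*} [NormedAddCommGroup G] [NormedSpace ℝ G] (ξ : Cn n) :
    levi ξ (0 : Cn n → G) = 0 := by
  have h : ∀ b, dirDeriv b (0 : Cn n → G) = 0 := fun b => by
    ext z
    simp [dirDeriv]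
  ext z
  simp [levi, h]

/-- A locally non-negative additive functional on test functions is non-negative. -/
theorem nonneg_of_locally_nonneg {Ω : Set (Cn n)} (T : (Cn n → ℝ) → ℝ) (hT0 : T 0 = 0)
    (hadd : ∀ ψ φ, IsTest ψ Ω → IsTest φ Ω → T (ψ + φ) = T ψ + T φ)
    (hloc : ∀ x ∈ Ω, ∃ W : Set (Cn n), IsOpen W ∧ x ∈ W ∧ ∀ ψ, IsTest ψ (W ∩ Ω) → 0 ≤ T ψ)
    {ψ : Cn n → ℝ} (hψ : IsTest ψ Ω) : 0 ≤ T ψ := by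
  choose! W hWo hxW hW using hloc
  obtain ⟨f, hf⟩ := SmoothPartitionOfUnity.exists_isSubordinate 𝓘(ℝ, Cn n)
    (isClosed_tsupport ψ) (fun x : Ω => W x) (fun x => hWo x x.2)
    (fun x hx => Set.mem_iUnion.2 ⟨⟨x, hψ.subset hx⟩, hxW x (hψ.subset hx)⟩)
  -- Only finitely many functions of the partition meet the compact support, so finite additivity of
  -- `T` suffices.
  have hfin := f.locallyFinite.finite_nonempty_inter_compact hψ.compact
  set s := hfin.toFinset with hs
  have htest : ∀ i, IsTest (fun y => f i y * ψ y) (W i ∩ Ω) := fun i =>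
    { smooth := (contMDiff_iff_contDiff.1 (f i).contMDiff).mul hψ.smooth
      compact := hψ.compact.mul_left
      subset := Set.subset_inter
        ((closure_mono (Function.support_mul_subset_left _ _)).trans (hf i))
        ((closure_mono (Function.support_mul_subset_right _ _)).trans hψ.subset)
      nonneg := fun y => mul_nonneg (f.nonneg i y) (hψ.nonneg y) }
  have hsum : ∀ t : Finset Ω, IsTest (∑ i ∈ t, fun y => f i y * ψ y) Ω ∧
      T (∑ i ∈ t, fun y => f i y * ψ y) = ∑ i ∈ t, T (fun y => f i y * ψ y) := by
    classical
    intro t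
    induction t using Finset.induction_on with
    | empty =>
      refine ⟨⟨contDiff_const, HasCompactSupport.zero, by simp [tsupport], fun y => le_rfl⟩, ?_⟩
      simpa using hT0
    | insert i t hi ih =>
      have hi1 := (htest i).mono Set.inter_subset_right
      rw [Finset.sum_insert hi, Finset.sum_insert hi, hadd _ _ hi1 ih.1, ih.2]
      exact ⟨⟨hi1.smooth.add ih.1.smooth, hi1.compact.add ih.1.compact,
        (tsupport_add _ _).trans (Set.union_subset hi1.subset ih.1.subset),
        fun y => add_nonneg (hi1.nonneg y) (ih.1.nonneg y)⟩, rfl⟩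
  have hψe : ψ = ∑ i ∈ s, fun y => f i y * ψ y := by
    ext y
    rw [Finset.sum_apply, ← Finset.sum_mul]
    by_cases hy : y ∈ tsupport ψ
    · have h1 : ∑ i ∈ s, f i y = 1 := by
        rw [← f.sum_eq_one hy, finsum_eq_sum_of_support_subset]
        intro i hi
        rw [hs, Set.Finite.coe_toFinset]
        exact ⟨y, hi, hy⟩
      rw [h1, one_mul]
    · rw [image_eq_zero_of_notMem_tsupport hy, mul_zero]
  rw [hψe, (hsum s).2]
  exact Finset.sum_nonneg fun i _ => hW i i.2 _ (htest i)

end Test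

/-- `f` is locally integrable on `Ω` and has non-negative complex Hessian in the sense of
distributions. -/
structure DistPSH {n : ℕ} (f : Cn n → ℝ) (Ω : Set (Cn n)) : Prop where
  locallyIntegrableOn : LocallyIntegrableOn f Ω
  nonneg : ∀ ξ ψ, IsTest ψ Ω → 0 ≤ ∫ y, f y * levi ξ ψ y

namespace DistPSH

variable {n : ℕ} {f g : Cn n → ℝ} {Ω Ω' : Set (Cn n)} {ε : ℝ}

theorem mono (h : DistPSH f Ω) (hs : Ω' ⊆ Ω) : DistPSH f Ω' :=
  ⟨h.locallyIntegrableOn.mono_set hs, fun ξ ψ hψ => h.nonneg ξ ψ (hψ.mono hs)⟩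

theorem congr (hO : IsOpen Ω) (h : DistPSH f Ω) (hfg : ∀ᵐ y, y ∈ Ω → f y = g y) :
    DistPSH g Ω where
  locallyIntegrableOn := by
    rw [locallyIntegrableOn_iff hO.isLocallyClosed]
    intro K hK hKc
    refine (h.locallyIntegrableOn.integrableOn_compact_subset hK hKc).congr ?_
    filter_upwards [ae_restrict_of_ae hfg, ae_restrict_mem hKc.measurableSet] with y hy hyK
    exact hy (hK hyK)
  nonneg ξ ψ hψ := by
    have := h.nonneg ξ ψ hψ
    rwa [integral_congr_ae (g := fun y => g y * levi ξ ψ y)] at this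
    filter_upwards [hfg] with y hy
    by_cases hyΩ : y ∈ Ω
    · simp only [hy hyΩ]
    · simp only [image_eq_zero_of_notMem_tsupport fun h' =>
        hyΩ (hψ.subset (tsupport_levi_subset ψ ξ h')), mul_zero]

theorem integrable_mul_levi (hf : LocallyIntegrableOn f Ω) {ψ : Cn n → ℝ} (hψ : IsTest ψ Ω)
    (ξ : Cn n) : Integrable fun y => f y * levi ξ ψ y :=
  integrable_mul_of_locallyIntegrableOn hf (contDiff_levi hψ.smooth ξ).continuous
    (hasCompactSupport_levi hψ.compact ξ) ((tsupport_levi_subset ψ ξ).trans hψ.subset)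

/-- Test functions are cut into small pieces by a partition of unity; the pairing is additive once
local integrability, itself a local property, is known. -/
theorem of_local (h : ∀ x ∈ Ω, ∃ W : Set (Cn n), IsOpen W ∧ x ∈ W ∧ DistPSH f (W ∩ Ω)) :
    DistPSH f Ω := by
  have hL : LocallyIntegrableOn f Ω := fun x hx => by
    obtain ⟨W, hW, hxW, hD⟩ := h x hx
    obtain ⟨s, hs, hi⟩ := hD.locallyIntegrableOn x ⟨hxW, hx⟩
    refine ⟨s, ?_, hi⟩
    rwa [nhdsWithin_inter_of_mem (mem_nhdsWithin_of_mem_nhds (hW.mem_nhds hxW))]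
      at hs
  refine ⟨hL, fun ξ ψ hψ => ?_⟩
  refine nonneg_of_locally_nonneg (fun ψ => ∫ y, f y * levi ξ ψ y) (by simp [levi_zero_fun])
    (fun ψ φ h1 h2 => ?_) (fun x hx => ?_) hψ
  · rw [← integral_add (integrable_mul_levi hL h1 ξ) (integrable_mul_levi hL h2 ξ)]
    refine integral_congr_ae (Filter.Eventually.of_forall fun y => ?_)
    simp only
    rw [← mul_add, ← levi_add h1.smooth.contDiffAt h2.smooth.contDiffAt]
    rfl
  · obtain ⟨W, hW, hxW, hD⟩ := h x hx
    exact ⟨W, hW, hxW, hD.nonneg ξ⟩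

theorem of_smooth (hO : IsOpen Ω) (hf : ContDiffOn ℝ ∞ f Ω)
    (hl : ∀ z ∈ Ω, ∀ ξ, 0 ≤ levi ξ f z) : DistPSH f Ω where
  locallyIntegrableOn := hf.continuousOn.locallyIntegrableOn hO.measurableSet
  nonneg ξ ψ hψ := by
    rw [integral_mul_levi hO hf hψ.smooth hψ.compact hψ.subset]
    refine integral_nonneg fun y => ?_
    by_cases hy : y ∈ Ω
    · exact mul_nonneg (hl y hy ξ) (hψ.nonneg y)
    · simp [image_eq_zero_of_notMem_tsupport fun h' => hy (hψ.subset h')]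

/-- The Levi form of the mollification at `z` is the pairing of `f` with the Levi form of the
translated kernel `w ↦ mker n ε (z - w)`, which is a test function in `Ω` because the closed ball
lies there. -/
theorem levi_mollify_nonneg (h : DistPSH f Ω) (hf : LocallyIntegrable f) (hε : 0 < ε)
    {z : Cn n} (hz : Metric.closedBall z ε ⊆ Ω) (ξ : Cn n) : 0 ≤ levi ξ (mollify ε f) z := by
  change 0 ≤ levi ξ (convKer (mker n ε) f) z
  rw [levi_convKer (contDiff_mker ε) (hasCompactSupport_mker hε) hf]
  have ht : IsTest (fun w => mker n ε (z - w)) Ω :=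
    { smooth := (contDiff_mker ε).comp (contDiff_const.sub contDiff_id)
      compact := (hasCompactSupport_mker hε).comp_homeomorph (Homeomorph.subLeft z)
      subset := by
        refine (closure_minimal (fun w hw => ?_) Metric.isClosed_closedBall).trans hz
        have := support_mker_subset hε (show z - w ∈ Function.support (mker n ε) from hw)
        rw [Metric.mem_closedBall, dist_comm, dist_eq_norm]
        simpa using (mem_ball_zero_iff.1 this).le
      nonneg := fun w => mker_nonneg _ _ }
  have := h.nonneg ξ _ ht
  simp only [levi_comp_sub_left] at this
  simpa [convKer, mul_comm] using this

/-- A second mollification with a small radius makes `f` smooth with non-negative Levi form, so that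
the smooth case applies. As this radius tends to zero, weak convergence returns the mollifications
of `f` itself. -/
theorem mollify_mono_radius (h : DistPSH f Ω) (hO : IsOpen Ω) (hf : Integrable f) {ε₁ ε₂ : ℝ}
    (h1 : 0 < ε₁) (h12 : ε₁ ≤ ε₂) {z : Cn n} (hz : Metric.closedBall z ε₂ ⊆ Ω) :
    mollify ε₁ f z ≤ mollify ε₂ f z := by
  obtain ⟨δ, hδ, hδs⟩ := (isCompact_closedBall z ε₂).exists_cthickening_subset_open hO hz
  set O : Set (Cn n) := Metric.thickening (δ / 2) (Metric.closedBall z ε₂) with hOdef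
  have hO' : IsOpen O := Metric.isOpen_thickening
  have hzO : Metric.closedBall z ε₂ ⊆ O := Metric.self_subset_thickening (by linarith) _
  have hball : ∀ w ∈ O, ∀ d ≤ δ / 2, Metric.closedBall w d ⊆ Ω := fun w hw d hd x hx => by
    obtain ⟨y, hy, hwy⟩ := Metric.mem_thickening_iff.1 hw
    refine hδs (Metric.mem_cthickening_of_dist_le x y δ _ hy ?_)
    have := dist_triangle x w y
    have := Metric.mem_closedBall.1 hx
    linarith
  have he : Filter.Tendsto (fun k : ℕ => δ / 2 * (1 / ((k : ℝ) + 1))) Filter.atTop (𝓝[>] 0) := by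
    rw [tendsto_nhdsWithin_iff]
    constructor
    · simpa using tendsto_one_div_add_atTop_nhds_zero_nat.const_mul (δ / 2)
    · exact Filter.Eventually.of_forall fun k => by
        have : (0 : ℝ) < 1 / ((k : ℝ) + 1) := Nat.one_div_pos_of_nat
        exact mul_pos (by linarith) this
  have hineq : ∀ k : ℕ, mollify ε₁ (mollify (δ / 2 * (1 / ((k : ℝ) + 1))) f) z
      ≤ mollify ε₂ (mollify (δ / 2 * (1 / ((k : ℝ) + 1))) f) z := fun k => by
    have hp : (0 : ℝ) < 1 / ((k : ℝ) + 1) := Nat.one_div_pos_of_nat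
    have hp1 : 1 / ((k : ℝ) + 1) ≤ 1 := by
      rw [div_le_one (by positivity)]
      linarith [Nat.cast_nonneg (α := ℝ) k]
    have hpos : 0 < δ / 2 * (1 / ((k : ℝ) + 1)) := by positivity
    refine mollify_mono_radius_of_smooth (contDiff_mollify hpos hf.locallyIntegrable) hO'
      (fun w hw ξ => ?_) h1 h12 hzO
    exact h.levi_mollify_nonneg hf.locallyIntegrable hpos (hball w hw _ (by nlinarith)) ξ
  have hlim : ∀ e : ℝ, 0 < e → Filter.Tendsto
      (fun k : ℕ => mollify e (mollify (δ / 2 * (1 / ((k : ℝ) + 1))) f) z) Filter.atTop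
      (𝓝 (mollify e f z)) := fun e he0 =>
    tendsto_integral_smul_mollify hf (θ := fun w => mker n e (z - w))
      ((continuous_mker e).comp (by fun_prop))
      ((hasCompactSupport_mker he0).comp_homeomorph (Homeomorph.subLeft z)) he
  exact le_of_tendsto_of_tendsto' (hlim ε₁ h1) (hlim ε₂ (h1.trans_le h12)) hineq

end DistPSH

/-! ### Cut-off to compact sets -/

section Indicator

variable {n : ℕ} {f : Cn n → ℝ} {Ω : Set (Cn n)}

theorem integrable_indicator_of_locallyIntegrableOn {G : Type*} [NormedAddCommGroup G]
    {f : Cn n → G} (hf : LocallyIntegrableOn f Ω) {K : Set (Cn n)}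
    (hK : IsCompact K) (hs : K ⊆ Ω) : Integrable (K.indicator f) :=
  (hf.integrableOn_compact_subset hs hK).integrable_indicator hK.measurableSet

/-- Mollification needs a function on the whole space; cutting off to a compact `K` gives an
integrable one without changing `f` on `W`. -/
theorem DistPSH.indicator (h : DistPSH f Ω) {K W : Set (Cn n)} (hW : IsOpen W) (hWΩ : W ⊆ Ω)
    (hWK : W ⊆ K) : DistPSH (K.indicator f) W :=
  (h.mono hWΩ).congr hW (Filter.Eventually.of_forall fun y hy => by
    rw [Set.indicator_of_mem (hWK hy)])

end Indicator

/-! ### Exponentials of plurisubharmonic functions -/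

section Exp

variable {n : ℕ}

theorem levi_comp {f : Cn n → ℝ} {Φ Φ' Φ'' : ℝ → ℝ} {z : Cn n} (hf : ContDiffAt ℝ ∞ f z)
    (h1 : ∀ᶠ t in 𝓝 (f z), HasDerivAt Φ (Φ' t) t) (h2 : HasDerivAt Φ' (Φ'' (f z)) (f z))
    (ξ : Cn n) :
    levi ξ (fun w => Φ (f w)) z = Φ' (f z) * levi ξ f z
      + Φ'' (f z) * (dirDeriv ξ f z ^ 2 + dirDeriv (Complex.I • ξ) f z ^ 2) := by
  have key : ∀ b, dirDeriv b (dirDeriv b fun w => Φ (f w)) z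
      = Φ' (f z) * dirDeriv b (dirDeriv b f) z + Φ'' (f z) * dirDeriv b f z ^ 2 := fun b => by
    have hev : dirDeriv b (fun w => Φ (f w)) =ᶠ[𝓝 z] fun w => Φ' (f w) * dirDeriv b f w := by
      filter_upwards [eventually_contDiffAt hf, hf.continuousAt.eventually h1] with w hw hΦ
      have := (hΦ.comp_hasFDerivAt w hw.hasFDerivAt).fderiv
      change fderiv ℝ (Φ ∘ f) w b = _
      rw [this]
      rfl
    rw [(dirDeriv_congr hev b).self_of_nhds]
    have hA := h2.comp_hasFDerivAt z (ContDiffAt.differentiableAt_top hf).hasFDerivAt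
    have hB := (ContDiffAt.differentiableAt_top (contDiffAt_dirDeriv hf b)).hasFDerivAt
    have := (hA.mul hB).fderiv
    change fderiv ℝ ((Φ' ∘ f) * dirDeriv b f) z b = _
    rw [this]
    simp only [add_apply, smul_apply, smul_eq_mul, Function.comp_apply]
    simp only [dirDeriv]
    ring
  rw [levi, key, key, levi]
  ring

theorem levi_exp_nonneg {f : Cn n → ℝ} {z : Cn n} (hf : ContDiffAt ℝ ∞ f z) {ξ : Cn n}
    (h : 0 ≤ levi ξ f z) : 0 ≤ levi ξ (fun w => Real.exp (f w)) z := by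
  rw [levi_comp hf (Filter.Eventually.of_forall fun t => Real.hasDerivAt_exp t)
    (Real.hasDerivAt_exp _)]
  have := Real.exp_pos (f z)
  positivity

/-- A sequence of radii decreasing to zero. -/
theorem tendsto_radii {R : ℝ} (hR : 0 < R) :
    Filter.Tendsto (fun k : ℕ => R * (1 / ((k : ℝ) + 1))) Filter.atTop (𝓝[>] 0) := by
  rw [tendsto_nhdsWithin_iff]
  constructor
  · simpa using tendsto_one_div_add_atTop_nhds_zero_nat.const_mul R
  · exact Filter.Eventually.of_forall fun k => mul_pos hR Nat.one_div_pos_of_nat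

theorem radii_pos {R : ℝ} (hR : 0 < R) (k : ℕ) : 0 < R * (1 / ((k : ℝ) + 1)) :=
  mul_pos hR Nat.one_div_pos_of_nat

theorem radii_le {R : ℝ} (hR : 0 < R) (k : ℕ) : R * (1 / ((k : ℝ) + 1)) ≤ R := by
  have hp1 : 1 / ((k : ℝ) + 1) ≤ 1 := by
    rw [div_le_one (by positivity)]
    linarith [Nat.cast_nonneg (α := ℝ) k]
  nlinarith

theorem radii_anti {R : ℝ} (hR : 0 < R) : Antitone fun k : ℕ => R * (1 / ((k : ℝ) + 1)) :=
  fun _ _ h => mul_le_mul_of_nonneg_left (Nat.one_div_le_one_div h) hR.le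

/-- The exponential of a distributionally plurisubharmonic function. -/
theorem DistPSH.exp {φ : Cn n → ℝ} {Ω : Set (Cn n)} (h : DistPSH φ Ω) (hO : IsOpen Ω) :
    DistPSH (fun z => Real.exp (φ z)) Ω := by
  refine DistPSH.of_local fun x hx => ?_
  obtain ⟨R', hR', hR's⟩ := Metric.nhds_basis_closedBall.mem_iff.1 (hO.mem_nhds hx)
  -- With a third of the radius, closed balls of radius at most `R` around points of the ball of
  -- radius `2R` remain in the ball of radius `R'`.
  set R := R' / 3 with hRdef
  have hR : 0 < R := by positivity
  set φ' := (Metric.closedBall x R').indicator φ with hφ'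
  have hφi : Integrable φ' :=
    integrable_indicator_of_locallyIntegrableOn h.locallyIntegrableOn (isCompact_closedBall _ _) hR's
  have hD : DistPSH φ' (Metric.ball x R') :=
    h.indicator Metric.isOpen_ball (Metric.ball_subset_closedBall.trans hR's)
      Metric.ball_subset_closedBall
  have hsub : ∀ z ∈ Metric.ball x (2 * R), ∀ ε ≤ R, Metric.closedBall z ε ⊆ Metric.ball x R' :=
    fun z hz ε hε w hw => by
      have := dist_triangle w z x
      have := Metric.mem_closedBall.1 hw
      have := Metric.mem_ball.1 hz
      rw [Metric.mem_ball]
      linarith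
  set e : ℕ → ℝ := fun k => R * (1 / ((k : ℝ) + 1)) with he
  have hes := fun k => contDiff_mollify (f := φ') (radii_pos hR k) hφi.locallyIntegrable
  have hlevi : ∀ k, ∀ z ∈ Metric.ball x (2 * R), ∀ ξ, 0 ≤ levi ξ (mollify (e k) φ') z :=
    fun k z hz ξ => hD.levi_mollify_nonneg hφi.locallyIntegrable (radii_pos hR k)
      (hsub z hz _ (radii_le hR k)) ξ
  obtain ⟨C, hC⟩ := (isCompact_closedBall x R).exists_bound_of_continuousOn
    (contDiff_mollify (f := φ') hR hφi.locallyIntegrable).continuous.continuousOn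
  -- Mollifications decrease with the radius, so the largest of them, continuous on a compact ball,
  -- bounds all of them from above. This upper bound is what dominates the exponentials.
  have hbound : ∀ k, ∀ z ∈ Metric.ball x R, mollify (e k) φ' z ≤ C := fun k z hz => by
    refine (hD.mollify_mono_radius Metric.isOpen_ball hφi (radii_pos hR k) (radii_le hR k)
      (hsub z (Metric.ball_subset_ball (by linarith) hz) _ le_rfl)).trans ?_
    exact (le_abs_self _).trans (hC z (Metric.ball_subset_closedBall hz))
  have hae : ∀ᵐ z, z ∈ Metric.ball x R →
      Filter.Tendsto (fun k => Real.exp (mollify (e k) φ' z)) Filter.atTop (𝓝 (Real.exp (φ z))) := by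
    filter_upwards [ae_tendsto_mollify hφi.locallyIntegrable] with z hz hzR
    have h1 := hz (tendsto_radii hR)
    rw [hφ', Set.indicator_of_mem (Metric.closedBall_subset_closedBall (by linarith)
      (Metric.ball_subset_closedBall hzR))] at h1
    exact (Real.continuous_exp.tendsto _).comp h1
  have hbd : ∀ᵐ z, z ∈ Metric.ball x R → |Real.exp (φ z)| ≤ Real.exp C := by
    filter_upwards [hae] with z hz hzR
    rw [abs_of_pos (Real.exp_pos _)]
    exact le_of_tendsto' (hz hzR) fun k => Real.exp_le_exp.2 (hbound k z hzR)
  have hmeas : AEStronglyMeasurable (fun z => Real.exp (φ z))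
      (volume.restrict (Metric.ball x R)) := by
    have : AEStronglyMeasurable φ (volume.restrict (Metric.ball x R)) :=
      (h.locallyIntegrableOn.integrableOn_compact_subset hR's
        (isCompact_closedBall _ _)).aestronglyMeasurable.mono_measure
        (Measure.restrict_mono (Metric.ball_subset_closedBall.trans
          (Metric.closedBall_subset_closedBall (by linarith))) le_rfl)
    exact Real.continuous_exp.comp_aestronglyMeasurable this
  have hint : IntegrableOn (fun z => Real.exp (φ z)) (Metric.ball x R) := by
    refine Integrable.mono' (g := fun _ => Real.exp C)
      (integrableOn_const measure_ball_lt_top.ne) hmeas ?_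
    filter_upwards [ae_restrict_of_ae hbd, ae_restrict_mem measurableSet_ball] with z h1 h2
    exact h1 h2
  refine ⟨Metric.ball x R, Metric.isOpen_ball, Metric.mem_ball_self hR, ?_⟩
  refine DistPSH.mono (Ω := Metric.ball x R) ?_ Set.inter_subset_left
  refine ⟨hint.locallyIntegrableOn, fun ξ ψ hψ => ?_⟩
  have hlc := (contDiff_levi hψ.smooth ξ).continuous
  have hli := hlc.integrable_of_hasCompactSupport (hasCompactSupport_levi hψ.compact ξ) (μ := volume)
  have hz0 : ∀ z, z ∉ Metric.ball x R → levi ξ ψ z = 0 := fun z hz =>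
    image_eq_zero_of_notMem_tsupport fun h' => hz (hψ.subset (tsupport_levi_subset ψ ξ h'))
  have hlim : Filter.Tendsto (fun k => ∫ z, Real.exp (mollify (e k) φ' z) * levi ξ ψ z)
      Filter.atTop (𝓝 (∫ z, Real.exp (φ z) * levi ξ ψ z)) := by
    refine tendsto_integral_of_dominated_convergence (fun z => Real.exp C * |levi ξ ψ z|) ?_
      (hli.abs.const_mul _) ?_ ?_
    · intro k
      exact ((Real.continuous_exp.comp (hes k).continuous).mul hlc).aestronglyMeasurable
    · intro k
      refine Filter.Eventually.of_forall fun z => ?_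
      by_cases hz : z ∈ Metric.ball x R
      · rw [norm_mul, Real.norm_of_nonneg (Real.exp_pos _).le]
        exact mul_le_mul_of_nonneg_right (Real.exp_le_exp.2 (hbound k z hz)) (norm_nonneg _)
      · simp [hz0 z hz]
    · filter_upwards [hae] with z hz
      by_cases hzR : z ∈ Metric.ball x R
      · exact (hz hzR).mul_const _
      · simp [hz0 z hzR]
  refine ge_of_tendsto' hlim fun k => ?_
  have hsm : ContDiffOn ℝ ∞ (fun z => Real.exp (mollify (e k) φ' z)) (Metric.ball x R) :=
    (Real.contDiff_exp.comp (hes k)).contDiffOn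
  refine (DistPSH.of_smooth Metric.isOpen_ball hsm fun z hz ζ => ?_).nonneg ξ ψ hψ
  exact levi_exp_nonneg (hes k).contDiffAt
    (hlevi k z (Metric.ball_subset_ball (by linarith) hz) ζ)

end Exp

/-! ### Upper semicontinuous functions with the local sub-mean value property -/

/-- Upper semicontinuous real functions, bounded below, with the sub-mean value property on small
discs. -/
structure SubmeanOn {n : ℕ} (Ψ : Cn n → ℝ) (Ω : Set (Cn n)) : Prop where
  usc : UpperSemicontinuousOn Ψ Ω
  bddBelow : ∃ M, ∀ z ∈ Ω, M ≤ Ψ z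
  submean : ∀ x ∈ Ω, ∃ r > 0, ∀ z ∈ Metric.ball x r, ∀ v : Cn n, ‖v‖ < r → Ψ z ≤ circMean Ψ z v

section Submean

variable {n : ℕ} {Ψ : Cn n → ℝ} {Ω K : Set (Cn n)} {ε M : ℝ}

/-- The mollification is an average of translates of `g`. Each translate has the sub-mean value
inequality, Fubini transfers it to the average, and for a smooth function it forces the Levi form to
be non-negative. -/
theorem levi_mollify_nonneg_of_le_circMean {g : Cn n → ℝ} (hg : Measurable g) {C : ℝ}
    (hC : ∀ w, |g w| ≤ C) (hε : 0 < ε) {z : Cn n} {r : ℝ} (hr : 0 < r)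
    (h : ∀ w ∈ Metric.ball z ε, ∀ v : Cn n, ‖v‖ < r → g w ≤ circMean g w v) (ξ : Cn n) :
    0 ≤ levi ξ (mollify ε g) z := by
  have hpos : (0 : ℝ) ≤ 2 * Real.pi := by positivity
  have hgi : LocallyIntegrable g := by
    have : LocallyIntegrable fun _ : Cn n => C := locallyIntegrable_const C
    exact this.mono hg.aestronglyMeasurable
      (Filter.Eventually.of_forall fun w => (hC w).trans (le_abs_self C))
  refine levi_nonneg_of_le_circMean isOpen_univ (contDiff_mollify hε hgi).contDiffOn
    (Set.mem_univ z) ⟨r / (‖ξ‖ + 1), by positivity, fun s hs hsr => ?_⟩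
  have hv : ‖s • ξ‖ < r := by
    rw [norm_smul, Real.norm_of_nonneg hs.le]
    have : s * (‖ξ‖ + 1) < r := (lt_div_iff₀ (by positivity)).1 hsr
    nlinarith
  set v := s • ξ
  set ν : Measure ℝ := volume.restrict (Set.Ioc 0 (2 * Real.pi)) with hν
  set F : Cn n → ℝ → ℝ :=
    fun w θ => mker n ε w * g (z + w + Complex.exp (θ * Complex.I) • v) with hF
  have hmeas : Measurable (Function.uncurry F) := by
    refine ((continuous_mker ε).measurable.comp measurable_fst).mul (hg.comp ?_)
    have : Continuous fun p : Cn n × ℝ => z + p.1 + Complex.exp (p.2 * Complex.I) • v := by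
      fun_prop
    exact this.measurable
  have hint : Integrable (Function.uncurry F) ((volume : Measure (Cn n)).prod ν) := by
    have h1 : Integrable (fun p : Cn n × ℝ => mker n ε p.1 * C)
        ((volume : Measure (Cn n)).prod ν) :=
      (integrable_mker hε).mul_prod (integrable_const C)
    refine h1.mono' hmeas.aestronglyMeasurable (Filter.Eventually.of_forall fun p => ?_)
    simp only [Function.uncurry, hF]
    rw [norm_mul, Real.norm_of_nonneg (mker_nonneg _ _)]
    exact mul_le_mul_of_nonneg_left (hC _) (mker_nonneg _ _)
  have hinner : ∀ w, mker n ε w * circMean g (z + w) v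
      = (2 * Real.pi)⁻¹ * ∫ θ, F w θ ∂ν := fun w => by
    rw [circMean_eq, intervalIntegral.integral_of_le hpos]
    simp only [hF, integral_const_mul]
    ring
  have hi : Integrable fun w => mker n ε w * circMean g (z + w) v := by
    simp only [hinner]
    exact hint.integral_prod_left.const_mul _
  have hle : mollify ε g z ≤ ∫ w, mker n ε w * circMean g (z + w) v := by
    rw [mollify_eq_add]
    refine integral_mono ?_ hi fun w => ?_
    · have := (integrable_mollify hε hgi z).comp_sub_left z
      simpa [mker_neg] using this.comp_neg
    · by_cases hw : ‖w‖ < ε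
      · exact mul_le_mul_of_nonneg_left (h _ (by simpa using hw) v hv) (mker_nonneg _ _)
      · simp [mker_eq_zero hε (not_lt.1 hw)]
  refine hle.trans (le_of_eq ?_)
  simp only [hinner]
  rw [integral_const_mul, integral_integral_swap hint, circMean_eq,
    intervalIntegral.integral_of_le hpos]
  congr 1
  refine integral_congr_ae (Filter.Eventually.of_forall fun θ => ?_)
  simp only [hF, mollify_eq_add, smul_eq_mul]
  refine integral_congr_ae (Filter.Eventually.of_forall fun w => ?_)
  simp only
  rw [add_right_comm]

open Classical in
/-- The function that agrees with `Ψ` on `K` and is constant elsewhere. -/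
def cutAt (K : Set (Cn n)) (M : ℝ) (Ψ : Cn n → ℝ) (z : Cn n) : ℝ := if z ∈ K then Ψ z else M

theorem cutAt_of_mem {z : Cn n} (h : z ∈ K) : cutAt K M Ψ z = Ψ z := if_pos h

/-- The constant is a lower bound of `Ψ` and `K` is closed, so on leaving `K` the function can only
drop. -/
theorem upperSemicontinuous_cutAt (hK : IsClosed K) (hΨ : UpperSemicontinuousOn Ψ Ω) (hs : K ⊆ Ω)
    (hM : ∀ z ∈ Ω, M ≤ Ψ z) : UpperSemicontinuous (cutAt K M Ψ) := by
  intro z c hc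
  by_cases hz : z ∈ K
  · rw [cutAt_of_mem hz] at hc
    have h1 := hΨ z (hs hz) c hc
    have h2 : ∀ᶠ w in 𝓝 z, w ∈ Ω → Ψ w < c := eventually_nhdsWithin_iff.1 h1
    filter_upwards [h2] with w hw
    unfold cutAt
    split_ifs with hwK
    · exact hw (hs hwK)
    · exact (hM z (hs hz)).trans_lt hc
  · filter_upwards [hK.isOpen_compl.mem_nhds hz] with w hw
    rw [cutAt, if_neg hz] at hc
    rwa [cutAt, if_neg hw]

theorem exists_bound_cutAt (hK : IsCompact K) (hΨ : UpperSemicontinuousOn Ψ Ω) (hs : K ⊆ Ω)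
    (hM : ∀ z ∈ Ω, M ≤ Ψ z) : ∃ C, ∀ z, |cutAt K M Ψ z| ≤ C := by
  obtain ⟨B, hB⟩ := (hΨ.mono hs).bddAbove_of_isCompact hK
  refine ⟨max |M| (max |B| |M|), fun z => ?_⟩
  unfold cutAt
  split_ifs with hz
  · have h1 : Ψ z ≤ B := hB ⟨z, hz, rfl⟩
    have h2 := hM z (hs hz)
    rw [abs_le]
    have h3 := le_max_left |M| (max |B| |M|)
    have h4 := (le_max_left |B| |M|).trans (le_max_right |M| (max |B| |M|))
    have h5 := neg_abs_le M
    have h6 := le_abs_self B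
    constructor <;> linarith
  · exact le_max_left _ _

theorem circMean_congr {f g : Cn n → ℝ} {z v : Cn n}
    (h : ∀ w ∈ Metric.closedBall z ‖v‖, f w = g w) : circMean f z v = circMean g z v := by
  refine Real.circleAverage_congr_sphere fun ζ hζ => h _ ?_
  refine add_smul_mem_closedBall ?_ le_rfl
  simpa using (mem_sphere_iff_norm.1 hζ).le

namespace SubmeanOn

/-- On a neighbourhood the truncation to a compact set inherits the sub-mean value property. -/
theorem exists_nhds (h : SubmeanOn Ψ Ω) (M : ℝ) {x : Cn n} (hx : x ∈ Ω) (hxK : K ∈ 𝓝 x) :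
    ∃ r > 0, ∀ z ∈ Metric.ball x r, ∀ v : Cn n, ‖v‖ < r →
      cutAt K M Ψ z ≤ circMean (cutAt K M Ψ) z v := by
  obtain ⟨r, hr, hrm⟩ := h.submean x hx
  obtain ⟨δ, hδ, hδs⟩ := Metric.mem_nhds_iff.1 hxK
  refine ⟨min r (δ / 2), lt_min hr (by linarith), fun z hz v hv => ?_⟩
  have hzδ : dist z x < δ / 2 := (Metric.mem_ball.1 hz).trans_le (min_le_right _ _)
  have hvδ : ‖v‖ < δ / 2 := hv.trans_le (min_le_right _ _)
  have hmem : ∀ w ∈ Metric.closedBall z ‖v‖, w ∈ K := fun w hw => hδs (by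
    have := dist_triangle w z x
    have := Metric.mem_closedBall.1 hw
    rw [Metric.mem_ball]
    linarith)
  rw [cutAt_of_mem (hmem z (Metric.mem_closedBall_self (norm_nonneg _))),
    circMean_congr (g := Ψ) fun w hw => cutAt_of_mem (hmem w hw)]
  exact hrm z (Metric.ball_subset_ball (min_le_left _ _) hz) v (hv.trans_le (min_le_left _ _))

theorem measurable_cutAt (h : SubmeanOn Ψ Ω) (hK : IsClosed K) (hs : K ⊆ Ω)
    (hM : ∀ z ∈ Ω, M ≤ Ψ z) : Measurable (cutAt K M Ψ) :=
  (upperSemicontinuous_cutAt hK h.usc hs hM).measurable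

theorem locallyIntegrable_of_bound {g : Cn n → ℝ} (hg : Measurable g) {C : ℝ}
    (hC : ∀ z, |g z| ≤ C) : LocallyIntegrable g := by
  have : LocallyIntegrable fun _ : Cn n => C := locallyIntegrable_const C
  exact this.mono hg.aestronglyMeasurable
    (Filter.Eventually.of_forall fun w => (hC w).trans (le_abs_self C))

/-- The value is bounded by small mollifications. -/
theorem exists_le_mollify (h : SubmeanOn Ψ Ω) (hK : IsCompact K) (hs : K ⊆ Ω)
    (hM : ∀ z ∈ Ω, M ≤ Ψ z) {x : Cn n} (hxK : K ∈ 𝓝 x) :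
    ∃ r > 0, ∀ z ∈ Metric.ball x r, ∀ ε, 0 < ε → ε < r → Ψ z ≤ mollify ε (cutAt K M Ψ) z := by
  obtain ⟨C, hC⟩ := exists_bound_cutAt hK h.usc hs hM
  obtain ⟨r, hr, hrm⟩ := h.exists_nhds M (hs (mem_of_mem_nhds hxK)) hxK
  obtain ⟨δ, hδ, hδs⟩ := Metric.mem_nhds_iff.1 hxK
  refine ⟨min r δ, lt_min hr hδ, fun z hz ε hε hεr => ?_⟩
  have hzK : z ∈ K := hδs (Metric.ball_subset_ball (min_le_right _ _) hz)
  rw [← cutAt_of_mem (M := M) (Ψ := Ψ) hzK]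
  exact le_mollify_of_le_circMean hε (h.measurable_cutAt hK.isClosed hs hM) (fun w _ => hC w)
    fun w hw => hrm z (Metric.ball_subset_ball (min_le_left _ _) hz) w
      (hw.trans (hεr.trans_le (min_le_left _ _)))

/-- Near a point, the mollifications of the cut-off function are smooth with non-negative Levi form,
and they converge weakly. -/
theorem distPSH (h : SubmeanOn Ψ Ω) (hO : IsOpen Ω) : DistPSH Ψ Ω := by
  obtain ⟨M, hM⟩ := h.bddBelow
  refine DistPSH.of_local fun x hx => ?_
  obtain ⟨R, hR, hRs⟩ := Metric.nhds_basis_closedBall.mem_iff.1 (hO.mem_nhds hx)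
  set K := Metric.closedBall x R
  have hK : IsCompact K := isCompact_closedBall x R
  set g := cutAt K M Ψ with hgdef
  obtain ⟨C, hC⟩ := exists_bound_cutAt hK h.usc hRs hM
  have hgm := h.measurable_cutAt hK.isClosed hRs hM
  have hgi := locallyIntegrable_of_bound hgm hC
  obtain ⟨r, hr, hrm⟩ := h.exists_nhds M hx (Metric.closedBall_mem_nhds x hR)
  -- The bound `r / 2` leaves room for mollification radii up to `r / 2` inside the ball of radius
  -- `r`; the bound `R` keeps `W` inside `K`.
  set d := min (r / 2) R with hd
  have hdpos : 0 < d := lt_min (by linarith) hR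
  set W := Metric.ball x d with hW
  refine ⟨W, Metric.isOpen_ball, Metric.mem_ball_self hdpos, ?_⟩
  have hWK : W ⊆ K := Metric.ball_subset_closedBall.trans
    (Metric.closedBall_subset_closedBall (min_le_right _ _))
  refine DistPSH.mono (Ω := W) ?_ Set.inter_subset_left
  refine DistPSH.congr (f := g) Metric.isOpen_ball ?_
    (Filter.Eventually.of_forall fun y hy => cutAt_of_mem (hWK hy))
  refine ⟨hgi.locallyIntegrableOn _, fun ξ ψ hψ => ?_⟩
  -- `g` is constant outside `K` and need not be integrable. A second cut-off, too far away to be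
  -- felt by the mollifications on `W`, repairs this.
  set g' := (Metric.closedBall x (2 * R + r)).indicator g with hg'
  have hg'i : Integrable g' := integrable_indicator_of_locallyIntegrableOn
    (hgi.locallyIntegrableOn Set.univ) (isCompact_closedBall _ _) (Set.subset_univ _)
  have hlc := (contDiff_levi hψ.smooth ξ).continuous
  have hlim := tendsto_integral_smul_mollify hg'i hlc (hasCompactSupport_levi hψ.compact ξ)
    (tendsto_radii (R := r / 2) (by linarith))
  have he : ∫ y, g y * levi ξ ψ y = ∫ y, levi ξ ψ y • g' y := by
    refine integral_congr_ae (Filter.Eventually.of_forall fun y => ?_)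
    simp only [smul_eq_mul]
    by_cases hy : y ∈ W
    · rw [hg', Set.indicator_of_mem, mul_comm]
      refine Metric.closedBall_subset_closedBall ?_ (hWK hy)
      linarith
    · rw [image_eq_zero_of_notMem_tsupport fun h' => hy (hψ.subset (tsupport_levi_subset ψ ξ h'))]
      simp
  rw [he]
  refine ge_of_tendsto' hlim fun k => ?_
  have hk := radii_pos (R := r / 2) (by linarith) k
  have hk2 := radii_le (R := r / 2) (by linarith) k
  have hsm := contDiff_mollify hk hgi
  have heq : ∀ z ∈ W, mollify (r / 2 * (1 / ((k : ℝ) + 1))) g' z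
      = mollify (r / 2 * (1 / ((k : ℝ) + 1))) g z := fun z hz =>
    mollify_congr_of_eqOn_ball hk (Filter.Eventually.of_forall fun w hw => by
      rw [hg', Set.indicator_of_mem]
      have h1 := Metric.mem_ball.1 hw
      have h2 := Metric.mem_closedBall.1 (hWK hz)
      have h3 := dist_triangle w z x
      rw [Metric.mem_closedBall]
      linarith)
  have hD : DistPSH (mollify (r / 2 * (1 / ((k : ℝ) + 1))) g) W := by
    refine DistPSH.of_smooth Metric.isOpen_ball hsm.contDiffOn fun z hz ζ => ?_
    refine levi_mollify_nonneg_of_le_circMean hgm hC hk hr (fun w hw v hv => hrm w ?_ v hv) ζ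
    have h1 := Metric.mem_ball.1 hw
    have h2 := Metric.mem_ball.1 hz
    have h3 := dist_triangle w z x
    have h4 := min_le_left (r / 2) R
    rw [Metric.mem_ball]
    linarith
  have := hD.nonneg ξ ψ hψ
  refine this.trans (le_of_eq (integral_congr_ae (Filter.Eventually.of_forall fun y => ?_)))
  simp only [smul_eq_mul]
  by_cases hy : y ∈ W
  · rw [heq y hy, mul_comm]
  · rw [image_eq_zero_of_notMem_tsupport fun h' => hy (hψ.subset (tsupport_levi_subset ψ ξ h'))]
    simp

/-- Mollifications converge everywhere. -/
theorem tendsto_mollify (h : SubmeanOn Ψ Ω) (hK : IsCompact K) (hs : K ⊆ Ω)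
    (hM : ∀ z ∈ Ω, M ≤ Ψ z) {x : Cn n} (hxK : K ∈ 𝓝 x) {ι : Type*} {l : Filter ι} {e : ι → ℝ}
    (he : Filter.Tendsto e l (𝓝[>] 0)) :
    Filter.Tendsto (fun i => mollify (e i) (cutAt K M Ψ) x) l (𝓝 (Ψ x)) := by
  obtain ⟨C, hC⟩ := exists_bound_cutAt hK h.usc hs hM
  have hgi := locallyIntegrable_of_bound (h.measurable_cutAt hK.isClosed hs hM) hC
  obtain ⟨r, hr, hrm⟩ := h.exists_le_mollify hK hs hM hxK
  rw [Metric.tendsto_nhds]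
  intro δ hδ
  -- Upper semicontinuity bounds the mollifications from above by `Ψ x + δ / 2` for small radii; the
  -- sub-mean value property bounds them from below by `Ψ x`.
  have husc := upperSemicontinuous_cutAt hK.isClosed h.usc hs hM x (Ψ x + δ / 2)
    (by
      change cutAt K M Ψ x < _
      rw [cutAt_of_mem (mem_of_mem_nhds hxK)]
      linarith)
  obtain ⟨η, hη, hηs⟩ := Metric.eventually_nhds_iff_ball.1 husc
  filter_upwards [he.eventually (Ioo_mem_nhdsGT (lt_min hr hη))] with i hi
  have h1 := hrm x (Metric.mem_ball_self hr) (e i) hi.1 (hi.2.trans_le (min_le_left _ _))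
  have h2 := mollify_mono hi.1 hgi (locallyIntegrable_const (Ψ x + δ / 2)) (z := x)
    (Filter.Eventually.of_forall fun w hw => (hηs w
      (Metric.ball_subset_ball (hi.2.le.trans (min_le_right _ _)) hw)).le)
  rw [mollify_const hi.1] at h2
  rw [Real.dist_eq, abs_lt]
  constructor <;> linarith

/-- The sub-mean value property on small discs implies it on all discs. -/
theorem le_circMean (h : SubmeanOn Ψ Ω) (hO : IsOpen Ω) {y v : Cn n}
    (hdisc : ∀ ζ : ℂ, ‖ζ‖ ≤ 1 → y + ζ • v ∈ Ω) : Ψ y ≤ circMean Ψ y v := by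
  obtain ⟨M, hM⟩ := h.bddBelow
  set D : Set (Cn n) := (fun ζ : ℂ => y + ζ • v) '' Metric.closedBall 0 1 with hD
  have hDc : IsCompact D := (isCompact_closedBall 0 1).image (by fun_prop)
  have hDΩ : D ⊆ Ω := by
    rintro _ ⟨ζ, hζ, rfl⟩
    exact hdisc ζ (by simpa using hζ)
  obtain ⟨δ, hδ, hδs⟩ := hDc.exists_cthickening_subset_open hO hDΩ
  set K := Metric.cthickening δ D with hKdef
  have hK : IsCompact K := hDc.cthickening
  have hnear : ∀ z ∈ D, ∀ w, dist w z ≤ δ → w ∈ K := fun z hz w hw =>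
    Metric.mem_cthickening_of_dist_le w z δ D hz hw
  have hnhds : ∀ z ∈ D, K ∈ 𝓝 z := fun z hz =>
    Filter.mem_of_superset (Metric.closedBall_mem_nhds z hδ) fun w hw => hnear z hz w hw
  set g := cutAt K M Ψ with hg
  obtain ⟨C, hC⟩ := exists_bound_cutAt hK h.usc hδs hM
  have hgm := h.measurable_cutAt hK.isClosed hδs hM
  have hgi := locallyIntegrable_of_bound hgm hC
  set O := Metric.thickening (δ / 2) D with hOdef
  have hgD : DistPSH g (Metric.thickening δ D) :=
    ((h.distPSH hO).mono ((Metric.thickening_subset_cthickening _ _).trans hδs)).congr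
      Metric.isOpen_thickening (Filter.Eventually.of_forall fun z hz =>
        (cutAt_of_mem (Metric.thickening_subset_cthickening _ _ hz)).symm)
  set e : ℕ → ℝ := fun k => δ / 2 * (1 / ((k : ℝ) + 1)) with he
  have hδ2 : 0 < δ / 2 := by linarith
  have hsm := fun k => contDiff_mollify (radii_pos hδ2 k) hgi
  -- Around the disc the mollifications are smooth with non-negative Levi form, so they satisfy the
  -- inequality on the full disc. They converge at every point and not only almost everywhere, so
  -- the inequality passes to `Ψ`, although a circle is a null set when `v ≠ 0`.
  have hle : ∀ k, mollify (e k) g y ≤ circMean (mollify (e k) g) y v := fun k => by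
    refine le_circMean_of_levi_nonneg (O := O) Metric.isOpen_thickening (hsm k).contDiffOn ?_ ?_
    · exact fun ζ hζ => Metric.self_subset_thickening hδ2 _ ⟨ζ, by simpa using hζ, rfl⟩
    · refine fun z hz => hgD.levi_mollify_nonneg hgi (radii_pos hδ2 k) (fun w hw => ?_) v
      obtain ⟨x, hx, hzx⟩ := Metric.mem_thickening_iff.1 hz
      refine Metric.mem_thickening_iff.2 ⟨x, hx, ?_⟩
      have h1 := dist_triangle w z x
      have h2 := Metric.mem_closedBall.1 hw
      have h3 := radii_le hδ2 k
      linarith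
  have hDmem : ∀ θ : ℝ, y + Complex.exp (θ * Complex.I) • v ∈ D := fun θ =>
    ⟨_, by simp [Complex.norm_exp_ofReal_mul_I], rfl⟩
  have hlim1 : Filter.Tendsto (fun k => mollify (e k) g y) Filter.atTop (𝓝 (Ψ y)) :=
    h.tendsto_mollify hK hδs hM (hnhds y ⟨0, by simp, by simp⟩) (tendsto_radii hδ2)
  have hlim2 : Filter.Tendsto (fun k => circMean (mollify (e k) g) y v) Filter.atTop
      (𝓝 (circMean Ψ y v)) := by
    simp only [circMean_eq]
    refine Filter.Tendsto.const_mul _ ?_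
    refine intervalIntegral.tendsto_integral_filter_of_dominated_convergence (fun _ => C) ?_ ?_ ?_ ?_
    · refine Filter.Eventually.of_forall fun k => ?_
      have : Continuous fun θ : ℝ => mollify (e k) g (y + Complex.exp (θ * Complex.I) • v) :=
        (hsm k).continuous.comp (by fun_prop)
      exact this.aestronglyMeasurable
    · refine Filter.Eventually.of_forall fun k => Filter.Eventually.of_forall fun θ _ => ?_
      have hk := radii_pos hδ2 k
      rw [Real.norm_eq_abs, abs_le]
      constructor
      · have := mollify_mono hk (locallyIntegrable_const (-C)) hgi
          (z := y + Complex.exp (θ * Complex.I) • v)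
          (Filter.Eventually.of_forall fun w _ => (abs_le.1 (hC w)).1)
        rwa [mollify_const hk] at this
      · have := mollify_mono hk hgi (locallyIntegrable_const C)
          (z := y + Complex.exp (θ * Complex.I) • v)
          (Filter.Eventually.of_forall fun w _ => (abs_le.1 (hC w)).2)
        rwa [mollify_const hk] at this
    · exact intervalIntegrable_const
    · exact Filter.Eventually.of_forall fun θ _ =>
        h.tendsto_mollify hK hδs hM (hnhds _ (hDmem θ)) (tendsto_radii hδ2)
  exact le_of_tendsto_of_tendsto' hlim1 hlim2 hle

/-- Mollifications ignore null sets and converge to the two functions at every point. The common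
constant `min M M'` makes both cut-offs agree outside the compact set. -/
theorem eq_of_ae_eq {Ψ' : Cn n → ℝ} (h : SubmeanOn Ψ Ω) (h' : SubmeanOn Ψ' Ω) (hO : IsOpen Ω)
    (hae : ∀ᵐ z, z ∈ Ω → Ψ z = Ψ' z) {x : Cn n} (hx : x ∈ Ω) : Ψ x = Ψ' x := by
  obtain ⟨M, hM⟩ := h.bddBelow
  obtain ⟨M', hM'⟩ := h'.bddBelow
  obtain ⟨R, hR, hRs⟩ := Metric.nhds_basis_closedBall.mem_iff.1 (hO.mem_nhds hx)
  have hK := isCompact_closedBall x R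
  have hnh := Metric.closedBall_mem_nhds x hR
  have h1 := h.tendsto_mollify hK hRs (M := min M M')
    (fun z hz => (min_le_left _ _).trans (hM z hz)) hnh (tendsto_radii one_pos)
  have h2 := h'.tendsto_mollify hK hRs (M := min M M')
    (fun z hz => (min_le_right _ _).trans (hM' z hz)) hnh (tendsto_radii one_pos)
  refine tendsto_nhds_unique h1 (h2.congr fun k => ?_)
  refine mollify_congr_of_eqOn_ball (radii_pos one_pos k) ?_
  filter_upwards [hae] with z hz _
  unfold cutAt
  split_ifs with hzK
  · exact (hz (hRs hzK)).symm
  · rfl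

end SubmeanOn

end Submean

/-! ### Plurisubharmonic functions with values in `[-∞, ∞)` -/

/-- The real-valued truncation `max φ M`. -/
def trunc {α : Type*} (M : ℝ) (φ : α → EReal) (z : α) : ℝ := (max (φ z) (M : EReal)).toReal

section Trunc

variable {n : ℕ} {φ : Cn n → EReal} {Ω : Set (Cn n)} {M : ℝ}

theorem coe_trunc {α : Type*} {φ : α → EReal} {z : α} (h : φ z < ⊤) :
    (trunc M φ z : EReal) = max (φ z) M :=
  EReal.coe_toReal (max_lt h (EReal.coe_lt_top M)).ne
    ((EReal.bot_lt_coe M).trans_le (le_max_right _ _)).ne'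

theorem le_trunc {α : Type*} {φ : α → EReal} {z : α} (h : φ z < ⊤) : M ≤ trunc M φ z := by
  rw [← EReal.coe_le_coe_iff, coe_trunc h]
  exact le_max_right _ _

theorem trunc_lt_iff {α : Type*} {φ : α → EReal} {z : α} (h : φ z < ⊤) {c : ℝ} :
    trunc M φ z < c ↔ φ z < c ∧ M < c := by
  rw [← EReal.coe_lt_coe_iff, coe_trunc h, max_lt_iff, EReal.coe_lt_coe_iff]

theorem trunc_le_iff {α : Type*} {φ : α → EReal} {z : α} (h : φ z < ⊤) {c : ℝ} :
    trunc M φ z ≤ c ↔ φ z ≤ c ∧ M ≤ c := by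
  rw [← EReal.coe_le_coe_iff, coe_trunc h, max_le_iff, EReal.coe_le_coe_iff]

/-- The truncation at a level below `c` decides whether the value is below `c`, and these
comparisons determine an extended real number. -/
theorem eq_of_trunc_eq {α : Type*} {φ φ' : α → EReal} {z : α} (h : φ z < ⊤) (h' : φ' z < ⊤)
    (heq : ∀ M : ℝ, trunc M φ z = trunc M φ' z) : φ z = φ' z := by
  have key : ∀ {φ φ' : α → EReal}, φ z < ⊤ → φ' z < ⊤ →
      (∀ M : ℝ, trunc M φ z = trunc M φ' z) → φ z ≤ φ' z := fun {φ φ'} h h' heq => by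
    refine EReal.le_of_forall_lt_iff_le.1 fun c hc => ?_
    have h1 : trunc (c - 1) φ' z < c := (trunc_lt_iff h').2 ⟨hc, by linarith⟩
    rw [← heq, trunc_lt_iff h] at h1
    exact h1.1.le
  exact le_antisymm (key h h' heq) (key h' h fun M => (heq M).symm)

theorem usc_trunc {X : Type*} [TopologicalSpace X] {φ : X → EReal} {U : Set X}
    (h : UpperSemicontinuousOn φ U) (ht : ∀ x ∈ U, φ x < ⊤) :
    UpperSemicontinuousOn (trunc M φ) U := by
  intro x hx c hc
  change trunc M φ x < c at hc
  rw [trunc_lt_iff (ht x hx)] at hc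
  filter_upwards [h x hx c hc.1, self_mem_nhdsWithin] with w hw hwU
  exact (trunc_lt_iff (ht w hwU)).2 ⟨hw, hc.2⟩

/-- Only values on the compact disc occur; cutting off there gives a bounded function that is upper
semicontinuous on the whole space, hence measurable. -/
theorem circleIntegrable_of_usc {Ψ : Cn n → ℝ} (h : UpperSemicontinuousOn Ψ Ω)
    (hM : ∀ z ∈ Ω, M ≤ Ψ z) {y v : Cn n} (hdisc : ∀ ζ : ℂ, ‖ζ‖ ≤ 1 → y + ζ • v ∈ Ω) :
    CircleIntegrable (fun ζ : ℂ => Ψ (y + ζ • v)) 0 1 := by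
  set D : Set (Cn n) := (fun ζ : ℂ => y + ζ • v) '' Metric.closedBall 0 1 with hD
  have hDc : IsCompact D := (isCompact_closedBall 0 1).image (by fun_prop)
  have hDΩ : D ⊆ Ω := by
    rintro _ ⟨ζ, hζ, rfl⟩
    exact hdisc ζ (by simpa using hζ)
  obtain ⟨C, hC⟩ := exists_bound_cutAt hDc h hDΩ hM
  have hm := (upperSemicontinuous_cutAt hDc.isClosed h hDΩ hM).measurable
  have heq : (fun θ : ℝ => Ψ (y + circleMap 0 1 θ • v))
      = fun θ : ℝ => cutAt D M Ψ (y + circleMap 0 1 θ • v) := by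
    ext θ
    have hmem : y + circleMap 0 1 θ • v ∈ D :=
      ⟨circleMap 0 1 θ, by simp [circleMap, Complex.norm_exp_ofReal_mul_I], rfl⟩
    exact (cutAt_of_mem hmem).symm
  rw [CircleIntegrable, heq]
  have hcont : Continuous fun θ : ℝ => y + circleMap 0 1 θ • v := by fun_prop
  refine (intervalIntegrable_const (c := C)).mono_fun
    (hm.comp hcont.measurable).aestronglyMeasurable ?_
  exact Filter.Eventually.of_forall fun θ => (hC _).trans (le_abs_self C)

theorem le_circMean_const {Ψ : Cn n → ℝ} (h : UpperSemicontinuousOn Ψ Ω)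
    (hM : ∀ z ∈ Ω, M ≤ Ψ z) {y v : Cn n} (hdisc : ∀ ζ : ℂ, ‖ζ‖ ≤ 1 → y + ζ • v ∈ Ω) :
    M ≤ circMean Ψ y v := by
  have := Real.circleAverage_mono (c := 0) (R := 1) (f₁ := fun _ => M)
    (circleIntegrable_const M 0 1) (circleIntegrable_of_usc h hM hdisc)
    (fun ζ hζ => hM _ (hdisc ζ (by simpa using (mem_sphere_iff_norm.1 hζ).le)))
  rwa [Real.circleAverage_const] at this

theorem SubmeanOn.of_discs {Ψ : Cn n → ℝ} (hO : IsOpen Ω) (h : UpperSemicontinuousOn Ψ Ω)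
    (hM : ∀ z ∈ Ω, M ≤ Ψ z) (hd : ∀ y v : Cn n, (∀ ζ : ℂ, ‖ζ‖ ≤ 1 → y + ζ • v ∈ Ω) →
      Ψ y ≤ circMean Ψ y v) : SubmeanOn Ψ Ω where
  usc := h
  bddBelow := ⟨M, hM⟩
  submean x hx := by
    obtain ⟨R, hR, hRs⟩ := Metric.isOpen_iff.1 hO x hx
    refine ⟨R / 2, by linarith, fun z hz v hv => hd z v fun ζ hζ => hRs ?_⟩
    have h1 := Metric.mem_closedBall.1 (add_smul_mem_closedBall (z := z) hζ hv.le)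
    have h2 := Metric.mem_ball.1 hz
    have h3 := dist_triangle (z + ζ • v) z x
    rw [Metric.mem_ball]
    linarith

theorem SubmeanOn.of_trunc (hO : IsOpen Ω) (hu : UpperSemicontinuousOn φ Ω)
    (ht : ∀ x ∈ Ω, φ x < ⊤) (hd : ∀ y v : Cn n, (∀ ζ : ℂ, ‖ζ‖ ≤ 1 → y + ζ • v ∈ Ω) →
      φ y ≤ (circMean (trunc M φ) y v : ℝ)) : SubmeanOn (trunc M φ) Ω := by
  have hM : ∀ z ∈ Ω, M ≤ trunc M φ z := fun z hz => le_trunc (ht z hz)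
  have hu' := usc_trunc (M := M) hu ht
  refine SubmeanOn.of_discs hO hu' hM fun y v hdisc => ?_
  rw [trunc_le_iff (ht y (by simpa using hdisc 0 (by simp)))]
  exact ⟨hd y v hdisc, le_circMean_const hu' hM hdisc⟩

/-- The limit of a decreasing sequence of smooth plurisubharmonic functions. -/
theorem le_circMean_trunc_of_antitone (hO : IsOpen Ω) {G : ℕ → Cn n → ℝ}
    (hG : ∀ k, ContDiffOn ℝ ∞ (G k) Ω) (hl : ∀ k, ∀ z ∈ Ω, ∀ ξ, 0 ≤ levi ξ (G k) z)
    (hanti : ∀ z ∈ Ω, Antitone fun k => G k z)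
    (hlim : ∀ z ∈ Ω, Filter.Tendsto (fun k => (G k z : EReal)) Filter.atTop (𝓝 (φ z)))
    {y v : Cn n} (hdisc : ∀ ζ : ℂ, ‖ζ‖ ≤ 1 → y + ζ • v ∈ Ω) (M : ℝ) :
    φ y ≤ (circMean (trunc M φ) y v : ℝ) := by
  have hle : ∀ z ∈ Ω, ∀ k, φ z ≤ G k z := fun z hz k =>
    (show Antitone fun k => (G k z : EReal) from fun i j hij =>
      EReal.coe_le_coe_iff.2 (hanti z hz hij)).le_of_tendsto (hlim z hz) k
  have ht : ∀ z ∈ Ω, φ z < ⊤ := fun z hz => (hle z hz 0).trans_lt (EReal.coe_lt_top _)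
  have hy : y ∈ Ω := by simpa using hdisc 0 (by simp)
  have hcirc : ∀ θ : ℝ, y + Complex.exp (θ * Complex.I) • v ∈ Ω := fun θ =>
    hdisc _ (Complex.norm_exp_ofReal_mul_I θ).le
  have hpc : Continuous fun θ : ℝ => y + Complex.exp (θ * Complex.I) • v := by fun_prop
  have hGc : ∀ k, Continuous fun θ : ℝ => G k (y + Complex.exp (θ * Complex.I) • v) := fun k =>
    (hG k).continuousOn.comp_continuous hpc hcirc
  have htl : ∀ z ∈ Ω, Filter.Tendsto (fun k => max (G k z) M) Filter.atTop
      (𝓝 (trunc M φ z)) := fun z hz => by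
    rw [← EReal.tendsto_coe, coe_trunc (ht z hz)]
    have := (hlim z hz).max (tendsto_const_nhds (x := (M : EReal)))
    refine this.congr fun k => ?_
    exact (EReal.coe_strictMono.monotone.map_max).symm
  -- The truncation is inserted on the circle only, which weakens the inequality. It bounds the
  -- functions from below, so that their means converge by domination even where the limit is `-∞`.
  have hmean : ∀ k, G k y ≤ circMean (fun z => max (G k z) M) y v := fun k => by
    refine (le_circMean_of_levi_nonneg hO (hG k) hdisc fun z hz => hl k z hz v).trans ?_
    rw [circMean_eq, circMean_eq]
    refine mul_le_mul_of_nonneg_left ?_ (by positivity)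
    exact intervalIntegral.integral_mono (by positivity) ((hGc k).intervalIntegrable _ _)
      (((hGc k).max continuous_const).intervalIntegrable _ _) fun θ => le_max_left _ _
  have hconv : Filter.Tendsto (fun k => circMean (fun z => max (G k z) M) y v) Filter.atTop
      (𝓝 (circMean (trunc M φ) y v)) := by
    simp only [circMean_eq]
    refine Filter.Tendsto.const_mul _ ?_
    refine intervalIntegral.tendsto_integral_filter_of_dominated_convergence
      (fun θ => |max (G 0 (y + Complex.exp (θ * Complex.I) • v)) M| + |M|) ?_ ?_ ?_ ?_
    · exact Filter.Eventually.of_forall fun k =>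
        ((hGc k).max continuous_const).aestronglyMeasurable
    · refine Filter.Eventually.of_forall fun k => Filter.Eventually.of_forall fun θ _ => ?_
      have h1 : max (G k (y + Complex.exp (θ * Complex.I) • v)) M
          ≤ max (G 0 (y + Complex.exp (θ * Complex.I) • v)) M :=
        max_le_max_right _ (hanti _ (hcirc θ) (Nat.zero_le k))
      have h2 := le_max_right (G k (y + Complex.exp (θ * Complex.I) • v)) M
      rw [Real.norm_eq_abs, abs_le]
      have h3 := neg_abs_le M
      have h4 := le_abs_self (max (G 0 (y + Complex.exp (θ * Complex.I) • v)) M)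
      have h5 := abs_nonneg M
      have h6 := abs_nonneg (max (G 0 (y + Complex.exp (θ * Complex.I) • v)) M)
      constructor <;> linarith
    · exact ((((hGc 0).max continuous_const).abs.add continuous_const)).intervalIntegrable _ _
    · exact Filter.Eventually.of_forall fun θ _ => htl _ (hcirc θ)
  exact le_of_tendsto_of_tendsto' (hlim y hy) (EReal.tendsto_coe.2 hconv) fun k =>
    EReal.coe_le_coe_iff.2 (hmean k)

/-- The limit lies below every member of the sequence, so a strict upper bound for one continuous
member persists nearby. -/
theorem usc_of_antitone {X : Type*} [TopologicalSpace X] {φ : X → EReal} {U : Set X}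
    {G : ℕ → X → ℝ} (hG : ∀ k, ContinuousOn (G k) U) (hanti : ∀ z ∈ U, Antitone fun k => G k z)
    (hlim : ∀ z ∈ U, Filter.Tendsto (fun k => (G k z : EReal)) Filter.atTop (𝓝 (φ z))) :
    UpperSemicontinuousOn φ U := by
  intro x hx c hc
  obtain ⟨k, hk⟩ := ((hlim x hx).eventually (gt_mem_nhds hc)).exists
  have h1 : ContinuousWithinAt (fun z => (G k z : EReal)) U x :=
    continuous_coe_real_ereal.continuousAt.comp_continuousWithinAt (hG k x hx)
  filter_upwards [h1.eventually (gt_mem_nhds hk), self_mem_nhdsWithin] with w hw hwU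
  refine lt_of_le_of_lt ?_ hw
  exact (show Antitone fun k => (G k w : EReal) from fun i j hij =>
      EReal.coe_le_coe_iff.2 (hanti w hwU hij)).le_of_tendsto (hlim w hwU) k

end Trunc

/-! ### Finiteness almost everywhere and local integrability -/

section Finite

variable {n : ℕ} {φ : Cn n → EReal} {Ω : Set (Cn n)}

theorem abs_trunc_le {α : Type*} {φ : α → EReal} {z : α} (ht : φ z ≠ ⊤) (hb : φ z ≠ ⊥) (k : ℕ) :
    |trunc (-(k : ℝ)) φ z| ≤ |(φ z).toReal| := by
  lift φ z to ℝ using ⟨ht, hb⟩ with c hc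
  have : trunc (-(k : ℝ)) φ z = max c (-(k : ℝ)) := by
    rw [← EReal.coe_eq_coe_iff, coe_trunc (by rw [← hc]; exact EReal.coe_lt_top _), ← hc]
    exact (EReal.coe_strictMono.monotone.map_max).symm
  rw [this, EReal.toReal_coe]
  rcases le_total c (-(k : ℝ)) with h | h
  · rw [max_eq_right h, abs_neg, Nat.abs_cast]
    have := neg_le_abs c
    linarith
  · rw [max_eq_left h]

theorem tendsto_trunc {α : Type*} {φ : α → EReal} {z : α} (ht : φ z ≠ ⊤) (hb : φ z ≠ ⊥) :
    Filter.Tendsto (fun k : ℕ => trunc (-(k : ℝ)) φ z) Filter.atTop (𝓝 (φ z).toReal) := by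
  lift φ z to ℝ using ⟨ht, hb⟩ with c hc
  have : ∀ k : ℕ, trunc (-(k : ℝ)) φ z = max c (-(k : ℝ)) := fun k => by
    rw [← EReal.coe_eq_coe_iff, coe_trunc (by rw [← hc]; exact EReal.coe_lt_top _), ← hc]
    exact (EReal.coe_strictMono.monotone.map_max).symm
  obtain ⟨N, hN⟩ := exists_nat_ge (-c)
  refine tendsto_const_nhds.congr' ?_
  filter_upwards [Filter.eventually_ge_atTop N] with k hk
  rw [this, EReal.toReal_coe, max_eq_left]
  have : (N : ℝ) ≤ k := by exact_mod_cast hk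
  linarith

theorem trunc_bot {α : Type*} {φ : α → EReal} {z : α} (h : φ z = ⊥) (M : ℝ) :
    trunc M φ z = M := by
  rw [trunc, h, bot_sup_eq, EReal.toReal_coe]

/-- Near a point close to one with finite value, a plurisubharmonic function is integrable. -/
theorem integrableOn_of_submean (ht : ∀ x ∈ Ω, φ x < ⊤)
    (hS : ∀ k : ℕ, SubmeanOn (trunc (-(k : ℝ)) φ) Ω) {z₀ : Cn n} {R : ℝ} (hR : 0 < R)
    (hsub : Metric.closedBall z₀ R ⊆ Ω) (hz₀ : φ z₀ ≠ ⊥)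
    (hO : IsOpen Ω) :
    (∀ᵐ z, z ∈ Metric.ball z₀ R → φ z ≠ ⊥) ∧
      IntegrableOn (fun z => (φ z).toReal) (Metric.ball z₀ (R / 2)) := by
  set K := Metric.closedBall z₀ R with hKdef
  have hK : IsCompact K := isCompact_closedBall z₀ R
  have hz₀Ω : z₀ ∈ Ω := hsub (Metric.mem_closedBall_self hR.le)
  have hMk : ∀ k : ℕ, ∀ z ∈ Ω, -(k : ℝ) ≤ trunc (-(k : ℝ)) φ z := fun k z hz => le_trunc (ht z hz)
  obtain ⟨C, hC⟩ := exists_bound_cutAt hK (hS 0).usc hsub (hMk 0)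
  have hanti : ∀ k : ℕ, ∀ z ∈ Ω, trunc (-(k : ℝ)) φ z ≤ trunc (-((0 : ℕ) : ℝ)) φ z := fun k z hz => by
    rw [trunc_le_iff (ht z hz)]
    have h1 := (trunc_le_iff (ht z hz)).1 (le_refl (trunc (-((0 : ℕ) : ℝ)) φ z))
    refine ⟨h1.1, le_trans ?_ h1.2⟩
    simp
  have hCk : ∀ k : ℕ, ∀ z ∈ K, trunc (-(k : ℝ)) φ z ≤ C := fun k z hz => by
    refine (hanti k z (hsub hz)).trans ?_
    have := hC z
    rw [cutAt_of_mem hz] at this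
    exact (le_abs_self _).trans this
  set g : ℕ → Cn n → ℝ := fun k => cutAt K (-(k : ℝ)) (trunc (-(k : ℝ)) φ) with hg
  have hgm : ∀ k, Measurable (g k) := fun k => (hS k).measurable_cutAt hK.isClosed hsub (hMk k)
  have hgb : ∀ k, ∃ C, ∀ z, |g k z| ≤ C := fun k => exists_bound_cutAt hK (hS k).usc hsub (hMk k)
  have hgi : ∀ k, LocallyIntegrable (g k) := fun k => by
    obtain ⟨C, hC⟩ := hgb k
    exact SubmeanOn.locallyIntegrable_of_bound (hgm k) hC
  have hgle : ∀ k, ∀ z ∈ Metric.ball z₀ R, g k z ≤ C := fun k z hz => by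
    rw [hg]
    simp only
    rw [cutAt_of_mem (Metric.ball_subset_closedBall hz)]
    exact hCk k z (Metric.ball_subset_closedBall hz)
  -- The finite value at `z₀` bounds the mollifications at `z₀` from below, uniformly in the
  -- truncation level.
  have hmean : ∀ k, (φ z₀).toReal ≤ mollify R (g k) z₀ := fun k => by
    obtain ⟨C', hC'⟩ := hgb k
    have h1 : g k z₀ ≤ mollify R (g k) z₀ := by
      refine le_mollify_of_le_circMean hR (hgm k) (fun w _ => hC' w) fun w hw => ?_
      rw [hg]
      simp only
      rw [cutAt_of_mem (Metric.mem_closedBall_self hR.le),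
        circMean_congr (g := trunc (-(k : ℝ)) φ) fun x hx =>
          cutAt_of_mem (Metric.closedBall_subset_closedBall hw.le hx)]
      exact (hS k).le_circMean hO fun ζ hζ => hsub (add_smul_mem_closedBall hζ hw.le)
    refine le_trans ?_ h1
    rw [hg]
    simp only
    rw [cutAt_of_mem (Metric.mem_closedBall_self hR.le), ← EReal.coe_le_coe_iff,
      coe_trunc (ht z₀ hz₀Ω), EReal.coe_toReal (ht z₀ hz₀Ω).ne hz₀]
    exact le_max_left _ _
  -- the non-negative integrands
  set F : ℕ → Cn n → ℝ := fun k w => mker n R (z₀ - w) * (C - g k w) with hF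
  have hFi : ∀ k, Integrable (F k) := fun k => by
    have hl : LocallyIntegrable fun w => C - g k w := (locallyIntegrable_const C).sub (hgi k)
    exact integrable_mollify hR hl z₀
  have hF0 : ∀ k w, 0 ≤ F k w := fun k w => by
    by_cases hw : w ∈ Metric.ball z₀ R
    · exact mul_nonneg (mker_nonneg _ _) (by linarith [hgle k w hw])
    · simp [hF, mker_eq_zero hR (by rwa [Metric.mem_ball, dist_comm, dist_eq_norm, not_lt] at hw)]
  have hFint : ∀ k, ∫ w, F k w ≤ C - (φ z₀).toReal := fun k => by
    have h1 : ∫ w, F k w = C - mollify R (g k) z₀ := by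
      have h2 := integral_sub (integrable_mollify hR (locallyIntegrable_const C) z₀)
        (integrable_mollify hR (hgi k) z₀)
      have h3 : ∫ w, mker n R (z₀ - w) • C = C := mollify_const hR C z₀
      rw [h3] at h2
      simp only [smul_eq_mul] at h2
      simp only [hF, mul_sub]
      exact h2
    linarith [hmean k]
  -- Fatou's lemma: the truncation level tends to `-∞` while the integrals stay below `C - φ z₀`.
  have hlint : ∫⁻ w, Filter.liminf (fun k => ENNReal.ofReal (F k w)) Filter.atTop
      ≤ ENNReal.ofReal (C - (φ z₀).toReal) := by
    refine (lintegral_liminf_le fun k => ?_).trans ?_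
    · refine ENNReal.measurable_ofReal.comp (Measurable.mul ?_ (measurable_const.sub (hgm k)))
      exact ((continuous_mker R).comp (by fun_prop)).measurable
    · refine Filter.liminf_le_of_le (by isBoundedDefault) fun b hb => ?_
      obtain ⟨k, hk⟩ := hb.exists
      refine hk.trans ?_
      rw [← ofReal_integral_eq_lintegral_ofReal (hFi k) (Filter.Eventually.of_forall (hF0 k))]
      exact ENNReal.ofReal_le_ofReal (hFint k)
  have hlm : Measurable fun w => Filter.liminf (fun k => ENNReal.ofReal (F k w)) Filter.atTop := by
    refine Measurable.liminf fun k => ?_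
    refine ENNReal.measurable_ofReal.comp (Measurable.mul ?_ (measurable_const.sub (hgm k)))
    exact ((continuous_mker R).comp (by fun_prop)).measurable
  have hfin : ∀ᵐ w, Filter.liminf (fun k => ENNReal.ofReal (F k w)) Filter.atTop < ⊤ :=
    ae_lt_top hlm (hlint.trans_lt ENNReal.ofReal_lt_top).ne
  have hmkpos : ∀ w ∈ Metric.ball z₀ R, 0 < mker n R (z₀ - w) := fun w hw =>
    mker_pos hR (by rwa [Metric.mem_ball, dist_comm, dist_eq_norm] at hw)
  have hbot : ∀ᵐ z, z ∈ Metric.ball z₀ R → φ z ≠ ⊥ := by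
    filter_upwards [hfin] with w hw hwR hbot
    -- Where `φ = -∞` the integrand grows like `C + k`, which the finite integral of the lower limit
    -- permits only on a null set.
    have htop : Filter.Tendsto (fun k => ENNReal.ofReal (F k w)) Filter.atTop (𝓝 ⊤) := by
      refine ENNReal.tendsto_ofReal_atTop.comp ?_
      have : ∀ k : ℕ, F k w = mker n R (z₀ - w) * (C + k) := fun k => by
        simp only [hF, hg]
        rw [cutAt_of_mem (Metric.ball_subset_closedBall hwR), trunc_bot hbot]
        ring
      simp only [this]
      exact Filter.Tendsto.const_mul_atTop (hmkpos w hwR)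
        (Filter.tendsto_atTop_add_const_left _ _ tendsto_natCast_atTop_atTop)
    rw [htop.liminf_eq] at hw
    exact lt_irrefl _ hw
  refine ⟨hbot, ?_⟩
  have hball : Metric.ball z₀ (R / 2) ⊆ Metric.ball z₀ R := Metric.ball_subset_ball (by linarith)
  have hlimF : ∀ᵐ w, w ∈ Metric.ball z₀ R →
      Filter.Tendsto (fun k => g k w) Filter.atTop (𝓝 (φ w).toReal) := by
    filter_upwards [hbot] with w hw hwR
    have hwK := Metric.ball_subset_closedBall hwR
    exact (tendsto_trunc (ht w (hsub hwK)).ne (hw hwR)).congr fun k => (cutAt_of_mem hwK).symm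
  -- lower bound of the kernel
  obtain ⟨c, hc, hcm⟩ : ∃ c > 0, ∀ w ∈ Metric.ball z₀ (R / 2), c ≤ mker n R (z₀ - w) := by
    have hcont : ContinuousOn (fun w => mker n R (z₀ - w)) (Metric.closedBall z₀ (R / 2)) :=
      ((continuous_mker R).comp (by fun_prop)).continuousOn
    obtain ⟨x, hx, hxm⟩ := (isCompact_closedBall z₀ (R / 2)).exists_isMinOn
      ⟨z₀, Metric.mem_closedBall_self (by linarith)⟩ hcont
    exact ⟨_, hmkpos x (Metric.closedBall_subset_ball (by linarith) hx),
      fun w hw => hxm (Metric.ball_subset_closedBall hw)⟩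
  have hmeas : AEStronglyMeasurable (fun z => (φ z).toReal)
      (volume.restrict (Metric.ball z₀ (R / 2))) := by
    refine aestronglyMeasurable_of_tendsto_ae Filter.atTop
      (fun k => (hgm k).aestronglyMeasurable) ?_
    filter_upwards [ae_restrict_of_ae hlimF, ae_restrict_mem measurableSet_ball] with w h1 h2
    exact h1 (hball h2)
  -- On the half ball the kernel is at least `c`, so the bound on the weighted integral controls the
  -- unweighted integral of `C - φ ≥ 0`.
  have hfl : ∫⁻ w in Metric.ball z₀ (R / 2), ENNReal.ofReal (c * (C - (φ w).toReal)) < ⊤ := by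
    refine lt_of_le_of_lt ?_ (hlint.trans_lt ENNReal.ofReal_lt_top)
    refine le_trans ?_ (setLIntegral_le_lintegral (Metric.ball z₀ (R / 2)) _)
    refine lintegral_mono_ae ?_
    filter_upwards [ae_restrict_of_ae hlimF, ae_restrict_mem measurableSet_ball] with w h1 h2
    have h3 : Filter.Tendsto (fun k => ENNReal.ofReal (F k w)) Filter.atTop
        (𝓝 (ENNReal.ofReal (mker n R (z₀ - w) * (C - (φ w).toReal)))) :=
      (ENNReal.continuous_ofReal.tendsto _).comp
        (((tendsto_const_nhds).sub (h1 (hball h2))).const_mul _)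
    rw [h3.liminf_eq]
    refine ENNReal.ofReal_le_ofReal (mul_le_mul_of_nonneg_right (hcm w h2) ?_)
    have := le_of_tendsto' (h1 (hball h2)) fun k => hgle k w (hball h2)
    linarith
  have hcC : IntegrableOn (fun w => c * (C - (φ w).toReal)) (Metric.ball z₀ (R / 2)) := by
    refine ⟨(aestronglyMeasurable_const.sub hmeas).const_mul c, ?_⟩
    rw [hasFiniteIntegral_iff_ofReal]
    · exact hfl
    · filter_upwards [ae_restrict_of_ae hlimF, ae_restrict_mem measurableSet_ball] with w h1 h2
      have := le_of_tendsto' (h1 (hball h2)) fun k => hgle k w (hball h2)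
      exact mul_nonneg hc.le (sub_nonneg.2 this)
  have h1 : IntegrableOn (fun w => C - c⁻¹ * (c * (C - (φ w).toReal)))
      (Metric.ball z₀ (R / 2)) :=
    (integrableOn_const (C := C) measure_ball_lt_top.ne).sub (hcC.const_mul c⁻¹)
  refine h1.congr (Filter.Eventually.of_forall fun w => ?_)
  field_simp
  ring

/-- A plurisubharmonic function that is finite on a dense set. -/
theorem distPSH_toReal_of_dense (hO : IsOpen Ω) (ht : ∀ x ∈ Ω, φ x < ⊤)
    (hS : ∀ k : ℕ, SubmeanOn (trunc (-(k : ℝ)) φ) Ω)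
    (hd : ∀ x ∈ Ω, ∀ r > 0, ∃ z ∈ Metric.ball x r, φ z ≠ ⊥) :
    (∀ᵐ z, z ∈ Ω → φ z ≠ ⊥) ∧ DistPSH (fun z => (φ z).toReal) Ω := by
  have hloc : ∀ x ∈ Ω, ∃ r > 0, (∀ᵐ z, z ∈ Metric.ball x r → φ z ≠ ⊥) ∧
      IntegrableOn (fun z => (φ z).toReal) (Metric.ball x r) := fun x hx => by
    obtain ⟨R, hR, hRs⟩ := Metric.isOpen_iff.1 hO x hx
    -- At distance less than `R / 8`, the closed ball of radius `R / 2` around `z₀` stays in `Ω`,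
    -- and the concentric ball of radius `R / 4` contains the ball of radius `R / 8` around `x`.
    obtain ⟨z₀, hz₀, hb⟩ := hd x hx (R / 8) (by linarith)
    have hz₀' := Metric.mem_ball.1 hz₀
    obtain ⟨h1, h2⟩ := integrableOn_of_submean ht hS (z₀ := z₀) (R := R / 2) (by linarith)
      (fun w hw => hRs (by
        have := Metric.mem_closedBall.1 hw
        have := dist_triangle w z₀ x
        rw [Metric.mem_ball]
        linarith)) hb hO
    have hsub : Metric.ball x (R / 8) ⊆ Metric.ball z₀ (R / 2 / 2) := fun w hw => by
      have := Metric.mem_ball.1 hw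
      have := dist_triangle w x z₀
      rw [dist_comm x z₀] at this
      rw [Metric.mem_ball]
      linarith
    refine ⟨R / 8, by linarith, ?_, h2.mono_set hsub⟩
    filter_upwards [h1] with w hw hwx
    exact hw (Metric.ball_subset_ball (by linarith) (hsub hwx))
  have hL : LocallyIntegrableOn (fun z => (φ z).toReal) Ω := fun x hx => by
    obtain ⟨r, hr, _, hi⟩ := hloc x hx
    exact ⟨Metric.ball x r, mem_nhdsWithin_of_mem_nhds (Metric.ball_mem_nhds x hr), hi⟩
  have hae : ∀ᵐ z, z ∈ Ω → φ z ≠ ⊥ := by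
    rw [ae_iff]
    refine measure_null_of_locally_null _ fun x hx => ?_
    simp only [Set.mem_ofPred_eq, Classical.not_imp] at hx
    obtain ⟨r, hr, h1, _⟩ := hloc x hx.1
    refine ⟨_, inter_mem_nhdsWithin _ (Metric.ball_mem_nhds x hr), ?_⟩
    rw [ae_iff] at h1
    refine measure_mono_null (fun w hw => ?_) h1
    simp only [Set.mem_ofPred_eq, Classical.not_imp] at hw ⊢
    exact ⟨hw.2, hw.1.2⟩
  refine ⟨hae, hL, fun ξ ψ hψ => ?_⟩
  have hint := DistPSH.integrable_mul_levi hL hψ ξ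
  have h0 : ∀ y, y ∉ Ω → levi ξ ψ y = 0 := fun y hy =>
    image_eq_zero_of_notMem_tsupport fun h' => hy (hψ.subset (tsupport_levi_subset ψ ξ h'))
  -- The truncation levels `-k` are at most zero, so the truncations are dominated by `|φ|`, which
  -- is integrable against the test function.
  have hlim : Filter.Tendsto (fun k : ℕ => ∫ y, trunc (-(k : ℝ)) φ y * levi ξ ψ y) Filter.atTop
      (𝓝 (∫ y, (φ y).toReal * levi ξ ψ y)) := by
    refine tendsto_integral_of_dominated_convergence (fun y => ‖(φ y).toReal * levi ξ ψ y‖)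
      (fun k => ?_) hint.norm (fun k => ?_) ?_
    · exact (DistPSH.integrable_mul_levi ((hS k).distPSH hO).locallyIntegrableOn hψ
        ξ).aestronglyMeasurable
    · filter_upwards [hae] with y hy
      by_cases hyΩ : y ∈ Ω
      · rw [norm_mul, norm_mul]
        exact mul_le_mul_of_nonneg_right (abs_trunc_le (ht y hyΩ).ne (hy hyΩ) k) (norm_nonneg _)
      · simp [h0 y hyΩ]
    · filter_upwards [hae] with y hy
      by_cases hyΩ : y ∈ Ω
      · exact (tendsto_trunc (ht y hyΩ).ne (hy hyΩ)).mul_const _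
      · simp [h0 y hyΩ]
  exact ge_of_tendsto' hlim fun k => ((hS k).distPSH hO).nonneg ξ ψ hψ

end Finite

/-! ### Plurisubharmonic functions in the charts of a manifold -/

section Manifold

variable {n : ℕ} {X : Type*} [TopologicalSpace X]

theorem isOpen_chartSet (e : OpenPartialHomeomorph X (Cn n)) {U : Set X} (hU : IsOpen U) :
    IsOpen (chartSet e U) := e.isOpen_inter_preimage_symm hU

theorem usc_comp_symm {φ : X → EReal} {U : Set X} (h : UpperSemicontinuousOn φ U)
    (e : OpenPartialHomeomorph X (Cn n)) :
    UpperSemicontinuousOn (fun y => φ (e.symm y)) (chartSet e U) := by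
  intro y hy c hc
  have h1 := h (e.symm y) hy.2 c hc
  have h2 : Filter.Tendsto e.symm (𝓝[chartSet e U] y) (𝓝[U] (e.symm y)) := by
    refine tendsto_nhdsWithin_of_tendsto_nhds_of_eventually_within _ ?_ ?_
    · exact (e.continuousAt_symm hy.1).tendsto.mono_left nhdsWithin_le_nhds
    · filter_upwards [self_mem_nhdsWithin] with w hw
      exact hw.2
  exact h2.eventually h1

variable [ChartedSpace (Cn n) X]

theorem IsPlurisubharmonicOn.submeanOn {φ : X → EReal} {U : Set X} (hU : IsOpen U)
    (h : IsPlurisubharmonicOn n φ U) {e : OpenPartialHomeomorph X (Cn n)}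
    (he : e ∈ atlas (Cn n) X) (M : ℝ) :
    SubmeanOn (trunc M fun y => φ (e.symm y)) (chartSet e U) :=
  SubmeanOn.of_trunc (isOpen_chartSet e hU) (usc_comp_symm h.upperSemicontinuousOn e)
    (fun _ hy => h.lt_top _ hy.2) fun y v hd => h.submean e he y v hd M

/-- Plurisubharmonicity is a local property. -/
theorem IsPlurisubharmonicOn.of_local {φ : X → EReal} {U : Set X} (hU : IsOpen U)
    (h : ∀ x ∈ U, ∃ W : Set X, IsOpen W ∧ x ∈ W ∧ IsPlurisubharmonicOn n φ W) :
    IsPlurisubharmonicOn n φ U := by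
  have hu : UpperSemicontinuousOn φ U := fun x hx c hc => by
    obtain ⟨W, hW, hxW, hp⟩ := h x hx
    have := hp.upperSemicontinuousOn x hxW c hc
    rw [hW.nhdsWithin_eq hxW] at this
    exact this.filter_mono nhdsWithin_le_nhds
  have ht : ∀ x ∈ U, φ x < ⊤ := fun x hx => by
    obtain ⟨W, _, hxW, hp⟩ := h x hx
    exact hp.lt_top x hxW
  refine ⟨hu, ht, fun e he y v hd M => ?_⟩
  -- `SubmeanOn` asks for small discs only, so it can be checked locally; `SubmeanOn.le_circMean`
  -- then reaches every disc in the chart.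
  have hS : SubmeanOn (trunc M fun y => φ (e.symm y)) (chartSet e U) := by
    refine ⟨usc_trunc (usc_comp_symm hu e) fun y hy => ht _ hy.2,
      ⟨M, fun y hy => le_trunc (ht _ hy.2)⟩, fun y hy => ?_⟩
    obtain ⟨W, hW, hyW, hp⟩ := h (e.symm y) hy.2
    exact (hp.submeanOn hW he M).submean y ⟨hy.1, hyW⟩
  have h1 := hS.le_circMean (isOpen_chartSet e hU) hd
  have hy : y ∈ chartSet e U := by simpa using hd 0 (by simp)
  exact ((trunc_le_iff (φ := fun y => φ (e.symm y)) (ht _ hy.2)).1 h1).1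

/-- Plurisubharmonic functions that agree almost everywhere agree. -/
theorem IsPlurisubharmonicOn.eq_of_ae_eq {φ φ' : X → EReal} {U : Set X} (hU : IsOpen U)
    (h : IsPlurisubharmonicOn n φ U) (h' : IsPlurisubharmonicOn n φ' U)
    (hae : AEOn n U fun x => φ x = φ' x) {x : X} (hx : x ∈ U) : φ x = φ' x := by
  have hc := mem_chart_source (Cn n) x
  have he := chart_mem_atlas (Cn n) x
  set e := chartAt (Cn n) x
  have hs : e.symm (e x) = x := e.left_inv hc
  have hmem : e x ∈ chartSet e U := ⟨e.map_source hc, by rwa [Set.mem_preimage, hs]⟩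
  have := eq_of_trunc_eq (φ := fun y => φ (e.symm y)) (φ' := fun y => φ' (e.symm y)) (z := e x)
    (h.lt_top _ hmem.2) (h'.lt_top _ hmem.2) fun M => by
      refine (h.submeanOn hU he M).eq_of_ae_eq (h'.submeanOn hU he M) (isOpen_chartSet e hU) ?_ hmem
      filter_upwards [hae e he] with y hy hyU
      simp only [trunc, hy hyU]
  simpa [hs] using this

end Manifold

open ComplexOrder

/-! ### Wirtinger derivatives in a complex direction -/

/-- The derivative `∂_ξ`. -/
def wirt {n : ℕ} (ξ : Cn n) (f : Cn n → ℂ) (z : Cn n) : ℂ :=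
  (1 / 2 : ℂ) * (dirDeriv ξ f z - Complex.I * dirDeriv (Complex.I • ξ) f z)

/-- The derivative `∂̄_ξ`. -/
def wirtBar {n : ℕ} (ξ : Cn n) (f : Cn n → ℂ) (z : Cn n) : ℂ :=
  (1 / 2 : ℂ) * (dirDeriv ξ f z + Complex.I * dirDeriv (Complex.I • ξ) f z)

section Wirtinger

variable {n : ℕ} {f g : Cn n → ℂ} {z : Cn n}

theorem single_I (j : Fin n) :
    (EuclideanSpace.single j Complex.I : Cn n)
      = Complex.I • EuclideanSpace.single j (1 : ℂ) := by
  ext i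
  simp

theorem dz_eq_wirt (j : Fin n) (f : Cn n → ℂ) :
    dz j f = wirt (EuclideanSpace.single j 1) f := by
  ext z
  rw [dz, wirt, single_I]
  rfl

theorem dzbar_eq_wirtBar (j : Fin n) (f : Cn n → ℂ) :
    dzbar j f = wirtBar (EuclideanSpace.single j 1) f := by
  ext z
  rw [dzbar, wirtBar, single_I]
  rfl

theorem dirDeriv_smul_dir (c : ℂ) (ξ : Cn n) (f : Cn n → ℂ) (z : Cn n) :
    dirDeriv (c • ξ) f z = c.re * dirDeriv ξ f z + c.im * dirDeriv (Complex.I • ξ) f z := by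
  have h : c • ξ = c.re • ξ + c.im • (Complex.I • ξ) := by
    conv_lhs => rw [← Complex.re_add_im c]
    rw [add_smul, mul_smul, Complex.coe_smul, Complex.coe_smul]
  rw [dirDeriv, h, map_add, map_smul, map_smul]
  simp [dirDeriv]

theorem dirDeriv_add_dir (ξ η : Cn n) (f : Cn n → ℂ) (z : Cn n) :
    dirDeriv (ξ + η) f z = dirDeriv ξ f z + dirDeriv η f z := by
  simp [dirDeriv]

theorem dirDeriv_I_I_smul (ξ : Cn n) (f : Cn n → ℂ) (z : Cn n) :
    dirDeriv (Complex.I • Complex.I • ξ) f z = - dirDeriv ξ f z := by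
  rw [smul_smul, Complex.I_mul_I]
  simp [dirDeriv]

/-- `∂_ξ` is complex linear in `ξ`. -/
def wirtDir (f : Cn n → ℂ) (z : Cn n) : Cn n →ₗ[ℂ] ℂ where
  toFun ξ := wirt ξ f z
  map_add' ξ η := by
    simp only [wirt, smul_add, dirDeriv_add_dir]
    ring
  map_smul' c ξ := by
    simp only [wirt, smul_comm Complex.I c, dirDeriv_smul_dir c, dirDeriv_I_I_smul, smul_eq_mul,
      RingHom.id_apply]
    conv_rhs => rw [← Complex.re_add_im c]
    linear_combination ((1 / 2 : ℂ) * c.im * dirDeriv (Complex.I • ξ) f z) * Complex.I_sq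

/-- `∂̄_ξ` is conjugate linear in `ξ`. -/
def wirtBarDir (f : Cn n → ℂ) (z : Cn n) : Cn n →ₗ⋆[ℂ] ℂ where
  toFun ξ := wirtBar ξ f z
  map_add' ξ η := by
    simp only [wirtBar, smul_add, dirDeriv_add_dir]
    ring
  map_smul' c ξ := by
    simp only [wirtBar, smul_comm Complex.I c, dirDeriv_smul_dir c, dirDeriv_I_I_smul, smul_eq_mul]
    have hc : (starRingEnd ℂ) c = c.re - c.im * Complex.I := by
      apply Complex.ext <;> simp
    rw [hc]
    linear_combination ((1 / 2 : ℂ) * c.im * dirDeriv (Complex.I • ξ) f z) * Complex.I_sq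

theorem sum_smul_single (ξ : Cn n) : ∑ j, ξ j • (EuclideanSpace.single j (1 : ℂ) : Cn n) = ξ := by
  ext i
  simp [Pi.single_apply]

theorem sum_mul_dz (ξ : Cn n) (f : Cn n → ℂ) (z : Cn n) :
    ∑ j, ξ j * dz j f z = wirt ξ f z := by
  change _ = wirtDir f z ξ
  conv_rhs => rw [← sum_smul_single ξ]
  rw [map_sum]
  refine Finset.sum_congr rfl fun j _ => ?_
  rw [map_smul, dz_eq_wirt]
  rfl

theorem sum_mul_dzbar (ξ : Cn n) (f : Cn n → ℂ) (z : Cn n) :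
    ∑ j, (starRingEnd ℂ) (ξ j) * dzbar j f z = wirtBar ξ f z := by
  change _ = wirtBarDir f z ξ
  conv_rhs => rw [← sum_smul_single ξ]
  rw [map_sum]
  refine Finset.sum_congr rfl fun j _ => ?_
  rw [LinearMap.map_smulₛₗ, dzbar_eq_wirtBar]
  rfl

theorem dirDeriv_fun_add (hf : DifferentiableAt ℝ f z) (hg : DifferentiableAt ℝ g z) (a : Cn n) :
    dirDeriv a (fun w => f w + g w) z = dirDeriv a f z + dirDeriv a g z := by
  simp [dirDeriv, fderiv_fun_add hf hg]

theorem dirDeriv_fun_mul (hf : DifferentiableAt ℝ f z) (hg : DifferentiableAt ℝ g z) (a : Cn n) :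
    dirDeriv a (fun w => f w * g w) z = dirDeriv a f z * g z + f z * dirDeriv a g z := by
  simp only [dirDeriv, fderiv_fun_mul hf hg, add_apply, smul_apply, smul_eq_mul]
  ring

theorem dirDeriv_fun_sum {ι : Type*} {s : Finset ι} {F : ι → Cn n → ℂ}
    (h : ∀ i ∈ s, DifferentiableAt ℝ (F i) z) (a : Cn n) :
    dirDeriv a (fun w => ∑ i ∈ s, F i w) z = ∑ i ∈ s, dirDeriv a (F i) z := by
  simp only [dirDeriv, fderiv_fun_sum h]
  rw [sum_apply]

theorem dirDeriv_const (c : ℂ) (a z : Cn n) : dirDeriv a (fun _ => c) z = 0 := by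
  simp [dirDeriv]

theorem dirDeriv_conj (f : Cn n → ℂ) (a z : Cn n) :
    dirDeriv a (fun w => (starRingEnd ℂ) (f w)) z = (starRingEnd ℂ) (dirDeriv a f z) := by
  change fderiv ℝ (fun w => Complex.conjCLE (f w)) z a = _
  change fderiv ℝ (Complex.conjCLE ∘ f) z a = _
  rw [ContinuousLinearEquiv.comp_fderiv Complex.conjCLE]
  rfl

theorem wirt_fun_mul (hf : DifferentiableAt ℝ f z) (hg : DifferentiableAt ℝ g z) (ξ : Cn n) :
    wirt ξ (fun w => f w * g w) z = wirt ξ f z * g z + f z * wirt ξ g z := by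
  simp only [wirt, dirDeriv_fun_mul hf hg]
  ring

theorem wirtBar_fun_mul (hf : DifferentiableAt ℝ f z) (hg : DifferentiableAt ℝ g z) (ξ : Cn n) :
    wirtBar ξ (fun w => f w * g w) z = wirtBar ξ f z * g z + f z * wirtBar ξ g z := by
  simp only [wirtBar, dirDeriv_fun_mul hf hg]
  ring

theorem wirt_fun_add (hf : DifferentiableAt ℝ f z) (hg : DifferentiableAt ℝ g z) (ξ : Cn n) :
    wirt ξ (fun w => f w + g w) z = wirt ξ f z + wirt ξ g z := by
  simp only [wirt, dirDeriv_fun_add hf hg]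
  ring

theorem wirt_fun_sum {ι : Type*} {s : Finset ι} {F : ι → Cn n → ℂ}
    (h : ∀ i ∈ s, DifferentiableAt ℝ (F i) z) (ξ : Cn n) :
    wirt ξ (fun w => ∑ i ∈ s, F i w) z = ∑ i ∈ s, wirt ξ (F i) z := by
  simp only [wirt, dirDeriv_fun_sum h, Finset.mul_sum, Finset.sum_sub_distrib, mul_sub]

theorem wirt_const (c : ℂ) (ξ z : Cn n) : wirt ξ (fun _ => c) z = 0 := by
  simp [wirt, dirDeriv_const]

theorem wirtBar_const (c : ℂ) (ξ z : Cn n) : wirtBar ξ (fun _ => c) z = 0 := by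
  simp [wirtBar, dirDeriv_const]

theorem wirt_const_mul (c : ℂ) (hf : DifferentiableAt ℝ f z) (ξ : Cn n) :
    wirt ξ (fun w => c * f w) z = c * wirt ξ f z := by
  rw [wirt_fun_mul (differentiableAt_const c) hf, wirt_const]
  ring

theorem wirtBar_conj (f : Cn n → ℂ) (ξ z : Cn n) :
    wirtBar ξ (fun w => (starRingEnd ℂ) (f w)) z = (starRingEnd ℂ) (wirt ξ f z) := by
  simp only [wirtBar, wirt, dirDeriv_conj, map_mul, map_sub, Complex.conj_I, map_div₀, map_one,
    Complex.conj_ofNat]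
  ring

theorem wirt_conj (f : Cn n → ℂ) (ξ z : Cn n) :
    wirt ξ (fun w => (starRingEnd ℂ) (f w)) z = (starRingEnd ℂ) (wirtBar ξ f z) := by
  simp only [wirtBar, wirt, dirDeriv_conj, map_mul, map_add, Complex.conj_I, map_div₀, map_one,
    Complex.conj_ofNat]
  ring

theorem wirt_congr (h : f =ᶠ[𝓝 z] g) (ξ : Cn n) : wirt ξ f =ᶠ[𝓝 z] wirt ξ g := by
  filter_upwards [dirDeriv_congr h ξ, dirDeriv_congr h (Complex.I • ξ)] with w h1 h2
  rw [wirt, wirt, h1, h2]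

theorem wirtBar_congr (h : f =ᶠ[𝓝 z] g) (ξ : Cn n) : wirtBar ξ f =ᶠ[𝓝 z] wirtBar ξ g := by
  filter_upwards [dirDeriv_congr h ξ, dirDeriv_congr h (Complex.I • ξ)] with w h1 h2
  rw [wirtBar, wirtBar, h1, h2]

theorem contDiffAt_wirt (hf : ContDiffAt ℝ ∞ f z) (ξ : Cn n) : ContDiffAt ℝ ∞ (wirt ξ f) z :=
  contDiffAt_const.mul ((contDiffAt_dirDeriv hf ξ).sub
    (contDiffAt_const.mul (contDiffAt_dirDeriv hf _)))

theorem contDiffAt_wirtBar (hf : ContDiffAt ℝ ∞ f z) (ξ : Cn n) :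
    ContDiffAt ℝ ∞ (wirtBar ξ f) z :=
  contDiffAt_const.mul ((contDiffAt_dirDeriv hf ξ).add
    (contDiffAt_const.mul (contDiffAt_dirDeriv hf _)))

theorem dirDeriv_comm (hf : ContDiffAt ℝ ∞ f z) (a b : Cn n) :
    dirDeriv a (dirDeriv b f) z = dirDeriv b (dirDeriv a f) z := by
  rw [dirDeriv_dirDeriv hf, dirDeriv_dirDeriv hf]
  exact (hf.isSymmSndFDerivAt (by simpa using ENat.LEInfty.out)) a b

theorem dirDeriv_wirtBar (hf : ContDiffAt ℝ ∞ f z) (ξ a : Cn n) :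
    dirDeriv a (wirtBar ξ f) z = (1 / 2 : ℂ) * (dirDeriv a (dirDeriv ξ f) z
      + Complex.I * dirDeriv a (dirDeriv (Complex.I • ξ) f) z) := by
  have h1 := ContDiffAt.differentiableAt_top (contDiffAt_dirDeriv hf ξ)
  have h2 := ContDiffAt.differentiableAt_top (contDiffAt_dirDeriv hf (Complex.I • ξ))
  change dirDeriv a (fun w => (1 / 2 : ℂ) * (dirDeriv ξ f w
    + Complex.I * dirDeriv (Complex.I • ξ) f w)) z = _
  rw [dirDeriv_fun_mul (by fun_prop) (h1.fun_add (h2.const_mul _)), dirDeriv_const,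
    dirDeriv_fun_add h1 (h2.const_mul _), dirDeriv_fun_mul (by fun_prop) h2, dirDeriv_const]
  ring

theorem dirDeriv_wirt (hf : ContDiffAt ℝ ∞ f z) (ξ a : Cn n) :
    dirDeriv a (wirt ξ f) z = (1 / 2 : ℂ) * (dirDeriv a (dirDeriv ξ f) z
      - Complex.I * dirDeriv a (dirDeriv (Complex.I • ξ) f) z) := by
  have h1 := ContDiffAt.differentiableAt_top (contDiffAt_dirDeriv hf ξ)
  have h2 := ContDiffAt.differentiableAt_top (contDiffAt_dirDeriv hf (Complex.I • ξ))
  have : wirt ξ f = fun w => (1 / 2 : ℂ) * (dirDeriv ξ f w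
      + (-Complex.I) * dirDeriv (Complex.I • ξ) f w) := by
    ext w
    rw [wirt]
    ring
  rw [this, dirDeriv_fun_mul (by fun_prop) (h1.fun_add (h2.const_mul _)), dirDeriv_const,
    dirDeriv_fun_add h1 (h2.const_mul _), dirDeriv_fun_mul (by fun_prop) h2, dirDeriv_const]
  ring

/-- The mixed second derivatives cancel by symmetry; the pure ones add up to a quarter of the
Laplacian on the complex line. -/
theorem wirt_wirtBar (hf : ContDiffAt ℝ ∞ f z) (ξ : Cn n) :
    wirt ξ (wirtBar ξ f) z = (1 / 4 : ℂ) * levi ξ f z := by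
  rw [wirt, dirDeriv_wirtBar hf, dirDeriv_wirtBar hf, dirDeriv_comm hf ξ (Complex.I • ξ), levi]
  linear_combination (-(1 / 4 : ℂ) * dirDeriv (Complex.I • ξ) (dirDeriv (Complex.I • ξ) f) z)
    * Complex.I_sq

theorem wirtBar_wirt (hf : ContDiffAt ℝ ∞ f z) (ξ : Cn n) :
    wirtBar ξ (wirt ξ f) z = (1 / 4 : ℂ) * levi ξ f z := by
  rw [wirtBar, dirDeriv_wirt hf, dirDeriv_wirt hf, dirDeriv_comm hf ξ (Complex.I • ξ), levi]
  linear_combination (-(1 / 4 : ℂ) * dirDeriv (Complex.I • ξ) (dirDeriv (Complex.I • ξ) f) z)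
    * Complex.I_sq

/-- The complex Hessian evaluated on a vector is a quarter of the Laplacian along the line. -/
theorem sum_dz_dzbar (hf : ContDiffAt ℝ ∞ f z) (ξ : Cn n) :
    ∑ j, ∑ k, ξ j * (starRingEnd ℂ) (ξ k) * dz j (dzbar k f) z = (1 / 4 : ℂ) * levi ξ f z := by
  rw [← wirt_wirtBar hf, ← sum_mul_dz]
  refine Finset.sum_congr rfl fun j _ => ?_
  have hd : ∀ k, DifferentiableAt ℝ (dzbar k f) z := fun k => by
    rw [dzbar_eq_wirtBar]
    exact ContDiffAt.differentiableAt_top (contDiffAt_wirtBar hf _)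
  have : wirtBar ξ f = fun w => ∑ k, (starRingEnd ℂ) (ξ k) * dzbar k f w := by
    ext w
    rw [sum_mul_dzbar]
  rw [this, dz_eq_wirt, wirt_fun_sum fun k _ => (hd k).const_mul _, Finset.mul_sum]
  refine Finset.sum_congr rfl fun k _ => ?_
  rw [wirt_const_mul _ (hd k), dz_eq_wirt]
  ring

theorem wirtBar_eq_zero (hf : DifferentiableAt ℂ f z) (ξ : Cn n) : wirtBar ξ f z = 0 := by
  have h : ∀ a, dirDeriv a f z = fderiv ℂ f z a := fun a => by
    rw [dirDeriv, (hf.hasFDerivAt.restrictScalars ℝ).fderiv]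
    rfl
  rw [wirtBar, h, h, map_smul, smul_eq_mul, ← mul_assoc, Complex.I_mul_I]
  ring

theorem wirt_eq (hf : DifferentiableAt ℂ f z) (ξ : Cn n) : wirt ξ f z = fderiv ℂ f z ξ := by
  have h : ∀ a, dirDeriv a f z = fderiv ℂ f z a := fun a => by
    rw [dirDeriv, (hf.hasFDerivAt.restrictScalars ℝ).fderiv]
    rfl
  rw [wirt, h, h, map_smul, smul_eq_mul, ← mul_assoc, Complex.I_mul_I]
  ring

/-- Both orders of `∂_ξ` and `∂̄_ξ` give a quarter of the Laplacian, so `∂̄_ξ` may be applied first,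
where it kills a holomorphic function. -/
theorem wirtBar_wirt_eq_zero (hs : ContDiffAt ℝ ∞ f z)
    (hf : ∀ᶠ w in 𝓝 z, DifferentiableAt ℂ f w) (ξ : Cn n) : wirtBar ξ (wirt ξ f) z = 0 := by
  rw [wirtBar_wirt hs, ← wirt_wirtBar hs]
  have : wirtBar ξ f =ᶠ[𝓝 z] fun _ => 0 := by
    filter_upwards [hf] with w hw
    exact wirtBar_eq_zero hw ξ
  rw [(wirt_congr this ξ).self_of_nhds, wirt_const]

end Wirtinger

/-! ### Positive matrices -/

section Psd

variable {n : ℕ}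

/-- A positive semi-definite matrix is a sum of matrices of rank one. -/
theorem exists_sum_of_posSemidef {P : Matrix (Fin n) (Fin n) ℂ} (hP : P.PosSemidef) :
    ∃ (m : ℕ) (ξ : Fin m → Cn n), ∀ X : Fin n → Fin n → ℂ,
      ∑ j, ∑ k, P k j * X j k = ∑ l, ∑ j, ∑ k, ξ l j * (starRingEnd ℂ) (ξ l k) * X j k := by
  obtain ⟨m, v, hv⟩ := Matrix.posSemidef_iff_eq_sum_vecMulVec.1 hP
  refine ⟨m, fun l => WithLp.toLp 2 (star (v l)), fun X => ?_⟩
  have h1 : ∀ j k, P k j * X j k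
      = ∑ l, (star (v l)) j * (starRingEnd ℂ) ((star (v l)) k) * X j k := fun j k => by
    rw [hv, Matrix.sum_apply, Finset.sum_mul]
    refine Finset.sum_congr rfl fun l _ => ?_
    simp only [Matrix.vecMulVec_apply, Pi.star_apply, Complex.star_def, Complex.conj_conj]
    ring
  simp only [h1]
  rw [Finset.sum_congr rfl fun j _ => Finset.sum_comm]
  rw [Finset.sum_comm]

/-- A positive semi-definite matrix is a sum of matrices of rank one, and pairing with one of these
evaluates the form of `X` on a single vector. -/
theorem sum_posSemidef_re_nonneg {P : Matrix (Fin n) (Fin n) ℂ} (hP : P.PosSemidef)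
    {X : Fin n → Fin n → ℂ}
    (hX : ∀ ξ : Cn n, 0 ≤ (∑ j, ∑ k, ξ j * (starRingEnd ℂ) (ξ k) * X j k).re) :
    0 ≤ (∑ j, ∑ k, P k j * X j k).re := by
  obtain ⟨m, ξ, h⟩ := exists_sum_of_posSemidef hP
  rw [h, Complex.re_sum]
  exact Finset.sum_nonneg fun l _ => hX (ξ l)

theorem hessian_pairing_nonneg {P : Matrix (Fin n) (Fin n) ℂ} (hP : P.PosSemidef) {f : Cn n → ℝ}
    {z : Cn n} (hf : ContDiffAt ℝ ∞ f z) (hl : ∀ ξ, 0 ≤ levi ξ f z) :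
    0 ≤ (∑ j, ∑ k, P k j * dz j (dzbar k fun w => (f w : ℂ)) z).re := by
  refine sum_posSemidef_re_nonneg hP fun ξ => ?_
  rw [sum_dz_dzbar (contDiffAt_ofReal hf), levi_ofReal hf]
  have := hl ξ
  rw [show (1 / 4 : ℂ) = ((1 / 4 : ℝ) : ℂ) by norm_num, ← Complex.ofReal_mul, Complex.ofReal_re]
  positivity

end Psd

/-! ### The Levi form and holomorphic maps -/

section Holomorphic

variable {n : ℕ}

theorem dirDeriv_clm_comp {G H : Type*} [NormedAddCommGroup G] [NormedSpace ℝ G]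
    [NormedAddCommGroup H] [NormedSpace ℝ H] (L : G →L[ℝ] H) {f : Cn n → G} {z : Cn n}
    (hf : DifferentiableAt ℝ f z) (a : Cn n) :
    dirDeriv a (fun w => L (f w)) z = L (dirDeriv a f z) := by
  have := (L.hasFDerivAt.comp z hf.hasFDerivAt).fderiv
  change fderiv ℝ (L ∘ f) z a = _
  rw [this]
  rfl

theorem dirDeriv_dirDeriv_clm_comp {G H : Type*} [NormedAddCommGroup G] [NormedSpace ℝ G]
    [NormedAddCommGroup H] [NormedSpace ℝ H] (L : G →L[ℝ] H) {f : Cn n → G} {z : Cn n}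
    (hf : ContDiffAt ℝ ∞ f z) (a b : Cn n) :
    dirDeriv b (dirDeriv a fun w => L (f w)) z = L (dirDeriv b (dirDeriv a f) z) := by
  have : dirDeriv a (fun w => L (f w)) =ᶠ[𝓝 z] fun w => L (dirDeriv a f w) := by
    filter_upwards [eventually_contDiffAt hf] with w hw
    exact dirDeriv_clm_comp L hw a
  rw [(dirDeriv_congr this b).self_of_nhds,
    dirDeriv_clm_comp L (ContDiffAt.differentiableAt_top (contDiffAt_dirDeriv hf a))]

theorem levi_re {f : Cn n → ℂ} {z : Cn n} (hf : ContDiffAt ℝ ∞ f z) (a : Cn n) :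
    levi a (fun w => (f w).re) z = (levi a f z).re := by
  have := fun b => dirDeriv_dirDeriv_clm_comp Complex.reCLM hf b b
  simp only [Complex.reCLM_apply] at this
  rw [levi, this, this, levi, Complex.add_re]

theorem dirDeriv_symm {G : Type*} [NormedAddCommGroup G] [NormedSpace ℝ G] {f : Cn n → G}
    {z : Cn n} (hf : ContDiffAt ℝ ∞ f z) (a b : Cn n) :
    dirDeriv a (dirDeriv b f) z = dirDeriv b (dirDeriv a f) z := by
  rw [dirDeriv_dirDeriv hf, dirDeriv_dirDeriv hf]
  exact (hf.isSymmSndFDerivAt (by simpa using ENat.LEInfty.out)) a b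

theorem dirDeriv_I_smul {G : Type*} [NormedAddCommGroup G] [NormedSpace ℂ G]
    {f : Cn n → G} {z : Cn n} (hf : DifferentiableAt ℂ f z) (a : Cn n) :
    dirDeriv (Complex.I • a) f z = Complex.I • dirDeriv a f z := by
  have h : ∀ a, dirDeriv a f z = fderiv ℂ f z a := fun a => by
    rw [dirDeriv, (hf.hasFDerivAt.restrictScalars ℝ).fderiv]
    rfl
  rw [h, h, map_smul]

/-- Two derivatives in the direction `iξ` produce the factor `i² = -1`, by complex linearity of the
derivative and symmetry of second derivatives. Vector values are allowed because coordinate changes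
are the intended application. -/
theorem levi_eq_zero_of_holomorphic {G : Type*} [NormedAddCommGroup G] [NormedSpace ℂ G]
    {f : Cn n → G} {z : Cn n} (hs : ContDiffAt ℝ ∞ f z)
    (hf : ∀ᶠ w in 𝓝 z, DifferentiableAt ℂ f w) (ξ : Cn n) : levi ξ f z = 0 := by
  have hI : dirDeriv (Complex.I • ξ) f =ᶠ[𝓝 z] fun w => Complex.I • dirDeriv ξ f w := by
    filter_upwards [hf] with w hw
    exact dirDeriv_I_smul hw ξ
  let L : G →L[ℝ] G := (Complex.I • ContinuousLinearMap.id ℂ G).restrictScalars ℝ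
  have hL : ∀ {g : Cn n → G}, DifferentiableAt ℝ g z → ∀ a,
      dirDeriv a (fun w => Complex.I • g w) z = Complex.I • dirDeriv a g z := fun {g} hg a =>
    dirDeriv_clm_comp L hg a
  have hd : ∀ a, DifferentiableAt ℝ (dirDeriv a f) z := fun a =>
    ContDiffAt.differentiableAt_top (contDiffAt_dirDeriv hs a)
  rw [levi, (dirDeriv_congr hI _).self_of_nhds, hL (hd ξ), dirDeriv_symm hs (Complex.I • ξ) ξ,
    (dirDeriv_congr hI _).self_of_nhds, hL (hd ξ), smul_smul, Complex.I_mul_I]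
  simp

/-- The Levi form is invariant under holomorphic maps. -/
theorem levi_comp_holomorphic {τ : Cn n → Cn n} {g : Cn n → ℝ} {y : Cn n}
    (hs : ContDiffAt ℝ ∞ τ y) (hτ : ∀ᶠ w in 𝓝 y, DifferentiableAt ℂ τ w)
    (hg : ContDiffAt ℝ ∞ g (τ y)) (ξ : Cn n) :
    levi ξ (fun w => g (τ w)) y = levi (dirDeriv ξ τ y) g (τ y) := by
  have key : ∀ a, dirDeriv a (dirDeriv a fun w => g (τ w)) y
      = fderiv ℝ (fderiv ℝ g) (τ y) (dirDeriv a τ y) (dirDeriv a τ y)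
        + fderiv ℝ g (τ y) (dirDeriv a (dirDeriv a τ) y) := fun a => by
    have hev : dirDeriv a (fun w => g (τ w)) =ᶠ[𝓝 y]
        fun w => fderiv ℝ g (τ w) (dirDeriv a τ w) := by
      filter_upwards [eventually_contDiffAt hs, hs.continuousAt.eventually
        (eventually_contDiffAt hg)] with w h1 h2
      have := (h2.hasFDerivAt.comp w h1.hasFDerivAt).fderiv
      change fderiv ℝ (g ∘ τ) w a = _
      rw [this]
      rfl
    rw [(dirDeriv_congr hev a).self_of_nhds]
    have hA := (ContDiffAt.differentiableAt_top (contDiffAt_fderiv_of_top hg)).hasFDerivAt.comp y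
      (ContDiffAt.differentiableAt_top hs).hasFDerivAt
    have hB := (ContDiffAt.differentiableAt_top (contDiffAt_dirDeriv hs a)).hasFDerivAt
    have := (hA.clm_apply hB).fderiv
    change fderiv ℝ (fun w => (fderiv ℝ g ∘ τ) w (dirDeriv a τ w)) y a = _
    rw [this]
    simp [dirDeriv]
    abel
  have h0 := levi_eq_zero_of_holomorphic hs hτ ξ
  rw [levi] at h0
  rw [levi, key, key, levi_eq hg, dirDeriv_I_smul hτ.self_of_nhds]
  -- The second derivatives of `τ` enter linearly, and together they form the Levi form of a
  -- holomorphic map, which vanishes.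
  have h1 : fderiv ℝ g (τ y) (dirDeriv ξ (dirDeriv ξ τ) y)
      + fderiv ℝ g (τ y) (dirDeriv (Complex.I • ξ) (dirDeriv (Complex.I • ξ) τ) y) = 0 := by
    rw [← map_add, h0, map_zero]
  linarith

theorem wirt_wirtBar_comm {f : Cn n → ℂ} {z : Cn n} (hf : ContDiffAt ℝ ∞ f z) (ξ η : Cn n) :
    wirt ξ (wirtBar η f) z = wirtBar η (wirt ξ f) z := by
  rw [wirt, wirtBar, dirDeriv_wirtBar hf, dirDeriv_wirtBar hf, dirDeriv_wirt hf, dirDeriv_wirt hf,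
    dirDeriv_comm hf η ξ, dirDeriv_comm hf η (Complex.I • ξ), dirDeriv_comm hf (Complex.I • η) ξ,
    dirDeriv_comm hf (Complex.I • η) (Complex.I • ξ)]
  ring

theorem levi_fun_sum {G : Type*} [NormedAddCommGroup G] [NormedSpace ℝ G] {ι : Type*}
    {s : Finset ι} {F : ι → Cn n → G} {z : Cn n} (h : ∀ i ∈ s, ContDiffAt ℝ ∞ (F i) z) (a : Cn n) :
    levi a (fun w => ∑ i ∈ s, F i w) z = ∑ i ∈ s, levi a (F i) z := by
  classical
  induction s using Finset.induction_on with
  | empty =>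
    simp only [Finset.sum_empty]
    exact congrFun (levi_zero_fun a) z
  | insert i s hi ih =>
    simp only [Finset.sum_insert hi]
    rw [levi_add (h i (Finset.mem_insert_self i s))
      (ContDiffAt.sum fun j hj => h j (Finset.mem_insert_of_mem hj)),
      ih fun j hj => h j (Finset.mem_insert_of_mem hj)]

end Holomorphic

/-! ### Chern curvature -/

/-- Entrywise `∂_ξ`. -/
def wirtMat {n r : ℕ} (ξ : Cn n) (M : Cn n → Matrix (Fin r) (Fin r) ℂ) (y : Cn n) :
    Matrix (Fin r) (Fin r) ℂ := Matrix.of fun a b => wirt ξ (fun w => M w a b) y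

/-- Entrywise `∂̄_ξ`. -/
def wirtBarMat {n r : ℕ} (ξ : Cn n) (M : Cn n → Matrix (Fin r) (Fin r) ℂ) (y : Cn n) :
    Matrix (Fin r) (Fin r) ℂ := Matrix.of fun a b => wirtBar ξ (fun w => M w a b) y

/-- The sesquilinear form of the matrix `M`. -/
def sesq {r : ℕ} (M : Matrix (Fin r) (Fin r) ℂ) (c d : Fin r → ℂ) : ℂ :=
  ∑ a, ∑ b, c a * (starRingEnd ℂ) (d b) * M a b

section Chern

variable {n r : ℕ} {M : Cn n → Matrix (Fin r) (Fin r) ℂ} {u : Fin r → Cn n → ℂ} {y : Cn n}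

open Matrix

theorem sesq_eq (M : Matrix (Fin r) (Fin r) ℂ) (c d : Fin r → ℂ) :
    sesq M c d = c ⬝ᵥ (M *ᵥ star d) := by
  simp only [sesq, dotProduct, mulVec, Finset.mul_sum]
  refine Finset.sum_congr rfl fun a _ => Finset.sum_congr rfl fun b _ => ?_
  simp only [Pi.star_apply, Complex.star_def]
  ring

theorem sum_chernCurvature (hM : ∀ a b, ContDiffAt ℝ ∞ (fun w => M w a b) y) (ξ : Cn n)
    (a b : Fin r) :
    ∑ j, ∑ k, ξ j * (starRingEnd ℂ) (ξ k) * chernCurvature M j k y a b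
      = -((1 / 4 : ℂ) * levi ξ (fun w => M w a b) y)
        + (wirtMat ξ M y * (M y)⁻¹ * wirtBarMat ξ M y) a b := by
  have h1 : wirtMat ξ M y = ∑ j, ξ j • dzMat j M y := by
    ext a b
    simp only [Matrix.sum_apply, Matrix.smul_apply, smul_eq_mul, dzMat, wirtMat, of_apply]
    rw [sum_mul_dz]
  have h2 : wirtBarMat ξ M y = ∑ k, (starRingEnd ℂ) (ξ k) • dzbarMat k M y := by
    ext a b
    simp only [Matrix.sum_apply, Matrix.smul_apply, smul_eq_mul, dzbarMat, wirtBarMat, of_apply]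
    rw [sum_mul_dzbar]
  have h3 : wirtMat ξ M y * (M y)⁻¹ * wirtBarMat ξ M y
      = ∑ j, ∑ k, (ξ j * (starRingEnd ℂ) (ξ k)) • (dzMat j M y * (M y)⁻¹ * dzbarMat k M y) := by
    rw [h1, h2, Matrix.sum_mul, Matrix.sum_mul]
    refine Finset.sum_congr rfl fun j _ => ?_
    rw [Matrix.mul_sum]
    refine Finset.sum_congr rfl fun k _ => ?_
    rw [Matrix.smul_mul, Matrix.smul_mul, Matrix.mul_smul, smul_smul]
  rw [h3, ← sum_dz_dzbar (hM a b)]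
  simp only [Matrix.sum_apply, Matrix.smul_apply, smul_eq_mul, chernCurvature, Matrix.add_apply,
    Matrix.neg_apply, mul_add, Finset.sum_add_distrib, mul_neg, Finset.sum_neg_distrib]
  rfl

/-- This is the product rule for `∂_ξ ∂̄_ξ`: `∂̄_ξ` does not see the holomorphic factor `f`, `∂_ξ`
does not see the conjugate factor, and four terms survive. -/
theorem levi_mul_conj_mul {f g m : Cn n → ℂ} (hf : ContDiffAt ℝ ∞ f y) (hg : ContDiffAt ℝ ∞ g y)
    (hm : ContDiffAt ℝ ∞ m y) (hf' : ∀ᶠ w in 𝓝 y, DifferentiableAt ℂ f w)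
    (hg' : ∀ᶠ w in 𝓝 y, DifferentiableAt ℂ g w) (ξ : Cn n) :
    (1 / 4 : ℂ) * levi ξ (fun w => f w * (starRingEnd ℂ) (g w) * m w) y
      = f y * (starRingEnd ℂ) (g y) * ((1 / 4 : ℂ) * levi ξ m y)
        + wirt ξ f y * (starRingEnd ℂ) (g y) * wirtBar ξ m y
        + f y * (starRingEnd ℂ) (wirt ξ g y) * wirt ξ m y
        + wirt ξ f y * (starRingEnd ℂ) (wirt ξ g y) * m y := by
  have hc : ∀ {g : Cn n → ℂ} {y}, ContDiffAt ℝ ∞ g y →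
      ContDiffAt ℝ ∞ (fun w => (starRingEnd ℂ) (g w)) y := fun h =>
    Complex.conjCLE.contDiff.contDiffAt.comp _ h
  have hT : ContDiffAt ℝ ∞ (fun w => f w * (starRingEnd ℂ) (g w) * m w) y :=
    (hf.mul (hc hg)).mul hm
  rw [← wirt_wirtBar hT]
  have hev : wirtBar ξ (fun w => f w * (starRingEnd ℂ) (g w) * m w) =ᶠ[𝓝 y]
      fun w => f w * (starRingEnd ℂ) (wirt ξ g w) * m w
        + f w * (starRingEnd ℂ) (g w) * wirtBar ξ m w := by
    filter_upwards [eventually_contDiffAt hf, eventually_contDiffAt (hc hg),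
      eventually_contDiffAt hm, hf'] with w h1 h2 h3 h4
    rw [wirtBar_fun_mul (h1.fun_mul h2) h3, wirtBar_fun_mul h1 h2, wirtBar_conj,
      wirtBar_eq_zero h4]
    ring
  have d1 := ContDiffAt.differentiableAt_top hf
  have d2 := ContDiffAt.differentiableAt_top (hc hg)
  have d3 := ContDiffAt.differentiableAt_top hm
  have d4 := ContDiffAt.differentiableAt_top (hc (contDiffAt_wirt hg ξ))
  have d5 := ContDiffAt.differentiableAt_top (contDiffAt_wirtBar hm ξ)
  rw [(wirt_congr hev ξ).self_of_nhds, wirt_fun_add ((d1.fun_mul d4).fun_mul d3)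
    ((d1.fun_mul d2).fun_mul d5), wirt_fun_mul (d1.fun_mul d4) d3, wirt_fun_mul d1 d4,
    wirt_fun_mul (d1.fun_mul d2) d5, wirt_fun_mul d1 d2, wirt_conj, wirt_conj,
    wirtBar_wirt_eq_zero hg hg', wirtBar_eq_zero hg'.self_of_nhds, wirt_wirtBar hm]
  simp only [map_zero]
  ring

theorem contDiffAt_sesq (hM : ∀ a b, ContDiffAt ℝ ∞ (fun w => M w a b) y)
    (hu : ∀ a, ContDiffAt ℝ ∞ (u a) y) :
    ContDiffAt ℝ ∞ (fun w => sesq (M w) (fun a => u a w) (fun a => u a w)) y := by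
  refine ContDiffAt.sum fun a _ => ContDiffAt.sum fun b _ => ((hu a).mul ?_).mul (hM a b)
  exact Complex.conjCLE.contDiff.contDiffAt.comp _ (hu b)

theorem levi_sesq (hM : ∀ a b, ContDiffAt ℝ ∞ (fun w => M w a b) y)
    (hu : ∀ a, ContDiffAt ℝ ∞ (u a) y) (hu' : ∀ a, ∀ᶠ w in 𝓝 y, DifferentiableAt ℂ (u a) w)
    (ξ : Cn n) :
    (1 / 4 : ℂ) * levi ξ (fun w => sesq (M w) (fun a => u a w) (fun a => u a w)) y
      = sesq (of fun a b => (1 / 4 : ℂ) * levi ξ (fun w => M w a b) y)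
          (fun a => u a y) (fun a => u a y)
        + sesq (wirtBarMat ξ M y) (fun a => wirt ξ (u a) y) (fun a => u a y)
        + sesq (wirtMat ξ M y) (fun a => u a y) (fun a => wirt ξ (u a) y)
        + sesq (M y) (fun a => wirt ξ (u a) y) (fun a => wirt ξ (u a) y) := by
  have hs : ∀ a b, ContDiffAt ℝ ∞ (fun w => u a w * (starRingEnd ℂ) (u b w) * M w a b) y :=
    fun a b => ((hu a).mul (Complex.conjCLE.contDiff.contDiffAt.comp _ (hu b))).mul (hM a b)
  simp only [sesq]
  rw [levi_fun_sum fun a _ => ContDiffAt.sum fun b _ => hs a b]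
  simp only [levi_fun_sum fun b (_ : b ∈ Finset.univ) => hs _ b, Finset.mul_sum,
    levi_mul_conj_mul (hu _) (hu _) (hM _ _) (hu' _) (hu' _), Finset.sum_add_distrib]
  rfl

theorem wirtBarMat_eq (hH : ∀ᶠ w in 𝓝 y, (M w).IsHermitian) (ξ : Cn n) :
    wirtBarMat ξ M y = (wirtMat ξ M y)ᴴ := by
  ext a b
  rw [conjTranspose_apply, wirtBarMat, wirtMat, of_apply, of_apply, Complex.star_def,
    ← wirtBar_conj]
  refine (wirtBar_congr ?_ ξ).self_of_nhds
  filter_upwards [hH] with w hw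
  exact (hw.apply a b).symm

/-- Completing the square: with `N` the matrix of the metric and `M₁` its `∂_ξ`-derivative, `d + c
M₁ N⁻¹` is the covariant derivative of a section with value `c` and derivative `d` for the Chern
connection. The last term on the left is the part of the curvature that is quadratic in first
derivatives. -/
theorem sesq_complete_square {N M₁ : Matrix (Fin r) (Fin r) ℂ} (hN : N.PosDef) (c d : Fin r → ℂ) :
    sesq M₁ᴴ d c + sesq M₁ c d + sesq N d d + sesq (M₁ * N⁻¹ * M₁ᴴ) c c
      = sesq N (d + c ᵥ* (M₁ * N⁻¹)) (d + c ᵥ* (M₁ * N⁻¹)) := by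
  have hu : IsUnit N.det := (Matrix.isUnit_iff_isUnit_det _).1 hN.isUnit
  have h1 : star (c ᵥ* (M₁ * N⁻¹)) = (N⁻¹ * M₁ᴴ) *ᵥ star c := by
    rw [star_vecMul, conjTranspose_mul, conjTranspose_nonsing_inv, hN.isHermitian.eq]
  have h2 : N *ᵥ ((N⁻¹ * M₁ᴴ) *ᵥ star c) = M₁ᴴ *ᵥ star c := by
    rw [mulVec_mulVec, ← Matrix.mul_assoc, Matrix.mul_nonsing_inv _ hu, Matrix.one_mul]
  have h3 : ∀ x, (c ᵥ* (M₁ * N⁻¹)) ⬝ᵥ (N *ᵥ x) = c ⬝ᵥ (M₁ *ᵥ x) := fun x => by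
    rw [← dotProduct_mulVec, mulVec_mulVec, Matrix.mul_assoc, Matrix.nonsing_inv_mul _ hu,
      Matrix.mul_one]
  have h4 : (c ᵥ* (M₁ * N⁻¹)) ⬝ᵥ (M₁ᴴ *ᵥ star c) = c ⬝ᵥ ((M₁ * N⁻¹ * M₁ᴴ) *ᵥ star c) := by
    rw [← dotProduct_mulVec, mulVec_mulVec]
  simp only [sesq_eq, star_add, mulVec_add, add_dotProduct, dotProduct_add, h1, h2, h3, h4]
  ring

theorem sesq_self_nonneg {N : Matrix (Fin r) (Fin r) ℂ} (hN : N.PosSemidef) (c : Fin r → ℂ) :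
    0 ≤ (sesq N c c).re := by
  have := hN.dotProduct_mulVec_nonneg (star c)
  rw [star_star] at this
  rw [sesq_eq]
  exact (Complex.le_def.1 this).1

/-- The Levi form of the squared length of a holomorphic section. -/
theorem levi_sesq_eq (hM : ∀ a b, ContDiffAt ℝ ∞ (fun w => M w a b) y)
    (hP : ∀ᶠ w in 𝓝 y, (M w).PosDef) (hu : ∀ a, ContDiffAt ℝ ∞ (u a) y)
    (hu' : ∀ a, ∀ᶠ w in 𝓝 y, DifferentiableAt ℂ (u a) w) (ξ : Cn n) :
    (1 / 4 : ℂ) * levi ξ (fun w => sesq (M w) (fun a => u a w) (fun a => u a w)) y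
      + ∑ j, ∑ k, ξ j * (starRingEnd ℂ) (ξ k)
          * sesq (chernCurvature M j k y) (fun a => u a y) (fun a => u a y)
      = sesq (M y)
          ((fun a => wirt ξ (u a) y) + (fun a => u a y) ᵥ* (wirtMat ξ M y * (M y)⁻¹))
          ((fun a => wirt ξ (u a) y) + (fun a => u a y) ᵥ* (wirtMat ξ M y * (M y)⁻¹)) := by
  -- Contraction of the curvature with `ξ` separates the second derivative of the metric, which
  -- cancels against a term of `levi_sesq`, from the quadratic term, which completes the square.
  have hc : ∑ j, ∑ k, ξ j * (starRingEnd ℂ) (ξ k)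
      * sesq (chernCurvature M j k y) (fun a => u a y) (fun a => u a y)
      = - sesq (of fun a b => (1 / 4 : ℂ) * levi ξ (fun w => M w a b) y)
          (fun a => u a y) (fun a => u a y)
        + sesq (wirtMat ξ M y * (M y)⁻¹ * wirtBarMat ξ M y)
          (fun a => u a y) (fun a => u a y) := by
    have : ∑ j, ∑ k, ξ j * (starRingEnd ℂ) (ξ k)
        * sesq (chernCurvature M j k y) (fun a => u a y) (fun a => u a y)
        = ∑ a, ∑ b, u a y * (starRingEnd ℂ) (u b y)
          * ∑ j, ∑ k, ξ j * (starRingEnd ℂ) (ξ k) * chernCurvature M j k y a b := by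
      simp only [sesq, Finset.mul_sum]
      rw [Finset.sum_congr rfl fun j _ => Finset.sum_comm]
      rw [Finset.sum_comm]
      refine Finset.sum_congr rfl fun a _ => ?_
      rw [Finset.sum_congr rfl fun j _ => Finset.sum_comm]
      rw [Finset.sum_comm]
      refine Finset.sum_congr rfl fun b _ => ?_
      refine Finset.sum_congr rfl fun j _ => Finset.sum_congr rfl fun k _ => ?_
      ring
    rw [this]
    simp only [sum_chernCurvature hM, sesq, of_apply, mul_add, Finset.sum_add_distrib, mul_neg,
      Finset.sum_neg_distrib]
  rw [levi_sesq hM hu hu', hc, ← sesq_complete_square hP.self_of_nhds,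
    wirtBarMat_eq (hP.mono fun w hw => hw.isHermitian)]
  ring

/-- Semi-negative curvature makes the squared length of holomorphic sections subharmonic. -/
theorem hessian_sesq_nonneg (hM : ∀ a b, ContDiffAt ℝ ∞ (fun w => M w a b) y)
    (hP : ∀ᶠ w in 𝓝 y, (M w).PosDef) (hu : ∀ a, ContDiffAt ℝ ∞ (u a) y)
    (hu' : ∀ a, ∀ᶠ w in 𝓝 y, DifferentiableAt ℂ (u a) w) {P : Matrix (Fin n) (Fin n) ℂ}
    (hPP : P.PosSemidef)
    (hcurv : (∑ j, ∑ k, P k j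
      * sesq (chernCurvature M j k y) (fun a => u a y) (fun a => u a y)).re ≤ 0) :
    0 ≤ (∑ j, ∑ k, P k j
      * dz j (dzbar k fun w => sesq (M w) (fun a => u a w) (fun a => u a w)) y).re := by
  -- On each rank one part of `P`, Hessian plus curvature is the squared length of a covariant
  -- derivative.
  have h := sum_posSemidef_re_nonneg hPP
    (X := fun j k => dz j (dzbar k fun w => sesq (M w) (fun a => u a w) (fun a => u a w)) y
      + sesq (chernCurvature M j k y) (fun a => u a y) (fun a => u a y)) fun ξ => by
    simp only [mul_add, Finset.sum_add_distrib]
    rw [sum_dz_dzbar (contDiffAt_sesq hM hu), levi_sesq_eq hM hP hu hu']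
    exact sesq_self_nonneg hP.self_of_nhds.posSemidef _
  simp only [mul_add, Finset.sum_add_distrib, Complex.add_re] at h
  linarith

/-- If the squared lengths of holomorphic sections have non-negative Levi form, the curvature is
semi-negative. -/
theorem curvature_nonpos (hM : ∀ a b, ContDiffAt ℝ ∞ (fun w => M w a b) y)
    (hP : ∀ᶠ w in 𝓝 y, (M w).PosDef) (c : Fin r → ℂ)
    (hl : ∀ (L : Fin r → (Cn n →L[ℂ] ℂ)) (ξ : Cn n), 0 ≤ (levi ξ (fun w => sesq (M w)
      (fun a => c a + L a (w - y)) (fun a => c a + L a (w - y))) y).re)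
    {P : Matrix (Fin n) (Fin n) ℂ} (hPP : P.PosSemidef) :
    (∑ j, ∑ k, P k j * sesq (chernCurvature M j k y) c c).re ≤ 0 := by
  -- The linear part cancels the connection term: the section `c + L (w - y)` has value `c` and
  -- vanishing covariant derivative at `y`, so there the curvature is minus the Hessian of its
  -- squared length.
  let L : Fin r → (Cn n →L[ℂ] ℂ) := fun a =>
    -∑ j, ((c ᵥ* (dzMat j M y * (M y)⁻¹)) a) • (EuclideanSpace.proj j : Cn n →L[ℂ] ℂ)
  have hL : ∀ ξ a, L a ξ = -(c ᵥ* (wirtMat ξ M y * (M y)⁻¹)) a := fun ξ a => by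
    have h1 : wirtMat ξ M y = ∑ j, ξ j • dzMat j M y := by
      ext a b
      simp only [Matrix.sum_apply, Matrix.smul_apply, smul_eq_mul, dzMat, wirtMat, of_apply]
      rw [sum_mul_dz]
    rw [h1, Matrix.sum_mul, Matrix.vecMul_sum, Finset.sum_apply]
    simp only [L, _root_.neg_apply, _root_.sum_apply, _root_.smul_apply, smul_eq_mul, Matrix.smul_mul,
      Matrix.vecMul_smul, Pi.smul_apply, PiLp.proj_apply]
    refine congrArg _ (Finset.sum_congr rfl fun j _ => mul_comm _ _)
  have hus : ∀ a, ContDiff ℂ ω (fun w => c a + L a (w - y)) := fun a => by fun_prop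
  have huh : ∀ a w, DifferentiableAt ℂ (fun w => c a + L a (w - y)) w := fun a w =>
    ((hus a).differentiable (by simp)) w
  have hur : ∀ a, ContDiffAt ℝ ∞ (fun w => c a + L a (w - y)) y := fun a =>
    (((hus a).restrict_scalars ℝ).of_le (by simp)).contDiffAt
  have hw : ∀ ξ a, wirt ξ (fun w => c a + L a (w - y)) y = L a ξ := fun ξ a => by
    rw [wirt_eq (huh a y), fderiv_const_add]
    have : HasFDerivAt (fun w => L a (w - y)) (L a) y := by
      exact (L a).hasFDerivAt.comp y ((hasFDerivAt_id (𝕜 := ℂ) y).sub_const y)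
    rw [this.fderiv]
  have h := sum_posSemidef_re_nonneg hPP
    (X := fun j k => - sesq (chernCurvature M j k y) c c) fun ξ => by
    have h1 := levi_sesq_eq hM hP hur (fun a => Filter.Eventually.of_forall (huh a)) ξ
    have h2 : (fun a => wirt ξ (fun w => c a + L a (w - y)) y)
        + (fun a => c a + L a (y - y)) ᵥ* (wirtMat ξ M y * (M y)⁻¹) = 0 := by
      ext a
      have h0 : (fun a => c a + L a (y - y)) = c := by
        ext a
        rw [sub_self, map_zero, add_zero]
      rw [Pi.add_apply, hw, h0, hL, neg_add_cancel]
      rfl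
    rw [h2] at h1
    have h3 := hl L ξ
    simp only [sub_self, map_zero, add_zero] at h1
    have h4 : sesq (M y) (0 : Fin r → ℂ) 0 = 0 := by simp [sesq]
    rw [h4] at h1
    have h5 : ∑ j, ∑ k, ξ j * (starRingEnd ℂ) (ξ k) * -sesq (chernCurvature M j k y) c c
        = ((1 / 4 : ℝ) : ℂ) * levi ξ (fun w => sesq (M w)
          (fun a => c a + L a (w - y)) (fun a => c a + L a (w - y))) y := by
      simp only [mul_neg, Finset.sum_neg_distrib]
      push_cast
      linear_combination -h1
    rw [h5, Complex.re_ofReal_mul]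
    positivity
  simp only [mul_neg, Finset.sum_neg_distrib, Complex.neg_re] at h
  linarith

end Chern

/-! ### Integration by parts for Wirtinger derivatives -/

section IBP

variable {n : ℕ} {Ω : Set (Cn n)}

theorem integral_mul_wirt {f θ : Cn n → ℂ} (hO : IsOpen Ω)
    (hf : ContDiffOn ℝ ∞ f Ω) (hθ : ContDiff ℝ ∞ θ) (hc : HasCompactSupport θ)
    (hs : tsupport θ ⊆ Ω) (ξ : Cn n) :
    ∫ y, f y * wirt ξ θ y = - ∫ y, wirt ξ f y * θ y := by
  have h := integral_mul_dirDeriv hO hf hθ hc hs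
  have i1 : ∀ a, Integrable fun y => f y * dirDeriv a θ y := fun a =>
    integrable_mul_of_tsupport_subset hO hf.continuousOn (contDiff_dirDeriv hθ a).continuous
      (hasCompactSupport_dirDeriv hc a) ((tsupport_dirDeriv_subset _ a).trans hs)
  have i2 : ∀ a, Integrable fun y => dirDeriv a f y * θ y := fun a =>
    integrable_mul_of_tsupport_subset hO (contDiffOn_dirDeriv hO hf a).continuousOn hθ.continuous
      hc hs
  have e1 : ∀ y, f y * wirt ξ θ y = (1 / 2 : ℂ) * (f y * dirDeriv ξ θ y)
      - (1 / 2 * Complex.I : ℂ) * (f y * dirDeriv (Complex.I • ξ) θ y) := fun y => by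
    rw [wirt]; ring
  have e2 : ∀ y, wirt ξ f y * θ y = (1 / 2 : ℂ) * (dirDeriv ξ f y * θ y)
      - (1 / 2 * Complex.I : ℂ) * (dirDeriv (Complex.I • ξ) f y * θ y) := fun y => by
    rw [wirt]; ring
  simp only [e1, e2]
  rw [integral_sub ((i1 _).const_mul _) ((i1 _).const_mul _),
    integral_sub ((i2 _).const_mul _) ((i2 _).const_mul _), integral_const_mul, integral_const_mul,
    integral_const_mul, integral_const_mul, h, h]
  ring

theorem integral_mul_wirtBar {f θ : Cn n → ℂ} (hO : IsOpen Ω)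
    (hf : ContDiffOn ℝ ∞ f Ω) (hθ : ContDiff ℝ ∞ θ) (hc : HasCompactSupport θ)
    (hs : tsupport θ ⊆ Ω) (ξ : Cn n) :
    ∫ y, f y * wirtBar ξ θ y = - ∫ y, wirtBar ξ f y * θ y := by
  have h := integral_mul_dirDeriv hO hf hθ hc hs
  have i1 : ∀ a, Integrable fun y => f y * dirDeriv a θ y := fun a =>
    integrable_mul_of_tsupport_subset hO hf.continuousOn (contDiff_dirDeriv hθ a).continuous
      (hasCompactSupport_dirDeriv hc a) ((tsupport_dirDeriv_subset _ a).trans hs)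
  have i2 : ∀ a, Integrable fun y => dirDeriv a f y * θ y := fun a =>
    integrable_mul_of_tsupport_subset hO (contDiffOn_dirDeriv hO hf a).continuousOn hθ.continuous
      hc hs
  have e1 : ∀ y, f y * wirtBar ξ θ y = (1 / 2 : ℂ) * (f y * dirDeriv ξ θ y)
      + (1 / 2 * Complex.I : ℂ) * (f y * dirDeriv (Complex.I • ξ) θ y) := fun y => by
    rw [wirtBar]; ring
  have e2 : ∀ y, wirtBar ξ f y * θ y = (1 / 2 : ℂ) * (dirDeriv ξ f y * θ y)
      + (1 / 2 * Complex.I : ℂ) * (dirDeriv (Complex.I • ξ) f y * θ y) := fun y => by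
    rw [wirtBar]; ring
  simp only [e1, e2]
  rw [integral_add ((i1 _).const_mul _) ((i1 _).const_mul _),
    integral_add ((i2 _).const_mul _) ((i2 _).const_mul _), integral_const_mul, integral_const_mul,
    integral_const_mul, integral_const_mul, h, h]
  ring

theorem contDiff_wirtBar {f : Cn n → ℂ} (hf : ContDiff ℝ ∞ f) (ξ : Cn n) :
    ContDiff ℝ ∞ (wirtBar ξ f) :=
  contDiff_iff_contDiffAt.2 fun _ => contDiffAt_wirtBar hf.contDiffAt ξ

theorem contDiff_wirt {f : Cn n → ℂ} (hf : ContDiff ℝ ∞ f) (ξ : Cn n) :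
    ContDiff ℝ ∞ (wirt ξ f) :=
  contDiff_iff_contDiffAt.2 fun _ => contDiffAt_wirt hf.contDiffAt ξ

theorem tsupport_wirtBar_subset (f : Cn n → ℂ) (ξ : Cn n) :
    tsupport (wirtBar ξ f) ⊆ tsupport f := by
  refine closure_minimal (fun y hy => ?_) (isClosed_tsupport f)
  by_contra h
  have h1 : ∀ a, dirDeriv a f y = 0 := fun a =>
    image_eq_zero_of_notMem_tsupport fun h' => h (tsupport_dirDeriv_subset f a h')
  exact hy (by simp [wirtBar, h1])

theorem tsupport_wirt_subset (f : Cn n → ℂ) (ξ : Cn n) :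
    tsupport (wirt ξ f) ⊆ tsupport f := by
  refine closure_minimal (fun y hy => ?_) (isClosed_tsupport f)
  by_contra h
  have h1 : ∀ a, dirDeriv a f y = 0 := fun a =>
    image_eq_zero_of_notMem_tsupport fun h' => h (tsupport_dirDeriv_subset f a h')
  exact hy (by simp [wirt, h1])

theorem contDiff_dz_dzbar {f : Cn n → ℂ} (hf : ContDiff ℝ ∞ f) (j k : Fin n) :
    ContDiff ℝ ∞ (dz j (dzbar k f)) := by
  rw [dz_eq_wirt, dzbar_eq_wirtBar]
  exact contDiff_wirt (contDiff_wirtBar hf _) _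

theorem tsupport_dz_dzbar_subset (f : Cn n → ℂ) (j k : Fin n) :
    tsupport (dz j (dzbar k f)) ⊆ tsupport f := by
  rw [dz_eq_wirt, dzbar_eq_wirtBar]
  exact (tsupport_wirt_subset _ _).trans (tsupport_wirtBar_subset _ _)

theorem hasCompactSupport_of_tsupport_subset {G H : Type*} [Zero G] [Zero H] {f : Cn n → G}
    {g : Cn n → H} (hf : HasCompactSupport f) (h : tsupport g ⊆ tsupport f) :
    HasCompactSupport g := hf.of_isClosed_subset (isClosed_tsupport g) h

/-- Integration by parts twice. -/
theorem integral_mul_dz_dzbar {f θ : Cn n → ℂ} (hO : IsOpen Ω)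
    (hf : ContDiffOn ℝ ∞ f Ω) (hθ : ContDiff ℝ ∞ θ) (hc : HasCompactSupport θ)
    (hs : tsupport θ ⊆ Ω) (j k : Fin n) :
    ∫ y, f y * dz j (dzbar k θ) y = ∫ y, dz j (dzbar k f) y * θ y := by
  rw [dz_eq_wirt, dzbar_eq_wirtBar, dz_eq_wirt, dzbar_eq_wirtBar]
  have hsub := tsupport_wirtBar_subset θ (EuclideanSpace.single k 1)
  rw [integral_mul_wirt hO hf (contDiff_wirtBar hθ _) (hasCompactSupport_of_tsupport_subset hc hsub)
    (hsub.trans hs), integral_mul_wirtBar hO (fun z hz =>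
      (contDiffAt_wirt (hf.contDiffAt (hO.mem_nhds hz)) _).contDiffWithinAt) hθ hc hs, neg_neg]
  refine integral_congr_ae (Filter.Eventually.of_forall fun y => ?_)
  by_cases hy : y ∈ Ω
  · simp only [wirt_wirtBar_comm (hf.contDiffAt (hO.mem_nhds hy))]
  · simp only [image_eq_zero_of_notMem_tsupport fun h' => hy (hs h'), mul_zero]

end IBP

/-! ### Second order operators with positive coefficients -/

section Operators

variable {n : ℕ} {Ω : Set (Cn n)}

theorem contDiff_mul_of_tsupport_subset {f θ : Cn n → ℂ} (hO : IsOpen Ω)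
    (hf : ContDiffOn ℝ ∞ f Ω) (hθ : ContDiff ℝ ∞ θ) (hs : tsupport θ ⊆ Ω) :
    ContDiff ℝ ∞ fun y => θ y * f y := by
  refine contDiff_iff_contDiffAt.2 fun y => ?_
  by_cases hy : y ∈ Ω
  · exact hθ.contDiffAt.mul (hf.contDiffAt (hO.mem_nhds hy))
  · have : (fun y => θ y * f y) =ᶠ[𝓝 y] fun _ => 0 := by
      filter_upwards [(isClosed_tsupport θ).isOpen_compl.mem_nhds fun h => hy (hs h)] with w hw
      rw [image_eq_zero_of_notMem_tsupport hw, zero_mul]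
    exact contDiffAt_const.congr_of_eventuallyEq this

/-- A distributionally plurisubharmonic function is subharmonic for every second order operator
`∑ ∂_j ∂̄_k (C_{kj} ·)` with positive semi-definite coefficients. -/
theorem DistPSH.nonneg_of_posSemidef {f : Cn n → ℝ} (h : DistPSH f Ω) (hO : IsOpen Ω)
    {C : Cn n → Matrix (Fin n) (Fin n) ℂ} (hC : ∀ j k, ContDiffOn ℝ ∞ (fun y => C y j k) Ω)
    (hP : ∀ y ∈ Ω, (C y).PosSemidef) {ψ : Cn n → ℝ} (hψ : IsTest ψ Ω) :
    0 ≤ ∫ y, f y * (∑ j, ∑ k, dz j (dzbar k fun w => (ψ w : ℂ) * C w k j) y).re := by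
  have hψc : ContDiff ℝ ∞ (fun y => (ψ y : ℂ)) :=
    contDiff_iff_contDiffAt.2 fun z => contDiffAt_ofReal hψ.smooth.contDiffAt
  have hθ : ∀ j k, ContDiff ℝ ∞ (fun w => (ψ w : ℂ) * C w k j) := fun j k =>
    contDiff_mul_of_tsupport_subset hO (hC k j) hψc (by rw [tsupport_ofReal]; exact hψ.subset)
  have hθs : ∀ j k, tsupport (fun w => (ψ w : ℂ) * C w k j) ⊆ tsupport ψ := fun j k => by
    rw [← tsupport_ofReal]
    exact closure_mono (Function.support_mul_subset_left _ _)
  have hθc : ∀ j k, HasCompactSupport (fun w => (ψ w : ℂ) * C w k j) := fun j k =>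
    hasCompactSupport_of_tsupport_subset hψ.compact (hθs j k)
  obtain ⟨Θ, hΘ⟩ : ∃ Θ : Cn n → ℝ, Θ = fun y =>
    (∑ j, ∑ k, dz j (dzbar k fun w => (ψ w : ℂ) * C w k j) y).re := ⟨_, rfl⟩
  have hΘs : ContDiff ℝ ∞ Θ := by
    rw [hΘ]
    exact Complex.reCLM.contDiff.comp (ContDiff.sum fun j _ => ContDiff.sum fun k _ =>
      contDiff_dz_dzbar (hθ j k) j k)
  have hΘ0 : ∀ y, y ∉ tsupport ψ → Θ y = 0 := fun y hy => by
    rw [hΘ]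
    simp only
    rw [Finset.sum_eq_zero, Complex.zero_re]
    intro j _
    refine Finset.sum_eq_zero fun k _ => image_eq_zero_of_notMem_tsupport fun h' => hy ?_
    exact hθs j k (tsupport_dz_dzbar_subset _ j k h')
  have hΘc : HasCompactSupport Θ := HasCompactSupport.intro hψ.compact hΘ0
  -- This is the room around the support of `ψ` for mollification radii smaller than `δ`; the
  -- cut-off to `K` makes `f` integrable.
  obtain ⟨δ, hδ, hδΩ⟩ := hψ.compact.exists_cthickening_subset_open hO hψ.subset
  set K := Metric.cthickening δ (tsupport ψ) with hK
  have hKc : IsCompact K := hψ.compact.cthickening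
  set f' := K.indicator f with hf'
  have hfi : Integrable f' :=
    integrable_indicator_of_locallyIntegrableOn h.locallyIntegrableOn hKc hδΩ
  have hD : DistPSH f' (Metric.thickening δ (tsupport ψ)) :=
    h.indicator Metric.isOpen_thickening ((Metric.thickening_subset_cthickening _ _).trans hδΩ)
      (Metric.thickening_subset_cthickening _ _)
  have heq : ∫ y, f y * Θ y = ∫ y, Θ y • f' y := by
    refine integral_congr_ae (Filter.Eventually.of_forall fun y => ?_)
    by_cases hy : y ∈ tsupport ψ
    · have hyK : y ∈ K := Metric.self_subset_cthickening _ hy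
      simp only [hf', Set.indicator_of_mem hyK, smul_eq_mul]
      ring
    · simp only [hΘ0 y hy, mul_zero, zero_smul]
  have hgoal : ∫ y, f y * (∑ j, ∑ k, dz j (dzbar k fun w => (ψ w : ℂ) * C w k j) y).re
      = ∫ y, f y * Θ y := by rw [hΘ]
  rw [hgoal, heq]
  have hR : 0 < δ / 2 := by linarith
  -- By weak convergence it suffices to treat the mollifications. For these both derivatives move
  -- from `ψ C` to the smooth function, whose non-negative Hessian pairs non-negatively with `C`.
  refine ge_of_tendsto' (tendsto_integral_smul_mollify hfi hΘs.continuous hΘc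
    (tendsto_radii hR)) fun i => ?_
  obtain ⟨ε, hε⟩ : ∃ ε, ε = δ / 2 * (1 / ((i : ℝ) + 1)) := ⟨_, rfl⟩
  have hε0 : 0 < ε := hε ▸ radii_pos hR i
  have hεδ : ε < δ := by
    have := radii_le hR i
    rw [← hε] at this
    linarith
  rw [← hε]
  obtain ⟨F, hF⟩ : ∃ F, F = mollify ε f' := ⟨_, rfl⟩
  have hFs : ContDiff ℝ ∞ F := hF ▸ contDiff_mollify hε0 hfi.locallyIntegrable
  have hFl : ∀ z ∈ tsupport ψ, ∀ ξ, 0 ≤ levi ξ F z := fun z hz ξ => by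
    rw [hF]
    refine hD.levi_mollify_nonneg hfi.locallyIntegrable hε0 (fun w hw => ?_) ξ
    rw [Metric.mem_thickening_iff]
    exact ⟨z, hz, (Metric.mem_closedBall.1 hw).trans_lt hεδ⟩
  rw [← hF]
  have hFc : ContDiff ℝ ∞ (fun y => (F y : ℂ)) :=
    contDiff_iff_contDiffAt.2 fun z => contDiffAt_ofReal hFs.contDiffAt
  have hi1 : ∀ j k, Integrable fun y => (F y : ℂ) * dz j (dzbar k fun w => (ψ w : ℂ) * C w k j) y :=
    fun j k => integrable_mul_of_tsupport_subset isOpen_univ hFc.continuous.continuousOn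
      (contDiff_dz_dzbar (hθ j k) j k).continuous
      (hasCompactSupport_of_tsupport_subset (hθc j k) (tsupport_dz_dzbar_subset _ j k))
      (Set.subset_univ _)
  have hi2 : ∀ j k, Integrable fun y =>
      dz j (dzbar k fun w => (F w : ℂ)) y * ((ψ y : ℂ) * C y k j) :=
    fun j k => integrable_mul_of_tsupport_subset isOpen_univ
      (contDiff_dz_dzbar hFc j k).continuous.continuousOn (hθ j k).continuous (hθc j k)
      (Set.subset_univ _)
  have hC1 : ∫ y, (F y : ℂ) * ∑ j, ∑ k, dz j (dzbar k fun w => (ψ w : ℂ) * C w k j) y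
      = ∫ y, ∑ j, ∑ k, dz j (dzbar k fun w => (F w : ℂ)) y * ((ψ y : ℂ) * C y k j) := by
    simp only [Finset.mul_sum]
    rw [integral_finsetSum _ fun j _ => integrable_finsetSum _ fun k _ => hi1 j k,
      integral_finsetSum _ fun j _ => integrable_finsetSum _ fun k _ => hi2 j k]
    refine Finset.sum_congr rfl fun j _ => ?_
    rw [integral_finsetSum _ fun k _ => hi1 j k, integral_finsetSum _ fun k _ => hi2 j k]
    exact Finset.sum_congr rfl fun k _ => integral_mul_dz_dzbar isOpen_univ hFc.contDiffOn (hθ j k)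
      (hθc j k) (Set.subset_univ _) j k
  have hint1 : Integrable fun y =>
      (F y : ℂ) * ∑ j, ∑ k, dz j (dzbar k fun w => (ψ w : ℂ) * C w k j) y := by
    simp only [Finset.mul_sum]
    exact integrable_finsetSum _ fun j _ => integrable_finsetSum _ fun k _ => hi1 j k
  have hint2 : Integrable fun y =>
      ∑ j, ∑ k, dz j (dzbar k fun w => (F w : ℂ)) y * ((ψ y : ℂ) * C y k j) :=
    integrable_finsetSum _ fun j _ => integrable_finsetSum _ fun k _ => hi2 j k
  have hC2 : ∫ y, Θ y • F y
      = (∫ y, (F y : ℂ) * ∑ j, ∑ k, dz j (dzbar k fun w => (ψ w : ℂ) * C w k j) y).re := by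
    have h1 := integral_re hint1
    simp only [RCLike.re_to_complex] at h1
    rw [← h1, hΘ]
    refine integral_congr_ae (Filter.Eventually.of_forall fun y => ?_)
    simp only [Complex.re_ofReal_mul, smul_eq_mul, mul_comm]
  rw [hC2, hC1]
  have h1 := integral_re hint2
  simp only [RCLike.re_to_complex] at h1
  rw [← h1]
  refine integral_nonneg fun y => ?_
  by_cases hy : y ∈ tsupport ψ
  · have h2 := hessian_pairing_nonneg (hP y (hψ.subset hy)) hFs.contDiffAt (hFl y hy)
    have h3 : ∑ j, ∑ k, dz j (dzbar k fun w => (F w : ℂ)) y * ((ψ y : ℂ) * C y k j)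
        = (ψ y : ℂ) * ∑ j, ∑ k, C y k j * dz j (dzbar k fun w => (F w : ℂ)) y := by
      simp only [Finset.mul_sum]
      refine Finset.sum_congr rfl fun j _ => Finset.sum_congr rfl fun k _ => ?_
      ring
    simp only [Pi.zero_apply]
    rw [h3, Complex.re_ofReal_mul]
    exact mul_nonneg (hψ.nonneg y) h2
  · have : (ψ y : ℂ) = 0 := by rw [image_eq_zero_of_notMem_tsupport hy]; rfl
    simp [this]

theorem dz_dzbar_ofReal_add {ψ φ : Cn n → ℝ} (hψ : ContDiff ℝ ∞ ψ) (hφ : ContDiff ℝ ∞ φ)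
    (j k : Fin n) (y : Cn n) :
    dz j (dzbar k fun w => (((ψ + φ) w : ℝ) : ℂ)) y
      = dz j (dzbar k fun w => (ψ w : ℂ)) y + dz j (dzbar k fun w => (φ w : ℂ)) y := by
  have hψc : ∀ z, ContDiffAt ℝ ∞ (fun y => (ψ y : ℂ)) z := fun z => contDiffAt_ofReal hψ.contDiffAt
  have hφc : ∀ z, ContDiffAt ℝ ∞ (fun y => (φ y : ℂ)) z := fun z => contDiffAt_ofReal hφ.contDiffAt
  simp only [dz_eq_wirt, dzbar_eq_wirtBar]
  rw [← wirt_fun_add (ContDiffAt.differentiableAt_top (contDiffAt_wirtBar (hψc y) _))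
    (ContDiffAt.differentiableAt_top (contDiffAt_wirtBar (hφc y) _))]
  refine congrArg (fun g => wirt _ g y) (funext fun z => ?_)
  simp only [Pi.add_apply, Complex.ofReal_add]
  simp only [wirtBar, dirDeriv_fun_add (ContDiffAt.differentiableAt_top (hψc z))
    (ContDiffAt.differentiableAt_top (hφc z))]
  ring

/-- It suffices to test with second order operators with constant positive coefficients, locally. -/
theorem DistPSH.of_posDef {f : Cn n → ℝ} (hL : LocallyIntegrableOn f Ω)
    (h : ∀ B : Matrix (Fin n) (Fin n) ℂ, B.PosDef → ∀ x ∈ Ω, ∃ W : Set (Cn n), IsOpen W ∧ x ∈ W ∧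
      ∀ ψ, IsTest ψ (W ∩ Ω) →
        0 ≤ ∫ y, f y * (∑ j, ∑ k, B k j * dz j (dzbar k fun w => (ψ w : ℂ)) y).re) :
    DistPSH f Ω := by
  have hop : ∀ (B : Matrix (Fin n) (Fin n) ℂ) ψ, IsTest ψ Ω →
      Integrable fun y => f y * (∑ j, ∑ k, B k j * dz j (dzbar k fun w => (ψ w : ℂ)) y).re :=
    fun B ψ hψ => by
      have hψc : ContDiff ℝ ∞ (fun y => (ψ y : ℂ)) :=
        contDiff_iff_contDiffAt.2 fun z => contDiffAt_ofReal hψ.smooth.contDiffAt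
      have h0 : ∀ y, y ∉ tsupport ψ →
          (∑ j, ∑ k, B k j * dz j (dzbar k fun w => (ψ w : ℂ)) y).re = 0 := fun y hy => by
        rw [Finset.sum_eq_zero, Complex.zero_re]
        intro j _
        refine Finset.sum_eq_zero fun k _ => ?_
        have h1 : dz j (dzbar k fun w => (ψ w : ℂ)) y = 0 :=
          image_eq_zero_of_notMem_tsupport fun h' => hy (by
            have := tsupport_dz_dzbar_subset _ j k h'
            rwa [tsupport_ofReal] at this)
        rw [h1, mul_zero]
      refine integrable_mul_of_locallyIntegrableOn hL ?_ (HasCompactSupport.intro hψ.compact h0) ?_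
      · exact Complex.continuous_re.comp (continuous_finsetSum _ fun j _ =>
          continuous_finsetSum _ fun k _ =>
            continuous_const.mul (contDiff_dz_dzbar hψc j k).continuous)
      · refine (closure_minimal (fun y hy => ?_) (isClosed_tsupport ψ)).trans hψ.subset
        by_contra hc
        exact hy (h0 y hc)
  -- The neighbourhood may depend on `B`, since the partition of unity is used for each `B`
  -- separately.
  have hglob : ∀ B : Matrix (Fin n) (Fin n) ℂ, B.PosDef → ∀ ψ, IsTest ψ Ω →
      0 ≤ ∫ y, f y * (∑ j, ∑ k, B k j * dz j (dzbar k fun w => (ψ w : ℂ)) y).re :=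
    fun B hB ψ hψ => by
      refine nonneg_of_locally_nonneg (fun ψ : Cn n → ℝ =>
        ∫ y, f y * (∑ j, ∑ k, B k j * dz j (dzbar k fun w => (ψ w : ℂ)) y).re) ?_ ?_ (h B hB) hψ
      · have h0 : ∀ j k y, dz j (dzbar k fun w : Cn n => (((0 : Cn n → ℝ) w : ℝ) : ℂ)) y = 0 :=
          fun j k y => by
            have : (fun w : Cn n => (((0 : Cn n → ℝ) w : ℝ) : ℂ)) = fun _ => 0 := by
              ext w; simp
            rw [this, dz_eq_wirt, dzbar_eq_wirtBar]
            have h1 : wirtBar (EuclideanSpace.single k 1) (fun _ : Cn n => (0 : ℂ)) = fun _ => 0 := by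
              ext w
              exact wirtBar_const _ _ _
            rw [h1, wirt_const]
        simp only [h0]
        simp
      · intro ψ φ h1 h2
        rw [← integral_add (hop B ψ h1) (hop B φ h2)]
        refine integral_congr_ae (Filter.Eventually.of_forall fun y => ?_)
        simp only [dz_dzbar_ofReal_add h1.smooth h2.smooth, mul_add, Finset.sum_add_distrib,
          Complex.add_re]
  refine ⟨hL, fun ξ ψ hψ => ?_⟩
  -- The rank one matrix of `ξ` is only semi-definite, so `t` times the identity is added. The
  -- inequality for `ξ` is the limit `t → 0`.
  have key : ∀ t : ℝ, 0 < t → 0 ≤ (1 / 4) * (∫ y, f y * levi ξ ψ y)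
      + t * ∫ y, f y * (∑ j, ∑ k, (1 : Matrix (Fin n) (Fin n) ℂ) k j
        * dz j (dzbar k fun w => (ψ w : ℂ)) y).re := fun t ht => by
    have hB : (Matrix.vecMulVec (star (ξ : Fin n → ℂ)) (ξ : Fin n → ℂ)
        + (t : ℝ) • (1 : Matrix (Fin n) (Fin n) ℂ)).PosDef :=
      Matrix.PosDef.posSemidef_add (Matrix.posSemidef_vecMulVec_star_self _)
        (Matrix.PosDef.one.smul ht)
    have h1 := hglob _ hB ψ hψ
    rw [← integral_const_mul, ← integral_const_mul, ← integral_add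
      ((DistPSH.integrable_mul_levi hL hψ ξ).const_mul _) ((hop 1 ψ hψ).const_mul _)]
    refine h1.trans_eq (integral_congr_ae (Filter.Eventually.of_forall fun y => ?_))
    have h2 := sum_dz_dzbar (contDiffAt_ofReal (hψ.smooth.contDiffAt (x := y))) ξ
    rw [levi_ofReal hψ.smooth.contDiffAt] at h2
    have h3 : ∑ j, ∑ k, (Matrix.vecMulVec (star (ξ : Fin n → ℂ)) (ξ : Fin n → ℂ)
        + (t : ℝ) • (1 : Matrix (Fin n) (Fin n) ℂ)) k j * dz j (dzbar k fun w => (ψ w : ℂ)) y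
        = ((1 / 4 * levi ξ ψ y : ℝ) : ℂ) + (t : ℂ) * ∑ j, ∑ k, (1 : Matrix (Fin n) (Fin n) ℂ) k j
          * dz j (dzbar k fun w => (ψ w : ℂ)) y := by
      push_cast
      rw [← h2]
      simp only [Finset.mul_sum]
      rw [← Finset.sum_add_distrib]
      refine Finset.sum_congr rfl fun j _ => ?_
      rw [← Finset.sum_add_distrib]
      refine Finset.sum_congr rfl fun k _ => ?_
      simp only [Matrix.add_apply, Matrix.vecMulVec_apply, Matrix.smul_apply, Pi.star_apply,
        Complex.star_def, Complex.real_smul]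
      ring
    simp only
    rw [h3, Complex.add_re, Complex.ofReal_re, Complex.re_ofReal_mul]
    ring
  by_contra hneg
  rw [not_le] at hneg
  obtain ⟨a, ha⟩ : ∃ a, a = ∫ y, f y * levi ξ ψ y := ⟨_, rfl⟩
  obtain ⟨b, hb⟩ : ∃ b, b = ∫ y, f y * (∑ j, ∑ k, (1 : Matrix (Fin n) (Fin n) ℂ) k j
        * dz j (dzbar k fun w => (ψ w : ℂ)) y).re := ⟨_, rfl⟩
  rw [← ha, ← hb] at key
  rw [← ha] at hneg
  -- This `t` is so small that `t b ≤ -a / 8`, which leaves `a / 4 - a / 8 < 0`.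
  have h1 := key (-a / (8 * (|b| + 1))) (by have := abs_nonneg b; apply div_pos <;> linarith)
  have h2 : -a / (8 * (|b| + 1)) * b ≤ -a / 8 := by
    have hb1 : 0 < |b| + 1 := by positivity
    rw [div_mul_eq_mul_div, div_le_div_iff₀ (by positivity) (by norm_num)]
    have := le_abs_self b
    nlinarith
  linarith

/-- A smooth distributionally plurisubharmonic function has non-negative Levi form. -/
theorem DistPSH.levi_nonneg {f : Cn n → ℝ} (h : DistPSH f Ω) (hO : IsOpen Ω)
    (hf : ContDiffOn ℝ ∞ f Ω) {z : Cn n} (hz : z ∈ Ω) (ξ : Cn n) : 0 ≤ levi ξ f z := by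
  by_contra hneg
  rw [not_le] at hneg
  have hcont : ContinuousAt (levi ξ f) z :=
    (contDiffAt_levi (hf.contDiffAt (hO.mem_nhds hz)) ξ).continuousAt
  obtain ⟨R, hR, hRs⟩ := Metric.nhds_basis_closedBall.mem_iff.1
    (Filter.inter_mem (hO.mem_nhds hz) (hcont.eventually (gt_mem_nhds hneg)))
  -- A kernel supported where the Levi form is negative is a test function whose pairing is
  -- negative.
  have ht : IsTest (fun w => mker n R (w - z)) Ω :=
    { smooth := (contDiff_mker R).comp (contDiff_id.sub contDiff_const)
      compact := (hasCompactSupport_mker hR).comp_homeomorph (Homeomorph.subRight z)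
      subset := by
        refine (closure_minimal (fun w hw => ?_) Metric.isClosed_closedBall).trans
          (hRs.trans Set.inter_subset_left)
        have := support_mker_subset hR (show w - z ∈ Function.support (mker n R) from hw)
        rw [Metric.mem_closedBall, dist_eq_norm]
        exact (mem_ball_zero_iff.1 this).le
      nonneg := fun w => mker_nonneg _ _ }
  have h1 := h.nonneg ξ _ ht
  rw [integral_mul_levi hO hf ht.smooth ht.compact ht.subset] at h1
  have hint : Integrable fun y => -(levi ξ f y * mker n R (y - z)) := by
    refine Integrable.neg ?_
    refine integrable_mul_of_locallyIntegrableOn (Ω := Ω) ?_ ht.smooth.continuous ht.compact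
      ht.subset
    exact (contDiffOn_levi hO hf ξ).continuousOn.locallyIntegrableOn hO.measurableSet
  have hnn : ∀ y, 0 ≤ -(levi ξ f y * mker n R (y - z)) := fun y => by
    by_cases hy : y ∈ Metric.closedBall z R
    · have := (hRs hy).2
      have := mker_nonneg R (y - z)
      simp only [Set.mem_ofPred_eq] at *
      nlinarith
    · rw [mker_eq_zero hR, mul_zero, neg_zero]
      rw [Metric.mem_closedBall, not_le, dist_eq_norm] at hy
      exact hy.le
  have hpos : 0 < ∫ y, -(levi ξ f y * mker n R (y - z)) := by
    rw [integral_pos_iff_support_of_nonneg hnn hint]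
    refine (Metric.measure_ball_pos volume z hR).trans_le (measure_mono fun y hy => ?_)
    have h2 := (hRs (Metric.ball_subset_closedBall hy)).2
    have h3 : 0 < mker n R (y - z) := mker_pos hR (by rwa [Metric.mem_ball, dist_eq_norm] at hy)
    simp only [Set.mem_ofPred_eq] at h2
    rw [Function.mem_support]
    nlinarith
  rw [integral_neg] at hpos
  linarith

end Operators

/-! ### Sesquilinear forms of Hermitian matrices -/

section Sesq

variable {r : ℕ}

open Matrix

theorem sesq_add_left (M : Matrix (Fin r) (Fin r) ℂ) (c c' d : Fin r → ℂ) :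
    sesq M (c + c') d = sesq M c d + sesq M c' d := by
  simp [sesq_eq]

theorem sesq_add_right (M : Matrix (Fin r) (Fin r) ℂ) (c d d' : Fin r → ℂ) :
    sesq M c (d + d') = sesq M c d + sesq M c d' := by
  simp [sesq_eq, mulVec_add]

theorem sesq_smul_left (M : Matrix (Fin r) (Fin r) ℂ) (t : ℂ) (c d : Fin r → ℂ) :
    sesq M (t • c) d = t * sesq M c d := by
  simp [sesq_eq]

theorem sesq_smul_right (M : Matrix (Fin r) (Fin r) ℂ) (t : ℂ) (c d : Fin r → ℂ) :
    sesq M c (t • d) = (starRingEnd ℂ) t * sesq M c d := by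
  simp [sesq_eq, mulVec_smul]

theorem sesq_single (M : Matrix (Fin r) (Fin r) ℂ) (a b : Fin r) :
    sesq M (Pi.single a 1) (Pi.single b 1) = M a b := by
  simp only [sesq]
  rw [Finset.sum_eq_single a, Finset.sum_eq_single b]
  · simp
  · intro c _ hc
    simp [hc]
  · simp
  · intro c _ hc
    simp [hc]
  · simp

theorem sesq_conj_symm {M : Matrix (Fin r) (Fin r) ℂ} (hM : M.IsHermitian) (c d : Fin r → ℂ) :
    (starRingEnd ℂ) (sesq M c d) = sesq M d c := by
  simp only [sesq, map_sum, map_mul, Complex.conj_conj]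
  rw [Finset.sum_comm]
  refine Finset.sum_congr rfl fun a _ => Finset.sum_congr rfl fun b _ => ?_
  have : (starRingEnd ℂ) (M b a) = M a b := hM.apply a b
  rw [this]
  ring

theorem ofReal_sesq_re {M : Matrix (Fin r) (Fin r) ℂ} (hM : M.IsHermitian) (c : Fin r → ℂ) :
    ((sesq M c c).re : ℂ) = sesq M c c :=
  Complex.conj_eq_iff_re.1 (sesq_conj_symm hM c c)

/-- The matrix recovered from its quadratic form. -/
def polarMat (q : (Fin r → ℂ) → ℝ) : Matrix (Fin r) (Fin r) ℂ := of fun a b =>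
  (1 / 4 : ℂ) * (q (Pi.single a 1 + Pi.single b 1) - q (Pi.single a 1 + (-1 : ℂ) • Pi.single b 1)
    + Complex.I * q (Pi.single a 1 + Complex.I • Pi.single b 1)
    - Complex.I * q (Pi.single a 1 + (-Complex.I) • Pi.single b 1))

theorem polarMat_eq {M : Matrix (Fin r) (Fin r) ℂ} (hM : M.IsHermitian) {q : (Fin r → ℂ) → ℝ}
    (hq : ∀ c, q c = (sesq M c c).re) : polarMat q = M := by
  ext a b
  rw [polarMat, of_apply]
  simp only [hq, ofReal_sesq_re hM]
  simp only [sesq_add_left, sesq_add_right, sesq_smul_left,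
    sesq_smul_right, sesq_single, map_neg, map_one, Complex.conj_I]
  linear_combination ((1 / 2 : ℂ) * (M b a - M a b)) * Complex.I_sq

theorem posDef_of_sesq {M : Matrix (Fin r) (Fin r) ℂ} (hM : M.IsHermitian)
    (h : ∀ c, c ≠ 0 → 0 < (sesq M c c).re) : M.PosDef := by
  refine Matrix.PosDef.of_dotProduct_mulVec_pos hM fun x hx => ?_
  have h1 : star x ⬝ᵥ (M *ᵥ x) = sesq M (star x) (star x) := by rw [sesq_eq, star_star]
  rw [h1, ← ofReal_sesq_re hM]
  have := h (star x) (by simpa using hx)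
  exact_mod_cast this

theorem sesq_self_pos {M : Matrix (Fin r) (Fin r) ℂ} (hM : M.PosDef) {c : Fin r → ℂ}
    (hc : c ≠ 0) : 0 < (sesq M c c).re := by
  have := hM.dotProduct_mulVec_pos (x := star c) (by simpa using hc)
  rw [star_star] at this
  rw [sesq_eq]
  exact (Complex.lt_def.1 this).1

end Sesq

theorem re_integral_nonneg {α : Type*} [MeasurableSpace α] {μ : Measure α} {f : α → ℂ}
    (h : ∀ᵐ x ∂μ, 0 ≤ (f x).re) : 0 ≤ (∫ x, f x ∂μ).re := by
  by_cases hi : Integrable f μ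
  · have h1 := integral_re hi
    simp only [RCLike.re_to_complex] at h1
    rw [← h1]
    exact integral_nonneg_of_ae h
  · rw [integral_undef hi, Complex.zero_re]

/-! ### Mollification of a metric -/

section Mollified

variable {n r : ℕ} {q : Cn n → (Fin r → ℂ) → ℝ} {K : Cn n → Matrix (Fin r) (Fin r) ℂ}

/-- Entrywise mollification. -/
def mollifyMat (ε : ℝ) (K : Cn n → Matrix (Fin r) (Fin r) ℂ) (z : Cn n) :
    Matrix (Fin r) (Fin r) ℂ := Matrix.of fun a b => mollify ε (fun w => K w a b) z

theorem sesq_mollifyMat {ε : ℝ} (hε : 0 < ε) (hK : ∀ a b, Integrable fun z => K z a b)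
    (hq : ∀ᵐ z, ∀ c, (q z c : ℂ) = sesq (K z) c c) (c : Fin r → ℂ) (z : Cn n) :
    sesq (mollifyMat ε K z) c c = ((mollify ε (fun w => q w c) z : ℝ) : ℂ) := by
  have hi : ∀ a b, Integrable fun w => mker n ε (z - w) • K w a b := fun a b =>
    integrable_mollify hε (hK a b).locallyIntegrable z
  have h1 : sesq (mollifyMat ε K z) c c
      = ∫ w, ∑ a, ∑ b, (c a * (starRingEnd ℂ) (c b)) * (mker n ε (z - w) • K w a b) := by
    rw [integral_finsetSum _ fun a _ => integrable_finsetSum _ fun b _ => (hi a b).const_mul _]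
    refine Finset.sum_congr rfl fun a _ => ?_
    rw [integral_finsetSum _ fun b _ => (hi a b).const_mul _]
    refine Finset.sum_congr rfl fun b _ => ?_
    rw [integral_const_mul]
    rfl
  rw [h1]
  refine Eq.trans ?_ integral_ofReal
  refine integral_congr_ae ?_
  filter_upwards [hq] with w hw
  simp only [smul_eq_mul, hw c, sesq, Finset.mul_sum, Complex.real_smul,
    RCLike.ofReal_mul, Complex.coe_algebraMap]
  refine Finset.sum_congr rfl fun a _ => Finset.sum_congr rfl fun b _ => ?_
  ring

theorem contDiff_mollifyMat {ε : ℝ} (hε : 0 < ε) (hK : ∀ a b, Integrable fun z => K z a b)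
    (a b : Fin r) : ContDiff ℝ ∞ fun z => mollifyMat ε K z a b :=
  contDiff_mollify hε (hK a b).locallyIntegrable

theorem isHermitian_mollifyMat {ε : ℝ} (hH : ∀ᵐ z, (K z).IsHermitian) (z : Cn n) :
    (mollifyMat ε K z).IsHermitian := by
  ext a b
  rw [Matrix.conjTranspose_apply, mollifyMat, Matrix.of_apply, Matrix.of_apply, Complex.star_def]
  change (starRingEnd ℂ) (∫ w, mker n ε (z - w) • K w b a) = ∫ w, mker n ε (z - w) • K w a b
  rw [← integral_conj]
  refine integral_congr_ae ?_
  filter_upwards [hH] with w hw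
  have : (starRingEnd ℂ) (K w b a) = K w a b := hw.apply a b
  simp only [Complex.real_smul, map_mul, Complex.conj_ofReal, this]

/-- Squared lengths of holomorphic sections for the mollified metric: a superposition of squared
lengths of translated sections. -/
theorem integral_sesq_mollifyMat_nonneg {ε : ℝ} (hε : 0 < ε)
    (hK : ∀ a b, Integrable fun z => K z a b) {u : Cn n → Fin r → ℂ} {Ω : Set (Cn n)}
    (hO : IsOpen Ω) (hu : ContinuousOn u Ω) {χ : Cn n → ℝ} (hχ : Continuous χ)
    (hc : HasCompactSupport χ) (hs : tsupport χ ⊆ Ω)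
    (h : ∀ x : Cn n, ‖x‖ < ε →
      0 ≤ (∫ w, (χ (w + x) : ℂ) * sesq (K w) (u (w + x)) (u (w + x))).re) :
    0 ≤ ∫ z, (sesq (mollifyMat ε K z) (u z) (u z)).re * χ z := by
  have hχc : Continuous fun z => (χ z : ℂ) := Complex.continuous_ofReal.comp hχ
  have hcc := hasCompactSupport_ofReal hc
  have hsc : tsupport (fun y => (χ y : ℂ)) ⊆ Ω := by rwa [tsupport_ofReal]
  have hua : ∀ a, ContinuousOn (fun z => u z a) Ω := fun a => (continuous_apply a).comp_continuousOn hu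
  have hθ : ∀ a b, Continuous fun z => (u z a * (starRingEnd ℂ) (u z b)) * (χ z : ℂ) := fun a b =>
    continuous_mul_of_tsupport_subset hO
      ((hua a).mul (Complex.continuous_conj.comp_continuousOn (hua b))) hχc hsc
  have hθc : ∀ a b, HasCompactSupport fun z => (u z a * (starRingEnd ℂ) (u z b)) * (χ z : ℂ) :=
    fun a b => hasCompactSupport_mul hcc
  have hint : ∀ a b, Integrable (fun p : Cn n × Cn n =>
      ((u p.1 a * (starRingEnd ℂ) (u p.1 b)) * (χ p.1 : ℂ))
        * ((mker n ε p.2 : ℂ) * K (p.1 - p.2) a b)) (volume.prod volume) := fun a b => by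
    have h1 : Integrable (fun p : Cn n × Cn n => (mker n ε p.2 : ℂ) * K (p.1 - p.2) a b)
        (volume.prod volume) :=
      Integrable.convolution_integrand (ContinuousLinearMap.mul ℝ ℂ)
        (f := fun x => (mker n ε x : ℂ)) (integrable_mker hε).ofReal (hK a b)
    obtain ⟨C, hC⟩ := (hθc a b).exists_bound_of_continuous (hθ a b)
    exact h1.bdd_mul (c := C) ((hθ a b).comp continuous_fst).aestronglyMeasurable
      (Filter.Eventually.of_forall fun p => hC p.1)
  obtain ⟨T, hT⟩ : ∃ T : Cn n → Cn n → ℂ, T = fun z x => ∑ a, ∑ b,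
      ((u z a * (starRingEnd ℂ) (u z b)) * (χ z : ℂ)) * ((mker n ε x : ℂ) * K (z - x) a b) :=
    ⟨_, rfl⟩
  have hTi : Integrable (Function.uncurry T) (volume.prod volume) := by
    rw [hT]
    exact integrable_finsetSum _ fun a _ => integrable_finsetSum _ fun b _ => hint a b
  have hslice : ∀ a b z, Integrable fun x => (mker n ε x : ℂ) * K (z - x) a b := fun a b z => by
    have h1 := (integrable_mollify hε (hK a b).locallyIntegrable z).comp_sub_left z
    simpa using h1
  have hmol : ∀ a b z, mollifyMat ε K z a b = ∫ x, (mker n ε x : ℂ) * K (z - x) a b :=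
    fun a b z => by
      rw [mollifyMat, Matrix.of_apply, mollify_eq_sub]
      simp only [Complex.real_smul]
  have hz : ∀ z, ∫ x, T z x = (χ z : ℂ) * sesq (mollifyMat ε K z) (u z) (u z) := fun z => by
    rw [hT]
    simp only
    rw [integral_finsetSum _ fun a _ => integrable_finsetSum _ fun b _ => (hslice a b z).const_mul _,
      sesq, Finset.mul_sum]
    refine Finset.sum_congr rfl fun a _ => ?_
    rw [integral_finsetSum _ fun b _ => (hslice a b z).const_mul _, Finset.mul_sum]
    refine Finset.sum_congr rfl fun b _ => ?_
    rw [integral_const_mul, hmol]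
    ring
  have hL : ∫ z, (sesq (mollifyMat ε K z) (u z) (u z)).re * χ z = (∫ z, ∫ x, T z x).re := by
    have h1 := integral_re hTi.integral_prod_left
    simp only [RCLike.re_to_complex, Function.uncurry] at h1
    rw [← h1]
    refine integral_congr_ae (Filter.Eventually.of_forall fun z => ?_)
    simp only [hz, Complex.re_ofReal_mul]
    ring
  rw [hL, integral_integral_swap hTi]
  refine re_integral_nonneg (Filter.Eventually.of_forall fun x => ?_)
  by_cases hx : ‖x‖ < ε
  -- For a fixed shift `x`, the substitution `z = w + x` evaluates the original form on the
  -- translated section `u (· + x)`.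
  · have h2 : ∫ z, T z x
        = (mker n ε x : ℂ) * ∫ w, (χ (w + x) : ℂ) * sesq (K w) (u (w + x)) (u (w + x)) := by
      rw [← integral_add_right_eq_self (fun z => T z x) x, ← integral_const_mul]
      refine integral_congr_ae (Filter.Eventually.of_forall fun w => ?_)
      rw [hT]
      simp only [sesq, Finset.mul_sum, add_sub_cancel_right]
      refine Finset.sum_congr rfl fun a _ => Finset.sum_congr rfl fun b _ => ?_
      ring
    rw [h2, Complex.re_ofReal_mul]
    exact mul_nonneg (mker_nonneg _ _) (h x hx)
  · have h2 : ∀ z, T z x = 0 := fun z => by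
      rw [hT]
      simp [mker_eq_zero hε (not_lt.1 hx)]
    simp [h2]

theorem sesq_contDiffOn {M : Cn n → Matrix (Fin r) (Fin r) ℂ} {Ω : Set (Cn n)}
    {u : Cn n → Fin r → ℂ} (hO : IsOpen Ω) (hM : ∀ a b, ContDiffOn ℝ ∞ (fun z => M z a b) Ω)
    (hu : ContDiffOn ℝ ∞ u Ω) :
    ContDiffOn ℝ ∞ (fun z => (sesq (M z) (u z) (u z)).re) Ω := fun z hz => by
  refine ContDiffAt.contDiffWithinAt (Complex.reCLM.contDiff.contDiffAt.comp z ?_)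
  exact contDiffAt_sesq (u := fun a z => u z a) (fun a b => (hM a b).contDiffAt (hO.mem_nhds hz))
    fun a => contDiffAt_pi.1 (hu.contDiffAt (hO.mem_nhds hz)) a

theorem contDiffOn_real_of_complex {G : Type*} [NormedAddCommGroup G] [NormedSpace ℂ G]
    {u : Cn n → G} {Ω : Set (Cn n)} (hu : ContDiffOn ℂ ω u Ω) : ContDiffOn ℝ ∞ u Ω :=
  (hu.restrict_scalars ℝ).of_le (by simp)

/-- A weakly semi-negative family of forms is the limit of a decreasing sequence of smooth positive
definite matrices for which the squared lengths of holomorphic sections are plurisubharmonic. -/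
theorem exists_approximation {z₀ : Cn n} {R : ℝ} (hR : 0 < R)
    (hq : ∀ᵐ z, z ∈ Metric.ball z₀ R → ∃ K : Matrix (Fin r) (Fin r) ℂ, K.PosDef ∧
      ∀ c, q z c = (sesq K c c).re)
    (hW : ∀ Ω : Set (Cn n), IsOpen Ω → Ω ⊆ Metric.ball z₀ R → ∀ u : Cn n → Fin r → ℂ,
      ContDiffOn ℂ ω u Ω → DistPSH (fun z => q z (u z)) Ω) :
    ∃ M : ℕ → Cn n → Matrix (Fin r) (Fin r) ℂ,
      (∀ ν a b, ContDiff ℝ ∞ fun z => M ν z a b) ∧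
      (∀ ν, ∀ z ∈ Metric.ball z₀ (R / 4), (M ν z).PosDef) ∧
      (∀ z ∈ Metric.ball z₀ (R / 4), ∀ c, Antitone fun ν => (sesq (M ν z) c c).re) ∧
      (∀ᵐ z, z ∈ Metric.ball z₀ (R / 4) → ∀ c,
        Filter.Tendsto (fun ν => (sesq (M ν z) c c).re) Filter.atTop (𝓝 (q z c))) ∧
      ∀ ν, ∀ Ω : Set (Cn n), IsOpen Ω → Ω ⊆ Metric.ball z₀ (R / 4) → ∀ u : Cn n → Fin r → ℂ,
        ContDiffOn ℂ ω u Ω → ∀ z ∈ Ω, ∀ ξ,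
          0 ≤ levi ξ (fun w => (sesq (M ν w) (u w) (u w)).re) z := by
  -- Three radii occur: the data live on the ball of radius `R`, the cut-off is at `3R / 4`, and
  -- mollifications of radius at most `R / 4` are used on the ball of radius `R / 4`.
  set D := Metric.closedBall z₀ (3 * R / 4) with hD
  have hDb : D ⊆ Metric.ball z₀ R := Metric.closedBall_subset_ball (by linarith)
  set q' : Cn n → (Fin r → ℂ) → ℝ := fun z c => D.indicator (fun z => q z c) z with hq'
  have hq'in : ∀ z ∈ D, ∀ c, q' z c = q z c := fun z hz c => Set.indicator_of_mem hz _
  have hq'out : ∀ z, z ∉ D → ∀ c, q' z c = 0 := fun z hz c => Set.indicator_of_notMem hz _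
  have hconst : ∀ c, DistPSH (fun z => q z c) (Metric.ball z₀ R) := fun c =>
    hW _ Metric.isOpen_ball subset_rfl (fun _ => c) contDiffOn_const
  have hq'i : ∀ c, Integrable fun z => q' z c := fun c =>
    integrable_indicator_of_locallyIntegrableOn (hconst c).locallyIntegrableOn
      (isCompact_closedBall _ _) hDb
  -- Polarisation, unlike a choice of the matrices in `hq`, expresses the entries through the
  -- functions `z ↦ q' z c` and thus makes them integrable.
  set K : Cn n → Matrix (Fin r) (Fin r) ℂ := fun z => polarMat (q' z) with hKdef
  have hKi : ∀ a b, Integrable fun z => K z a b := fun a b => by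
    simp only [hKdef, polarMat, Matrix.of_apply]
    exact ((((hq'i _).ofReal.sub (hq'i _).ofReal).add ((hq'i _).ofReal.const_mul _)).sub
      ((hq'i _).ofReal.const_mul _)).const_mul _
  have hK0 : ∀ z, z ∉ D → K z = 0 := fun z hz => by
    ext a b
    simp [hKdef, polarMat, hq'out z hz]
  have hKin : ∀ᵐ z, z ∈ D → (K z).PosDef ∧ ∀ c, q' z c = (sesq (K z) c c).re := by
    filter_upwards [hq] with z hz hzD
    obtain ⟨N, hN, hNq⟩ := hz (hDb hzD)
    have : K z = N := polarMat_eq hN.isHermitian fun c => by rw [hq'in z hzD, hNq]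
    rw [this]
    exact ⟨hN, fun c => by rw [hq'in z hzD, hNq]⟩
  have hKH : ∀ᵐ z, (K z).IsHermitian := by
    filter_upwards [hKin] with z hz
    by_cases hzD : z ∈ D
    · exact (hz hzD).1.isHermitian
    · rw [hK0 z hzD]
      exact Matrix.isHermitian_zero
  have hqK : ∀ᵐ z, ∀ c, (q' z c : ℂ) = sesq (K z) c c := by
    filter_upwards [hKin, hKH] with z hz hH c
    by_cases hzD : z ∈ D
    · rw [(hz hzD).2, ofReal_sesq_re hH]
    · rw [hq'out z hzD, hK0 z hzD]
      simp [sesq]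
  have hR4 : 0 < R / 4 := by linarith
  obtain ⟨e, he⟩ : ∃ e : ℕ → ℝ, e = fun k : ℕ => R / 4 * (1 / ((k : ℝ) + 1)) := ⟨_, rfl⟩
  have he0 : ∀ k, 0 < e k := fun k => he ▸ radii_pos hR4 k
  have heR : ∀ k, e k ≤ R / 4 := fun k => he ▸ radii_le hR4 k
  have hea : Antitone e := he ▸ radii_anti hR4
  have het : Filter.Tendsto e Filter.atTop (𝓝[>] 0) := he ▸ tendsto_radii hR4
  have hbD : ∀ z ∈ Metric.ball z₀ (R / 4), ∀ w, dist w z ≤ R / 4 → w ∈ D := fun z hz w hw => by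
    have := dist_triangle w z z₀
    have := Metric.mem_ball.1 hz
    rw [hD, Metric.mem_closedBall]
    linarith
  have hDq' : ∀ c, DistPSH (fun z => q' z c) (Metric.ball z₀ (3 * R / 4)) := fun c =>
    (hconst c).indicator Metric.isOpen_ball (Metric.ball_subset_ball (by linarith))
      Metric.ball_subset_closedBall
  have hre : ∀ ν z c, (sesq (mollifyMat (e ν) K z) c c).re = mollify (e ν) (fun w => q' w c) z :=
    fun ν z c => by rw [sesq_mollifyMat (he0 ν) hKi hqK, Complex.ofReal_re]
  refine ⟨fun ν => mollifyMat (e ν) K, fun ν => contDiff_mollifyMat (he0 ν) hKi,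
    fun ν z hz => ?_, fun z hz c ν ν' hν => ?_, ?_, fun ν Ω hO hΩ u hu => ?_⟩
  · refine posDef_of_sesq (isHermitian_mollifyMat hKH z) fun c hc => ?_
    rw [hre]
    have hpos : ∀ᵐ w, w ∈ D → 0 < q' w c := by
      filter_upwards [hKin] with w hw hwD
      rw [(hw hwD).2]
      exact sesq_self_pos (hw hwD).1 hc
    have hnn : ∀ᵐ w, 0 ≤ mker n (e ν) (z - w) • q' w c := by
      filter_upwards [hpos] with w hw
      by_cases hwD : w ∈ D
      · exact mul_nonneg (mker_nonneg _ _) (hw hwD).le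
      · rw [hq'out w hwD, smul_zero]
    change 0 < ∫ w, mker n (e ν) (z - w) • q' w c
    rw [integral_pos_iff_support_of_nonneg_ae hnn
      (integrable_mollify (he0 ν) (hq'i c).locallyIntegrable z)]
    refine (Metric.measure_ball_pos volume z (he0 ν)).trans_le (measure_mono_ae ?_)
    filter_upwards [hpos] with w hw hwb
    have h1 : dist w z < e ν := hwb
    refine (mul_pos (mker_pos (he0 ν) ?_) (hw (hbD z hz w (h1.le.trans (heR ν))))).ne'
    rwa [← dist_eq_norm, dist_comm]
  · simp only [hre]
    -- Constant sections are holomorphic, so `z ↦ q z c` is plurisubharmonic in the sense of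
    -- distributions and its mollifications decrease with the radius.
    refine (hDq' c).mollify_mono_radius Metric.isOpen_ball (hq'i c) (he0 ν') (hea hν) fun w hw => ?_
    have := dist_triangle w z z₀
    have := Metric.mem_ball.1 hz
    have := Metric.mem_closedBall.1 hw
    have := heR ν
    rw [Metric.mem_ball]
    linarith
  · have h1 : ∀ᵐ z, ∀ a b, Filter.Tendsto (fun ν => mollifyMat (e ν) K z a b) Filter.atTop
        (𝓝 (K z a b)) := by
      rw [ae_all_iff]
      intro a
      rw [ae_all_iff]
      intro b
      filter_upwards [ae_tendsto_mollify (hKi a b).locallyIntegrable] with z hz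
      exact hz het
    filter_upwards [h1, hqK] with z hz hqz hzb c
    have h2 : Filter.Tendsto (fun ν => sesq (mollifyMat (e ν) K z) c c) Filter.atTop
        (𝓝 (sesq (K z) c c)) :=
      tendsto_finsetSum _ fun a _ => tendsto_finsetSum _ fun b _ => (hz a b).const_mul _
    have h3 := (Complex.continuous_re.tendsto _).comp h2
    rw [← hqz c, Complex.ofReal_re, hq'in z (hbD z hzb z (by rw [dist_self]; exact hR4.le))] at h3
    exact h3
  · have hur := contDiffOn_real_of_complex hu
    have hsm := sesq_contDiffOn hO (fun a b => (contDiff_mollifyMat (he0 ν) hKi a b).contDiffOn) hur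
    have hDP : DistPSH (fun w => (sesq (mollifyMat (e ν) K w) (u w) (u w)).re) Ω := by
      refine ⟨hsm.continuousOn.locallyIntegrableOn hO.measurableSet, fun ξ ψ hψ => ?_⟩
      refine integral_sesq_mollifyMat_nonneg (he0 ν) hKi hO hur.continuousOn
        (contDiff_levi hψ.smooth ξ).continuous (hasCompactSupport_levi hψ.compact ξ)
        ((tsupport_levi_subset ψ ξ).trans hψ.subset) fun x hx => ?_
      have hxΩ : ∀ w, w + x ∈ Ω → w ∈ Metric.ball z₀ (3 * R / 4) := fun w hw => by
        have h1 := Metric.mem_ball.1 (hΩ hw)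
        have h2 : dist w (w + x) < R / 4 := by
          rw [dist_eq_norm, sub_add_cancel_left, norm_neg]
          exact hx.trans_le (heR ν)
        have := dist_triangle w (w + x) z₀
        rw [Metric.mem_ball]
        linarith
      have hcontx : Continuous fun w : Cn n => w + x := by fun_prop
      -- The translate of `u` is holomorphic on the translated set. This is why the hypothesis is
      -- needed for all sections and open sets and not only for constant vectors.
      have hOx : IsOpen ((fun w => w + x) ⁻¹' Ω) := hO.preimage hcontx
      have hux : ContDiffOn ℂ ω (fun w => u (w + x)) ((fun w => w + x) ⁻¹' Ω) :=
        hu.comp (contDiff_id.add contDiff_const).contDiffOn fun w hw => hw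
      have h1 := hW _ hOx (fun w hw => Metric.ball_subset_ball (by linarith) (hxΩ w hw)) _ hux
      have hψx : IsTest (fun w => ψ (w + x)) ((fun w => w + x) ⁻¹' Ω) :=
        { smooth := hψ.smooth.comp (contDiff_id.add contDiff_const)
          compact := hψ.compact.comp_homeomorph (Homeomorph.addRight x)
          subset := by
            have : tsupport (fun w => ψ (w + x)) = (fun w => w + x) ⁻¹' tsupport ψ :=
              tsupport_comp_eq_preimage ψ (Homeomorph.addRight x)
            rw [this]
            exact Set.preimage_mono hψ.subset
          nonneg := fun w => hψ.nonneg _ }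
      have h2 := h1.nonneg ξ _ hψx
      have hlx : ∀ w, levi ξ (fun w => ψ (w + x)) w = levi ξ ψ (w + x) := fun w => by
        have hd : ∀ (g : Cn n → ℝ) a, dirDeriv a (fun w => g (w + x)) = fun w => dirDeriv a g (w + x) :=
          fun g a => by
            ext w
            simp only [dirDeriv, fderiv_comp_add_right]
        simp only [levi, hd]
      have h3 : ∫ w, ((levi ξ ψ (w + x) : ℝ) : ℂ) * sesq (K w) (u (w + x)) (u (w + x))
          = ((∫ w, q w (u (w + x)) * levi ξ (fun w => ψ (w + x)) w : ℝ) : ℂ) := by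
        refine Eq.trans ?_ integral_ofReal
        refine integral_congr_ae ?_
        filter_upwards [hqK] with w hw
        by_cases hwΩ : w + x ∈ Ω
        · rw [← hw, hq'in w (Metric.ball_subset_closedBall (hxΩ w hwΩ)), hlx]
          simp [mul_comm]
        · have h0 : levi ξ ψ (w + x) = 0 := image_eq_zero_of_notMem_tsupport fun h' =>
            hwΩ (hψ.subset (tsupport_levi_subset ψ ξ h'))
          rw [hlx, h0]
          simp
      rw [h3, Complex.ofReal_re]
      exact h2
    exact fun z hz ξ => hDP.levi_nonneg hO hsm hz ξ

end Mollified

/-! ### Logarithms of squared lengths -/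

section Log

variable {n r : ℕ}

/-- The hypothesis is the Levi form at `z` of `|g|² F` for holomorphic `g` with `g z = 1` and `∂_ξ g
z = a + ib`. A suitable choice of `a` and `b` bounds the squared gradient of `F` by `F` times its
Levi form, up to the regularisation, and this is positivity for the logarithm. -/
theorem levi_log_nonneg {F : Cn n → ℝ} {z ξ : Cn n} (hF : ContDiffAt ℝ ∞ F z) (h0 : 0 ≤ F z)
    (h : ∀ a b : ℝ, 0 ≤ levi ξ F z
      + 4 * (a * dirDeriv ξ F z - b * dirDeriv (Complex.I • ξ) F z) + 4 * (a ^ 2 + b ^ 2) * F z)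
    {δ : ℝ} (hδ : 0 < δ) : 0 ≤ levi ξ (fun w => Real.log (F w + δ)) z := by
  have hpos : 0 < F z + δ := by linarith
  have h1 : ∀ᶠ t in 𝓝 (F z), HasDerivAt (fun t => Real.log (t + δ)) ((t + δ)⁻¹) t := by
    have : ∀ᶠ t in 𝓝 (F z), 0 < t + δ :=
      ((continuous_id.add continuous_const).tendsto (F z)).eventually (lt_mem_nhds hpos)
    filter_upwards [this] with t ht
    exact ((hasDerivAt_id t).add_const δ).log ht.ne' |>.congr_deriv (by simp)
  have h2 : HasDerivAt (fun t => (t + δ)⁻¹) (-((F z + δ) ^ 2)⁻¹) (F z) :=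
    ((hasDerivAt_id (F z)).add_const δ).fun_inv hpos.ne' |>.congr_deriv (by simp [neg_div])
  rw [levi_comp (Φ := fun t => Real.log (t + δ)) (Φ' := fun t => (t + δ)⁻¹)
    (Φ'' := fun t => -((t + δ) ^ 2)⁻¹) hF h1 h2]
  obtain ⟨P, hP⟩ : ∃ P, P = dirDeriv ξ F z := ⟨_, rfl⟩
  obtain ⟨Q, hQ⟩ : ∃ Q, Q = dirDeriv (Complex.I • ξ) F z := ⟨_, rfl⟩
  obtain ⟨L, hL⟩ : ∃ L, L = levi ξ F z := ⟨_, rfl⟩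
  obtain ⟨s, hs⟩ : ∃ s, s = F z + δ := ⟨_, rfl⟩
  have hF' : F z = s - δ := by linarith
  -- The minimiser in `a`, `b`, with `s = F z + δ` in place of `F z` so that nothing is divided by
  -- zero. The discrepancy is the term `δ (P² + Q²) / s²`, which has the favourable sign.
  have h3 := h (-P / (2 * s)) (Q / (2 * s))
  rw [← hP, ← hQ, ← hL, hF'] at h3
  rw [← hP, ← hQ, ← hL, ← hs]
  rw [← hs] at hpos
  have h4 : L + 4 * (-P / (2 * s) * P - Q / (2 * s) * Q)
      + 4 * ((-P / (2 * s)) ^ 2 + (Q / (2 * s)) ^ 2) * (s - δ)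
      = s * (s⁻¹ * L + -(s ^ 2)⁻¹ * (P ^ 2 + Q ^ 2)) - δ * ((P ^ 2 + Q ^ 2) / s ^ 2) := by
    field_simp
    ring
  rw [h4] at h3
  have h5 : 0 ≤ δ * ((P ^ 2 + Q ^ 2) / s ^ 2) := by positivity
  exact nonneg_of_mul_nonneg_right (by linarith) hpos

/-- If the squared lengths of holomorphic sections are plurisubharmonic, so are their
(regularised) logarithms. -/
theorem levi_log_sesq_nonneg {M : Cn n → Matrix (Fin r) (Fin r) ℂ} {Ω : Set (Cn n)}
    (hO : IsOpen Ω) (hM : ∀ a b, ContDiffOn ℝ ∞ (fun z => M z a b) Ω)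
    (hP : ∀ z ∈ Ω, (M z).PosSemidef)
    (hl : ∀ u : Cn n → Fin r → ℂ, ContDiffOn ℂ ω u Ω → ∀ z ∈ Ω, ∀ ξ,
      0 ≤ levi ξ (fun w => (sesq (M w) (u w) (u w)).re) z)
    {u : Cn n → Fin r → ℂ} (hu : ContDiffOn ℂ ω u Ω) {z : Cn n} (hz : z ∈ Ω) (ξ : Cn n)
    {δ : ℝ} (hδ : 0 < δ) :
    0 ≤ levi ξ (fun w => Real.log ((sesq (M w) (u w) (u w)).re + δ)) z := by
  rcases eq_or_ne ξ 0 with rfl | hξ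
  · rw [levi_zero]
  have hmz : ContDiffAt ℝ ∞ (fun w => sesq (M w) (u w) (u w)) z :=
    contDiffAt_sesq (u := fun a z => u z a) (fun a b => (hM a b).contDiffAt (hO.mem_nhds hz))
      fun a => contDiffAt_pi.1 ((contDiffOn_real_of_complex hu).contDiffAt (hO.mem_nhds hz)) a
  have hFz := (sesq_contDiffOn hO hM (contDiffOn_real_of_complex hu)).contDiffAt (hO.mem_nhds hz)
  refine levi_log_nonneg hFz (sesq_self_nonneg (hP z hz) _) (fun a b => ?_) hδ
  let μ : ℂ := ⟨a, b⟩
  have hξ2 : (inner ℂ ξ ξ : ℂ) ≠ 0 := inner_self_ne_zero.2 hξ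
  -- A linear form with value `μ = a + ib` on `ξ` makes `(1 + ℓ (w - z)) u` a holomorphic section to
  -- which `hl` applies; its squared length is the product that the hypothesis of `levi_log_nonneg`
  -- describes.
  obtain ⟨ℓ, hℓ⟩ : ∃ ℓ : Cn n →L[ℂ] ℂ, ℓ ξ = μ := by
    refine ⟨(μ / inner ℂ ξ ξ) • innerSL ℂ ξ, ?_⟩
    rw [_root_.smul_apply, innerSL_apply_apply, smul_eq_mul, div_mul_cancel₀ _ hξ2]
  have hgs : ContDiff ℂ ω (fun w => 1 + ℓ (w - z)) := by fun_prop
  have hgh : ∀ w, DifferentiableAt ℂ (fun w => 1 + ℓ (w - z)) w := fun w =>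
    (hgs.differentiable (by simp)) w
  have hgr : ContDiffAt ℝ ∞ (fun w => 1 + ℓ (w - z)) z :=
    ((hgs.restrict_scalars ℝ).of_le (by simp)).contDiffAt
  have hgw : wirt ξ (fun w => 1 + ℓ (w - z)) z = μ := by
    rw [wirt_eq (hgh z), fderiv_const_add]
    have : HasFDerivAt (fun w => ℓ (w - z)) ℓ z :=
      ℓ.hasFDerivAt.comp z ((hasFDerivAt_id (𝕜 := ℂ) z).sub_const z)
    rw [this.fderiv, hℓ]
  have h1 := hl (fun w => (1 + ℓ (w - z)) • u w) (hgs.contDiffOn.smul hu) z hz ξ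
  have h2 : ∀ w, sesq (M w) ((1 + ℓ (w - z)) • u w) ((1 + ℓ (w - z)) • u w)
      = (1 + ℓ (w - z)) * (starRingEnd ℂ) (1 + ℓ (w - z)) * sesq (M w) (u w) (u w) := fun w => by
    rw [sesq_smul_left, sesq_smul_right, mul_assoc]
  simp only [h2] at h1
  have hcz : ContDiffAt ℝ ∞ (fun w => (starRingEnd ℂ) (1 + ℓ (w - z))) z :=
    Complex.conjCLE.contDiff.contDiffAt.comp z hgr
  rw [levi_re ((hgr.mul hcz).mul hmz)] at h1
  have h3 := levi_mul_conj_mul hgr hgr hmz (Filter.Eventually.of_forall hgh)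
    (Filter.Eventually.of_forall hgh) ξ
  simp only [hgw, sub_self, map_zero, add_zero, map_one, one_mul, mul_one] at h3
  generalize levi ξ (fun w => (1 + ℓ (w - z)) * (starRingEnd ℂ) (1 + ℓ (w - z))
    * sesq (M w) (u w) (u w)) z = Λ at h1 h3
  have hre : ∀ a, dirDeriv a (fun w => (sesq (M w) (u w) (u w)).re) z
      = (dirDeriv a (fun w => sesq (M w) (u w) (u w)) z).re := fun a =>
    dirDeriv_clm_comp Complex.reCLM (ContDiffAt.differentiableAt_top hmz) a
  have him : ∀ a, (dirDeriv a (fun w => sesq (M w) (u w) (u w)) z).im = 0 := fun a => by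
    have h4 : dirDeriv a (fun w => (sesq (M w) (u w) (u w)).im) z
        = (dirDeriv a (fun w => sesq (M w) (u w) (u w)) z).im :=
      dirDeriv_clm_comp Complex.imCLM (ContDiffAt.differentiableAt_top hmz) a
    have h5 : (fun w => (sesq (M w) (u w) (u w)).im) =ᶠ[𝓝 z] fun _ => 0 := by
      filter_upwards [hO.mem_nhds hz] with w hw
      exact Complex.conj_eq_iff_im.1 (sesq_conj_symm (hP w hw).isHermitian _ _)
    rw [← h4, (dirDeriv_congr h5 a).self_of_nhds]
    simp [dirDeriv]
  rw [levi_re hmz, hre, hre]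
  have h6 := congrArg Complex.re h3
  simp only [wirt, wirtBar, Complex.add_re, Complex.mul_re, Complex.mul_im, Complex.sub_re,
    Complex.sub_im, Complex.add_im, Complex.conj_re, Complex.conj_im, Complex.I_re, Complex.I_im,
    him, μ] at h6
  norm_num at h6
  nlinarith

end Log

/-! ### Change of charts -/

section Charts
variable {n : ℕ} {X : Type*} [TopologicalSpace X] [ChartedSpace (Cn n) X]

section Transfer
variable [IsManifold 𝓘(ℂ, Cn n) ω X]

theorem mem_maximalAtlas {e : OpenPartialHomeomorph X (Cn n)} (he : e ∈ atlas (Cn n) X) :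
    e ∈ IsManifold.maximalAtlas 𝓘(ℂ, Cn n) ω X :=
  StructureGroupoid.subset_maximalAtlas _ he

/-- Coordinate changes are holomorphic. -/
theorem contDiffOn_coordChange {e e' : OpenPartialHomeomorph X (Cn n)} (he : e ∈ atlas (Cn n) X)
    (he' : e' ∈ atlas (Cn n) X) :
    ContDiffOn ℂ ω (fun y => e' (e.symm y)) (chartSet e e'.source) := by
  rw [← contMDiffOn_iff_contDiffOn]
  exact (contMDiffOn_of_mem_maximalAtlas (mem_maximalAtlas he')).comp
    ((contMDiffOn_symm_of_mem_maximalAtlas (mem_maximalAtlas he)).mono Set.inter_subset_left)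
    fun y hy => hy.2

/-- Smoothness of metrics is real smoothness, and the holomorphic atlas is also a smooth one because
its coordinate changes are smooth. -/
theorem isManifold_real : IsManifold 𝓘(ℝ, Cn n) ∞ X := by
  refine isManifold_of_contDiffOn _ _ _ fun e e' he he' => ?_
  have := contDiffOn_real_of_complex (contDiffOn_coordChange (X := X) he he')
  refine (this.mono ?_).congr ?_
  · intro y hy
    simpa [chartSet] using hy
  · intro y hy
    simp

theorem mem_maximalAtlas_real {e : OpenPartialHomeomorph X (Cn n)} (he : e ∈ atlas (Cn n) X) :
    haveI := isManifold_real (n := n) (X := X)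
    e ∈ IsManifold.maximalAtlas 𝓘(ℝ, Cn n) ∞ X :=
  haveI := isManifold_real (n := n) (X := X)
  StructureGroupoid.subset_maximalAtlas _ he

theorem contDiffOn_of_contMDiffOn {G : Type*} [NormedAddCommGroup G] [NormedSpace ℝ G] {f : X → G}
    {W : Set X} (hf : ContMDiffOn 𝓘(ℝ, Cn n) 𝓘(ℝ, G) ∞ f W)
    {e : OpenPartialHomeomorph X (Cn n)} (he : e ∈ atlas (Cn n) X) :
    ContDiffOn ℝ ∞ (fun y => f (e.symm y)) (chartSet e W) := by
  rw [← contMDiffOn_iff_contDiffOn]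
  exact hf.comp ((contMDiffOn_symm_of_mem_maximalAtlas (mem_maximalAtlas_real he)).mono
    Set.inter_subset_left) fun y hy => hy.2

theorem contMDiffOn_of_contDiffOn {G : Type*} [NormedAddCommGroup G] [NormedSpace ℝ G] {f : X → G}
    {W : Set X} {e : OpenPartialHomeomorph X (Cn n)} (he : e ∈ atlas (Cn n) X) (hWe : W ⊆ e.source)
    (hf : ContDiffOn ℝ ∞ (fun y => f (e.symm y)) (chartSet e W)) :
    ContMDiffOn 𝓘(ℝ, Cn n) 𝓘(ℝ, G) ∞ f W := by
  rw [← contMDiffOn_iff_contDiffOn] at hf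
  refine (hf.comp ((contMDiffOn_of_mem_maximalAtlas (mem_maximalAtlas_real he)).mono hWe)
    fun x hx => ⟨e.map_source (hWe hx), ?_⟩).congr fun x hx => ?_
  · rw [Set.mem_preimage, e.left_inv (hWe hx)]
    exact hx
  · simp [e.left_inv (hWe hx)]

/-- Non-negativity of the Levi form does not depend on the chart. -/
theorem levi_nonneg_of_chart {G : X → ℝ} {W : Set X} (hW : IsOpen W)
    {e e' : OpenPartialHomeomorph X (Cn n)} (he : e ∈ atlas (Cn n) X) (he' : e' ∈ atlas (Cn n) X)
    (hWe : W ⊆ e.source) (hG : ContDiffOn ℝ ∞ (fun y => G (e.symm y)) (chartSet e W))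
    (hl : ∀ y ∈ chartSet e W, ∀ ξ, 0 ≤ levi ξ (fun y => G (e.symm y)) y) :
    ContDiffOn ℝ ∞ (fun y => G (e'.symm y)) (chartSet e' W) ∧
      ∀ y ∈ chartSet e' W, ∀ ξ, 0 ≤ levi ξ (fun y => G (e'.symm y)) y := by
  have hτ := contDiffOn_coordChange (X := X) he' he
  have hO := isOpen_chartSet e hW
  have hO' := isOpen_chartSet e' hW
  have hs : chartSet e' W ⊆ chartSet e' e.source := fun y hy => ⟨hy.1, hWe hy.2⟩
  have hm : ∀ y ∈ chartSet e' W, e (e'.symm y) ∈ chartSet e W := fun y hy =>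
    ⟨e.map_source (hWe hy.2), by rw [Set.mem_preimage, e.left_inv (hWe hy.2)]; exact hy.2⟩
  have hτ' := (hτ.mono hs)
  have heq : Set.EqOn (fun y => G (e'.symm y)) (fun y => G (e.symm (e (e'.symm y))))
      (chartSet e' W) := fun y hy => by
    simp only [e.left_inv (hWe hy.2)]
  have hsm := (hG.comp (contDiffOn_real_of_complex hτ') hm).congr heq
  refine ⟨hsm, fun y hy ξ => ?_⟩
  rw [(levi_congr (heq.eventuallyEq_of_mem (hO'.mem_nhds hy)) ξ).self_of_nhds]
  rw [levi_comp_holomorphic (τ := fun y => e (e'.symm y)) (g := fun y => G (e.symm y))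
    ((contDiffOn_real_of_complex hτ').contDiffAt (hO'.mem_nhds hy)) ?_
    (hG.contDiffAt (hO.mem_nhds (hm y hy)))]
  · exact hl _ (hm y hy) _
  · filter_upwards [hO'.mem_nhds hy] with w hw
    exact (hτ'.contDiffAt (hO'.mem_nhds hw)).differentiableAt (by simp)

end Transfer

section AE

/-- A property that holds almost everywhere near every point, in some chart, holds almost
everywhere. -/
theorem aeOn_of_local [IsManifold 𝓘(ℂ, Cn n) ω X] {U : Set X}
    {P : X → Prop}
    (h : ∀ x ∈ U, ∃ e ∈ atlas (Cn n) X, ∃ W : Set X, IsOpen W ∧ x ∈ W ∧ W ⊆ e.source ∧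
      ∀ᵐ y, y ∈ chartSet e (W ∩ U) → P (e.symm y)) : AEOn n U P := by
  intro e' he'
  rw [ae_iff]
  refine measure_null_of_locally_null _ fun y hy => ?_
  simp only [Set.mem_ofPred_eq, Classical.not_imp] at hy
  obtain ⟨e, he, W, hW, hxW, hWe, hae⟩ := h (e'.symm y) hy.1.2
  refine ⟨_, inter_mem_nhdsWithin _ ((isOpen_chartSet e' hW).mem_nhds ⟨hy.1.1, hxW⟩), ?_⟩
  rw [ae_iff] at hae
  -- The exceptional set is carried from the chart `e` to `e'` by a coordinate change, and
  -- differentiable maps between spaces of equal dimension preserve null sets.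
  have hd : DifferentiableOn ℝ (fun z => e' (e.symm z))
      ({z | ¬ (z ∈ chartSet e (W ∩ U) → P (e.symm z))} ∩ chartSet e e'.source) := by
    have h1 := contDiffOn_real_of_complex (contDiffOn_coordChange (X := X) he he')
    exact (h1.differentiableOn (by simp)).mono Set.inter_subset_right
  have := addHaar_image_eq_zero_of_differentiableOn_of_addHaar_eq_zero volume hd
    (measure_mono_null Set.inter_subset_left hae)
  refine measure_mono_null (fun w hw => ?_) this
  simp only [Set.mem_inter_iff, Set.mem_ofPred_eq, Classical.not_imp] at hw
  obtain ⟨⟨hw1, hw2⟩, hw3⟩ := hw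
  have hws := hWe hw3.2
  refine ⟨e (e'.symm w), ⟨?_, e.map_source hws, ?_⟩, ?_⟩
  · simp only [Set.mem_ofPred_eq, Classical.not_imp, chartSet, Set.mem_inter_iff, Set.mem_preimage,
      e.left_inv hws]
    exact ⟨⟨e.map_source hws, hw3.2, hw1.2⟩, hw2⟩
  · rw [Set.mem_preimage, e.left_inv hws]
    exact e'.map_target hw1.1
  · simp only [e.left_inv hws, e'.right_inv hw1.1]

end AE

end Charts

set_option linter.unusedSectionVars false

/-! ### Sections in trivializations -/

section Coordinates
variable {n : ℕ} {X : Type*} [TopologicalSpace X] [ChartedSpace (Cn n) X]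
variable {F : Type*} [NormedAddCommGroup F] [NormedSpace ℂ F] [FiniteDimensional ℂ F]
variable {V : X → Type*} [∀ x, AddCommGroup (V x)] [∀ x, Module ℂ (V x)]
  [TopologicalSpace (TotalSpace F V)] [∀ x, TopologicalSpace (V x)] [FiberBundle F V]

/-- Coordinates on the fibres in a trivialization. -/
def fcoord (t : Trivialization F (TotalSpace.proj : TotalSpace F V → X)) [t.IsLinear ℂ] (x : X) :
    V x →ₗ[ℂ] (Fin (Module.finrank ℂ F) → ℂ) :=
  (Module.finBasis ℂ F).equivFun.toLinearMap ∘ₗ t.linearMapAt ℂ x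

/-- The vector with given coordinates in a trivialization. -/
def flift (t : Trivialization F (TotalSpace.proj : TotalSpace F V → X)) [t.IsLinear ℂ] (x : X) :
    (Fin (Module.finrank ℂ F) → ℂ) →ₗ[ℂ] V x :=
  t.symmₗ ℂ x ∘ₗ (Module.finBasis ℂ F).equivFun.symm.toLinearMap

variable {t : Trivialization F (TotalSpace.proj : TotalSpace F V → X)} [t.IsLinear ℂ]

theorem fcoord_flift {x : X} (hx : x ∈ t.baseSet) (c : Fin (Module.finrank ℂ F) → ℂ) :
    fcoord t x (flift t x c) = c := by
  simp only [fcoord, flift, LinearMap.coe_comp, Function.comp_apply, LinearEquiv.coe_coe,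
    t.linearMapAt_symmₗ hx, LinearEquiv.apply_symm_apply]

theorem flift_fcoord {x : X} (hx : x ∈ t.baseSet) (v : V x) : flift t x (fcoord t x v) = v := by
  simp only [fcoord, flift, LinearMap.coe_comp, Function.comp_apply, LinearEquiv.coe_coe,
    LinearEquiv.symm_apply_apply]
  exact t.symmₗ_linearMapAt hx v

theorem fcoord_eq_zero_iff {x : X} (hx : x ∈ t.baseSet) {v : V x} : fcoord t x v = 0 ↔ v = 0 :=
  ⟨fun h => by rw [← flift_fcoord hx v, h, map_zero], fun h => by rw [h, map_zero]⟩

theorem flift_eq_zero_iff {x : X} (hx : x ∈ t.baseSet) {c : Fin (Module.finrank ℂ F) → ℂ} :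
    flift t x c = 0 ↔ c = 0 :=
  ⟨fun h => by rw [← fcoord_flift hx c, h, map_zero], fun h => by rw [h, map_zero]⟩

variable [IsManifold 𝓘(ℂ, Cn n) ω X] [VectorBundle ℂ F V] [ContMDiffVectorBundle ω F V 𝓘(ℂ, Cn n)]

theorem isHolomorphicSectionOn_iff {s : ∀ x, V x} {W : Set X} (hW : IsOpen W)
    [MemTrivializationAtlas t] (ht : W ⊆ t.baseSet) :
    IsHolomorphicSectionOn n F s W ↔
      ContMDiffOn 𝓘(ℂ, Cn n) 𝓘(ℂ, Fin (Module.finrank ℂ F) → ℂ) ω (fun x => fcoord t x (s x)) W := by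
  rw [IsHolomorphicSectionOn, t.contMDiffOn_section_iff hW ht]
  have hb : ∀ x ∈ W, fcoord t x (s x) = (Module.finBasis ℂ F).equivFunL (t ⟨x, s x⟩).2 := by
    intro x hx
    simp only [fcoord, LinearMap.coe_comp, Function.comp_apply, LinearEquiv.coe_coe,
      t.linearMapAt_apply, if_pos (ht hx)]
    rfl
  constructor
  · intro h
    exact ((Module.finBasis ℂ F).equivFunL.contDiff.contMDiff.comp_contMDiffOn h).congr hb
  · intro h
    refine ((Module.finBasis ℂ F).equivFunL.symm.contDiff.contMDiff.comp_contMDiffOn h).congr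
      fun x hx => ?_
    simp [hb x hx]

/-- The coordinates of a holomorphic section are holomorphic functions in every chart. -/
theorem IsHolomorphicSectionOn.contDiffOn_fcoord {s : ∀ x, V x} {W : Set X} (hW : IsOpen W)
    [MemTrivializationAtlas t] (ht : W ⊆ t.baseSet) (hs : IsHolomorphicSectionOn n F s W)
    {e : OpenPartialHomeomorph X (Cn n)} (he : e ∈ atlas (Cn n) X) :
    ContDiffOn ℂ ω (fun y => fcoord t (e.symm y) (s (e.symm y))) (chartSet e W) := by
  rw [← contMDiffOn_iff_contDiffOn]
  exact ((isHolomorphicSectionOn_iff hW ht).1 hs).comp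
    ((contMDiffOn_symm_of_mem_maximalAtlas (mem_maximalAtlas he)).mono Set.inter_subset_left)
    fun y hy => hy.2

theorem isHolomorphicSectionOn_of_contDiffOn {s : ∀ x, V x} {W : Set X} (hW : IsOpen W)
    [MemTrivializationAtlas t] (ht : W ⊆ t.baseSet)
    {e : OpenPartialHomeomorph X (Cn n)} (he : e ∈ atlas (Cn n) X) (hWe : W ⊆ e.source)
    (hs : ContDiffOn ℂ ω (fun y => fcoord t (e.symm y) (s (e.symm y))) (chartSet e W)) :
    IsHolomorphicSectionOn n F s W := by
  rw [isHolomorphicSectionOn_iff hW ht]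
  rw [← contMDiffOn_iff_contDiffOn] at hs
  refine (hs.comp ((contMDiffOn_of_mem_maximalAtlas (mem_maximalAtlas he)).mono hWe)
    fun x hx => ⟨e.map_source (hWe hx), ?_⟩).congr fun x hx => ?_
  · rw [Set.mem_preimage, e.left_inv (hWe hx)]
    exact hx
  · exact congrArg (fun z => fcoord t z (s z)) (e.left_inv (hWe hx)).symm


/-- A vector of holomorphic functions defines a holomorphic section. -/
theorem isHolomorphicSectionOn_flift [MemTrivializationAtlas t]
    {e : OpenPartialHomeomorph X (Cn n)} (he : e ∈ atlas (Cn n) X) {Ω : Set (Cn n)}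
    (hO : IsOpen Ω) (hΩ : Ω ⊆ chartSet e t.baseSet)
    {u : Cn n → Fin (Module.finrank ℂ F) → ℂ} (hu : ContDiffOn ℂ ω u Ω) :
    IsHolomorphicSectionOn n F (fun x => flift t x (u (e x))) (e.source ∩ e ⁻¹' Ω) := by
  have hb : e.source ∩ e ⁻¹' Ω ⊆ t.baseSet := fun x hx => by
    have := (hΩ hx.2).2
    rwa [Set.mem_preimage, e.left_inv hx.1] at this
  refine isHolomorphicSectionOn_of_contDiffOn (e.isOpen_inter_preimage hO) hb he
    Set.inter_subset_left ?_
  have hs : chartSet e (e.source ∩ e ⁻¹' Ω) ⊆ Ω := fun y hy => by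
    have := hy.2.2
    rwa [Set.mem_preimage, e.right_inv hy.1] at this
  refine (hu.mono hs).congr fun y hy => ?_
  simp only [fcoord_flift (hb hy.2), e.right_inv hy.1]

/-- Holomorphic combinations of holomorphic sections are holomorphic. -/
theorem isHolomorphicSectionOn_sum {ι : Type*} [Fintype ι] {W : Set X}
    {f : ι → ∀ x, V x} (hf : ∀ i, IsHolomorphicSectionOn n F (f i) W) 
    {e : OpenPartialHomeomorph X (Cn n)} (he : e ∈ atlas (Cn n) X) {c : ι → Cn n → ℂ}
    (hc : ∀ i, ContDiffOn ℂ ω (c i) (chartSet e W)) :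
    IsHolomorphicSectionOn n F (fun x => ∑ i, c i (e x) • f i x) (W ∩ e.source) := by
  have h1 : ∀ i, ContMDiffOn 𝓘(ℂ, Cn n) 𝓘(ℂ, ℂ) ω (fun x => c i (e x)) (W ∩ e.source) := by
    intro i
    have := hc i
    rw [← contMDiffOn_iff_contDiffOn] at this
    refine this.comp ((contMDiffOn_of_mem_maximalAtlas (mem_maximalAtlas he)).mono
      Set.inter_subset_right) fun x hx => ⟨e.map_source hx.2, ?_⟩
    rw [Set.mem_preimage, e.left_inv hx.2]
    exact hx.1
  exact ContMDiffOn.sum_section fun i _ => (h1 i).smul_section ((hf i).mono Set.inter_subset_left)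

/-- The identity theorem: a section that does not vanish identically near a point has, on a
coordinate ball around that point, a dense set of points where it does not vanish. -/
theorem exists_ball_section_ne_zero [MemTrivializationAtlas t] {U : Set X} (hU : IsOpen U) {x : X} 
    {s : ∀ x, V x} (hs : IsHolomorphicSectionOn n F s U) (hne : ¬ ∀ᶠ y in 𝓝 x, s y = 0)
    {e : OpenPartialHomeomorph X (Cn n)} (he : e ∈ atlas (Cn n) X) (hx : x ∈ e.source)
    {R : ℝ} (hR : 0 < R) (hball : Metric.ball (e x) R ⊆ chartSet e (U ∩ t.baseSet))
    {z : Cn n} (hz : z ∈ Metric.ball (e x) R) : ∃ᶠ w in 𝓝 z, s (e.symm w) ≠ 0 := by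
  intro hev
  simp only [not_not] at hev
  have hc := (IsHolomorphicSectionOn.contDiffOn_fcoord (t := t) (s := s) (hU.inter t.open_baseSet)
    Set.inter_subset_right (ContMDiffOn.mono hs Set.inter_subset_left) he).mono hball
  have han : AnalyticOnNhd ℂ (fun y => fcoord t (e.symm y) (s (e.symm y))) (Metric.ball (e x) R) :=
    (Metric.isOpen_ball.analyticOn_iff_analyticOnNhd).1 hc.analyticOn
  -- By the identity theorem on the ball, which is convex and hence connected, vanishing near `z`
  -- spreads to a neighbourhood of the centre, against the hypothesis on the germ at `x`.
  have h0 := han.eqOn_zero_of_preconnected_of_eventuallyEq_zero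
    (convex_ball _ _).isPreconnected hz (by
      filter_upwards [hev] with w hw
      simp [hw])
  apply hne
  have h1 : ∀ᶠ y in 𝓝 x, e y ∈ Metric.ball (e x) R :=
    (e.continuousAt hx).eventually (Metric.ball_mem_nhds _ hR)
  filter_upwards [h1, e.open_source.mem_nhds hx] with y hy hys
  have h2 : fcoord t (e.symm (e y)) (s (e.symm (e y))) = 0 := h0 hy
  have h3 : e.symm (e y) ∈ t.baseSet := (hball hy).2.2
  rw [fcoord_eq_zero_iff h3] at h2
  rwa [e.left_inv hys] at h2

/-- By the identity theorem on a coordinate ball, the germ of the section is non-zero at all points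
near `x`. Trace conditions speak of non-zero germs only, so this is what allows their use at each of
these points. -/
theorem frequently_section_ne_zero {U : Set X} (hU : IsOpen U) {x : X} (hx : x ∈ U)
    {s : ∀ x, V x} (hs : IsHolomorphicSectionOn n F s U) (hne : ¬ ∀ᶠ y in 𝓝 x, s y = 0) :
    ∃ W : Set X, IsOpen W ∧ x ∈ W ∧ W ⊆ U ∧ ∀ y ∈ W, ∃ᶠ w in 𝓝 y, s w ≠ 0 := by
  set e := chartAt (Cn n) x
  set t := trivializationAt F V x
  have he : e ∈ atlas (Cn n) X := chart_mem_atlas _ x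
  have hxe : x ∈ e.source := mem_chart_source _ x
  have hO := isOpen_chartSet e (hU.inter t.open_baseSet)
  obtain ⟨R, hR, hball⟩ := Metric.isOpen_iff.1 hO (e x) ⟨e.map_source hxe, by
    rw [Set.mem_preimage, e.left_inv hxe]
    exact ⟨hx, FiberBundle.mem_baseSet_trivializationAt' x⟩⟩
  refine ⟨e.source ∩ e ⁻¹' Metric.ball (e x) R, e.isOpen_inter_preimage Metric.isOpen_ball,
    ⟨hxe, Metric.mem_ball_self hR⟩, fun y hy => ?_, fun y hy => ?_⟩
  · have := (hball hy.2).2.1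
    rwa [e.left_inv hy.1] at this
  · have := exists_ball_section_ne_zero (t := t) hU hs hne he hxe hR hball hy.2
    have h2 : Filter.Tendsto e.symm (𝓝 (e y)) (𝓝 y) := by
      have := e.continuousAt_symm (e.map_source hy.1)
      rwa [ContinuousAt, e.left_inv hy.1] at this
    exact h2.frequently this

end Coordinates

/-! ### Sesquilinear forms from matrices -/

section Forms
variable {r : ℕ} {E' : Type*} [AddCommGroup E'] [Module ℂ E']

/-- The sesquilinear form with matrix `M` in the coordinates `D`. -/
def formOf (M : Matrix (Fin r) (Fin r) ℂ) (D : E' →ₗ[ℂ] (Fin r → ℂ)) : E' →ₗ[ℂ] E' →ₗ⋆[ℂ] ℂ :=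
  LinearMap.mk₂'ₛₗ (RingHom.id ℂ) (starRingEnd ℂ) (fun v w => sesq M (D v) (D w))
    (fun v v' w => by rw [map_add, sesq_add_left])
    (fun c v w => by rw [map_smul, sesq_smul_left]; rfl)
    (fun v w w' => by rw [map_add, sesq_add_right])
    (fun c v w => by rw [map_smul, sesq_smul_right]; rfl)

theorem formOf_apply (M : Matrix (Fin r) (Fin r) ℂ) (D : E' →ₗ[ℂ] (Fin r → ℂ)) (v w : E') :
    formOf M D v w = sesq M (D v) (D w) := rfl

theorem ContDiffOn.sesq {n : ℕ} {M : Cn n → Matrix (Fin r) (Fin r) ℂ} {Ω : Set (Cn n)}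
    {u v : Cn n → Fin r → ℂ} (hM : ∀ a b, ContDiffOn ℝ ∞ (fun z => M z a b) Ω)
    (hu : ContDiffOn ℝ ∞ u Ω) (hv : ContDiffOn ℝ ∞ v Ω) :
    ContDiffOn ℝ ∞ (fun z => SingHerm.sesq (M z) (u z) (v z)) Ω := by
  simp only [SingHerm.sesq]
  have h1 : ∀ b, ContDiffOn ℝ ∞ (fun z => (starRingEnd ℂ) (v z b)) Ω := fun b =>
    Complex.conjCLE.contDiff.comp_contDiffOn (contDiffOn_pi.1 hv b)
  exact ContDiffOn.sum fun a _ => ContDiffOn.sum fun b _ =>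
    ((contDiffOn_pi.1 hu a).mul (h1 b)).mul (hM a b)

end Forms

/-! ### Coefficients of Hermitian metrics in charts -/

section Manifold
variable {n : ℕ} {X : Type*} [TopologicalSpace X] [ChartedSpace (Cn n) X]
  [IsManifold 𝓘(ℂ, Cn n) ω X]

theorem mdifferentiable_of_mem_atlas_complex {e : OpenPartialHomeomorph X (Cn n)}
    (he : e ∈ atlas (Cn n) X) : e.MDifferentiable 𝓘(ℂ, Cn n) 𝓘(ℂ, Cn n) := by
  have : IsManifold 𝓘(ℂ, Cn n) 1 X := IsManifold.of_le (n := ω) le_top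
  exact mdifferentiable_of_mem_atlas he

/-- The coordinate vector fields of a chart. -/
def coordField (e : OpenPartialHomeomorph X (Cn n)) (ξ : Cn n) (x : X) :
    TangentSpace 𝓘(ℂ, Cn n) x :=
  (mfderiv 𝓘(ℂ, Cn n) 𝓘(ℂ, Cn n) e.symm (e x) ξ : Cn n)

theorem isHolomorphicSectionOn_coordField {e : OpenPartialHomeomorph X (Cn n)}
    (he : e ∈ atlas (Cn n) X) (ξ : Cn n) :
    IsHolomorphicSectionOn n (Cn n) (E := fun x : X => TangentSpace 𝓘(ℂ, Cn n) x)
      (coordField e ξ) e.source := by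
  have h1 : ContMDiff 𝓘(ℂ, Cn n) (𝓘(ℂ, Cn n).prod 𝓘(ℂ, Cn n)) ω
      (fun y : Cn n => (TotalSpace.mk' (Cn n) y ξ : TangentBundle 𝓘(ℂ, Cn n) (Cn n))) := fun y =>
    contMDiffAt_vectorSpace_iff_contDiffAt.2 contDiffAt_const
  have h2 := ContMDiffOn.contMDiffOn_tangentMapWithin (m := ω) (n := ω)
    (contMDiffOn_symm_of_mem_maximalAtlas (mem_maximalAtlas he)) (by simp)
    e.open_target.uniqueMDiffOn
  have h3 := h2.comp (h1.comp_contMDiffOn (contMDiffOn_of_mem_maximalAtlas (mem_maximalAtlas he)))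
    fun x hx => e.map_source hx
  refine h3.congr fun x hx => ?_
  simp only [Function.comp_apply, tangentMapWithin]
  rw [mfderivWithin_of_isOpen e.open_target (e.map_source hx)]
  exact congrArg (fun z : X => (TotalSpace.mk' (Cn n) z (coordField e ξ x : Cn n) :
    TangentBundle 𝓘(ℂ, Cn n) X)) (e.left_inv hx).symm

/-- Holomorphic vector fields have holomorphic components in a chart. -/
theorem contMDiffOn_mfderiv_chart {e : OpenPartialHomeomorph X (Cn n)}
    (he : e ∈ atlas (Cn n) X) {W : Set X} (hWe : W ⊆ e.source) 
    {s : ∀ x : X, TangentSpace 𝓘(ℂ, Cn n) x}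
    (hs : IsHolomorphicSectionOn n (Cn n) (E := fun x : X => TangentSpace 𝓘(ℂ, Cn n) x) s W) :
    ContMDiffOn 𝓘(ℂ, Cn n) 𝓘(ℂ, Cn n) ω
      (fun x => (mfderiv 𝓘(ℂ, Cn n) 𝓘(ℂ, Cn n) e x (s x) : Cn n)) W := by
  have h2 := ContMDiffOn.contMDiffOn_tangentMapWithin (m := ω) (n := ω)
    (contMDiffOn_of_mem_maximalAtlas (mem_maximalAtlas he)) (by simp)
    e.open_source.uniqueMDiffOn
  have h3 := h2.comp hs fun x hx => hWe hx
  refine ((contMDiff_snd_tangentBundle_modelSpace (Cn n) 𝓘(ℂ, Cn n)).comp_contMDiffOn h3).congr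
    fun x hx => ?_
  change _ = (mfderivWithin 𝓘(ℂ, Cn n) 𝓘(ℂ, Cn n) e e.source x (s x) : Cn n)
  rw [mfderivWithin_of_isOpen e.open_source (hWe hx)]

theorem contDiffOn_comp_symm_complex {G : Type*} [NormedAddCommGroup G] [NormedSpace ℂ G] {f : X → G}
    {W : Set X} (hf : ContMDiffOn 𝓘(ℂ, Cn n) 𝓘(ℂ, G) ω f W)
    {e : OpenPartialHomeomorph X (Cn n)} (he : e ∈ atlas (Cn n) X) :
    ContDiffOn ℂ ω (fun y => f (e.symm y)) (chartSet e W) := by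
  rw [← contMDiffOn_iff_contDiffOn]
  exact hf.comp ((contMDiffOn_symm_of_mem_maximalAtlas (mem_maximalAtlas he)).mono
    Set.inter_subset_left) fun y hy => hy.2

/-- The constant Hermitian form `A` in the chart `e`. -/
def chartForm (e : OpenPartialHomeomorph X (Cn n)) (A : Matrix (Fin n) (Fin n) ℂ) (x : X) :
    TangentSpace 𝓘(ℂ, Cn n) x →ₗ[ℂ] TangentSpace 𝓘(ℂ, Cn n) x →ₗ⋆[ℂ] ℂ :=
  formOf A ((WithLp.linearEquiv 2 ℂ (Fin n → ℂ)).toLinearMap ∘ₗ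
    (mfderiv 𝓘(ℂ, Cn n) 𝓘(ℂ, Cn n) e x :
      TangentSpace 𝓘(ℂ, Cn n) x →L[ℂ] TangentSpace 𝓘(ℂ, Cn n) (e x)).toLinearMap)

theorem chartForm_apply (e : OpenPartialHomeomorph X (Cn n)) (A : Matrix (Fin n) (Fin n) ℂ) (x : X)
    (v w : TangentSpace 𝓘(ℂ, Cn n) x) : chartForm e A x v w =
      sesq A (WithLp.ofLp (mfderiv 𝓘(ℂ, Cn n) 𝓘(ℂ, Cn n) e x v : Cn n))
        (WithLp.ofLp (mfderiv 𝓘(ℂ, Cn n) 𝓘(ℂ, Cn n) e x w : Cn n)) := rfl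

theorem contMDiffOn_chartForm {e : OpenPartialHomeomorph X (Cn n)}
    (he : e ∈ atlas (Cn n) X) (A : Matrix (Fin n) (Fin n) ℂ) {W : Set X} (hWe : W ⊆ e.source) 
    {s t : ∀ x : X, TangentSpace 𝓘(ℂ, Cn n) x}
    (hs : IsHolomorphicSectionOn n (Cn n) (E := fun x : X => TangentSpace 𝓘(ℂ, Cn n) x) s W)
    (ht : IsHolomorphicSectionOn n (Cn n) (E := fun x : X => TangentSpace 𝓘(ℂ, Cn n) x) t W) :
    ContMDiffOn 𝓘(ℝ, Cn n) 𝓘(ℝ, ℂ) ∞ (fun x => chartForm e A x (s x) (t x)) W := by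
  have h : ∀ {s : ∀ x : X, TangentSpace 𝓘(ℂ, Cn n) x}, 
      IsHolomorphicSectionOn n (Cn n) (E := fun x : X => TangentSpace 𝓘(ℂ, Cn n) x) s W →
      ContDiffOn ℝ ∞ (fun y => WithLp.ofLp
        (mfderiv 𝓘(ℂ, Cn n) 𝓘(ℂ, Cn n) e (e.symm y) (s (e.symm y)) : Cn n)) (chartSet e W) := by
    intro s hs
    have h1 := contDiffOn_real_of_complex
      (contDiffOn_comp_symm_complex (contMDiffOn_mfderiv_chart he hWe hs) he)
    exact (PiLp.continuousLinearEquiv 2 ℝ (fun _ : Fin n => ℂ)).contDiff.comp_contDiffOn h1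
  refine contMDiffOn_of_contDiffOn he hWe ?_
  simp only [chartForm_apply]
  exact ContDiffOn.sesq (M := fun _ => A) (fun a b => contDiffOn_const) (h hs) (h ht)

theorem mfderiv_chart_symm {e : OpenPartialHomeomorph X (Cn n)} (he : e ∈ atlas (Cn n) X)
    {y : Cn n} (hy : y ∈ e.target) (ξ : Cn n) :
    mfderiv 𝓘(ℂ, Cn n) 𝓘(ℂ, Cn n) e (e.symm y) (mfderiv 𝓘(ℂ, Cn n) 𝓘(ℂ, Cn n) e.symm y ξ) = ξ :=
  congrArg (fun L : Cn n →L[ℂ] Cn n => L ξ)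
    ((mdifferentiable_of_mem_atlas_complex he).comp_symm_deriv hy)

namespace HermitianMetric
variable (g : HermitianMetric n X)

theorem coeff_eq {e : OpenPartialHomeomorph X (Cn n)} {y : Cn n} (hy : y ∈ e.target) (j k : Fin n) :
    g.coeff e y j k = g.form (e.symm y) (coordField e (EuclideanSpace.single j 1) (e.symm y))
      (coordField e (EuclideanSpace.single k 1) (e.symm y)) := by
  have h : ∀ ξ : Cn n, mfderiv 𝓘(ℂ, Cn n) 𝓘(ℂ, Cn n) e.symm y ξ = coordField e ξ (e.symm y) := by
    intro ξ
    have : ∀ y', y' = y → ((mfderiv 𝓘(ℂ, Cn n) 𝓘(ℂ, Cn n) e.symm y ξ : Cn n) =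
      (mfderiv 𝓘(ℂ, Cn n) 𝓘(ℂ, Cn n) e.symm y' ξ : Cn n)) := by
      rintro _ rfl
      rfl
    exact this _ (e.right_inv hy)
  rw [coeff, Matrix.of_apply, h, h]

/-- The coordinate vector fields are holomorphic sections of the tangent bundle, and a smooth metric
has smooth values on such sections. -/
theorem contDiffOn_coeff {e : OpenPartialHomeomorph X (Cn n)} (he : e ∈ atlas (Cn n) X)
    (j k : Fin n) : ContDiffOn ℝ ∞ (fun y => g.coeff e y j k) e.target := by
  have h := contDiffOn_of_contMDiffOn (g.isSmooth.smooth e.source e.open_source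
    (Set.subset_univ _) _ _ (isHolomorphicSectionOn_coordField he (EuclideanSpace.single j 1))
    (isHolomorphicSectionOn_coordField he (EuclideanSpace.single k 1))) he
  refine (h.mono fun y hy => ⟨hy, e.map_target hy⟩).congr fun y hy => g.coeff_eq hy j k

theorem posDef_coeff {e : OpenPartialHomeomorph X (Cn n)} (he : e ∈ atlas (Cn n) X) {y : Cn n}
    (hy : y ∈ e.target) : (g.coeff e y).PosDef := by
  refine posDef_of_sesq ?_ fun c hc => ?_
  · ext j k
    rw [Matrix.conjTranspose_apply, coeff, Matrix.of_apply, Matrix.of_apply,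
      g.isSmooth.conj_symm _ (Set.mem_univ _) _ _, Complex.star_def, Complex.conj_conj]
  · have h1 : sesq (g.coeff e y) c c = g.form (e.symm y)
        (mfderiv 𝓘(ℂ, Cn n) 𝓘(ℂ, Cn n) e.symm y (WithLp.toLp 2 c))
        (mfderiv 𝓘(ℂ, Cn n) 𝓘(ℂ, Cn n) e.symm y (WithLp.toLp 2 c)) := by
      have h2 : (WithLp.toLp 2 c : Cn n) = ∑ j, c j • EuclideanSpace.single j (1 : ℂ) := by
        ext i
        simp [Pi.single_apply]
      have h3 : mfderiv 𝓘(ℂ, Cn n) 𝓘(ℂ, Cn n) e.symm y (WithLp.toLp 2 c : Cn n) =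
          ∑ j, c j • mfderiv 𝓘(ℂ, Cn n) 𝓘(ℂ, Cn n) e.symm y (EuclideanSpace.single j (1 : ℂ)) := by
        rw [h2]
        exact (map_sum _ _ _).trans (Finset.sum_congr rfl fun j _ => map_smul _ _ _)
      rw [h3]
      simp only [map_sum, LinearMap.sum_apply, map_smul, LinearMap.smul_apply, smul_eq_mul,
        map_smulₛₗ, Finset.mul_sum, sesq, coeff, Matrix.of_apply]
      rw [Finset.sum_comm]
      exact Finset.sum_congr rfl fun a _ => Finset.sum_congr rfl fun b _ => by ring
    rw [h1]
    refine g.isSmooth.pos _ (Set.mem_univ _) _ fun h0 => hc ?_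
    have h4 := mfderiv_chart_symm he hy (WithLp.toLp 2 c)
    rw [h0] at h4
    have h5 : (0 : Cn n) = WithLp.toLp 2 c := (map_zero
      (mfderiv 𝓘(ℂ, Cn n) 𝓘(ℂ, Cn n) e (e.symm y))).symm.trans h4
    simpa using congrArg WithLp.ofLp h5.symm

end HermitianMetric
end Manifold

/-! ### Gluing Hermitian metrics from charts -/

section Metric
variable {n : ℕ} {X : Type*} [TopologicalSpace X] [ChartedSpace (Cn n) X]
  [IsManifold 𝓘(ℂ, Cn n) ω X]

/-- The weighted sum of constant Hermitian forms in the charts. -/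
def weightedForm (A : Matrix (Fin n) (Fin n) ℂ)
    (ρ : SmoothPartitionOfUnity X 𝓘(ℝ, Cn n) X Set.univ) (x : X) :
    TangentSpace 𝓘(ℂ, Cn n) x →ₗ[ℂ] TangentSpace 𝓘(ℂ, Cn n) x →ₗ⋆[ℂ] ℂ :=
  ∑ i ∈ ρ.finsupport x, ((ρ i x : ℝ) : ℂ) • chartForm (chartAt (Cn n) i) A x

theorem weightedForm_apply (A : Matrix (Fin n) (Fin n) ℂ)
    (ρ : SmoothPartitionOfUnity X 𝓘(ℝ, Cn n) X Set.univ) (x : X)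
    (v w : TangentSpace 𝓘(ℂ, Cn n) x) : weightedForm A ρ x v w =
      ∑ i ∈ ρ.finsupport x, (ρ i x : ℝ) • chartForm (chartAt (Cn n) i) A x v w := by
  simp only [weightedForm, LinearMap.sum_apply, LinearMap.smul_apply, Complex.real_smul,
    smul_eq_mul]

/-- The metric glued from constant Hermitian forms in the charts. -/
def gluedMetric {A : Matrix (Fin n) (Fin n) ℂ} (hA : A.PosDef)
    {ρ : SmoothPartitionOfUnity X 𝓘(ℝ, Cn n) X Set.univ}
    (hρ : ρ.IsSubordinate fun i => (chartAt (Cn n) i).source) : HermitianMetric n X where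
  form := weightedForm A ρ
  isSmooth :=
    { conj_symm := fun x _ v w => by
        simp only [weightedForm_apply, map_sum, chartForm_apply, Complex.real_smul, map_mul,
          Complex.conj_ofReal, sesq_conj_symm hA.1]
      pos := fun x _ v hv => by
        have hi : ∀ i ∈ ρ.finsupport x, x ∈ (chartAt (Cn n) i).source := fun i hi =>
          hρ i (subset_tsupport _ (by simpa using hi))
        have hpos : ∀ i ∈ ρ.finsupport x,
            0 < (((ρ i x : ℝ) • chartForm (chartAt (Cn n) i) A x v v : ℂ)).re := by
          intro i hi'
          rw [Complex.real_smul, Complex.re_ofReal_mul]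
          have h0 : ρ i x ≠ 0 := by simpa using hi'
          refine mul_pos (lt_of_le_of_ne (ρ.nonneg i x) h0.symm) (sesq_self_pos hA fun h => hv ?_)
          refine (mdifferentiable_of_mem_atlas_complex
            (chart_mem_atlas (Cn n) i)).mfderiv_injective (hi i hi') ?_
          have h1 : (mfderiv 𝓘(ℂ, Cn n) 𝓘(ℂ, Cn n) (chartAt (Cn n) i) x v : Cn n) = 0 := by
            exact (WithLp.ofLp_injective 2) (h.trans (WithLp.ofLp_zero 2).symm)
          exact h1.trans (map_zero (mfderiv 𝓘(ℂ, Cn n) 𝓘(ℂ, Cn n) (chartAt (Cn n) i) x)).symm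
        obtain ⟨i, hi0⟩ := ρ.exists_pos_of_mem (Set.mem_univ x)
        rw [weightedForm_apply, Complex.re_sum]
        exact Finset.sum_pos hpos ⟨i, by simpa using hi0.ne'⟩
      smooth := fun W hW _ s t hs ht => by
        have := isManifold_real (n := n) (X := X)
        intro x hx
        have h1 : ContMDiffAt 𝓘(ℝ, Cn n) 𝓘(ℝ, ℂ) ∞
            (fun x => ∑ᶠ i, ρ i x • chartForm (chartAt (Cn n) i) A x (s x) (t x)) x := by
          refine ρ.contMDiffAt_finsum fun i hi => ?_
          have hW' := hW.inter (chartAt (Cn n) i).open_source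
          exact (contMDiffOn_chartForm (chart_mem_atlas (Cn n) i) A Set.inter_subset_right
            (ContMDiffOn.mono hs Set.inter_subset_left)
            (ContMDiffOn.mono ht Set.inter_subset_left)).contMDiffAt
              (hW'.mem_nhds ⟨hx, hρ i hi⟩)
        refine ContMDiffAt.contMDiffWithinAt (h1.congr_of_eventuallyEq
          (Filter.Eventually.of_forall fun y => ?_))
        refine (weightedForm_apply A ρ y _ _).trans ?_
        exact ρ.sum_finsupport_smul_eq_finsum y
          (fun i y => chartForm (chartAt (Cn n) i) A y (s y) (t y)) }

/-- Near every point of a chart there are Hermitian metrics with prescribed constant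
coefficients. -/
theorem exists_hermitianMetric_coeff_eq [T2Space X] [SecondCountableTopology X] (x₀ : X) {z : Cn n}
    (hz : z ∈ (chartAt (Cn n) x₀).target) {A : Matrix (Fin n) (Fin n) ℂ} (hA : A.PosDef) :
    ∃ (g : HermitianMetric n X) (ε : ℝ), 0 < ε ∧
      Metric.ball z ε ⊆ (chartAt (Cn n) x₀).target ∧
      ∀ y ∈ Metric.ball z ε, g.coeff (chartAt (Cn n) x₀) y = A := by
  have := isManifold_real (n := n) (X := X)
  have : LocallyCompactSpace X := ChartedSpace.locallyCompactSpace (Cn n) X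
  set e := chartAt (Cn n) x₀
  obtain ⟨ε, hε, hb⟩ := Metric.nhds_basis_closedBall.mem_iff.1 (e.open_target.mem_nhds hz)
  have hK : IsCompact (e.symm '' Metric.closedBall z ε) :=
    (isCompact_closedBall z ε).image_of_continuousOn (e.continuousOn_symm.mono hb)
  classical
  -- The covering sets with index other than `x₀` avoid the closed ball, so on the ball only the
  -- function with index `x₀` survives, and it equals one there. Points outside the source of `e`
  -- are covered by their own charts.
  obtain ⟨ρ, hρ⟩ := SmoothPartitionOfUnity.exists_isSubordinate 𝓘(ℝ, Cn n) isClosed_univ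
    (fun i => if i = x₀ then e.source else (chartAt (Cn n) i).source \ e.symm '' Metric.closedBall z ε)
    (fun i => by
      split_ifs
      · exact e.open_source
      · exact (chartAt (Cn n) i).open_source.sdiff hK.isClosed)
    (fun y _ => by
      rw [Set.mem_iUnion]
      by_cases hy : y ∈ e.source
      · exact ⟨x₀, by simpa using hy⟩
      · refine ⟨y, ?_⟩
        rw [if_neg (by
          rintro rfl
          exact hy (mem_chart_source (Cn n) y))]
        refine ⟨mem_chart_source (Cn n) y, ?_⟩
        rintro ⟨w, hw, rfl⟩
        exact hy (e.map_target (hb hw)))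
  have hρ' : ρ.IsSubordinate fun i => (chartAt (Cn n) i).source := fun i => by
    refine (hρ i).trans ?_
    dsimp only
    split_ifs with h
    · rw [h]
    · exact Set.sdiff_subset
  refine ⟨gluedMetric hA hρ', ε, hε, Metric.ball_subset_closedBall.trans hb, fun y hy => ?_⟩
  have hy' := Metric.ball_subset_closedBall hy
  have h0 : ∀ i, i ≠ x₀ → ρ i (e.symm y) = 0 := fun i hi => by
    by_contra h
    have := hρ i (subset_tsupport _ h)
    simp only [if_neg hi] at this
    exact this.2 ⟨y, hy', rfl⟩
  have h1 : ρ x₀ (e.symm y) = 1 := by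
    rw [← ρ.sum_eq_one (Set.mem_univ (e.symm y)), finsum_eq_single _ x₀ h0]
  have hs : ρ.finsupport (e.symm y) = {x₀} := by
    ext i
    rw [ρ.mem_finsupport, Finset.mem_singleton, Function.mem_support]
    refine ⟨fun h => by_contra fun hi => h (h0 i hi), ?_⟩
    rintro rfl
    rw [h1]
    exact one_ne_zero
  ext j k
  rw [HermitianMetric.coeff, Matrix.of_apply]
  change weightedForm A ρ _ _ _ = _
  rw [weightedForm_apply, hs, Finset.sum_singleton, h1, one_smul, chartForm_apply]
  have h2 := fun ξ => mfderiv_chart_symm (chart_mem_atlas (Cn n) x₀) (hb hy') ξ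
  rw [show (chartAt (Cn n) x₀) = e from rfl] at h2 ⊢
  have h3 : ∀ i : Fin n, WithLp.ofLp (mfderiv 𝓘(ℂ, Cn n) 𝓘(ℂ, Cn n) e (e.symm y)
      (mfderiv 𝓘(ℂ, Cn n) 𝓘(ℂ, Cn n) e.symm y (EuclideanSpace.single i (1 : ℂ))) : Cn n) =
      Pi.single i 1 := fun i => by
    rw [h2]
    rfl
  rw [h3, h3, sesq_single]

end Metric

/-! ### The adjugate of a positive definite matrix -/

section Adjugate
variable {n : ℕ}

theorem contDiffOn_det {m : Type*} [Fintype m] [DecidableEq m] {M : Cn n → Matrix m m ℂ}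
    {Ω : Set (Cn n)}
    (hM : ∀ a b, ContDiffOn ℝ ∞ (fun z => M z a b) Ω) : ContDiffOn ℝ ∞ (fun z => (M z).det) Ω := by
  simp only [Matrix.det_apply']
  exact ContDiffOn.sum fun σ _ => contDiffOn_const.mul (contDiffOn_prod fun i _ => hM _ _)

theorem contDiffOn_adjugate {m : Type*} [Fintype m] [DecidableEq m] {M : Cn n → Matrix m m ℂ}
    {Ω : Set (Cn n)}
    (hM : ∀ a b, ContDiffOn ℝ ∞ (fun z => M z a b) Ω) (i j : m) :
    ContDiffOn ℝ ∞ (fun z => (M z).adjugate i j) Ω := by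
  simp only [Matrix.adjugate_apply]
  refine contDiffOn_det fun a b => ?_
  by_cases ha : a = j
  · subst ha
    simp only [Matrix.updateRow_self]
    exact contDiffOn_const
  · simp only [Matrix.updateRow_ne ha]
    exact hM a b

theorem adjugate_eq_det_smul_inv {m : Type*} [Fintype m] [DecidableEq m] {M : Matrix m m ℂ}
    (hM : M.PosDef) : M.adjugate = M.det • M⁻¹ := by
  rw [Matrix.inv_def, smul_smul, Ring.mul_inverse_cancel _ hM.det_pos.ne'.isUnit, one_smul]

theorem posSemidef_adjugate {m : Type*} [Fintype m] [DecidableEq m] {M : Matrix m m ℂ}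
    (hM : M.PosDef) : M.adjugate.PosSemidef := by
  rw [adjugate_eq_det_smul_inv hM]
  exact hM.inv.posSemidef.smul hM.det_pos.le

end Adjugate

/-! ### Griffiths semi-negativity implies trace semi-negativity -/

section Trace
variable {n : ℕ} {X : Type*} [TopologicalSpace X] [ChartedSpace (Cn n) X]
  [IsManifold 𝓘(ℂ, Cn n) ω X]

theorem adjointDensity_eq_zero (g : HermitianMetric n X) (e : OpenPartialHomeomorph X (Cn n))
    {ψ : Cn n → ℝ} {y : Cn n} (hy : y ∉ tsupport ψ) : adjointDensity g e ψ y = 0 := by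
  have h : ∀ j k, dz j (dzbar k fun w => (ψ w : ℂ) * (g.coeff e w).adjugate k j) y = 0 :=
    fun j k => by
      refine image_eq_zero_of_notMem_tsupport fun h => hy ?_
      rw [← tsupport_ofReal]
      exact (closure_mono (Function.support_mul_subset_left _ _))
        (tsupport_dz_dzbar_subset _ _ _ h)
  simp only [adjointDensity, h, Finset.sum_const_zero, Complex.zero_re]

theorem setIntegral_mul_adjointDensity (g : HermitianMetric n X)
    (e : OpenPartialHomeomorph X (Cn n)) (f : Cn n → ℝ) {ψ : Cn n → ℝ} {Ω : Set (Cn n)}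
    (hs : tsupport ψ ⊆ Ω) : ∫ y in Ω, f y * adjointDensity g e ψ y =
      ∫ y, f y * adjointDensity g e ψ y :=
  setIntegral_eq_integral_of_forall_compl_eq_zero fun y hy => by
    rw [adjointDensity_eq_zero g e fun h => hy (hs h), mul_zero]

theorem log_sq_toReal (a : ℝ≥0∞) : (ENNReal.log (a ^ 2)).toReal = 2 * (ENNReal.log a).toReal := by
  rw [ENNReal.log_pow, EReal.toReal_mul]
  norm_cast

variable {F : Type*} [NormedAddCommGroup F] [NormedSpace ℂ F] [FiniteDimensional ℂ F]
variable {V : X → Type*} [∀ x, AddCommGroup (V x)] [∀ x, Module ℂ (V x)]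
  [TopologicalSpace (TotalSpace F V)] [∀ x, TopologicalSpace (V x)] [FiberBundle F V]
  [VectorBundle ℂ F V] [ContMDiffVectorBundle ω F V 𝓘(ℂ, Cn n)]

theorem isOpen_ne_zero_near {U : Set X} (hU : IsOpen U) {s : ∀ x, V x}
    (hs : IsHolomorphicSectionOn n F s U) {e : OpenPartialHomeomorph X (Cn n)}
    (he : e ∈ atlas (Cn n) X) : IsOpen {y | y ∈ chartSet e U ∧ s (e.symm y) ≠ 0} := by
  rw [isOpen_iff_mem_nhds]
  rintro y ⟨hy, hne⟩
  have ht := FiberBundle.mem_baseSet_trivializationAt' (F := F) (E := V) (e.symm y)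
  have hO := isOpen_chartSet e (hU.inter (trivializationAt F V (e.symm y)).open_baseSet)
  have hc := (IsHolomorphicSectionOn.contDiffOn_fcoord (s := s)
    (t := trivializationAt F V (e.symm y))
    (hU.inter (trivializationAt F V (e.symm y)).open_baseSet)
    Set.inter_subset_right (ContMDiffOn.mono hs Set.inter_subset_left) he).continuousOn
  have hyO : y ∈ chartSet e (U ∩ (trivializationAt F V (e.symm y)).baseSet) := ⟨hy.1, hy.2, ht⟩
  have h1 := (hc.continuousAt (hO.mem_nhds hyO)).eventually_ne
    (fun h => hne ((fcoord_eq_zero_iff ht).1 h))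
  filter_upwards [h1, hO.mem_nhds hyO] with w hw hwO
  exact ⟨⟨hwO.1, hwO.2.1⟩, fun h => hw (by rw [h, map_zero])⟩

/-- Griffiths semi-negativity implies trace semi-negativity. -/
theorem GriffithsSemiNegative.traceSemiNegative {k : ∀ x, V x → ℝ≥0∞}
    (hk : GriffithsSemiNegative n F k)
    (hae : AEOn n (Set.univ : Set X) fun x => ∀ v : V x, v ≠ 0 → 0 < k x v ∧ k x v < ⊤)
    (g : HermitianMetric n X) : TraceSemiNegative F g k := by
  intro x U hU hx s hs hne
  obtain ⟨W, hW, hxW, hWU, hfr⟩ := frequently_section_ne_zero hU hx hs hne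
  have hsW : IsHolomorphicSectionOn n F s W := ContMDiffOn.mono hs hWU
  have hpsh := hk W hW s hsW
  have key : ∀ e ∈ atlas (Cn n) X,
      (∀ᵐ z, z ∈ chartSet e W → ENNReal.log (k (e.symm z) (s (e.symm z))) ≠ ⊥) ∧
      DistPSH (fun z => (ENNReal.log (k (e.symm z) (s (e.symm z)))).toReal) (chartSet e W) := by
    intro e he
    refine distPSH_toReal_of_dense (isOpen_chartSet e hW) (fun y hy => hpsh.lt_top _ hy.2)
      (fun m => hpsh.submeanOn hW he _) fun y hy r hr => ?_
    -- Finite values are dense: the section is non-zero on a non-empty open subset, which has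
    -- positive measure, while the metric is positive definite almost everywhere.
    have hopen := (isOpen_ne_zero_near hW hsW he).inter (Metric.isOpen_ball (x := y) (ε := r))
    have hnonempty : ({y | y ∈ chartSet e W ∧ s (e.symm y) ≠ 0} ∩ Metric.ball y r).Nonempty := by
      have h1 := hfr _ hy.2
      have h2 : e.source ∩ e ⁻¹' (chartSet e W ∩ Metric.ball y r) ∈ 𝓝 (e.symm y) := by
        refine (e.isOpen_inter_preimage ((isOpen_chartSet e hW).inter
          Metric.isOpen_ball)).mem_nhds ⟨e.map_target hy.1, ?_⟩
        rw [Set.mem_preimage, e.right_inv hy.1]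
        exact ⟨hy, Metric.mem_ball_self hr⟩
      obtain ⟨w, hw, hws⟩ := (h1.and_eventually h2).exists
      exact ⟨e w, ⟨hws.2.1, by rwa [e.left_inv hws.1]⟩, hws.2.2⟩
    have hpos := hopen.measure_pos volume hnonempty
    by_contra! hcon
    refine hpos.ne' (measure_mono_null (fun z hz => ?_) (ae_iff.1 (hae e he)))
    simp only [Set.mem_ofPred_eq, Classical.not_imp]
    refine ⟨⟨hz.1.1.1, Set.mem_univ _⟩, fun h => ?_⟩
    have := h _ hz.1.2
    exact this.1.ne' (ENNReal.log_eq_bot_iff.1 (hcon z hz.2))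
  refine ⟨W, hW, hxW, hWU, ⟨fun e he => ?_, fun e he => ?_, fun e he ψ hψ hψc hψs hψ0 => ?_⟩⟩
  · filter_upwards [(key e he).1] with y hy hyW
    have h1 : k (e.symm y) (s (e.symm y)) ≠ 0 := by simpa using hy hyW
    have h2 : k (e.symm y) (s (e.symm y)) ≠ ⊤ := by simpa using (hpsh.lt_top _ hyW.2).ne
    exact ⟨by simpa using h1, by simpa using h2⟩
  · simp only [log_sq_toReal]
    exact (key e he).2.locallyIntegrableOn.smul (2 : ℝ)
  · rw [setIntegral_mul_adjointDensity g e _ hψs]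
    -- The coefficients of `ω^{n-1}` form the adjugate of a positive definite matrix, so the
    -- operator for `ω` is of the type covered by `DistPSH.nonneg_of_posSemidef`.
    have h1 := (key e he).2.nonneg_of_posSemidef (isOpen_chartSet e hW)
      (C := fun y => (g.coeff e y).adjugate)
      (fun j l => (contDiffOn_adjugate (g.contDiffOn_coeff he) j l).mono Set.inter_subset_left)
      (fun y hy => posSemidef_adjugate (g.posDef_coeff he hy.1)) ⟨hψ, hψc, hψs, hψ0⟩
    simp only [log_sq_toReal, mul_assoc, integral_const_mul]
    exact mul_nonneg zero_le_two h1

end Trace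

/-- `N` is the norm of a positive definite Hermitian form. -/
def IsHermitianNorm {E' : Type*} [AddCommGroup E'] [Module ℂ E'] (N : E' → ℝ≥0∞) : Prop :=
  ∃ H : E' →ₗ[ℂ] E' →ₗ⋆[ℂ] ℂ, (∀ v w, H w v = (starRingEnd ℂ) (H v w)) ∧
    (∀ v, v ≠ 0 → 0 < (H v v).re) ∧ ∀ v, N v ^ 2 = ENNReal.ofReal (H v v).re

namespace IsHermitianNorm
variable {E' : Type*} [AddCommGroup E'] [Module ℂ E'] {N : E' → ℝ≥0∞}

theorem lt_top (h : IsHermitianNorm N) (v : E') : N v < ⊤ := by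
  obtain ⟨H, -, -, h⟩ := h
  have := h v
  by_contra! hN
  rw [top_le_iff.1 hN] at this
  simp at this

theorem pos (h : IsHermitianNorm N) {v : E'} (hv : v ≠ 0) : 0 < N v := by
  obtain ⟨H, -, hp, h⟩ := h
  rw [pos_iff_ne_zero]
  intro h0
  have := h v
  rw [h0, zero_pow two_ne_zero] at this
  exact (ENNReal.ofReal_pos.2 (hp v hv)).ne this

theorem map_zero (h : IsHermitianNorm N) : N 0 = 0 := by
  obtain ⟨H, -, hp, h⟩ := h
  simpa using h 0

end IsHermitianNorm

/-! ### Trace semi-negativity for all metrics implies weak semi-negativity -/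

section Trace
variable {n : ℕ} {X : Type*} [TopologicalSpace X] [ChartedSpace (Cn n) X]
  [IsManifold 𝓘(ℂ, Cn n) ω X]

theorem dz_dzbar_const_mul {ψ : Cn n → ℝ} (hψ : ContDiff ℝ ∞ ψ) (c : ℂ) (j k : Fin n)
    (y : Cn n) : dz j (dzbar k fun w => (ψ w : ℂ) * c) y =
      c * dz j (dzbar k fun w => (ψ w : ℂ)) y := by
  have hψc : ContDiff ℝ ∞ (fun y => (ψ y : ℂ)) :=
    contDiff_iff_contDiffAt.2 fun z => contDiffAt_ofReal hψ.contDiffAt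
  have hd : ∀ z, DifferentiableAt ℝ (fun y => (ψ y : ℂ)) z := fun z =>
    ContDiffAt.differentiableAt_top hψc.contDiffAt
  have h1 : dzbar k (fun w => (ψ w : ℂ) * c) = fun w => c * dzbar k (fun w => (ψ w : ℂ)) w := by
    ext w
    rw [dzbar_eq_wirtBar, wirtBar_fun_mul (hd w) (differentiableAt_const c), wirtBar_const, dzbar_eq_wirtBar]
    ring
  have h2 : DifferentiableAt ℝ (dzbar k fun w => (ψ w : ℂ)) y := by
    rw [dzbar_eq_wirtBar]
    exact ContDiffAt.differentiableAt_top (contDiff_wirtBar hψc _).contDiffAt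
  rw [h1, dz_eq_wirt, dz_eq_wirt, wirt_const_mul _ h2]

/-- The adjoint density where the metric has constant coefficients. -/
theorem adjointDensity_of_const (g : HermitianMetric n X) {e : OpenPartialHomeomorph X (Cn n)}
    {ψ : Cn n → ℝ} (hψ : ContDiff ℝ ∞ ψ) {B : Matrix (Fin n) (Fin n) ℂ} (hB : B.PosDef)
    (hg : ∀ y ∈ tsupport ψ, g.coeff e y = B⁻¹) (y : Cn n) :
    adjointDensity g e ψ y = (B⁻¹).det.re *
      (∑ j, ∑ k, B k j * dz j (dzbar k fun w => (ψ w : ℂ)) y).re := by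
  have hdet : (B⁻¹).det = ((B⁻¹).det.re : ℂ) := by
    have := (Complex.lt_def.1 hB.inv.det_pos).2
    exact Complex.ext (by simp) (by simpa using this.symm)
  have hadj : (B⁻¹).adjugate = (B⁻¹).det • B := by
    rw [adjugate_eq_det_smul_inv hB.inv, Matrix.nonsing_inv_nonsing_inv _
      ((Matrix.isUnit_iff_isUnit_det _).1 hB.isUnit)]
  have h1 : ∀ j k, (fun w => (ψ w : ℂ) * (g.coeff e w).adjugate k j) =
      fun w => (ψ w : ℂ) * ((B⁻¹).det * B k j) := fun j k => by
    ext w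
    by_cases hw : w ∈ tsupport ψ
    · rw [hg w hw, hadj, Matrix.smul_apply, smul_eq_mul]
    · rw [image_eq_zero_of_notMem_tsupport hw, Complex.ofReal_zero, zero_mul, zero_mul]
  rw [adjointDensity]
  simp only [h1, dz_dzbar_const_mul hψ, mul_assoc, ← Finset.mul_sum]
  rw [hdet, Complex.re_ofReal_mul, Complex.ofReal_re]

theorem exp_log_sq_toReal {a : ℝ≥0∞} (h0 : ENNReal.log (a ^ 2) ≠ ⊥)
    (h1 : ENNReal.log (a ^ 2) ≠ ⊤) :
    Real.exp (ENNReal.log (a ^ 2)).toReal = (a ^ 2).toReal := by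
  rw [ne_eq, ENNReal.log_eq_bot_iff] at h0
  rw [ne_eq, ENNReal.log_eq_top_iff] at h1
  rw [ENNReal.log_pos_real h0 h1, EReal.toReal_coe, Real.exp_log (ENNReal.toReal_pos h0 h1)]

variable (F : Type*) [NormedAddCommGroup F] [NormedSpace ℂ F] [FiniteDimensional ℂ F]
variable {V : X → Type*} [∀ x, AddCommGroup (V x)] [∀ x, Module ℂ (V x)]
  [TopologicalSpace (TotalSpace F V)] [∀ x, TopologicalSpace (V x)] [FiberBundle F V]
  [VectorBundle ℂ F V]

/-- The squared length of the section with coordinates `u`, in the preferred chart and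
trivialization at `x₀`. -/
def sqLength (k : ∀ x, V x → ℝ≥0∞) (x₀ : X) (z : Cn n)
    (c : Fin (Module.finrank ℂ F) → ℂ) : ℝ :=
  (k ((chartAt (Cn n) x₀).symm z) (flift (trivializationAt F V x₀)
    ((chartAt (Cn n) x₀).symm z) c) ^ 2).toReal

/-- The squared lengths of holomorphic sections are plurisubharmonic in the sense of
distributions, locally. -/
def WeaklySemiNegative (k : ∀ x, V x → ℝ≥0∞) : Prop :=
  ∀ x₀ : X, ∃ R > 0, Metric.ball (chartAt (Cn n) x₀ x₀) R ⊆
      chartSet (chartAt (Cn n) x₀) (trivializationAt F V x₀).baseSet ∧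
    ∀ Ω : Set (Cn n), IsOpen Ω → Ω ⊆ Metric.ball (chartAt (Cn n) x₀ x₀) R →
    ∀ u : Cn n → Fin (Module.finrank ℂ F) → ℂ, ContDiffOn ℂ ω u Ω →
      DistPSH (fun z => sqLength F k x₀ z (u z)) Ω

theorem exists_ball_subset_chartSet (x₀ : X) {U : Set X} (hU : IsOpen U) (hx : x₀ ∈ U) :
    ∃ R > 0, Metric.ball (chartAt (Cn n) x₀ x₀) R ⊆ chartSet (chartAt (Cn n) x₀) U :=
  Metric.isOpen_iff.1 (isOpen_chartSet _ hU) _ ⟨mem_chart_target _ _, by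
    rwa [Set.mem_preimage, (chartAt (Cn n) x₀).left_inv (mem_chart_source _ _)]⟩

variable {F} [ContMDiffVectorBundle ω F V 𝓘(ℂ, Cn n)] [T2Space X] [SecondCountableTopology X]

/-- For every positive definite `B` some Hermitian metric has constant coefficients `B⁻¹` near a
given point, and its trace condition reads `∑ B_{kj} ∂_j ∂̄_k log |s|² ≥ 0` there. As all `B` occur,
`log |s|²` is plurisubharmonic in the sense of distributions, and so is its exponential. -/
theorem exists_distPSH_of_traceSemiNegative {k : ∀ x, V x → ℝ≥0∞}
    (hk : ∀ g : HermitianMetric n X, TraceSemiNegative F g k)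
    {e : OpenPartialHomeomorph X (Cn n)} (he : e ∈ atlas (Cn n) X)
    (hmet : ∀ z ∈ e.target, ∀ A : Matrix (Fin n) (Fin n) ℂ, A.PosDef →
      ∃ (g : HermitianMetric n X) (ε : ℝ), 0 < ε ∧ Metric.ball z ε ⊆ e.target ∧
        ∀ y ∈ Metric.ball z ε, g.coeff e y = A)
    {x : X} (hx : x ∈ e.source) {U : Set X} (hU : IsOpen U) (hxU : x ∈ U) {s : ∀ x, V x}
    (hs : IsHolomorphicSectionOn n F s U) (hne : ¬ ∀ᶠ y in 𝓝 x, s y = 0) :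
    ∃ W : Set X, IsOpen W ∧ x ∈ W ∧ W ⊆ U ∧
      DistPSH (fun z => (k (e.symm z) (s (e.symm z)) ^ 2).toReal) (chartSet e W) := by
  obtain ⟨W₁, hW₁, hxW₁, hWU₁, hfr⟩ := frequently_section_ne_zero hU hxU hs hne
  -- Any metric will do here: it provides local integrability and finiteness almost everywhere on
  -- one neighbourhood, before metrics depending on `B` come in.
  obtain ⟨g₀, -, -, -, -⟩ := hmet _ (e.map_source hx) 1 Matrix.PosDef.one
  obtain ⟨W₀, hW₀, hxW₀, hWU₀, hsub⟩ := hk g₀ x U hU hxU s hs hne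
  have hO := isOpen_chartSet e (hW₁.inter hW₀)
  have hlog : DistPSH (fun z => (ENNReal.log (k (e.symm z) (s (e.symm z)) ^ 2)).toReal)
      (chartSet e (W₁ ∩ W₀)) := by
    refine DistPSH.of_posDef ((hsub.locallyIntegrable e he).mono_set fun y hy => ⟨hy.1, hy.2.2⟩)
      fun B hB y hy => ?_
    obtain ⟨g, ε, hε, hball, hg⟩ := hmet y hy.1 _ hB.inv
    -- The trace condition is applied at the new point, where the germ is non-zero because the
    -- section does not vanish at points arbitrarily close to it.
    obtain ⟨W, hW, hyW, -, hsubW⟩ := hk g (e.symm y) U hU (hWU₁ hy.2.1) s hs fun h =>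
      (hfr _ hy.2.1) (h.mono fun w hw hw' => hw' hw)
    refine ⟨chartSet e W ∩ Metric.ball y ε, (isOpen_chartSet e hW).inter Metric.isOpen_ball,
      ⟨⟨hy.1, hyW⟩, Metric.mem_ball_self hε⟩, fun ψ hψ => ?_⟩
    have hψW : tsupport ψ ⊆ chartSet e W := fun w hw => (hψ.subset hw).1.1
    have h1 := hsubW.nonneg e he ψ hψ.smooth hψ.compact hψW hψ.nonneg
    rw [setIntegral_mul_adjointDensity g e _ hψW] at h1
    simp only [adjointDensity_of_const g hψ.smooth hB fun w hw => hg w (hψ.subset hw).1.2,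
      mul_left_comm _ (B⁻¹).det.re, integral_const_mul] at h1
    exact nonneg_of_mul_nonneg_right h1 (Complex.lt_def.1 hB.inv.det_pos).1
  refine ⟨W₁ ∩ W₀, hW₁.inter hW₀, ⟨hxW₁, hxW₀⟩, Set.inter_subset_left.trans hWU₁,
    (hlog.exp hO).congr hO ?_⟩
  filter_upwards [hsub.ae_finite e he] with y hy hyW
  have := hy ⟨hyW.1, hyW.2.2⟩
  exact exp_log_sq_toReal this.1 this.2

/-- A metric that is trace semi-negative for all Hermitian metrics on the manifold is weakly
semi-negative. -/
theorem WeaklySemiNegative.of_traceSemiNegative {k : ∀ x, V x → ℝ≥0∞}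
    (hae : AEOn n (Set.univ : Set X) fun x => IsHermitianNorm (k x))
    (hk : ∀ g : HermitianMetric n X, TraceSemiNegative F g k) : WeaklySemiNegative (n := n) F k := by
  intro x₀
  obtain ⟨R, hR, hb⟩ := exists_ball_subset_chartSet (n := n) x₀
    (trivializationAt F V x₀).open_baseSet (FiberBundle.mem_baseSet_trivializationAt' x₀)
  refine ⟨R, hR, hb, fun Ω hO hΩ u hu => DistPSH.of_local fun z hz => ?_⟩
  have he := chart_mem_atlas (Cn n) x₀
  have hmet : ∀ z ∈ (chartAt (Cn n) x₀).target, ∀ A : Matrix (Fin n) (Fin n) ℂ, A.PosDef →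
      ∃ (g : HermitianMetric n X) (ε : ℝ), 0 < ε ∧ Metric.ball z ε ⊆ (chartAt (Cn n) x₀).target ∧
        ∀ y ∈ Metric.ball z ε, g.coeff (chartAt (Cn n) x₀) y = A := fun z hz A hA =>
    exists_hermitianMetric_coeff_eq x₀ hz hA
  have hae' := hae _ he
  unfold sqLength
  generalize chartAt (Cn n) x₀ = e at *
  have hzt := (hb (hΩ hz)).1
  have hsec := isHolomorphicSectionOn_flift (t := trivializationAt F V x₀) he hO (hΩ.trans hb) hu
  have hU := e.isOpen_inter_preimage hO
  have hxU : e.symm z ∈ e.source ∩ e ⁻¹' Ω := ⟨e.map_target hzt, by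
    rwa [Set.mem_preimage, e.right_inv hzt]⟩
  by_cases hne : ∀ᶠ y in 𝓝 (e.symm z), flift (trivializationAt F V x₀) y (u (e y)) = 0
  -- A zero germ is not covered by the trace condition. Then the squared length vanishes near the
  -- point, but only almost everywhere, since `k` is known to be a norm at almost every point only.
  · obtain ⟨N, hN, hNo, hzN⟩ := eventually_nhds_iff.1 hne
    have hO' := (isOpen_chartSet e hNo).inter hO
    refine ⟨chartSet e N, isOpen_chartSet e hNo, ⟨hzt, hzN⟩, ?_⟩
    refine DistPSH.congr hO' (f := fun _ => 0) (DistPSH.of_smooth hO' contDiffOn_const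
      fun z _ ξ => (congrFun (levi_zero_fun (n := n) (G := ℝ) ξ) z).ge) ?_
    filter_upwards [hae'] with w hw hwN
    have h1 := hN _ hwN.1.2
    rw [e.right_inv hwN.1.1] at h1
    rw [h1, (hw ⟨hwN.1.1, Set.mem_univ _⟩).map_zero]
    simp
  · obtain ⟨W, hW, hzW, hWU, hd⟩ := exists_distPSH_of_traceSemiNegative hk he hmet
      (e.map_target hzt) hU hxU hsec hne
    refine ⟨chartSet e W, isOpen_chartSet e hW, ⟨hzt, hzW⟩, ?_⟩
    refine DistPSH.congr ((isOpen_chartSet e hW).inter hO) (hd.mono Set.inter_subset_left)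
      (Filter.Eventually.of_forall fun w hw => ?_)
    simp only [e.right_inv hw.1.1]

end Trace

/-! ### Decreasing limits -/

section Limits
variable {n : ℕ} {Ω : Set (Cn n)}

/-- Integration by parts moves both derivatives from `ψ` to `f`, where the pairing with `B` is
non-negative at every point. -/
theorem integral_mul_hessian_nonneg {f : Cn n → ℂ} (hO : IsOpen Ω) (hf : ContDiffOn ℝ ∞ f Ω)
    (hre : ∀ y ∈ Ω, ((f y).re : ℂ) = f y) {B : Matrix (Fin n) (Fin n) ℂ}
    (hess : ∀ y ∈ Ω, 0 ≤ (∑ j, ∑ k, B k j * dz j (dzbar k f) y).re) {ψ : Cn n → ℝ}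
    (hψ : IsTest ψ Ω) :
    0 ≤ ∫ y, (f y).re * (∑ j, ∑ k, B k j * dz j (dzbar k fun w => (ψ w : ℂ)) y).re := by
  have hψc : ContDiff ℝ ∞ (fun y => (ψ y : ℂ)) :=
    contDiff_iff_contDiffAt.2 fun z => contDiffAt_ofReal hψ.smooth.contDiffAt
  have hcc := hasCompactSupport_ofReal hψ.compact
  have hsub : ∀ j k, tsupport (dz j (dzbar k fun w => (ψ w : ℂ))) ⊆ tsupport ψ := fun j k => by
    rw [← tsupport_ofReal]
    exact tsupport_dz_dzbar_subset _ _ _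
  have hi : ∀ j k, Integrable fun y => f y * dz j (dzbar k fun w => (ψ w : ℂ)) y := fun j k =>
    integrable_mul_of_tsupport_subset hO hf.continuousOn (contDiff_dz_dzbar hψc j k).continuous
      (hasCompactSupport_of_tsupport_subset hψ.compact (hsub j k)) ((hsub j k).trans hψ.subset)
  have hi' : ∀ j k, Integrable fun y => dz j (dzbar k f) y * (ψ y : ℂ) := fun j k => by
    refine integrable_mul_of_tsupport_subset hO (fun z hz => ?_) hψc.continuous hcc
      (by rw [tsupport_ofReal]; exact hψ.subset)
    rw [dz_eq_wirt, dzbar_eq_wirtBar]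
    exact (contDiffAt_wirt (contDiffAt_wirtBar (hf.contDiffAt (hO.mem_nhds hz)) _)
      _).continuousAt.continuousWithinAt
  have h1 : ∫ y, (f y).re * (∑ j, ∑ k, B k j * dz j (dzbar k fun w => (ψ w : ℂ)) y).re =
      (∫ y, ∑ j, ∑ k, B k j * (f y * dz j (dzbar k fun w => (ψ w : ℂ)) y)).re := by
    have h2 := integral_re (𝕜 := ℂ) (integrable_finsetSum Finset.univ fun j _ =>
      integrable_finsetSum Finset.univ fun k _ => (hi j k).const_mul (B k j))
    simp only [RCLike.re_to_complex] at h2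
    rw [← h2]
    refine integral_congr_ae (Filter.Eventually.of_forall fun y => ?_)
    dsimp only
    by_cases hy : y ∈ Ω
    · rw [← Complex.re_ofReal_mul, hre y hy]
      simp only [Finset.mul_sum]
      congr 1
      exact Finset.sum_congr rfl fun j _ => Finset.sum_congr rfl fun k _ => by ring
    · have : ∀ j k, dz j (dzbar k fun w => (ψ w : ℂ)) y = 0 := fun j k =>
        image_eq_zero_of_notMem_tsupport fun h => hy (hψ.subset (hsub j k h))
      simp [this]
  rw [h1]
  have h3 : ∫ y, ∑ j, ∑ k, B k j * (f y * dz j (dzbar k fun w => (ψ w : ℂ)) y) =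
      ∫ y, ∑ j, ∑ k, B k j * (dz j (dzbar k f) y * (ψ y : ℂ)) := by
    rw [integral_finsetSum _ fun j _ => integrable_finsetSum Finset.univ fun k _ =>
      (hi j k).const_mul (B k j), integral_finsetSum _ fun j _ =>
      integrable_finsetSum Finset.univ fun k _ => (hi' j k).const_mul (B k j)]
    refine Finset.sum_congr rfl fun j _ => ?_
    rw [integral_finsetSum _ fun k _ => (hi j k).const_mul (B k j),
      integral_finsetSum _ fun k _ => (hi' j k).const_mul (B k j)]
    refine Finset.sum_congr rfl fun k _ => ?_
    rw [integral_const_mul, integral_const_mul, integral_mul_dz_dzbar hO hf hψc hcc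
      (by rw [tsupport_ofReal]; exact hψ.subset)]
  rw [h3]
  refine re_integral_nonneg (Filter.Eventually.of_forall fun y => ?_)
  have h4 : ∑ j, ∑ k, B k j * (dz j (dzbar k f) y * (ψ y : ℂ)) =
      (ψ y : ℂ) * ∑ j, ∑ k, B k j * dz j (dzbar k f) y := by
    simp only [Finset.mul_sum]
    exact Finset.sum_congr rfl fun j _ => Finset.sum_congr rfl fun k _ => by ring
  rw [h4, Complex.re_ofReal_mul]
  by_cases hy : y ∈ Ω
  · exact mul_nonneg (hψ.nonneg y) (hess y hy)
  · rw [image_eq_zero_of_notMem_tsupport fun h => hy (hψ.subset h), zero_mul]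

variable {f : Cn n → ℝ} {G : ℕ → Cn n → ℝ}

theorem ae_le_of_antitone (hanti : ∀ y ∈ Ω, Antitone fun ν => G ν y)
    (hnn : ∀ ν, ∀ y ∈ Ω, 0 ≤ G ν y)
    (hlim : ∀ᵐ y, y ∈ Ω → Filter.Tendsto (fun ν => G ν y) Filter.atTop (𝓝 (f y))) :
    ∀ᵐ y, y ∈ Ω → ‖f y‖ ≤ G 0 y := by
  filter_upwards [hlim] with y hy hyΩ
  rw [Real.norm_of_nonneg (ge_of_tendsto' (hy hyΩ) fun ν => hnn ν y hyΩ)]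
  exact (hanti y hyΩ).le_of_tendsto (hy hyΩ) 0

theorem locallyIntegrableOn_of_antitone (hO : IsOpen Ω) (hG : ∀ ν, ContinuousOn (G ν) Ω)
    (hanti : ∀ y ∈ Ω, Antitone fun ν => G ν y) (hnn : ∀ ν, ∀ y ∈ Ω, 0 ≤ G ν y)
    (hlim : ∀ᵐ y, y ∈ Ω → Filter.Tendsto (fun ν => G ν y) Filter.atTop (𝓝 (f y))) :
    LocallyIntegrableOn f Ω := by
  have hm : AEStronglyMeasurable f (volume.restrict Ω) :=
    aestronglyMeasurable_of_tendsto_ae Filter.atTop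
      (fun ν => (hG ν).aestronglyMeasurable hO.measurableSet)
      ((ae_restrict_iff' hO.measurableSet).2 hlim)
  rw [locallyIntegrableOn_iff hO.isLocallyClosed]
  intro K hK hKc
  refine Integrable.mono' (((hG 0).mono hK).integrableOn_compact hKc)
    (hm.mono_measure (Measure.restrict_mono hK le_rfl)) ?_
  refine (ae_restrict_iff' hKc.measurableSet).2 ?_
  filter_upwards [ae_le_of_antitone hanti hnn hlim] with y hy hyK
  exact hy (hK hyK)

/-- The first member of the decreasing non-negative sequence dominates the others. -/
theorem tendsto_integral_mul_of_antitone (hO : IsOpen Ω) (hG : ∀ ν, ContinuousOn (G ν) Ω)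
    (hanti : ∀ y ∈ Ω, Antitone fun ν => G ν y) (hnn : ∀ ν, ∀ y ∈ Ω, 0 ≤ G ν y)
    (hlim : ∀ᵐ y, y ∈ Ω → Filter.Tendsto (fun ν => G ν y) Filter.atTop (𝓝 (f y)))
    {θ : Cn n → ℝ} (hθ : Continuous θ) (hc : HasCompactSupport θ) (hs : tsupport θ ⊆ Ω) :
    Filter.Tendsto (fun ν => ∫ y, G ν y * θ y) Filter.atTop (𝓝 (∫ y, f y * θ y)) := by
  have hi : ∀ ν, Integrable fun y => G ν y * θ y := fun ν =>
    integrable_mul_of_locallyIntegrableOn ((hG ν).locallyIntegrableOn hO.measurableSet) hθ hc hs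
  refine tendsto_integral_of_dominated_convergence (fun y => ‖G 0 y * θ y‖)
    (fun ν => (hi ν).aestronglyMeasurable) (hi 0).norm (fun ν => ?_) ?_
  · refine Filter.Eventually.of_forall fun y => ?_
    by_cases hy : y ∈ Ω
    · rw [norm_mul, norm_mul, Real.norm_of_nonneg (hnn ν y hy), Real.norm_of_nonneg (hnn 0 y hy)]
      exact mul_le_mul_of_nonneg_right (hanti y hy (Nat.zero_le ν)) (norm_nonneg _)
    · rw [image_eq_zero_of_notMem_tsupport fun h => hy (hs h), mul_zero, mul_zero]
  · filter_upwards [hlim] with y hy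
    by_cases hyΩ : y ∈ Ω
    · exact (hy hyΩ).mul_const _
    · simp only [image_eq_zero_of_notMem_tsupport fun h => hyΩ (hs h), mul_zero]
      exact tendsto_const_nhds

end Limits

/-! ### Matrices of Hermitian metrics in frames -/

section Frames
variable {n : ℕ} {X : Type*} [TopologicalSpace X] [ChartedSpace (Cn n) X]
  [IsManifold 𝓘(ℂ, Cn n) ω X]
variable {F : Type*} [NormedAddCommGroup F] [NormedSpace ℂ F] [FiniteDimensional ℂ F]
variable {V : X → Type*} [∀ x, AddCommGroup (V x)] [∀ x, Module ℂ (V x)]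
  [TopologicalSpace (TotalSpace F V)] [∀ x, TopologicalSpace (V x)] [FiberBundle F V]

theorem form_sum_eq_sesq {r : ℕ} {E' : Type*} [AddCommGroup E'] [Module ℂ E']
    (H : E' →ₗ[ℂ] E' →ₗ⋆[ℂ] ℂ) (f : Fin r → E') (c d : Fin r → ℂ) :
    H (∑ a, c a • f a) (∑ b, d b • f b) = sesq (Matrix.of fun a b => H (f a) (f b)) c d := by
  simp only [map_sum, LinearMap.sum_apply, map_smul, LinearMap.smul_apply, smul_eq_mul,
    map_smulₛₗ, Finset.mul_sum, sesq, Matrix.of_apply]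
  rw [Finset.sum_comm]
  exact Finset.sum_congr rfl fun a _ => Finset.sum_congr rfl fun b _ => by ring

theorem frameMatrix_eq_of {r : ℕ} (H : ∀ x, V x →ₗ[ℂ] V x →ₗ⋆[ℂ] ℂ) (f : Fin r → ∀ x, V x)
    (e : OpenPartialHomeomorph X (Cn n)) (y : Cn n) : frameMatrix H f e y =
      Matrix.of fun a b => H (e.symm y) (f a (e.symm y)) (f b (e.symm y)) := rfl

variable {t : Trivialization F (TotalSpace.proj : TotalSpace F V → X)} [t.IsLinear ℂ]

/-- The frame of a trivialization. -/
def trivFrame (t : Trivialization F (TotalSpace.proj : TotalSpace F V → X)) [t.IsLinear ℂ]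
    (a : Fin (Module.finrank ℂ F)) (x : X) : V x := flift t x (Pi.single a 1)

theorem sum_smul_trivFrame (x : X) (c : Fin (Module.finrank ℂ F) → ℂ) :
    ∑ a, c a • trivFrame t a x = flift t x c := by
  simp only [trivFrame, ← map_smul, ← map_sum]
  congr 1
  ext i
  simp [Pi.single_apply]

theorem isLocalFrameOn_trivFrame [VectorBundle ℂ F V] [ContMDiffVectorBundle ω F V 𝓘(ℂ, Cn n)]
    [MemTrivializationAtlas t] {W : Set X} (hW : IsOpen W) (ht : W ⊆ t.baseSet) :
    IsLocalFrameOn 𝓘(ℂ, Cn n) F ω (trivFrame t) W where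
  linearIndependent {x} hx := by
    rw [Fintype.linearIndependent_iff]
    intro c hc
    rw [sum_smul_trivFrame, flift_eq_zero_iff (ht hx)] at hc
    exact fun i => congrFun hc i
  generating {x} hx := fun v _ => by
    rw [← flift_fcoord (ht hx) v, ← sum_smul_trivFrame]
    exact Submodule.sum_mem _ fun a _ => Submodule.smul_mem _ _ (Submodule.subset_span ⟨a, rfl⟩)
  contMDiffOn a := (isHolomorphicSectionOn_iff (s := trivFrame t a) hW ht).2
    ((contMDiffOn_const (c := Pi.single a (1 : ℂ))).congr fun x hx => fcoord_flift (ht hx) _)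

variable {r : ℕ} {H : ∀ x, V x →ₗ[ℂ] V x →ₗ⋆[ℂ] ℂ} {U : Set X}

theorem posDef_frameMatrix (hH : IsSmoothHermitianMetricOn n F H U) {f : Fin r → ∀ x, V x} {W : Set X}
    (hWU : W ⊆ U) (hf : IsLocalFrameOn 𝓘(ℂ, Cn n) F ω f W) {e : OpenPartialHomeomorph X (Cn n)}
    {y : Cn n} (hy : y ∈ chartSet e W) : (frameMatrix H f e y).PosDef := by
  refine posDef_of_sesq ?_ fun c hc => ?_
  · ext a b
    rw [Matrix.conjTranspose_apply, frameMatrix, Matrix.of_apply, Matrix.of_apply,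
      hH.conj_symm _ (hWU hy.2), Complex.star_def, Complex.conj_conj]
  · rw [frameMatrix_eq_of, ← form_sum_eq_sesq]
    refine hH.pos _ (hWU hy.2) _ fun h => hc ?_
    exact funext (Fintype.linearIndependent_iff.1 (hf.linearIndependent hy.2) c h)

theorem contDiffOn_frameMatrix (hH : IsSmoothHermitianMetricOn n F H U) {f : Fin r → ∀ x, V x}
    {W : Set X} (hW : IsOpen W) (hWU : W ⊆ U) (hf : IsLocalFrameOn 𝓘(ℂ, Cn n) F ω f W)
    {e : OpenPartialHomeomorph X (Cn n)} (he : e ∈ atlas (Cn n) X) (a b : Fin r) :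
    ContDiffOn ℝ ∞ (fun y => frameMatrix H f e y a b) (chartSet e W) :=
  contDiffOn_of_contMDiffOn (hH.smooth W hW hWU _ _ (hf.contMDiffOn a) (hf.contMDiffOn b)) he

theorem sum_sesq_eq (P : Matrix (Fin n) (Fin n) ℂ)
    (C : Fin n → Fin n → Matrix (Fin r) (Fin r) ℂ) (c : Fin r → ℂ) :
    ∑ j, ∑ k, P k j * sesq (C j k) c c =
      ∑ a, ∑ b, c a * (starRingEnd ℂ) (c b) * ∑ j, ∑ k, P k j * C j k a b := by
  simp only [sesq, Finset.mul_sum]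
  rw [Finset.sum_congr rfl fun j _ => Finset.sum_comm, Finset.sum_comm]
  refine Finset.sum_congr rfl fun a _ => ?_
  rw [Finset.sum_congr rfl fun j _ => Finset.sum_comm, Finset.sum_comm]
  exact Finset.sum_congr rfl fun b _ => Finset.sum_congr rfl fun j _ =>
    Finset.sum_congr rfl fun k _ => by ring

end Frames

/-! ### Approximable metrics are weakly semi-negative -/

section Trace
variable {n : ℕ} {X : Type*} [TopologicalSpace X] [ChartedSpace (Cn n) X]
  [IsManifold 𝓘(ℂ, Cn n) ω X]
variable {F : Type*} [NormedAddCommGroup F] [NormedSpace ℂ F] [FiniteDimensional ℂ F]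
variable {V : X → Type*} [∀ x, AddCommGroup (V x)] [∀ x, Module ℂ (V x)]
  [TopologicalSpace (TotalSpace F V)] [∀ x, TopologicalSpace (V x)] [FiberBundle F V]
  [VectorBundle ℂ F V] [ContMDiffVectorBundle ω F V 𝓘(ℂ, Cn n)]

/-- For a smooth metric that is trace semi-negative for a metric with constant coefficients, the
squared length of holomorphic sections is subharmonic for the corresponding operator. -/
theorem integral_sesq_mul_nonneg_of_trace {t : Trivialization F (TotalSpace.proj : TotalSpace F V → X)}
    [MemTrivializationAtlas t] {H : ∀ x, V x →ₗ[ℂ] V x →ₗ⋆[ℂ] ℂ} {U W : Set X} 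
    (hH : IsSmoothHermitianMetricOn n F H U) {g : HermitianMetric n X}
    (hT : SmoothTraceSemiNegativeOn F g H U) (hW : IsOpen W) (hWU : W ⊆ U) (hWt : W ⊆ t.baseSet)
    {e : OpenPartialHomeomorph X (Cn n)} (he : e ∈ atlas (Cn n) X) {Ω : Set (Cn n)}
    (hO : IsOpen Ω) (hΩ : Ω ⊆ chartSet e W) {B : Matrix (Fin n) (Fin n) ℂ} (hB : B.PosDef)
    (hg : ∀ y ∈ Ω, g.coeff e y = B⁻¹) {u : Cn n → Fin (Module.finrank ℂ F) → ℂ}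
    (hu : ContDiffOn ℂ ω u Ω) {ψ : Cn n → ℝ} (hψ : IsTest ψ Ω) :
    0 ≤ ∫ y, (sesq (frameMatrix H (trivFrame t) e y) (u y) (u y)).re *
      (∑ j, ∑ k, B k j * dz j (dzbar k fun w => (ψ w : ℂ)) y).re := by
  have hf := isLocalFrameOn_trivFrame (n := n) hW hWt
  have hM : ∀ a b, ContDiffOn ℝ ∞ (fun y => frameMatrix H (trivFrame t) e y a b) Ω := fun a b =>
    (contDiffOn_frameMatrix hH hW hWU hf he a b).mono hΩ
  have hu' := contDiffOn_real_of_complex hu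
  refine integral_mul_hessian_nonneg hO (ContDiffOn.sesq hM hu' hu')
    (fun y hy => ofReal_sesq_re (posDef_frameMatrix hH hWU hf (hΩ hy)).1 _) (fun y hy => ?_) hψ
  refine hessian_sesq_nonneg (u := fun a w => u w a)
    (fun a b => (hM a b).contDiffAt (hO.mem_nhds hy))
    (by filter_upwards [hO.mem_nhds hy] with w hw using posDef_frameMatrix hH hWU hf (hΩ hw))
    (fun a => (contDiffOn_pi.1 hu' a).contDiffAt (hO.mem_nhds hy)) (fun a => ?_) hB.posSemidef ?_
  · filter_upwards [hO.mem_nhds hy] with w hw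
    exact ((contDiffOn_pi.1 hu a).contDiffAt (hO.mem_nhds hw)).differentiableAt (by simp)
  -- Since the inverse of the coefficient matrix of `g` is `B` on `Ω`, the trace inequality is the
  -- curvature hypothesis with `P = B`.
  · have h1 := hT e he W hW hWU _ hf y (hΩ hy) (u y)
    rw [hg y hy, Matrix.nonsing_inv_nonsing_inv _
      ((Matrix.isUnit_iff_isUnit_det _).1 hB.isUnit)] at h1
    rwa [sum_sesq_eq]

variable [T2Space X] [SecondCountableTopology X]

/-- A metric that is trace semi-negative with approximation for all Hermitian metrics on the
manifold is weakly semi-negative. -/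
theorem WeaklySemiNegative.of_traceSemiNegativeWithApprox {k : ∀ x, V x → ℝ≥0∞}
    (hk : ∀ g : HermitianMetric n X, TraceSemiNegativeWithApprox F g k) :
    WeaklySemiNegative (n := n) F k := by
  intro x₀
  obtain ⟨R, hR, hb⟩ := exists_ball_subset_chartSet (n := n) x₀
    (trivializationAt F V x₀).open_baseSet (FiberBundle.mem_baseSet_trivializationAt' x₀)
  refine ⟨R, hR, hb, fun Ω hO hΩ u hu => ?_⟩
  have he := chart_mem_atlas (Cn n) x₀
  have hmet : ∀ z ∈ (chartAt (Cn n) x₀).target, ∀ A : Matrix (Fin n) (Fin n) ℂ, A.PosDef →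
      ∃ (g : HermitianMetric n X) (ε : ℝ), 0 < ε ∧ Metric.ball z ε ⊆ (chartAt (Cn n) x₀).target ∧
        ∀ y ∈ Metric.ball z ε, g.coeff (chartAt (Cn n) x₀) y = A := fun z hz A hA =>
    exists_hermitianMetric_coeff_eq x₀ hz hA
  unfold sqLength
  generalize chartAt (Cn n) x₀ = e at *
  -- The neighbourhood and the approximating sequence depend on the metric, hence on `B`, but the
  -- limit function does not. So the inequalities for different `B` can be combined at the end.
  have key : ∀ z ∈ Ω, ∀ B : Matrix (Fin n) (Fin n) ℂ, B.PosDef →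
      ∃ W : Set (Cn n), IsOpen W ∧ z ∈ W ∧ LocallyIntegrableOn (fun y => (k (e.symm y)
        (flift (trivializationAt F V x₀) (e.symm y) (u y)) ^ 2).toReal) (W ∩ Ω) ∧
      ∀ ψ, IsTest ψ (W ∩ Ω) → 0 ≤ ∫ y, (k (e.symm y)
        (flift (trivializationAt F V x₀) (e.symm y) (u y)) ^ 2).toReal *
          (∑ j, ∑ k, B k j * dz j (dzbar k fun w => (ψ w : ℂ)) y).re := by
    intro z hz B hB
    obtain ⟨g, ε, hε, hball, hg⟩ := hmet z (hb (hΩ hz)).1 _ hB.inv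
    obtain ⟨U, hU, hzU, H, hH, hT, hanti, hlim⟩ := hk g (e.symm z)
    have hUt := hU.inter (trivializationAt F V x₀).open_baseSet
    have hWo : IsOpen (chartSet e U ∩ Metric.ball z ε) :=
      (isOpen_chartSet e hU).inter Metric.isOpen_ball
    have hO' := hWo.inter hO
    have hΩ' : chartSet e U ∩ Metric.ball z ε ∩ Ω ⊆
        chartSet e (U ∩ (trivializationAt F V x₀).baseSet) := fun y hy =>
      ⟨hy.1.1.1, hy.1.1.2, (hb (hΩ hy.2)).2⟩
    have hform : ∀ ν y, H ν (e.symm y) (flift (trivializationAt F V x₀) (e.symm y) (u y))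
        (flift (trivializationAt F V x₀) (e.symm y) (u y)) =
        sesq (frameMatrix (H ν) (trivFrame (trivializationAt F V x₀)) e y) (u y) (u y) := by
      intro ν y
      rw [← sum_smul_trivFrame, form_sum_eq_sesq]
      rfl
    have hf := isLocalFrameOn_trivFrame (n := n) (t := trivializationAt F V x₀) hUt
      Set.inter_subset_right
    have hpos : ∀ ν, ∀ y ∈ chartSet e U ∩ Metric.ball z ε ∩ Ω,
        0 ≤ (sesq (frameMatrix (H ν) (trivFrame (trivializationAt F V x₀)) e y) (u y) (u y)).re :=
      fun ν y hy => sesq_self_nonneg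
        (posDef_frameMatrix (hH ν) Set.inter_subset_left hf (hΩ' hy)).posSemidef _
    have hu' := contDiffOn_real_of_complex (hu.mono (Set.inter_subset_right
      (s := chartSet e U ∩ Metric.ball z ε)))
    have hcont : ∀ ν, ContinuousOn (fun y => (sesq (frameMatrix (H ν)
        (trivFrame (trivializationAt F V x₀)) e y) (u y) (u y)).re)
        (chartSet e U ∩ Metric.ball z ε ∩ Ω) := fun ν =>
      (sesq_contDiffOn hO' (fun a b => (contDiffOn_frameMatrix (hH ν) hUt
        Set.inter_subset_left hf he a b).mono hΩ') hu').continuousOn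
    have hanti' : ∀ y ∈ chartSet e U ∩ Metric.ball z ε ∩ Ω, Antitone fun ν =>
        (sesq (frameMatrix (H ν) (trivFrame (trivializationAt F V x₀)) e y) (u y) (u y)).re := by
      intro y hy
      simp only [← hform]
      exact hanti _ hy.1.1.2 _
    have hlim' : ∀ᵐ y, y ∈ chartSet e U ∩ Metric.ball z ε ∩ Ω → Filter.Tendsto (fun ν =>
        (sesq (frameMatrix (H ν) (trivFrame (trivializationAt F V x₀)) e y) (u y) (u y)).re)
        Filter.atTop (𝓝 (k (e.symm y)
          (flift (trivializationAt F V x₀) (e.symm y) (u y)) ^ 2).toReal) := by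
      filter_upwards [hlim e he] with y hy hyW
      have h1 := hy hyW.1.1 (flift (trivializationAt F V x₀) (e.symm y) (u y))
      simp only [hform] at h1
      -- Finiteness of the limit comes from the decreasing sequence, as `k` itself is not assumed to
      -- be finite.
      have h2 : k (e.symm y) (flift (trivializationAt F V x₀) (e.symm y) (u y)) ^ 2 ≠ ⊤ := by
        refine ne_top_of_le_ne_top ENNReal.ofReal_ne_top (le_of_tendsto' h1 fun ν =>
          ENNReal.ofReal_le_ofReal (hanti' y hyW (Nat.zero_le ν)))
      have h3 := (ENNReal.tendsto_toReal h2).comp h1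
      refine h3.congr fun ν => ?_
      simp only [Function.comp_apply]
      rw [ENNReal.toReal_ofReal (hpos ν y hyW)]
    refine ⟨_, hWo, ⟨⟨(hb (hΩ hz)).1, hzU⟩, Metric.mem_ball_self hε⟩,
      locallyIntegrableOn_of_antitone hO' hcont hanti' hpos hlim', fun ψ hψ => ?_⟩
    have hψc : ContDiff ℝ ∞ (fun y => (ψ y : ℂ)) :=
      contDiff_iff_contDiffAt.2 fun z => contDiffAt_ofReal hψ.smooth.contDiffAt
    have h0 : ∀ y, y ∉ tsupport ψ →
        (∑ j, ∑ k, B k j * dz j (dzbar k fun w => (ψ w : ℂ)) y).re = 0 := fun y hy => by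
      have : ∀ j k, dz j (dzbar k fun w => (ψ w : ℂ)) y = 0 := fun j k =>
        image_eq_zero_of_notMem_tsupport fun h => hy (by
          rw [← tsupport_ofReal]
          exact tsupport_dz_dzbar_subset _ _ _ h)
      simp [this]
    have hts : tsupport (fun y => (∑ j, ∑ k, B k j * dz j (dzbar k fun w => (ψ w : ℂ)) y).re) ⊆
        tsupport ψ := closure_minimal (fun y hy => by
          by_contra h
          exact hy (h0 y h)) (isClosed_tsupport ψ)
    have hcon : Continuous fun y =>
        (∑ j, ∑ k, B k j * dz j (dzbar k fun w => (ψ w : ℂ)) y).re :=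
      Complex.continuous_re.comp (continuous_finsetSum _ fun j _ => continuous_finsetSum _
        fun k _ => continuous_const.mul (contDiff_dz_dzbar hψc j k).continuous)
    refine ge_of_tendsto' (tendsto_integral_mul_of_antitone hO' hcont hanti' hpos hlim' hcon
      (hasCompactSupport_of_tsupport_subset hψ.compact hts) (hts.trans hψ.subset)) fun ν => ?_
    exact integral_sesq_mul_nonneg_of_trace (hH ν) (hT ν) hUt Set.inter_subset_left
      Set.inter_subset_right he hO' hΩ' hB (fun y hy => hg y hy.1.2)
      (hu.mono Set.inter_subset_right) hψ
  refine DistPSH.of_posDef (fun z hz => ?_) fun B hB z hz => ?_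
  · obtain ⟨W, hW, hzW, hL, -⟩ := key z hz 1 Matrix.PosDef.one
    obtain ⟨s, hs, hi⟩ := hL z ⟨hzW, hz⟩
    refine ⟨s, ?_, hi⟩
    rwa [nhdsWithin_inter_of_mem (mem_nhdsWithin_of_mem_nhds (hW.mem_nhds hzW))] at hs
  · obtain ⟨W, hW, hzW, -, h⟩ := key z hz B hB
    exact ⟨W, hW, hzW, h⟩

end Trace

/-! ### Approximation by smooth metrics -/

section Approx
variable {n : ℕ} {X : Type*} [TopologicalSpace X] [ChartedSpace (Cn n) X]
  [IsManifold 𝓘(ℂ, Cn n) ω X]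
variable (F : Type*) [NormedAddCommGroup F] [NormedSpace ℂ F] [FiniteDimensional ℂ F]
variable {V : X → Type*} [∀ x, AddCommGroup (V x)] [∀ x, Module ℂ (V x)]
  [TopologicalSpace (TotalSpace F V)] [∀ x, TopologicalSpace (V x)] [FiberBundle F V]

/-- A decreasing sequence of smooth Hermitian metrics with limit `k` almost everywhere, for which
the squared lengths of holomorphic sections are plurisubharmonic. -/
structure IsGriffithsApprox (k : ∀ x, V x → ℝ≥0∞) (U : Set X)
    (H : ℕ → ∀ x, V x →ₗ[ℂ] V x →ₗ⋆[ℂ] ℂ) : Prop where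
  smooth : ∀ ν, IsSmoothHermitianMetricOn n F (H ν) U
  antitone : ∀ x ∈ U, ∀ v : V x, Antitone fun ν => (H ν x v v).re
  tendsto : AEOn n U fun x => ∀ v : V x,
    Filter.Tendsto (fun ν => ENNReal.ofReal (H ν x v v).re) Filter.atTop (𝓝 (k x v ^ 2))
  levi_nonneg : ∀ ν, ∀ W : Set X, IsOpen W → W ⊆ U → ∀ s : ∀ x, V x,
    IsHolomorphicSectionOn n F s W → ∀ e ∈ atlas (Cn n) X, ∀ y ∈ chartSet e W, ∀ ξ,
      0 ≤ levi ξ (fun y => (H ν (e.symm y) (s (e.symm y)) (s (e.symm y))).re) y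

variable {F} [VectorBundle ℂ F V] [ContMDiffVectorBundle ω F V 𝓘(ℂ, Cn n)]

theorem sqLength_eq_sesq {k : ∀ x, V x → ℝ≥0∞} {x₀ : X} {z : Cn n}
    (h : IsHermitianNorm (k ((chartAt (Cn n) x₀).symm z)))
    (hz : (chartAt (Cn n) x₀).symm z ∈ (trivializationAt F V x₀).baseSet) :
    ∃ K : Matrix (Fin (Module.finrank ℂ F)) (Fin (Module.finrank ℂ F)) ℂ, K.PosDef ∧
      ∀ c, sqLength F k x₀ z c = (sesq K c c).re := by
  obtain ⟨H, hc, hp, hH⟩ := h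
  have h1 : ∀ c, sesq (Matrix.of fun a b =>
      H (trivFrame (trivializationAt F V x₀) a ((chartAt (Cn n) x₀).symm z))
      (trivFrame (trivializationAt F V x₀) b ((chartAt (Cn n) x₀).symm z))) c c =
      H (flift (trivializationAt F V x₀) ((chartAt (Cn n) x₀).symm z) c)
        (flift (trivializationAt F V x₀) ((chartAt (Cn n) x₀).symm z) c) := fun c => by
    rw [← sum_smul_trivFrame, form_sum_eq_sesq]
  have h2 : ∀ v, 0 ≤ (H v v).re := fun v => by
    rcases eq_or_ne v 0 with rfl | hv
    · simp
    · exact (hp v hv).le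
  refine ⟨Matrix.of fun a b =>
      H (trivFrame (trivializationAt F V x₀) a ((chartAt (Cn n) x₀).symm z))
      (trivFrame (trivializationAt F V x₀) b ((chartAt (Cn n) x₀).symm z)),
    posDef_of_sesq ?_ fun c hc0 => ?_, fun c => ?_⟩
  rotate_left
  · rw [h1]
    exact hp _ fun h => hc0 ((flift_eq_zero_iff hz).1 h)
  · rw [h1, sqLength, hH, ENNReal.toReal_ofReal (h2 _)]
  · ext a b
    rw [Matrix.conjTranspose_apply, Matrix.of_apply, Matrix.of_apply,
      hc, Complex.star_def, Complex.conj_conj]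

/-- Weakly semi-negative metrics can be approximated by smooth ones. -/
theorem WeaklySemiNegative.exists_isGriffithsApprox {k : ∀ x, V x → ℝ≥0∞}
    (hk : WeaklySemiNegative (n := n) F k)
    (hae : AEOn n (Set.univ : Set X) fun x => IsHermitianNorm (k x)) (x₀ : X) :
    ∃ U : Set X, IsOpen U ∧ x₀ ∈ U ∧ U ⊆ (chartAt (Cn n) x₀).source ∧
      U ⊆ (trivializationAt F V x₀).baseSet ∧ ∃ H, IsGriffithsApprox (n := n) F k U H := by
  obtain ⟨R, hR, hb, hW⟩ := hk x₀
  have he := chart_mem_atlas (Cn n) x₀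
  have hae' := hae _ he
  have hx₀ := mem_chart_source (Cn n) x₀
  obtain ⟨M, hMs, hMp, hMa, hMl, hMn⟩ := exists_approximation hR (q := sqLength F k x₀)
    (by
      filter_upwards [hae'] with z hz hzb
      exact sqLength_eq_sesq (hz ⟨(hb hzb).1, Set.mem_univ _⟩) (hb hzb).2) hW
  have hfin : ∀ᵐ z, z ∈ Metric.ball (chartAt (Cn n) x₀ x₀) R → ∀ c,
      ENNReal.ofReal (sqLength F k x₀ z c) = k ((chartAt (Cn n) x₀).symm z)
        (flift (trivializationAt F V x₀) ((chartAt (Cn n) x₀).symm z) c) ^ 2 := by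
    filter_upwards [hae'] with z hz hzb c
    exact ENNReal.ofReal_toReal (ENNReal.pow_ne_top
      ((hz ⟨(hb hzb).1, Set.mem_univ _⟩).lt_top _).ne)
  generalize sqLength (n := n) F k x₀ = q at *
  generalize hte : chartAt (Cn n) x₀ = e at *
  have hB4 : Metric.ball (e x₀) (R / 4) ⊆ Metric.ball (e x₀) R :=
    Metric.ball_subset_ball (by linarith)
  have hUo : IsOpen (e.source ∩ e ⁻¹' Metric.ball (e x₀) (R / 4)) :=
    e.isOpen_inter_preimage Metric.isOpen_ball
  have hUt : e.source ∩ e ⁻¹' Metric.ball (e x₀) (R / 4) ⊆ (trivializationAt F V x₀).baseSet :=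
    fun x hx => by
      have := (hb (hB4 hx.2)).2
      rwa [Set.mem_preimage, e.left_inv hx.1] at this
  have hmem : ∀ y ∈ chartSet e (e.source ∩ e ⁻¹' Metric.ball (e x₀) (R / 4)),
      y ∈ Metric.ball (e x₀) (R / 4) := fun y hy => by
    have := hy.2.2
    rwa [Set.mem_preimage, e.right_inv hy.1] at this
  have hcoord : ∀ {W : Set X}, IsOpen W → W ⊆ e.source ∩ e ⁻¹' Metric.ball (e x₀) (R / 4) →
      ∀ {s : ∀ x, V x}, IsHolomorphicSectionOn n F s W → ContDiffOn ℂ ω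
        (fun y => fcoord (trivializationAt F V x₀) (e.symm y) (s (e.symm y))) (chartSet e W) :=
    fun hW hWU s hs => IsHolomorphicSectionOn.contDiffOn_fcoord hW (hWU.trans hUt) hs he
  refine ⟨_, hUo, ⟨hx₀, Metric.mem_ball_self (by linarith)⟩, Set.inter_subset_left, hUt,
    fun ν x => formOf (M ν (e x)) (fcoord (trivializationAt F V x₀) x), ?_⟩
  refine ⟨fun ν => ⟨fun x hx v w => ?_, fun x hx v hv => ?_, fun W hW hWU s s' hs hs' => ?_⟩,
    fun x hx v => ?_, ?_, fun ν W hW hWU s hs e' he' => ?_⟩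
  · rw [formOf_apply, formOf_apply, sesq_conj_symm (hMp ν _ hx.2).1]
  · rw [formOf_apply]
    exact sesq_self_pos (hMp ν _ hx.2) fun h => hv ((fcoord_eq_zero_iff (hUt hx)).1 h)
  · refine contMDiffOn_of_contDiffOn he (hWU.trans Set.inter_subset_left) ?_
    refine (ContDiffOn.sesq (M := M ν) (fun a b => (hMs ν a b).contDiffOn)
      (contDiffOn_real_of_complex (hcoord hW hWU hs))
      (contDiffOn_real_of_complex (hcoord hW hWU hs'))).congr fun y hy => ?_
    simp only [formOf_apply, e.right_inv hy.1]
  · simp only [formOf_apply]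
    exact hMa _ hx.2 _
  · refine aeOn_of_local fun x hx => ⟨e, he, _, hUo, hx, Set.inter_subset_left, ?_⟩
    filter_upwards [hMl, hfin] with y h1 h2 hy v
    have hyU : y ∈ chartSet e (e.source ∩ e ⁻¹' Metric.ball (e x₀) (R / 4)) := ⟨hy.1, hy.2.1⟩
    have hyb := hmem y hyU
    have h3 := (ENNReal.continuous_ofReal.tendsto _).comp
      (h1 hyb (fcoord (trivializationAt F V x₀) (e.symm y) v))
    rw [h2 (hB4 hyb), flift_fcoord (hUt hyU.2)] at h3
    refine h3.congr fun ν => ?_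
    simp only [Function.comp_apply, formOf_apply, e.right_inv hy.1]
  · have hc := hcoord hW hWU hs
    have hO := isOpen_chartSet e hW
    have hWb : chartSet e W ⊆ Metric.ball (e x₀) (R / 4) := fun y hy =>
      hmem y ⟨hy.1, hWU hy.2⟩
    have heq : Set.EqOn (fun y => (formOf (M ν (e (e.symm y)))
        (fcoord (trivializationAt F V x₀) (e.symm y)) (s (e.symm y)) (s (e.symm y))).re)
        (fun y => (sesq (M ν y) (fcoord (trivializationAt F V x₀) (e.symm y) (s (e.symm y)))
          (fcoord (trivializationAt F V x₀) (e.symm y) (s (e.symm y)))).re) (chartSet e W) := by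
      intro y hy
      simp only [formOf_apply, e.right_inv hy.1]
    -- The inequality is known in the chart at `x₀`, and holomorphic coordinate changes preserve the
    -- sign of the Levi form.
    refine (levi_nonneg_of_chart (G := fun x => (formOf (M ν (e x))
      (fcoord (trivializationAt F V x₀) x) (s x) (s x)).re) hW he he'
      (hWU.trans Set.inter_subset_left) ?_ fun y hy ξ => ?_).2
    · exact (sesq_contDiffOn hO (fun a b => (hMs ν a b).contDiffOn)
        (contDiffOn_real_of_complex hc)).congr heq
    · rw [(levi_congr (heq.eventuallyEq_of_mem (hO.mem_nhds hy)) ξ).self_of_nhds]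
      exact hMn ν _ hO hWb _ hc y hy ξ

/-- Metrics for which the squared lengths of holomorphic sections are plurisubharmonic are trace
semi-negative. -/
theorem IsGriffithsApprox.smoothTraceSemiNegativeOn {k : ∀ x, V x → ℝ≥0∞} {U : Set X}
    {H : ℕ → ∀ x, V x →ₗ[ℂ] V x →ₗ⋆[ℂ] ℂ} (h : IsGriffithsApprox (n := n) F k U H)
    (g : HermitianMetric n X) (ν : ℕ) : SmoothTraceSemiNegativeOn F g (H ν) U := by
  intro e he W hW hWU f hf y hy c
  have hO := isOpen_chartSet e hW
  rw [← sum_sesq_eq]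
  refine curvature_nonpos
    (fun a b => (contDiffOn_frameMatrix (h.smooth ν) hW hWU hf he a b).contDiffAt (hO.mem_nhds hy))
    (by filter_upwards [hO.mem_nhds hy] with w hw using posDef_frameMatrix (h.smooth ν) hWU hf hw)
    c (fun L ξ => ?_) (g.posDef_coeff he hy.1).inv.posSemidef
  -- Sections with affine coefficients in the given frame are holomorphic, which is all that
  -- `curvature_nonpos` requires. The metric `g` enters only through the positivity of its inverse
  -- matrix.
  have hc : ∀ a, ContDiffOn ℂ ω (fun w => c a + L a (w - y)) (chartSet e W) := fun a =>
    (contDiff_const.add ((L a).contDiff.comp (contDiff_id.sub contDiff_const))).contDiffOn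
  have hsec := isHolomorphicSectionOn_sum (n := n) hf.contMDiffOn he hc
  have hW' := hW.inter e.open_source
  have hy' : y ∈ chartSet e (W ∩ e.source) := ⟨hy.1, hy.2, e.map_target hy.1⟩
  have h1 := h.levi_nonneg ν _ hW' (Set.inter_subset_left.trans hWU) _ hsec e he y hy' ξ
  have hsm : ContDiffAt ℝ ∞ (fun w => sesq (frameMatrix (H ν) f e w)
      (fun a => c a + L a (w - y)) (fun a => c a + L a (w - y))) y :=
    contDiffAt_sesq (u := fun a w => c a + L a (w - y))
      (fun a b => (contDiffOn_frameMatrix (h.smooth ν) hW hWU hf he a b).contDiffAt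
        (hO.mem_nhds hy))
      (fun a => (contDiffOn_real_of_complex (hc a)).contDiffAt (hO.mem_nhds hy))
  rw [← levi_re hsm]
  refine h1.trans_eq ((levi_congr ?_ ξ).self_of_nhds)
  filter_upwards [hO.mem_nhds hy] with w hw
  simp only [e.right_inv hw.1]
  rw [form_sum_eq_sesq]
  rfl

theorem IsGriffithsApprox.traceSemiNegativeWithApprox {k : ∀ x, V x → ℝ≥0∞}
    (h : ∀ x₀ : X, ∃ U : Set X, IsOpen U ∧ x₀ ∈ U ∧ U ⊆ (chartAt (Cn n) x₀).source ∧
      U ⊆ (trivializationAt F V x₀).baseSet ∧ ∃ H, IsGriffithsApprox (n := n) F k U H)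
    (g : HermitianMetric n X) : TraceSemiNegativeWithApprox F g k := fun x₀ => by
  obtain ⟨U, hU, hxU, -, -, H, hH⟩ := h x₀
  exact ⟨U, hU, hxU, H, hH.smooth, fun ν => hH.smoothTraceSemiNegativeOn g ν, hH.antitone,
    hH.tendsto⟩

end Approx

/-! ### The limit of a Griffiths approximation -/

section Regularity
variable {n : ℕ} {X : Type*} [TopologicalSpace X] [ChartedSpace (Cn n) X]
  [IsManifold 𝓘(ℂ, Cn n) ω X]
variable {F : Type*} [NormedAddCommGroup F] [NormedSpace ℂ F] [FiniteDimensional ℂ F]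
variable {V : X → Type*} [∀ x, AddCommGroup (V x)] [∀ x, Module ℂ (V x)]
  [TopologicalSpace (TotalSpace F V)] [∀ x, TopologicalSpace (V x)] [FiberBundle F V]
  [VectorBundle ℂ F V] [ContMDiffVectorBundle ω F V 𝓘(ℂ, Cn n)]

/-- The norm that is the limit of a decreasing sequence of Hermitian norms. -/
def limitNorm {E' : Type*} [AddCommGroup E'] [Module ℂ E'] (H : ℕ → E' →ₗ[ℂ] E' →ₗ⋆[ℂ] ℂ)
    (v : E') : ℝ≥0∞ := ENNReal.ofReal (Real.sqrt (⨅ ν, (H ν v v).re))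

section LimitNorm
variable {E' : Type*} [AddCommGroup E'] [Module ℂ E'] {H : ℕ → E' →ₗ[ℂ] E' →ₗ⋆[ℂ] ℂ}

theorem tendsto_iInf_form (hnn : ∀ ν v, 0 ≤ (H ν v v).re)
    (hanti : ∀ v, Antitone fun ν => (H ν v v).re) (v : E') :
    Filter.Tendsto (fun ν => (H ν v v).re) Filter.atTop (𝓝 (⨅ ν, (H ν v v).re)) :=
  tendsto_atTop_ciInf (hanti v) ⟨0, by rintro _ ⟨ν, rfl⟩; exact hnn ν v⟩

theorem iInf_form_nonneg (hnn : ∀ ν v, 0 ≤ (H ν v v).re) (v : E') : 0 ≤ ⨅ ν, (H ν v v).re :=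
  le_ciInf fun ν => hnn ν v

theorem limitNorm_sq (hnn : ∀ ν v, 0 ≤ (H ν v v).re) (v : E') :
    limitNorm H v ^ 2 = ENNReal.ofReal (⨅ ν, (H ν v v).re) := by
  rw [limitNorm, ← ENNReal.ofReal_pow (Real.sqrt_nonneg _), Real.sq_sqrt (iInf_form_nonneg hnn v)]

theorem tendsto_limitNorm_sq (hnn : ∀ ν v, 0 ≤ (H ν v v).re)
    (hanti : ∀ v, Antitone fun ν => (H ν v v).re) (v : E') :
    Filter.Tendsto (fun ν => ENNReal.ofReal (H ν v v).re) Filter.atTop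
      (𝓝 (limitNorm H v ^ 2)) := by
  rw [limitNorm_sq hnn]
  exact (ENNReal.continuous_ofReal.tendsto _).comp (tendsto_iInf_form hnn hanti v)

/-- The summand `1 / (ν + 1)` keeps the logarithm finite where the form vanishes on `v`. It
decreases with `ν`, so monotonicity is not lost, and it disappears in the limit, also when the limit
is `-∞`. -/
theorem tendsto_log_limitNorm (hnn : ∀ ν v, 0 ≤ (H ν v v).re)
    (hanti : ∀ v, Antitone fun ν => (H ν v v).re) (v : E') :
    Filter.Tendsto (fun ν : ℕ => ((1 / 2 * Real.log ((H ν v v).re + 1 / ((ν : ℝ) + 1)) : ℝ) : EReal))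
      Filter.atTop (𝓝 (ENNReal.log (limitNorm H v))) := by
  have h1 : Filter.Tendsto (fun ν : ℕ => (H ν v v).re + 1 / ((ν : ℝ) + 1)) Filter.atTop
      (𝓝 (⨅ ν, (H ν v v).re)) := by
    simpa using (tendsto_iInf_form hnn hanti v).add tendsto_one_div_add_atTop_nhds_zero_nat
  have h2 := ((ENNReal.continuous_log.comp
    (ENNReal.continuous_ofReal.comp Real.continuous_sqrt)).tendsto _).comp h1
  refine h2.congr fun ν => ?_
  have hp : 0 < (H ν v v).re + 1 / ((ν : ℝ) + 1) := by
    have := hnn ν v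
    positivity
  simp only [Function.comp_apply]
  rw [ENNReal.log_ofReal_of_pos (Real.sqrt_pos.2 hp), Real.log_sqrt hp.le]
  congr 1
  ring

end LimitNorm

theorem ennreal_sq_injective : Function.Injective fun a : ℝ≥0∞ => a ^ 2 := fun a b h => by
  have h1 := ENNReal.rpow_left_injective (two_ne_zero (α := ℝ))
  exact h1 (by simpa using h)

namespace IsGriffithsApprox
variable {k : ∀ x, V x → ℝ≥0∞} {U : Set X} {H : ℕ → ∀ x, V x →ₗ[ℂ] V x →ₗ⋆[ℂ] ℂ}

theorem form_nonneg (h : IsGriffithsApprox (n := n) F k U H) {x : X} (hx : x ∈ U) (ν : ℕ)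
    (v : V x) : 0 ≤ (H ν x v v).re := by
  rcases eq_or_ne v 0 with rfl | hv
  · simp
  · exact ((h.smooth ν).pos x hx v hv).le

theorem levi_log_nonneg (h : IsGriffithsApprox (n := n) F k U H)
    {t : Trivialization F (TotalSpace.proj : TotalSpace F V → X)} [MemTrivializationAtlas t]
    {W : Set X} (hW : IsOpen W) (hWU : W ⊆ U) (hWt : W ⊆ t.baseSet) {s : ∀ x, V x}
    (hs : IsHolomorphicSectionOn n F s W) {e : OpenPartialHomeomorph X (Cn n)}
    (he : e ∈ atlas (Cn n) X) {y : Cn n} (hy : y ∈ chartSet e W) (ν : ℕ) (ξ : Cn n) {δ : ℝ}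
    (hδ : 0 < δ) : 0 ≤ levi ξ (fun y => Real.log
      ((H ν (e.symm y) (s (e.symm y)) (s (e.symm y))).re + δ)) y := by
  have hO := isOpen_chartSet e hW
  have hf := isLocalFrameOn_trivFrame (n := n) hW hWt
  have hform : ∀ y ∈ chartSet e W, H ν (e.symm y) (s (e.symm y)) (s (e.symm y)) =
      sesq (frameMatrix (H ν) (trivFrame t) e y) (fcoord t (e.symm y) (s (e.symm y)))
        (fcoord t (e.symm y) (s (e.symm y))) := by
    intro y hy
    rw [frameMatrix_eq_of, ← form_sum_eq_sesq, sum_smul_trivFrame, flift_fcoord (hWt hy.2)]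
  have h1 := levi_log_sesq_nonneg hO
    (fun a b => contDiffOn_frameMatrix (h.smooth ν) hW hWU hf he a b)
    (fun z hz => (posDef_frameMatrix (h.smooth ν) hWU hf hz).posSemidef)
    (fun u hu z hz ξ => ?_) (IsHolomorphicSectionOn.contDiffOn_fcoord hW hWt hs he) hy ξ hδ
  · refine h1.trans_eq ((levi_congr ?_ ξ).self_of_nhds)
    filter_upwards [hO.mem_nhds hy] with w hw
    rw [hform w hw]
  · have hsub : e.source ∩ e ⁻¹' chartSet e W ⊆ W := fun x hx => by
      have := hx.2.2
      rwa [Set.mem_preimage, e.left_inv hx.1] at this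
    have hz' : z ∈ chartSet e (e.source ∩ e ⁻¹' chartSet e W) := ⟨hz.1, e.map_target hz.1, by
      rwa [Set.mem_preimage, e.right_inv hz.1]⟩
    have h2 := h.levi_nonneg ν _ (e.isOpen_inter_preimage hO) (hsub.trans hWU) _
      (isHolomorphicSectionOn_flift (t := t) he hO (fun w hw => ⟨hw.1, hWt hw.2⟩) hu) e he z hz' ξ
    refine h2.trans_eq ((levi_congr ?_ ξ).self_of_nhds)
    filter_upwards [hO.mem_nhds hz] with w hw
    simp only [e.right_inv hw.1]
    rw [← sum_smul_trivFrame, form_sum_eq_sesq]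
    rfl

/-- The limit of a Griffiths semi-negative approximation is Griffiths semi-negative. -/
theorem isPlurisubharmonicOn (h : IsGriffithsApprox (n := n) F k U H)
    {t : Trivialization F (TotalSpace.proj : TotalSpace F V → X)} [MemTrivializationAtlas t]
    {W : Set X} (hW : IsOpen W) (hWU : W ⊆ U) (hWt : W ⊆ t.baseSet) {s : ∀ x, V x}
    (hs : IsHolomorphicSectionOn n F s W) :
    IsPlurisubharmonicOn n (fun x => ENNReal.log (limitNorm (fun ν => H ν x) (s x))) W := by
  have hanti : ∀ x ∈ W, Antitone fun ν : ℕ =>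
      1 / 2 * Real.log ((H ν x (s x) (s x)).re + 1 / ((ν : ℝ) + 1)) := by
    intro x hx i j hij
    have h1 := h.antitone x (hWU hx) (s x) hij
    have h2 := one_div_le_one_div_of_le (by positivity : (0 : ℝ) < (i : ℝ) + 1)
      (by exact_mod_cast Nat.succ_le_succ hij : ((i : ℝ) + 1) ≤ (j : ℝ) + 1)
    have h3 := h.form_nonneg (hWU hx) j (s x)
    have h4 : (0 : ℝ) < 1 / ((j : ℝ) + 1) := by positivity
    dsimp only at h1 ⊢
    have h5 := Real.log_le_log (by linarith : 0 < (H j x (s x) (s x)).re + 1 / ((j : ℝ) + 1))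
      (add_le_add h1 h2)
    linarith
  have hlim : ∀ x ∈ W, Filter.Tendsto (fun ν : ℕ =>
      ((1 / 2 * Real.log ((H ν x (s x) (s x)).re + 1 / ((ν : ℝ) + 1)) : ℝ) : EReal)) Filter.atTop
      (𝓝 (ENNReal.log (limitNorm (fun ν => H ν x) (s x)))) := fun x hx =>
    tendsto_log_limitNorm (fun ν => h.form_nonneg (hWU hx) ν) (h.antitone x (hWU hx)) (s x)
  have hsm : ∀ ν, ContMDiffOn 𝓘(ℝ, Cn n) 𝓘(ℝ, ℂ) ∞ (fun x => H ν x (s x) (s x)) W := fun ν =>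
    (h.smooth ν).smooth W hW hWU s s hs hs
  have hne : ∀ ν : ℕ, ∀ x ∈ W, (H ν x (s x) (s x)).re + 1 / ((ν : ℝ) + 1) ≠ 0 := fun ν x hx => by
    have := h.form_nonneg (hWU hx) ν (s x)
    positivity
  refine ⟨usc_of_antitone (fun ν => ?_) hanti hlim, fun x _ => ?_, fun e he y v hd M => ?_⟩
  · exact continuousOn_const.mul (((Complex.continuous_re.comp_continuousOn
      (hsm ν).continuousOn).add continuousOn_const).log (hne ν))
  · rw [ENNReal.log_lt_top_iff]
    exact ENNReal.ofReal_lt_top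
  · have hcd : ∀ ν, ContDiffOn ℝ ∞ (fun y =>
        (H ν (e.symm y) (s (e.symm y)) (s (e.symm y))).re) (chartSet e W) := fun ν =>
      Complex.reCLM.contDiff.comp_contDiffOn (contDiffOn_of_contMDiffOn (hsm ν) he)
    have hlog : ∀ ν : ℕ, ContDiffOn ℝ ∞ (fun y => Real.log
        ((H ν (e.symm y) (s (e.symm y)) (s (e.symm y))).re + 1 / ((ν : ℝ) + 1)))
        (chartSet e W) := fun ν =>
      ((hcd ν).add contDiffOn_const).log fun y hy => hne ν _ hy.2
    have hO := isOpen_chartSet e hW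
    exact le_circMean_trunc_of_antitone
      (φ := fun y => ENNReal.log (limitNorm (fun ν => H ν (e.symm y)) (s (e.symm y))))
      hO (fun ν => contDiffOn_const.mul (hlog ν))
      (fun ν z hz ξ => by
        rw [levi_const_mul]
        exact mul_nonneg (by norm_num) (h.levi_log_nonneg hW hWU hWt hs he hz ν ξ (by positivity)))
      (fun z hz => hanti _ hz.2) (fun z hz => hlim _ hz.2) hd M

theorem ae_limitNorm_eq (h : IsGriffithsApprox (n := n) F k U H) :
    AEOn n U fun x => limitNorm (fun ν => H ν x) = k x := by
  intro e he
  filter_upwards [h.tendsto e he] with y hy hyU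
  ext v
  have h1 := tendsto_nhds_unique (hy hyU v)
    (tendsto_limitNorm_sq (fun ν => h.form_nonneg hyU.2 ν) (h.antitone _ hyU.2) v)
  exact ennreal_sq_injective h1.symm

end IsGriffithsApprox

theorem AEOn.mono {U W : Set X} {P Q : X → Prop} (h : AEOn n U P) (hWU : W ⊆ U)
    (hPQ : ∀ x ∈ W, P x → Q x) : AEOn n W Q := fun e he => by
  filter_upwards [h e he] with y hy hyW
  exact hPQ _ hyW.2 (hy ⟨hyW.1, hWU hyW.2⟩)

theorem AEOn.and {U : Set X} {P Q : X → Prop} (h : AEOn n U P) (h' : AEOn n U Q) :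
    AEOn n U fun x => P x ∧ Q x := fun e he => by
  filter_upwards [h e he, h' e he] with y hy hy' hyW
  exact ⟨hy hyW, hy' hyW⟩

theorem IsPlurisubharmonicOn.congr {φ φ' : X → EReal} {U : Set X}
    (h : IsPlurisubharmonicOn n φ U) (hφ : ∀ x ∈ U, φ x = φ' x) :
    IsPlurisubharmonicOn n φ' U where
  upperSemicontinuousOn x hx c hc := by
    filter_upwards [h.upperSemicontinuousOn x hx c (by
      change φ x < c
      rw [hφ x hx]
      exact hc), self_mem_nhdsWithin]
      with y hy hyU
    rw [← hφ y hyU]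
    exact hy
  lt_top x hx := hφ x hx ▸ h.lt_top x hx
  submean e he y v hd M := by
    have h0 : e.symm y ∈ U := by simpa using (hd 0 (by simp)).2
    rw [← hφ _ h0]
    refine (h.submean e he y v hd M).trans_eq ?_
    rw [Real.circleAverage_congr_sphere fun ζ hζ => ?_]
    rw [hφ _ (hd ζ ?_).2]
    rw [abs_one, mem_sphere_zero_iff_norm] at hζ
    exact hζ.le

/-- Local approximations define a Griffiths semi-negative metric that is finite everywhere. -/
theorem exists_griffithsSemiNegative {k : ∀ x, V x → ℝ≥0∞}
    (h : ∀ x₀ : X, ∃ U : Set X, IsOpen U ∧ x₀ ∈ U ∧ U ⊆ (chartAt (Cn n) x₀).source ∧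
      U ⊆ (trivializationAt F V x₀).baseSet ∧ ∃ H, IsGriffithsApprox (n := n) F k U H) :
    ∃ H : ℕ → ∀ x, V x →ₗ[ℂ] V x →ₗ⋆[ℂ] ℂ,
      (∀ ν x v w, H ν x w v = (starRingEnd ℂ) (H ν x v w)) ∧
      (∀ ν x v, v ≠ 0 → 0 < (H ν x v v).re) ∧ (∀ x v, Antitone fun ν => (H ν x v v).re) ∧
      GriffithsSemiNegative n F (fun x => limitNorm fun ν => H ν x) ∧
      AEOn n Set.univ fun x => limitNorm (fun ν => H ν x) = k x := by
  choose U hU hxU hUe hUt H hH using h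
  -- Two local limits agree everywhere on the overlap: a vector is extended to a holomorphic section
  -- with constant coordinates, both logarithms are plurisubharmonic, and both equal `log k` of the
  -- section almost everywhere.
  have hcons : ∀ x₀, ∀ x ∈ U x₀, limitNorm (fun ν => H x ν x) = limitNorm fun ν => H x₀ ν x := by
    intro x₀ x hx
    ext v
    have hW := (hU x).inter (hU x₀)
    have hxb := hUt x₀ hx
    have hs : IsHolomorphicSectionOn n F (fun y => flift (trivializationAt F V x₀) y
        (fcoord (trivializationAt F V x₀) x v)) (U x ∩ U x₀) := by
      rw [isHolomorphicSectionOn_iff hW (Set.inter_subset_right.trans (hUt x₀))]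
      exact (contMDiffOn_const (c := fcoord (trivializationAt F V x₀) x v)).congr
        fun y hy => fcoord_flift (hUt x₀ hy.2) _
    have h1 := ((hH x).isPlurisubharmonicOn hW Set.inter_subset_left
      (Set.inter_subset_left.trans (hUt x)) hs).eq_of_ae_eq hW
      ((hH x₀).isPlurisubharmonicOn hW Set.inter_subset_right
      (Set.inter_subset_right.trans (hUt x₀)) hs)
      ((((hH x).ae_limitNorm_eq.mono Set.inter_subset_left fun _ _ h => h).and
        ((hH x₀).ae_limitNorm_eq.mono Set.inter_subset_right fun _ _ h => h)).mono subset_rfl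
        fun y _ h => by rw [h.1, h.2]) ⟨hxU x, hx⟩
    rw [flift_fcoord hxb] at h1
    exact ENNReal.log_injective h1
  -- At `x` the approximation chosen for `x` itself is used. This global sequence need not vary
  -- smoothly; only its fibrewise limit matters, which by `hcons` is locally the limit of a single
  -- smooth approximation.
  refine ⟨fun ν x => H x ν x, fun ν x v w => ((hH x).smooth ν).conj_symm x (hxU x) v w,
    fun ν x v hv => ((hH x).smooth ν).pos x (hxU x) v hv, fun x v => (hH x).antitone x (hxU x) v,
    fun W hW u hu => IsPlurisubharmonicOn.of_local hW fun x hx => ?_, ?_⟩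
  · refine ⟨W ∩ U x, hW.inter (hU x), ⟨hx, hxU x⟩, ?_⟩
    have h1 := (hH x).isPlurisubharmonicOn (hW.inter (hU x)) Set.inter_subset_right
      (Set.inter_subset_right.trans (hUt x)) (ContMDiffOn.mono hu Set.inter_subset_left)
    exact h1.congr fun y hy => by rw [← hcons x y hy.2]
  · refine aeOn_of_local fun x _ => ⟨chartAt (Cn n) x, chart_mem_atlas _ x, U x, hU x, hxU x,
      hUe x, ?_⟩
    filter_upwards [(hH x).ae_limitNorm_eq _ (chart_mem_atlas (Cn n) x)] with y hy hyU
    rw [hcons x _ hyU.2.1]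
    exact hy ⟨hyU.1, hyU.2.1⟩

end Regularity

/-! ### Hermitian norms and duality in one fibre -/

section Fibre
variable {A : Type*} [AddCommGroup A] [Module ℂ A] {W : Type*} [AddCommGroup W] [Module ℂ W]

/-- The inner product space structure of a positive definite form. -/
@[reducible] def formCore (H : W →ₗ[ℂ] W →ₗ⋆[ℂ] ℂ) (hc : ∀ v w, H w v = (starRingEnd ℂ) (H v w))
    (hp : ∀ v, v ≠ 0 → 0 < (H v v).re) : InnerProductSpace.Core ℂ W where
  inner v w := H w v
  conj_inner_symm v w := (hc v w).symm ▸ by simp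
  re_inner_nonneg v := by
    rcases eq_or_ne v 0 with rfl | hv
    · simp
    · exact (hp v hv).le
  add_left v w z := by simp
  smul_left v w c := by simp
  definite v h := by
    by_contra hv
    have := hp v hv
    rw [h] at this
    simp at this

theorem norm_form_sq_le {H : W →ₗ[ℂ] W →ₗ⋆[ℂ] ℂ} (hc : ∀ v w, H w v = (starRingEnd ℂ) (H v w))
    (hp : ∀ v, v ≠ 0 → 0 < (H v v).re) (v w : W) :
    ‖H v w‖ ^ 2 ≤ (H v v).re * (H w w).re := by
  let := (formCore H hc hp).toCore
  have h1 := InnerProductSpace.Core.inner_mul_inner_self_le (𝕜 := ℂ) v w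
  change ‖H w v‖ * ‖H v w‖ ≤ (H v v).re * (H w w).re at h1
  rwa [hc v w, RCLike.norm_conj, ← sq] at h1

theorem exists_basis_of_form [FiniteDimensional ℂ W] {H : W →ₗ[ℂ] W →ₗ⋆[ℂ] ℂ}
    (hc : ∀ v w, H w v = (starRingEnd ℂ) (H v w)) (hp : ∀ v, v ≠ 0 → 0 < (H v v).re) :
    ∃ b : Module.Basis (Fin (Module.finrank ℂ W)) ℂ W, ∀ v, (H v v).re = ∑ i, ‖b.repr v i‖ ^ 2 := by
  let : NormedAddCommGroup W := (formCore H hc hp).toNormedAddCommGroup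
  let : InnerProductSpace ℂ W := InnerProductSpace.ofCore (formCore H hc hp).toCore
  refine ⟨(stdOrthonormalBasis ℂ W).toBasis, fun v => ?_⟩
  have h1 : ‖v‖ ^ 2 = (H v v).re := norm_sq_eq_re_inner (𝕜 := ℂ) v
  rw [← h1, ← (stdOrthonormalBasis ℂ W).repr.norm_map v, EuclideanSpace.norm_sq_eq]
  rfl

/-- The Jordan–von Neumann theorem. -/
theorem IsHermitianNorm.of_parallelogram {N : A → ℝ≥0∞} (h0 : N 0 = 0)
    (hs : ∀ c : ℂ, c ≠ 0 → ∀ v, N (c • v) = ‖c‖ₑ * N v) (ht : ∀ v w, N (v + w) ≤ N v + N w)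
    (hpar : ∀ v w, N (v + w) ^ 2 + N (v - w) ^ 2 = 2 * N v ^ 2 + 2 * N w ^ 2)
    (hpos : ∀ v, v ≠ 0 → 0 < N v ∧ N v < ⊤) : IsHermitianNorm N := by
  have hfin : ∀ v, N v ≠ ⊤ := fun v => by
    rcases eq_or_ne v 0 with rfl | hv
    · simp [h0]
    · exact (hpos v hv).2.ne
  let : Norm A := ⟨fun v => (N v).toReal⟩
  have hnorm : ∀ v : A, ‖v‖ = (N v).toReal := fun v => rfl
  have core : NormedSpace.Core ℂ A :=
    { norm_nonneg := fun v => ENNReal.toReal_nonneg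
      norm_smul := fun c v => by
        rcases eq_or_ne c 0 with rfl | hc
        · simp [hnorm, h0]
        · rw [hnorm, hs c hc, ENNReal.toReal_mul, toReal_enorm, hnorm]
      norm_triangle := fun v w => by
        rw [hnorm, hnorm, hnorm, ← ENNReal.toReal_add (hfin v) (hfin w)]
        exact ENNReal.toReal_mono (ENNReal.add_ne_top.2 ⟨hfin v, hfin w⟩) (ht v w)
      norm_eq_zero_iff := fun v => by
        rw [hnorm, ENNReal.toReal_eq_zero_iff, or_iff_left (hfin v)]
        refine ⟨fun h => ?_, fun h => by rw [h, h0]⟩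
        by_contra hv
        exact (hpos v hv).1.ne' h }
  let : NormedAddCommGroup A := NormedAddCommGroup.ofCore core
  let : NormedSpace ℂ A := NormedSpace.ofCore core
  let : InnerProductSpace ℂ A := InnerProductSpace.ofNorm ℂ fun v w => by
    have h1 := congrArg ENNReal.toReal (hpar v w)
    rw [ENNReal.toReal_add (ENNReal.pow_ne_top (hfin _)) (ENNReal.pow_ne_top (hfin _)),
      ENNReal.toReal_add (ENNReal.mul_ne_top (by simp) (ENNReal.pow_ne_top (hfin _)))
        (ENNReal.mul_ne_top (by simp) (ENNReal.pow_ne_top (hfin _)))] at h1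
    simp only [ENNReal.toReal_pow, ENNReal.toReal_mul, ENNReal.toReal_ofNat] at h1
    change (N (v + w)).toReal * (N (v + w)).toReal + (N (v - w)).toReal * (N (v - w)).toReal =
      2 * ((N v).toReal * (N v).toReal + (N w).toReal * (N w).toReal)
    linarith
  refine ⟨LinearMap.mk₂'ₛₗ (RingHom.id ℂ) (starRingEnd ℂ) (fun v w => inner ℂ w v)
    (fun v v' w => inner_add_right _ _ _) (fun c v w => inner_smul_right _ _ _)
    (fun v w w' => inner_add_left _ _ _) (fun c v w => inner_smul_left _ _ _),
    fun v w => (inner_conj_symm (𝕜 := ℂ) v w).symm, fun v hv => ?_, fun v => ?_⟩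
  · change 0 < (inner ℂ v v).re
    have : (inner ℂ v v).re = ‖v‖ ^ 2 := (norm_sq_eq_re_inner (𝕜 := ℂ) v).symm
    rw [this, hnorm]
    have := ENNReal.toReal_pos (hpos v hv).1.ne' (hfin v)
    positivity
  · change N v ^ 2 = ENNReal.ofReal (inner ℂ v v).re
    have : (inner ℂ v v).re = ‖v‖ ^ 2 := (norm_sq_eq_re_inner (𝕜 := ℂ) v).symm
    rw [this, hnorm, ENNReal.ofReal_pow ENNReal.toReal_nonneg, ENNReal.ofReal_toReal (hfin v)]

/-- The norm that is dual to `N` for the pairing `B`. -/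
def polarNorm (B : W →ₗ[ℂ] A →ₗ[ℂ] ℂ) (N : W → ℝ≥0∞) (v : A) : ℝ≥0∞ :=
  ⨆ w : W, ⨆ _ : N w ≤ 1, ‖B w v‖ₑ

variable {B : W →ₗ[ℂ] A →ₗ[ℂ] ℂ} {N : W → ℝ≥0∞}

theorem le_polarNorm {w : W} (hw : N w ≤ 1) (v : A) : ‖B w v‖ₑ ≤ polarNorm B N v :=
  le_iSup₂ (f := fun w (_ : N w ≤ 1) => ‖B w v‖ₑ) w hw

theorem polarNorm_zero : polarNorm B N 0 = 0 := by simp [polarNorm]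

theorem polarNorm_smul (c : ℂ) (v : A) : polarNorm B N (c • v) = ‖c‖ₑ * polarNorm B N v := by
  simp only [polarNorm, map_smul, smul_eq_mul, enorm_mul, ENNReal.mul_iSup]

theorem polarNorm_add_le (v w : A) : polarNorm B N (v + w) ≤ polarNorm B N v + polarNorm B N w := by
  refine iSup₂_le fun ξ hξ => ?_
  rw [map_add]
  exact (enorm_add_le _ _).trans (add_le_add (le_polarNorm hξ v) (le_polarNorm hξ w))

/-- The dual norm in an orthonormal basis. -/
theorem polarNorm_sq_eq_sum {ι : Type*} [Fintype ι] (b : Module.Basis ι ℂ W)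
    (hb : ∀ w, N w ^ 2 = ENNReal.ofReal (∑ i, ‖b.repr w i‖ ^ 2)) (v : A) :
    polarNorm B N v ^ 2 = ENNReal.ofReal (∑ i, ‖B (b i) v‖ ^ 2) := by
  have hS : 0 ≤ ∑ i, ‖B (b i) v‖ ^ 2 := Finset.sum_nonneg fun i _ => sq_nonneg _
  suffices h : polarNorm B N v = ENNReal.ofReal (Real.sqrt (∑ i, ‖B (b i) v‖ ^ 2)) by
    rw [h, ← ENNReal.ofReal_pow (Real.sqrt_nonneg _), Real.sq_sqrt hS]
  have hexp : ∀ w, B w v = ∑ i, b.repr w i * B (b i) v := fun w => by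
    conv_lhs => rw [← b.sum_repr w]
    rw [map_sum, LinearMap.sum_apply]
    exact Finset.sum_congr rfl fun i _ => by rw [map_smul, LinearMap.smul_apply, smul_eq_mul]
  have hunit : ∀ w, N w ≤ 1 ↔ ∑ i, ‖b.repr w i‖ ^ 2 ≤ 1 := fun w => by
    rw [← ENNReal.ofReal_le_one, ← hb]
    exact ⟨fun h => pow_le_one' h 2, fun h => by
      by_contra! h'
      exact (one_lt_pow₀ h' two_ne_zero).not_ge h⟩
  refine le_antisymm (iSup₂_le fun w hw => ?_) ?_
  · rw [← ofReal_norm]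
    refine ENNReal.ofReal_le_ofReal (Real.le_sqrt_of_sq_le ?_)
    rw [hexp]
    have h1 : ‖∑ i, b.repr w i * B (b i) v‖ ≤ ∑ i, ‖b.repr w i‖ * ‖B (b i) v‖ :=
      (norm_sum_le _ _).trans_eq (Finset.sum_congr rfl fun i _ => norm_mul _ _)
    have h2 := Finset.sum_mul_sq_le_sq_mul_sq Finset.univ (fun i => ‖b.repr w i‖)
      fun i => ‖B (b i) v‖
    calc _ ≤ (∑ i, ‖b.repr w i‖ * ‖B (b i) v‖) ^ 2 := pow_le_pow_left₀ (norm_nonneg _) h1 2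
      _ ≤ _ := h2
      _ ≤ 1 * ∑ i, ‖B (b i) v‖ ^ 2 := mul_le_mul_of_nonneg_right ((hunit w).1 hw) hS
      _ = _ := one_mul _
  · rcases hS.eq_or_lt with h0 | hpos
    · rw [← h0, Real.sqrt_zero, ENNReal.ofReal_zero]
      exact zero_le
    obtain ⟨S, hSdef⟩ : ∃ S, S = ∑ i, ‖B (b i) v‖ ^ 2 := ⟨_, rfl⟩
    rw [← hSdef] at hpos ⊢
    have hsq := Real.sqrt_pos.2 hpos
    -- The case of equality in Cauchy–Schwarz: conjugate coefficients, normalised to length one.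
    obtain ⟨w, hw⟩ : ∃ w, ∀ i, b.repr w i =
        (starRingEnd ℂ) (B (b i) v) * ((Real.sqrt S)⁻¹ : ℝ) :=
      ⟨b.equivFun.symm fun i => (starRingEnd ℂ) (B (b i) v) * ((Real.sqrt S)⁻¹ : ℝ), fun i => by
        simp [← b.equivFun_apply, -Module.Basis.equivFun_symm_apply]⟩
    have h1 : N w ≤ 1 := by
      rw [hunit]
      simp only [hw, norm_mul, RCLike.norm_conj, Complex.norm_real, mul_pow, ← Finset.sum_mul]
      rw [← hSdef, Real.norm_of_nonneg (by positivity), inv_pow, Real.sq_sqrt hpos.le,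
        mul_inv_cancel₀ hpos.ne']
    refine le_trans (le_of_eq ?_) (le_polarNorm h1 v)
    rw [hexp, ← ofReal_norm]
    congr 1
    have h2 : ∑ i, b.repr w i * B (b i) v = ((Real.sqrt S : ℝ) : ℂ) := by
      have h3 : ∀ i, b.repr w i * B (b i) v =
          ((‖B (b i) v‖ ^ 2 * (Real.sqrt S)⁻¹ : ℝ) : ℂ) := fun i => by
        rw [hw]
        push_cast
        rw [← Complex.conj_mul']
        ring
      simp only [h3, ← Complex.ofReal_sum, ← Finset.sum_mul, ← hSdef]
      congr 1
      rw [← div_eq_mul_inv, Real.div_sqrt]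
    rw [h2, Complex.norm_real, Real.norm_of_nonneg hsq.le]

theorem polarNorm_parallelogram_of_basis {ι : Type*} [Fintype ι] (b : Module.Basis ι ℂ W)
    (hb : ∀ w, N w ^ 2 = ENNReal.ofReal (∑ i, ‖b.repr w i‖ ^ 2)) (v w : A) :
    polarNorm B N (v + w) ^ 2 + polarNorm B N (v - w) ^ 2 =
      2 * polarNorm B N v ^ 2 + 2 * polarNorm B N w ^ 2 := by
  have hS : ∀ v : A, 0 ≤ ∑ i, ‖B (b i) v‖ ^ 2 := fun v => Finset.sum_nonneg fun i _ => sq_nonneg _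
  simp only [polarNorm_sq_eq_sum b hb]
  rw [← ENNReal.ofReal_add (hS _) (hS _), ← ENNReal.ofReal_ofNat, ← ENNReal.ofReal_mul (by simp),
    ← ENNReal.ofReal_mul (by simp), ← ENNReal.ofReal_add (mul_nonneg (by simp) (hS _))
    (mul_nonneg (by simp) (hS _))]
  congr 1
  simp only [Finset.mul_sum, ← Finset.sum_add_distrib, map_add, map_sub]
  refine Finset.sum_congr rfl fun i _ => ?_
  have := parallelogram_law_with_norm ℂ (B (b i) v) (B (b i) w)
  linarith

/-- The dual of a Hermitian norm is a Hermitian norm. -/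
theorem IsHermitianNorm.polarNorm [FiniteDimensional ℂ W] (h : IsHermitianNorm N)
    (hB : ∀ v, (∀ w, B w v = 0) → v = 0) : IsHermitianNorm (polarNorm B N) := by
  obtain ⟨H, hc, hp, hH⟩ := h
  obtain ⟨b, hb⟩ := exists_basis_of_form hc hp
  simp only [hb] at hH
  obtain ⟨G, h1⟩ : ∃ G : A →ₗ[ℂ] A →ₗ⋆[ℂ] ℂ, ∀ v v' : A, G v v' =
      ∑ i, B (b i) v * (starRingEnd ℂ) (B (b i) v') :=
    ⟨LinearMap.mk₂'ₛₗ (RingHom.id ℂ) (starRingEnd ℂ)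
      (fun v v' => ∑ i, B (b i) v * (starRingEnd ℂ) (B (b i) v'))
      (fun v v' w => by simp [add_mul, Finset.sum_add_distrib])
      (fun c v w => by simp [Finset.mul_sum, mul_assoc])
      (fun v w w' => by simp [mul_add, Finset.sum_add_distrib])
      (fun c v w => by simp [Finset.mul_sum, mul_left_comm]), fun _ _ => rfl⟩
  have h2 : ∀ v, (∑ i, B (b i) v * (starRingEnd ℂ) (B (b i) v)).re = ∑ i, ‖B (b i) v‖ ^ 2 := by
    intro v
    rw [Complex.re_sum]
    refine Finset.sum_congr rfl fun i _ => ?_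
    rw [Complex.mul_conj, Complex.ofReal_re, Complex.normSq_eq_norm_sq]
  refine ⟨G, fun v w => ?_, fun v hv => ?_, fun v => ?_⟩
  · rw [h1, h1, map_sum]
    exact Finset.sum_congr rfl fun i _ => by rw [map_mul, Complex.conj_conj, mul_comm]
  · rw [h1, h2]
    by_contra! hle
    have h3 : ∀ i, B (b i) v = 0 := fun i => by
      have := (Finset.sum_eq_zero_iff_of_nonneg fun i _ => sq_nonneg ‖B (b i) v‖).1
        (le_antisymm hle (Finset.sum_nonneg fun i _ => sq_nonneg _)) i (Finset.mem_univ i)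
      simpa using this
    refine hv (hB v fun w => ?_)
    rw [← b.sum_repr w, map_sum, LinearMap.sum_apply]
    exact Finset.sum_eq_zero fun i _ => by
      rw [map_smul, LinearMap.smul_apply, h3, smul_zero]
  · rw [h1, h2, polarNorm_sq_eq_sum b hH]

end Fibre

/-! ### Limits of Hermitian norms and the bipolar theorem -/

section LimitFibre
variable {A : Type*} [AddCommGroup A] [Module ℂ A] {W : Type*} [AddCommGroup W] [Module ℂ W]
variable {H : ℕ → W →ₗ[ℂ] W →ₗ⋆[ℂ] ℂ}

/-- Polarisation. -/
theorem form_polarization {H : W →ₗ[ℂ] W →ₗ⋆[ℂ] ℂ} (hc : ∀ v w, H w v = (starRingEnd ℂ) (H v w))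
    (v w : W) : H v w = (1 / 4 : ℂ) * (((H (v + w) (v + w)).re : ℂ) - (H (v - w) (v - w)).re
      + Complex.I * (H (v + Complex.I • w) (v + Complex.I • w)).re
      - Complex.I * (H (v - Complex.I • w) (v - Complex.I • w)).re) := by
  have hre : ∀ v, ((H v v).re : ℂ) = H v v := fun v => Complex.conj_eq_iff_re.1 (hc v v).symm
  simp only [hre]
  simp only [map_add, map_sub, LinearMap.add_apply, LinearMap.sub_apply, map_smul, map_smulₛₗ,
    LinearMap.smul_apply, smul_eq_mul, Complex.conj_I]
  ring_nf
  simp only [Complex.I_sq]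
  ring

variable (hc : ∀ ν v w, H ν w v = (starRingEnd ℂ) (H ν v w))
  (hp : ∀ ν v, v ≠ 0 → 0 < (H ν v v).re) (hanti : ∀ v, Antitone fun ν => (H ν v v).re)
include hp

theorem form_nonneg_of_pos (ν : ℕ) (v : W) : 0 ≤ (H ν v v).re := by
  rcases eq_or_ne v 0 with rfl | hv
  · simp
  · exact (hp ν v hv).le

include hanti
theorem limitNorm_smul (c : ℂ) (v : W) : limitNorm H (c • v) = ‖c‖ₑ * limitNorm H v := by
  have h0 := form_nonneg_of_pos hp
  have h1 := tendsto_iInf_form h0 hanti (c • v)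
  have h2 : ∀ ν, (H ν (c • v) (c • v)).re = ‖c‖ ^ 2 * (H ν v v).re := fun ν => by
    rw [(H ν).map_smul, LinearMap.smul_apply, LinearMap.map_smulₛₗ, smul_eq_mul, smul_eq_mul,
      ← mul_assoc, Complex.mul_conj, Complex.re_ofReal_mul, Complex.normSq_eq_norm_sq]
  simp only [h2] at h1
  have h3 := tendsto_nhds_unique h1 ((tendsto_iInf_form h0 hanti v).const_mul (‖c‖ ^ 2))
  rw [limitNorm]
  simp only [h2]
  rw [h3, Real.sqrt_mul (sq_nonneg _), Real.sqrt_sq (norm_nonneg _),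
    ENNReal.ofReal_mul (norm_nonneg _), ofReal_norm, limitNorm]

include hc
/-- The limit form, contracted with a vector, is a linear functional. -/
theorem exists_limit_functional (w : W) : ∃ φ : W →ₗ[ℂ] ℂ,
    ∀ v, Filter.Tendsto (fun ν => H ν v w) Filter.atTop (𝓝 (φ v)) := by
  have h0 := form_nonneg_of_pos hp
  have hlim : ∀ v, ∃ l : ℂ, Filter.Tendsto (fun ν => H ν v w) Filter.atTop (𝓝 l) := fun v => by
    have hq : ∀ v, Filter.Tendsto (fun ν => ((H ν v v).re : ℂ)) Filter.atTop
        (𝓝 ((⨅ ν, (H ν v v).re : ℝ) : ℂ)) := fun v =>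
      (Complex.continuous_ofReal.tendsto _).comp (tendsto_iInf_form h0 hanti v)
    refine ⟨_, Filter.Tendsto.congr (fun ν => (form_polarization (hc ν) v w).symm)
      (Filter.Tendsto.const_mul _ ((((hq (v + w)).sub (hq (v - w))).add
        ((hq (v + Complex.I • w)).const_mul _)).sub ((hq (v - Complex.I • w)).const_mul _)))⟩
  choose l hl using hlim
  refine ⟨{ toFun := l, map_add' := fun v v' => ?_, map_smul' := fun c v => ?_ }, hl⟩
  · refine tendsto_nhds_unique (hl (v + v')) (((hl v).add (hl v')).congr fun ν => ?_)
    rw [map_add, LinearMap.add_apply]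
  · refine tendsto_nhds_unique (hl (c • v)) (((hl v).const_mul c).congr fun ν => ?_)
    rw [map_smul, LinearMap.smul_apply, smul_eq_mul]

variable {B : W →ₗ[ℂ] A →ₗ[ℂ] ℂ}

-- Division by the norm of `w` fails for null vectors of the limit, so `w` is divided by its norm
-- plus `ε`, and `ε` tends to zero.
omit hc in
theorem norm_pairing_le_of_polarNorm_le_one {v : A} (hv : polarNorm B (limitNorm H) v ≤ 1) (w : W) :
    ‖B w v‖ₑ ≤ limitNorm H w := by
  have hfin : limitNorm H w ≠ ⊤ := ENNReal.ofReal_ne_top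
  refine ENNReal.le_of_forall_pos_le_add fun ε hε _ => ?_
  obtain ⟨a, ha⟩ : ∃ a : ℝ, a = (limitNorm H w).toReal + ε := ⟨_, rfl⟩
  have hapos : 0 < a := by
    rw [ha]
    have : (0 : ℝ) < ε := hε
    positivity
  have hae : ENNReal.ofReal a = limitNorm H w + ε := by
    rw [ha, ENNReal.ofReal_add ENNReal.toReal_nonneg ε.coe_nonneg, ENNReal.ofReal_toReal hfin]
    simp
  have hinv : ‖((a⁻¹ : ℝ) : ℂ)‖ₑ = (ENNReal.ofReal a)⁻¹ := by
    rw [← ofReal_norm, Complex.norm_real, Real.norm_of_nonneg (by positivity),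
      ENNReal.ofReal_inv_of_pos hapos]
  have h1 : limitNorm H (((a⁻¹ : ℝ) : ℂ) • w) ≤ 1 := by
    rw [limitNorm_smul hp hanti, hinv, mul_comm, ← div_eq_mul_inv]
    refine ENNReal.div_le_of_le_mul ?_
    rw [one_mul, hae]
    exact le_self_add
  have h2 := (le_polarNorm (B := B) h1 v).trans hv
  rw [map_smul, LinearMap.smul_apply, enorm_smul, hinv, mul_comm, ← div_eq_mul_inv] at h2
  rw [← hae]
  have h3 := (ENNReal.div_le_iff (ENNReal.ofReal_pos.2 hapos).ne' ENNReal.ofReal_ne_top).1 h2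
  rwa [one_mul] at h3

/-- The bipolar theorem for limits of Hermitian norms. -/
theorem polarNorm_polarNorm (hB : ∀ φ : W →ₗ[ℂ] ℂ, ∃ v, ∀ w, B w v = φ w) (w : W) :
    polarNorm B.flip (polarNorm B (limitNorm H)) w = limitNorm H w := by
  have h0 := form_nonneg_of_pos hp
  refine le_antisymm (iSup₂_le fun v hv =>
    norm_pairing_le_of_polarNorm_le_one hp hanti hv w) ?_
  -- The norming functional is the limit form contracted with `w`, represented by a vector `v`.
  -- Cauchy–Schwarz passes to the limit and bounds it, and its value at `w` is the squared norm of
  -- `w`. Non-degeneracy of the limit is not needed.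
  obtain ⟨φ, hφ⟩ := exists_limit_functional hc hp hanti w
  obtain ⟨v, hv⟩ := hB φ
  have hq := tendsto_iInf_form h0 hanti
  have hCS : ∀ w', ‖B w' v‖ ^ 2 ≤ (⨅ ν, (H ν w' w').re) * ⨅ ν, (H ν w w).re := fun w' => by
    rw [hv]
    exact le_of_tendsto_of_tendsto' ((hφ w').norm.pow 2) ((hq w').mul (hq w))
      fun ν => norm_form_sq_le (hc ν) (hp ν) w' w
  have hself : B w v = ((⨅ ν, (H ν w w).re : ℝ) : ℂ) := by
    rw [hv]
    refine tendsto_nhds_unique (hφ w) ?_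
    refine ((Complex.continuous_ofReal.tendsto _).comp (hq w)).congr fun ν => ?_
    exact Complex.conj_eq_iff_re.1 (hc ν w w).symm
  obtain ⟨S, hS⟩ : ∃ S, S = ⨅ ν, (H ν w w).re := ⟨_, rfl⟩
  have hSnn : 0 ≤ S := hS ▸ iInf_form_nonneg h0 w
  rw [limitNorm]
  rw [← hS] at hself hCS ⊢
  rcases hSnn.eq_or_lt with h | hSpos
  · rw [← h, Real.sqrt_zero, ENNReal.ofReal_zero]
    exact zero_le
  have hsq := Real.sqrt_pos.2 hSpos
  have h1 : polarNorm B (limitNorm H) ((((Real.sqrt S)⁻¹ : ℝ) : ℂ) • v) ≤ 1 := by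
    refine iSup₂_le fun w' hw' => ?_
    have h2 : (⨅ ν, (H ν w' w').re) ≤ 1 := by
      rw [limitNorm, ENNReal.ofReal_le_one, Real.sqrt_le_iff] at hw'
      simpa using hw'.2
    rw [map_smul, smul_eq_mul, ← ofReal_norm, ENNReal.ofReal_le_one, norm_mul, Complex.norm_real,
      Real.norm_of_nonneg (by positivity), inv_mul_le_one₀ hsq]
    refine Real.le_sqrt_of_sq_le ((hCS w').trans ?_)
    exact mul_le_of_le_one_left hSnn h2
  refine le_trans (le_of_eq ?_) (le_polarNorm (B := B.flip) h1 w)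
  rw [LinearMap.flip_apply, map_smul, hself, smul_eq_mul, ← Complex.ofReal_mul, ← ofReal_norm,
    Complex.norm_real, Real.norm_of_nonneg (by positivity), inv_mul_eq_div, Real.div_sqrt]

/-- The dual norms increase to the dual norm of the limit. -/
theorem tendsto_polarNorm (v : A) :
    Filter.Tendsto (fun ν => polarNorm B (limitNorm fun _ => H ν) v) Filter.atTop
      (𝓝 (polarNorm B (limitNorm H) v)) := by
  have h0 := form_nonneg_of_pos hp
  have hmono : Monotone fun ν => polarNorm B (limitNorm fun _ => H ν) v := fun i j hij =>
    iSup₂_le fun w hw => le_polarNorm (B := B) (le_trans (ENNReal.ofReal_le_ofReal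
      (Real.sqrt_le_sqrt (by simpa using hanti w hij))) hw) v
  have heq : polarNorm B (limitNorm H) v = ⨆ ν, polarNorm B (limitNorm fun _ => H ν) v := by
    refine le_antisymm (iSup₂_le fun w hw => ?_) (iSup_le fun ν => iSup₂_le fun w hw => ?_)
    -- A vector of the unit ball of the limit need not lie in the unit ball of any member of the
    -- sequence, but after multiplication by `a < 1` it does.
    · refine ENNReal.le_of_forall_lt_one_mul_le fun a ha => ?_
      lift a to NNReal using ha.ne_top
      have ha1 : (a : ℝ) < 1 := by exact_mod_cast ha
      have hinf : (⨅ ν, (H ν w w).re) ≤ 1 := by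
        rw [limitNorm, ENNReal.ofReal_le_one, Real.sqrt_le_iff] at hw
        simpa using hw.2
      have hlt : (⨅ ν, (a : ℝ) ^ 2 * (H ν w w).re) < 1 := by
        rw [← Real.mul_iInf_of_nonneg (sq_nonneg _)]
        have h2 := iInf_form_nonneg h0 w
        have h3 : (a : ℝ) ^ 2 < 1 := by nlinarith [a.coe_nonneg]
        nlinarith [mul_le_of_le_one_right (sq_nonneg (a : ℝ)) hinf]
      obtain ⟨ν, hν⟩ := exists_lt_of_ciInf_lt hlt
      have hnorm : ‖((a : ℝ) : ℂ)‖ₑ = a := by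
        rw [← ofReal_norm, Complex.norm_real, Real.norm_of_nonneg a.coe_nonneg,
          ENNReal.ofReal_coe_nnreal]
      have h1 : limitNorm (fun _ => H ν) (((a : ℝ) : ℂ) • w) ≤ 1 := by
        rw [limitNorm, ciInf_const, ENNReal.ofReal_le_one, Real.sqrt_le_iff]
        refine ⟨zero_le_one, ?_⟩
        rw [(H ν).map_smul, LinearMap.smul_apply, LinearMap.map_smulₛₗ, smul_eq_mul, smul_eq_mul,
          ← mul_assoc, Complex.mul_conj, Complex.re_ofReal_mul, Complex.normSq_eq_norm_sq,
          Complex.norm_real, Real.norm_of_nonneg a.coe_nonneg, one_pow]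
        exact hν.le
      refine le_trans (le_of_eq ?_) ((le_polarNorm (B := B) h1 v).trans
        (le_iSup (fun ν => polarNorm B (limitNorm fun _ => H ν) v) ν))
      rw [map_smul, LinearMap.smul_apply, enorm_smul, hnorm]
    · refine le_polarNorm (B := B) (le_trans (ENNReal.ofReal_le_ofReal (Real.sqrt_le_sqrt ?_)) hw) v
      simpa using ciInf_le ⟨0, by rintro _ ⟨ν, rfl⟩; exact h0 ν w⟩ ν
  rw [heq]
  exact tendsto_atTop_iSup hmono

/-- The limit may be degenerate and its dual infinite, so no orthonormal basis is at hand. The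
identity is taken from the members of the sequence, whose dual norms converge in `[0, ∞]`. -/
theorem polarNorm_parallelogram [FiniteDimensional ℂ W] (v w : A) :
    polarNorm B (limitNorm H) (v + w) ^ 2 + polarNorm B (limitNorm H) (v - w) ^ 2 =
      2 * polarNorm B (limitNorm H) v ^ 2 + 2 * polarNorm B (limitNorm H) w ^ 2 := by
  have ht : ∀ v, Filter.Tendsto (fun ν => polarNorm B (limitNorm fun _ => H ν) v ^ 2) Filter.atTop
      (𝓝 (polarNorm B (limitNorm H) v ^ 2)) := fun v =>
    ((ENNReal.continuous_pow 2).tendsto _).comp (tendsto_polarNorm hc hp hanti v)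
  refine tendsto_nhds_unique ((ht (v + w)).add (ht (v - w))) (((ENNReal.Tendsto.const_mul (ht v)
    (Or.inr (by simp))).add (ENNReal.Tendsto.const_mul (ht w) (Or.inr (by simp)))).congr
    fun ν => ?_)
  obtain ⟨b, hb⟩ := exists_basis_of_form (hc ν) (hp ν)
  refine (polarNorm_parallelogram_of_basis b (fun w => ?_) v w).symm
  rw [limitNorm_sq fun _ => form_nonneg_of_pos hp ν, ciInf_const, hb]

end LimitFibre

/-- The bipolar theorem for Hermitian norms. -/
theorem IsHermitianNorm.polarNorm_polarNorm {A W : Type*} [AddCommGroup A] [Module ℂ A]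
    [AddCommGroup W] [Module ℂ W] {N : W → ℝ≥0∞} (h : IsHermitianNorm N) {B : W →ₗ[ℂ] A →ₗ[ℂ] ℂ}
    (hB : ∀ φ : W →ₗ[ℂ] ℂ, ∃ v, ∀ w, B w v = φ w) :
    SingHerm.polarNorm B.flip (SingHerm.polarNorm B N) = N := by
  obtain ⟨H, hc, hp, hN⟩ := h
  -- A Hermitian norm is the limit of a constant sequence, so the bipolar theorem for limits
  -- applies.
  have hlim : limitNorm (fun _ => H) = N := by
    ext v
    refine ennreal_sq_injective ?_
    have h0 : ∀ v, 0 ≤ (H v v).re := form_nonneg_of_pos (H := fun _ => H) (fun _ => hp) 0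
    change limitNorm (fun _ => H) v ^ 2 = N v ^ 2
    rw [limitNorm_sq (fun _ => h0), ciInf_const, hN]
  rw [← hlim]
  ext w
  exact SingHerm.polarNorm_polarNorm (fun _ => hc) (fun _ => hp) (fun _ => antitone_const) hB w

/-! ### Duality on the bundle and the Griffiths semi-positive metric -/

section Duality
variable {n : ℕ} {X : Type*} [TopologicalSpace X] [ChartedSpace (Cn n) X]
  [IsManifold 𝓘(ℂ, Cn n) ω X]
variable {F : Type*} [NormedAddCommGroup F] [NormedSpace ℂ F] [FiniteDimensional ℂ F]
variable {E : X → Type*} [∀ x, AddCommGroup (E x)] [∀ x, Module ℂ (E x)]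
  [TopologicalSpace (TotalSpace F E)] [∀ x, TopologicalSpace (E x)] [FiberBundle F E]

/-- The evaluation pairing between the fibres of the dual bundle and the bundle. -/
def dualPairing (E : X → Type*) [∀ x, AddCommGroup (E x)] [∀ x, Module ℂ (E x)]
    [∀ x, TopologicalSpace (E x)] [∀ x, IsTopologicalAddGroup (E x)]
    [∀ x, ContinuousSMul ℂ (E x)] (x : X) : Dual E x →ₗ[ℂ] E x →ₗ[ℂ] ℂ where
  toFun ξ := { toFun := fun v => ξ v, map_add' := ξ.map_add, map_smul' := ξ.map_smul }
  map_add' _ _ := rfl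
  map_smul' _ _ := rfl

variable [∀ x, IsTopologicalAddGroup (E x)] [∀ x, ContinuousSMul ℂ (E x)]

theorem dualMetric_eq_polarNorm (h : ∀ x, E x → ℝ≥0∞) (x : X) :
    dualMetric h x = polarNorm (dualPairing E x).flip (h x) := rfl

theorem eq_zero_of_dualPairing_eq_zero (x : X) (ξ : Dual E x)
    (h : ∀ v, (dualPairing E x).flip v ξ = 0) : ξ = 0 := by
  ext v
  exact h v

variable [VectorBundle ℂ F E]

variable (F) in
/-- The fibres are isomorphic to the model fibre. -/
def fibreEquiv (x : X) : E x ≃L[ℂ] F :=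
  (trivializationAt F E x).continuousLinearEquivAt ℂ x (FiberBundle.mem_baseSet_trivializationAt' x)

theorem finiteDimensional_fibre {x : X} (e : E x ≃L[ℂ] F) : FiniteDimensional ℂ (E x) :=
  e.symm.toLinearEquiv.finiteDimensional

/-- Linear functionals on the finite-dimensional model fibre are continuous, and a trivialization
carries this to `E x`. -/
theorem exists_dual_eq {x : X} (e : E x ≃L[ℂ] F) (φ : E x →ₗ[ℂ] ℂ) :
    ∃ ξ : Dual E x, ∀ v, (dualPairing E x).flip v ξ = φ v := by
  let ψ : F →L[ℂ] ℂ := (φ ∘ₗ e.symm.toLinearEquiv.toLinearMap).toContinuousLinearMap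
  let ξ : E x →L[ℂ] ℂ := ψ.comp e.toContinuousLinearMap
  refine ⟨ξ, fun v => ?_⟩
  change φ (e.symm (e v)) = φ v
  rw [ContinuousLinearEquiv.symm_apply_apply]

/-- Reflexivity of a finite-dimensional space, once the continuous dual has been identified with the
algebraic one. -/
theorem exists_evaluation_eq {x : X} (e : E x ≃L[ℂ] F) (φ : Dual E x →ₗ[ℂ] ℂ) :
    ∃ v : E x, ∀ ξ, dualPairing E x ξ v = φ ξ := by
  have := finiteDimensional_fibre e
  let d : Dual E x ≃ₗ[ℂ] Module.Dual ℂ (E x) := LinearEquiv.ofBijective (dualPairing E x)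
    ⟨(injective_iff_map_eq_zero _).2 fun ξ hξ => eq_zero_of_dualPairing_eq_zero x ξ fun v => by
      rw [LinearMap.flip_apply, hξ, LinearMap.zero_apply], fun φ => by
      obtain ⟨ξ, hξ⟩ := exists_dual_eq e φ
      exact ⟨ξ, LinearMap.ext hξ⟩⟩
  obtain ⟨v, hv⟩ := (Module.evalEquiv ℂ (E x)).surjective (φ ∘ₗ d.symm.toLinearMap)
  refine ⟨v, fun ξ => ?_⟩
  have h := LinearMap.congr_fun hv (d ξ)
  rw [LinearMap.comp_apply, LinearEquiv.coe_coe, LinearEquiv.symm_apply_apply] at h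
  exact h

theorem finiteDimensional_dual {x : X} (e : E x ≃L[ℂ] F) : FiniteDimensional ℂ (Dual E x) := by
  have := finiteDimensional_fibre e
  exact FiniteDimensional.of_injective (dualPairing E x)
    ((injective_iff_map_eq_zero _).2 fun ξ hξ => eq_zero_of_dualPairing_eq_zero x ξ fun v => by
      rw [LinearMap.flip_apply, hξ, LinearMap.zero_apply])

theorem IsSingularHermitianMetric.ae_isHermitianNorm {h : ∀ x, E x → ℝ≥0∞}
    (hh : IsSingularHermitianMetric n F h) :
    AEOn n (Set.univ : Set X) fun x => IsHermitianNorm (h x) :=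
  hh.ae_posDef.mono subset_rfl fun x _ hx => by
    refine IsHermitianNorm.of_parallelogram (hh.zero x) ?_ (hh.triangle x) (hh.parallelogram x) ?_
    · exact hh.smul x
    · exact hx

theorem IsSingularHermitianMetric.ae_isHermitianNorm_dualMetric {h : ∀ x, E x → ℝ≥0∞}
    (hh : IsSingularHermitianMetric n F h) :
    AEOn n (Set.univ : Set X) fun x => IsHermitianNorm (dualMetric h x) :=
  hh.ae_isHermitianNorm.mono subset_rfl fun x _ hx => by
    have := finiteDimensional_fibre (fibreEquiv F (E := E) x)
    rw [dualMetric_eq_polarNorm]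
    exact IsHermitianNorm.polarNorm (B := (dualPairing E x).flip) hx
      (eq_zero_of_dualPairing_eq_zero x)

variable [ContMDiffVectorBundle ω F E 𝓘(ℂ, Cn n)]
  [T2Space X] [SecondCountableTopology X]

theorem GriffithsSemiPositive.traceSemiPositive {h : ∀ x, E x → ℝ≥0∞}
    (hh : IsSingularHermitianMetric n F h) (hG : GriffithsSemiPositive n F h)
    (g : HermitianMetric n X) : TraceSemiPositive F g h :=
  GriffithsSemiNegative.traceSemiNegative hG (hh.ae_isHermitianNorm_dualMetric.mono subset_rfl
    fun _ _ hx _ hv => ⟨hx.pos hv, hx.lt_top _⟩) g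

/-- The route passes through the weak condition: trace semi-positivity for all metrics makes the
dual weakly semi-negative, and the approximating sequences obtained from this serve every `g`. -/
theorem GriffithsSemiPositive.traceSemiPositiveWithApprox {h : ∀ x, E x → ℝ≥0∞}
    (hh : IsSingularHermitianMetric n F h) (hG : GriffithsSemiPositive n F h)
    (g : HermitianMetric n X) : TraceSemiPositiveWithApprox F g h :=
  IsGriffithsApprox.traceSemiNegativeWithApprox (fun x₀ =>
    (WeaklySemiNegative.of_traceSemiNegative hh.ae_isHermitianNorm_dualMetric
      fun g => hG.traceSemiPositive hh g).exists_isGriffithsApprox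
      hh.ae_isHermitianNorm_dualMetric x₀) g

/-- If the dual metric is weakly semi-negative, the metric agrees almost everywhere with one that
is Griffiths semi-positive. -/
theorem exists_griffithsSemiPositive {h : ∀ x, E x → ℝ≥0∞} (hh : IsSingularHermitianMetric n F h)
    (hw : WeaklySemiNegative (n := n) (F →L[ℂ] ℂ) (V := Dual E) (dualMetric h)) :
    ∃ hG : ∀ x, E x → ℝ≥0∞, IsSingularHermitianMetric n F hG ∧ GriffithsSemiPositive n F hG ∧
      AEOn n (Set.univ : Set X) fun x => hG x = h x := by
  obtain ⟨H, hc, hp, hanti, hG, hae⟩ := exists_griffithsSemiNegative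
    (hw.exists_isGriffithsApprox hh.ae_isHermitianNorm_dualMetric)
  let e := fun x => fibreEquiv F (E := E) x
  have heq : AEOn n (Set.univ : Set X) fun x =>
      polarNorm (dualPairing E x) (limitNorm fun ν => H ν x) = h x :=
    (hae.and hh.ae_isHermitianNorm).mono subset_rfl fun x _ hx => by
      rw [hx.1]
      exact hx.2.polarNorm_polarNorm (B := (dualPairing E x).flip) (exists_dual_eq (e x))
  -- The dual of the limit norm may be infinite at points where the limit degenerates, which a
  -- singular Hermitian metric is allowed to be.
  refine ⟨fun x => polarNorm (dualPairing E x) (limitNorm fun ν => H ν x), ?_, ?_, heq⟩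
  · exact
    { zero := fun x => polarNorm_zero
      smul := fun x c _ v => polarNorm_smul c v
      triangle := fun x v w => polarNorm_add_le v w
      parallelogram := fun x v w => by
        have := finiteDimensional_dual (e x)
        exact polarNorm_parallelogram (fun ν => hc ν x) (fun ν => hp ν x) (hanti x) v w
      measurable := fun U hU s hs c hc => by
        -- Measurability is inherited from `h`, with which the new metric agrees almost everywhere.
        refine (hh.measurable U hU s hs c hc).congr ?_
        refine (ae_restrict_iff' (isOpen_chartSet c hU).measurableSet).2 ?_
        filter_upwards [heq c hc] with y hy hyU
        rw [hy ⟨hyU.1, Set.mem_univ _⟩]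
      ae_posDef := (heq.and hh.ae_posDef).mono subset_rfl fun x _ hx => by
        rw [hx.1]
        exact hx.2 }
  -- The bipolar identity holds in every fibre. Equality almost everywhere would not suffice, since
  -- plurisubharmonicity is a condition on the values at all points.
  · have hdual : dualMetric (fun x => polarNorm (dualPairing E x) (limitNorm fun ν => H ν x)) =
        fun x => limitNorm fun ν => H ν x := by
      ext x : 1
      ext ξ
      exact polarNorm_polarNorm (fun ν => hc ν x) (fun ν => hp ν x) (hanti x)
        (exists_evaluation_eq (e x)) ξ
    rw [GriffithsSemiPositive, hdual]
    exact hG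

end Duality

end SingHerm

end

/-! ### The equivalence -/

theorem theorem5 {n : ℕ}
    {X : Type*} [TopologicalSpace X] [T2Space X] [SecondCountableTopology X]
    [ChartedSpace (Cn n) X] [IsManifold 𝓘(ℂ, Cn n) ω X]
    {F : Type*} [NormedAddCommGroup F] [NormedSpace ℂ F] [FiniteDimensional ℂ F]
    (E : X → Type*) [∀ x, AddCommGroup (E x)] [∀ x, Module ℂ (E x)]
    [TopologicalSpace (TotalSpace F E)] [∀ x, TopologicalSpace (E x)]
    [∀ x, IsTopologicalAddGroup (E x)] [∀ x, ContinuousSMul ℂ (E x)]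
    [FiberBundle F E] [VectorBundle ℂ F E] [ContMDiffVectorBundle ω F E 𝓘(ℂ, Cn n)] :
    -- the three existence statements are equivalent
    [∃ h : ∀ x, E x → ℝ≥0∞, IsSingularHermitianMetric n F h ∧ GriffithsSemiPositive n F h,
      ∃ h : ∀ x, E x → ℝ≥0∞, IsSingularHermitianMetric n F h ∧
        ∀ g : HermitianMetric n X, TraceSemiPositive F g h,
      ∃ h : ∀ x, E x → ℝ≥0∞, IsSingularHermitianMetric n F h ∧
        ∀ g : HermitianMetric n X, TraceSemiPositiveWithApprox F g h].TFAE ∧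
    -- a Griffiths semi-positive metric serves itself
    (∀ h : ∀ x, E x → ℝ≥0∞, IsSingularHermitianMetric n F h → GriffithsSemiPositive n F h →
      ∀ g : HermitianMetric n X, TraceSemiPositive F g h ∧ TraceSemiPositiveWithApprox F g h) ∧
    -- conversely, there is a Griffiths semi-positive metric that is equal almost everywhere
    (∀ h : ∀ x, E x → ℝ≥0∞, IsSingularHermitianMetric n F h →
      ((∀ g : HermitianMetric n X, TraceSemiPositive F g h) ∨
        (∀ g : HermitianMetric n X, TraceSemiPositiveWithApprox F g h)) →
      ∃ hG : ∀ x, E x → ℝ≥0∞, IsSingularHermitianMetric n F hG ∧ GriffithsSemiPositive n F hG ∧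
        AEOn n (Set.univ : Set X) fun x => hG x = h x) := by
  have key : ∀ h : ∀ x, E x → ℝ≥0∞, IsSingularHermitianMetric n F h →
      ((∀ g : HermitianMetric n X, TraceSemiPositive F g h) ∨
        (∀ g : HermitianMetric n X, TraceSemiPositiveWithApprox F g h)) →
      ∃ hG : ∀ x, E x → ℝ≥0∞, IsSingularHermitianMetric n F hG ∧ GriffithsSemiPositive n F hG ∧
        AEOn n (Set.univ : Set X) fun x => hG x = h x := by
    rintro h hh (ht | ht)
    · exact exists_griffithsSemiPositive hh
        (WeaklySemiNegative.of_traceSemiNegative hh.ae_isHermitianNorm_dualMetric ht)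
    · exact exists_griffithsSemiPositive hh
        (WeaklySemiNegative.of_traceSemiNegativeWithApprox ht)
  refine ⟨?_, fun h hh hG g => ⟨hG.traceSemiPositive hh g, hG.traceSemiPositiveWithApprox hh g⟩,
    key⟩
  tfae_have 1 → 2 := fun ⟨h, hh, hG⟩ => ⟨h, hh, hG.traceSemiPositive hh⟩
  tfae_have 1 → 3 := fun ⟨h, hh, hG⟩ => ⟨h, hh, hG.traceSemiPositiveWithApprox hh⟩
  tfae_have 2 → 1 := fun ⟨h, hh, ht⟩ =>
    let ⟨hG, h1, h2, _⟩ := key h hh (Or.inl ht)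
    ⟨hG, h1, h2⟩
  tfae_have 3 → 1 := fun ⟨h, hh, ht⟩ =>
    let ⟨hG, h1, h2, _⟩ := key h hh (Or.inr ht)
    ⟨hG, h1, h2⟩
  tfae_finish
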